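/- Let $p$ be a prime, let $C\subset\mathrm{GL}_2(\mathbb F_p)$ be a non-split Cartan subgroup (the unit group of a subalgebra of $M_2(\mathbb F_p)$ that is a field with $p^2$ elements), and let $N(C)$ be its normalizer in $\mathrm{GL}_2(\mathbb F_p)$. Let $\Gamma_{ns}(p)\subset\Gamma_{ns}^+(p)$ be the subgroups of $\mathrm{SL}_2(\mathbb Z)$ of the elements whose reduction modulo $p$ lies in $C$, respectively in $N(C)$. Let $X_{ns}(p)$ and $X_{ns}^+(p)$ be the modular curves whose complex points are the compact Riemann surfaces $(\mathcal H\cup\mathbb Q\cup\{\infty\})/\Gamma_{ns}(p)$ and $(\mathcal H\cup\mathbb Q\cup\{\infty\})/\Gamma_{ns}^+(p)$; automorphisms are automorphisms of these curves over $\mathbb C$. The cusps are the images of $\mathbb Q\cup\{\infty\}$, and the elliptic points are the images of the points of $\mathcal H$ whose stabilizer in the group is not contained in $\{\pm1\}$. An automorphism preserves the cusps (the elliptic points) if it maps the set of cusps (of elliptic points) onto itself. The elements of $\Gamma_{ns}^+(p)$ outside $\Gamma_{ns}(p)$ exist and all induce the same automorphism $w$ of $X_{ns}(p)$, the modular involution.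 Suppose that the genus of $X_{ns}(p)$ is at least $2$. (1) If $p\equiv 1 \pmod{12}$, the only nontrivial automorphism of $X_{ns}(p)$ preserving the cusps is the modular involution $w$. (2) If $p\not\equiv 1\pmod{12}$, the only nontrivial automorphism of $X_{ns}(p)$ preserving both the cusps and the elliptic points is $w$. (3) The only automorphism of $X_{ns}^+(p)$ preserving the cusps and the elliptic points is the identity. -/

import Mathlib

open scoped MatrixGroups Manifold UpperHalfPlane Topology

noncomputable section

namespace ModularCurve

/-! ## The extended upper half plane -/

/-- The extended upper half plane `ℍ ∪ ℚ ∪ {∞}`. -/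
inductive ExtendedPlane : Type
  | pt : ℍ → ExtendedPlane
  | cusp : OnePoint ℚ → ExtendedPlane

namespace ExtendedPlane

/-- `SL(2, ℤ)` acts on `ℍ ∪ ℚ ∪ {∞}` by Möbius transformations. -/
instance : MulAction SL(2, ℤ) ExtendedPlane where
  smul g
    | pt z => pt (g • z)
    | cusp s => cusp (Matrix.SpecialLinearGroup.mapGL ℚ g • s)
  one_smul x := by
    cases x with
    | pt z => exact congrArg pt (one_smul _ z)
    | cusp s =>
      change cusp (Matrix.SpecialLinearGroup.mapGL ℚ 1 • s) = cusp s
      rw [map_one, one_smul]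
  mul_smul g h x := by
    cases x with
    | pt z => exact congrArg pt (mul_smul g h z)
    | cusp s =>
      change cusp (Matrix.SpecialLinearGroup.mapGL ℚ (g * h) • s) = cusp (_ • _ • s)
      rw [map_mul, mul_smul]

theorem smul_pt (g : SL(2, ℤ)) (z : ℍ) : g • pt z = pt (g • z) := rfl

theorem smul_cusp (g : SL(2, ℤ)) (s : OnePoint ℚ) :
    g • cusp s = cusp (Matrix.SpecialLinearGroup.mapGL ℚ g • s) := rfl

/-- The cusp `∞`. -/
def infty : ExtendedPlane := cusp OnePoint.infty

/-- The horoball topology: a set is open if its trace on `ℍ` is open and if, for each of its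
cusps, written as `g • ∞` with `g ∈ SL(2, ℤ)`, it contains an open horoball
`g • {z | M < Im z}` based at that cusp. -/
instance : TopologicalSpace ExtendedPlane where
  IsOpen U := IsOpen {z : ℍ | pt z ∈ U} ∧
    ∀ g : SL(2, ℤ), g • infty ∈ U → ∃ M : ℝ, ∀ z : ℍ, M < z.im → g • pt z ∈ U
  isOpen_univ := ⟨by simp, fun _ _ => ⟨0, fun _ _ => trivial⟩⟩
  isOpen_inter U V hU hV := by
    refine ⟨hU.1.inter hV.1, fun g hg => ?_⟩
    obtain ⟨M, hM⟩ := hU.2 g hg.1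
    obtain ⟨N, hN⟩ := hV.2 g hg.2
    exact ⟨max M N, fun z hz =>
      ⟨hM z (lt_of_le_of_lt (le_max_left _ _) hz), hN z (lt_of_le_of_lt (le_max_right _ _) hz)⟩⟩
  isOpen_sUnion S hS := by
    refine ⟨?_, fun g hg => ?_⟩
    · have : {z : ℍ | pt z ∈ ⋃₀ S} = ⋃ U ∈ S, {z : ℍ | pt z ∈ U} := by
        ext z; simp
      rw [this]
      exact isOpen_biUnion fun U hU => (hS U hU).1
    · obtain ⟨U, hU, hgU⟩ := hg
      obtain ⟨M, hM⟩ := (hS U hU).2 g hgU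
      exact ⟨M, fun z hz => ⟨U, hU, hM z hz⟩⟩

theorem isOpen_iff (U : Set ExtendedPlane) :
    IsOpen U ↔ IsOpen {z : ℍ | pt z ∈ U} ∧
      ∀ g : SL(2, ℤ), g • infty ∈ U → ∃ M : ℝ, ∀ z : ℍ, M < z.im → g • pt z ∈ U :=
  Iff.rfl

theorem continuous_smul (g : SL(2, ℤ)) : Continuous fun x : ExtendedPlane => g • x := by
  refine ⟨fun U hU => ⟨?_, fun h hh => ?_⟩⟩
  · exact hU.1.preimage 
      (ContinuousConstSMul.continuous_const_smul (Matrix.SpecialLinearGroup.mapGL ℝ g))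
  · obtain ⟨M, hM⟩ := hU.2 (g * h) (by rw [mul_smul]; exact hh)
    exact ⟨M, fun z hz => by
      have := hM z hz
      rw [mul_smul] at this
      exact this⟩

end ExtendedPlane

open ExtendedPlane

/-! ## The compact Riemann surface attached to a subgroup of `SL(2, ℤ)` -/

/-- The orbit space `X(Γ) = (ℍ ∪ ℚ ∪ {∞}) / Γ`. -/
def Curve (Γ : Subgroup SL(2, ℤ)) : Type :=
  MulAction.orbitRel.Quotient Γ ExtendedPlane

variable {Γ : Subgroup SL(2, ℤ)}

/-- The quotient topology on `X(Γ)`. -/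
instance : TopologicalSpace (Curve Γ) :=
  inferInstanceAs (TopologicalSpace (Quotient (MulAction.orbitRel Γ ExtendedPlane)))

/-- The quotient map `ℍ ∪ ℚ ∪ {∞} → X(Γ)`. -/
def proj (Γ : Subgroup SL(2, ℤ)) (x : ExtendedPlane) : Curve Γ :=
  Quotient.mk (MulAction.orbitRel Γ ExtendedPlane) x

theorem proj_eq_iff {x y : ExtendedPlane} :
    proj Γ x = proj Γ y ↔ ∃ γ ∈ Γ, γ • y = x := by
  refine Quotient.eq.trans ?_
  rw [MulAction.orbitRel_apply, MulAction.mem_orbit_iff]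
  exact ⟨fun ⟨γ, h⟩ => ⟨γ, γ.2, h⟩, fun ⟨γ, hγ, h⟩ => ⟨⟨γ, hγ⟩, h⟩⟩

theorem continuous_proj : Continuous (proj Γ) := continuous_quotient_mk'

/-- The complex structure of the compact Riemann surface `X(Γ)`, given by its holomorphic
functions: a function on an open set `U` is holomorphic if it is continuous on `U` and its pullback
to `ℍ` is holomorphic. (At a cusp of width `h`, a continuous function with holomorphic pullback is a
holomorphic function of the local parameter `exp (2πiz/h)`, by Riemann's theorem on removable
singularities.) -/
def HolomorphicOn (F : Curve Γ → ℂ) (U : Set (Curve Γ)) : Prop :=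
  ContinuousOn F U ∧
    MDifferentiableOn 𝓘(ℂ) 𝓘(ℂ) (fun z : ℍ => F (proj Γ (pt z))) {z : ℍ | proj Γ (pt z) ∈ U}

/-- Holomorphic maps between the Riemann surfaces `X(Γ)` and `X(Γ')`: the continuous maps that pull
holomorphic functions on open sets back to holomorphic functions. -/
def IsHolomorphicMap {Γ' : Subgroup SL(2, ℤ)} (f : Curve Γ → Curve Γ') : Prop :=
  Continuous f ∧ ∀ (V : Set (Curve Γ')) (F : Curve Γ' → ℂ), IsOpen V → HolomorphicOn F V →
    HolomorphicOn (F ∘ f) (f ⁻¹' V)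

theorem isHolomorphicMap_id : IsHolomorphicMap (id : Curve Γ → Curve Γ) :=
  ⟨continuous_id, fun _ _ _ h => h⟩

theorem IsHolomorphicMap.comp {Γ' Γ'' : Subgroup SL(2, ℤ)} {g : Curve Γ' → Curve Γ''}
    {f : Curve Γ → Curve Γ'} (hg : IsHolomorphicMap g) (hf : IsHolomorphicMap f) :
    IsHolomorphicMap (g ∘ f) :=
  ⟨hg.1.comp hf.1, fun V F hV hF => hf.2 _ _ (hV.preimage hg.1) (hg.2 V F hV hF)⟩

/-- The automorphism group of the compact Riemann surface `X(Γ)`: the biholomorphic self-maps,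
i.e. the automorphisms of the corresponding smooth projective curve over `ℂ`. -/
def Aut (Γ : Subgroup SL(2, ℤ)) : Subgroup (Curve Γ ≃ₜ Curve Γ) where
  carrier := {u | IsHolomorphicMap u ∧ IsHolomorphicMap u.symm}
  mul_mem' hu hv := ⟨hu.1.comp hv.1, hv.2.comp hu.2⟩
  one_mem' := ⟨isHolomorphicMap_id, isHolomorphicMap_id⟩
  inv_mem' hu := ⟨hu.2, hu.1⟩

/-- The space of holomorphic differentials on `X(Γ)`. A differential `ω` is represented by the
function `g` on `ℍ` for which the pullback of `ω` to `ℍ` is `g(z) dz`; it is holomorphic if in a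
neighbourhood of each point of `X(Γ)` it is the differential `dF` of a holomorphic function `F`. -/
def holomorphicDifferentials (Γ : Subgroup SL(2, ℤ)) : Submodule ℂ (ℍ → ℂ) where
  carrier := {g | ∀ x : Curve Γ, ∃ U : Set (Curve Γ), IsOpen U ∧ x ∈ U ∧
    ∃ F : Curve Γ → ℂ, HolomorphicOn F U ∧ ∀ z : ℍ, proj Γ (pt z) ∈ U →
      HasDerivAt (fun t : ℂ => F (proj Γ (pt (UpperHalfPlane.ofComplex t)))) (g z) (z : ℂ)}
  zero_mem' x := ⟨Set.univ, isOpen_univ, trivial, fun _ => 0,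
    ⟨continuousOn_const, mdifferentiableOn_const⟩, fun z _ => hasDerivAt_const _ _⟩
  add_mem' {g h} hg hh x := by
    obtain ⟨U, hU, hxU, F, hF, hFg⟩ := hg x
    obtain ⟨V, hV, hxV, G, hG, hGh⟩ := hh x
    refine ⟨U ∩ V, hU.inter hV, ⟨hxU, hxV⟩, fun y => F y + G y,
      ⟨(hF.1.mono Set.inter_subset_left).add (hG.1.mono Set.inter_subset_right), ?_⟩,
      fun z hz => (hFg z hz.1).add (hGh z hz.2)⟩
    exact (hF.2.mono fun z hz => hz.1).add (hG.2.mono fun z hz => hz.2)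
  smul_mem' c g hg x := by
    obtain ⟨U, hU, hxU, F, hF, hFg⟩ := hg x
    exact ⟨U, hU, hxU, fun y => c * F y, ⟨continuousOn_const.mul hF.1,
      mdifferentiableOn_const.mul hF.2⟩, fun z hz => (hFg z hz).const_mul c⟩

/-- The genus of the compact Riemann surface `X(Γ)`: the dimension of its space of holomorphic
differentials. -/
def genus (Γ : Subgroup SL(2, ℤ)) : ℕ :=
  Module.finrank ℂ (holomorphicDifferentials Γ)

/-- The set of cusps of `X(Γ)`. -/
def cusps (Γ : Subgroup SL(2, ℤ)) : Set (Curve Γ) :=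
  {x | ∃ s : OnePoint ℚ, x = proj Γ (cusp s)}

/-- The set of elliptic points of `X(Γ)`: the images of the points of `ℍ` whose stabilizer in `Γ`
is not contained in `{1, -1}`, i.e. of the ramification points of `ℍ → Γ \ ℍ`. -/
def ellipticPoints (Γ : Subgroup SL(2, ℤ)) : Set (Curve Γ) :=
  {x | ∃ z : ℍ, x = proj Γ (pt z) ∧ ∃ γ ∈ Γ, γ ≠ 1 ∧ γ ≠ -1 ∧ γ • z = z}

/-- The automorphism `u` maps the set of cusps onto itself. -/
def PreservesCusps (u : Aut Γ) : Prop :=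
  u.1 '' cusps Γ = cusps Γ

/-- The automorphism `u` maps the set of elliptic points onto itself. -/
def PreservesEllipticPoints (u : Aut Γ) : Prop :=
  u.1 '' ellipticPoints Γ = ellipticPoints Γ

/-- The automorphism `u` is the one induced by the Möbius transformation `g`. -/
def IsInducedBy (u : Aut Γ) (g : SL(2, ℤ)) : Prop :=
  ∀ x : ExtendedPlane, u.1 (proj Γ x) = proj Γ (g • x)

/-! ## Modular curves attached to subgroups of `GL₂(ℤ/Nℤ)` -/

/-- The group `Γ_H` of the elements of `SL(2, ℤ)` whose reduction modulo `N` lies in `H`. -/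
def congruenceGroup {N : ℕ} (H : Subgroup (GL (Fin 2) (ZMod N))) : Subgroup SL(2, ℤ) :=
  H.comap (Matrix.SpecialLinearGroup.toGL.comp
    (Matrix.SpecialLinearGroup.map (Int.castRingHom (ZMod N))))

/-- `C` is a non-split Cartan subgroup of `GL₂(𝔽_p)`: the group of units of a subalgebra of
`M₂(𝔽_p)` that is a field with `p ^ 2` elements. -/
def IsNonsplitCartan {p : ℕ} (C : Subgroup (GL (Fin 2) (ZMod p))) : Prop :=
  ∃ K : Subalgebra (ZMod p) (Matrix (Fin 2) (Fin 2) (ZMod p)),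
    IsField K ∧ Module.finrank (ZMod p) K = 2 ∧
      ∀ g : GL (Fin 2) (ZMod p), g ∈ C ↔ (g : Matrix (Fin 2) (Fin 2) (ZMod p)) ∈ K

/-- The group `Γ_ns(p)` attached to a non-split Cartan subgroup `C`; `X_ns(p)` is the curve of this
group. -/
abbrev GammaNs {p : ℕ} (C : Subgroup (GL (Fin 2) (ZMod p))) : Subgroup SL(2, ℤ) :=
  congruenceGroup C

/-- The group `Γ_ns⁺(p)` attached to the normalizer of `C`; `X_ns⁺(p)` is the curve of this
group. -/
abbrev GammaNsPlus {p : ℕ} (C : Subgroup (GL (Fin 2) (ZMod p))) : Subgroup SL(2, ℤ) :=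
  congruenceGroup (Subgroup.normalizer (C : Set (GL (Fin 2) (ZMod p))))

/-- The automorphism `w` of `X_ns(p)` is the modular involution: it is induced by the elements of
`Γ_ns⁺(p)` outside `Γ_ns(p)`. -/
def IsModularInvolution {p : ℕ} (C : Subgroup (GL (Fin 2) (ZMod p))) (w : Aut (GammaNs C)) : Prop :=
  (∃ g : SL(2, ℤ), g ∈ GammaNsPlus C ∧ g ∉ GammaNs C) ∧
    ∀ g : SL(2, ℤ), g ∈ GammaNsPlus C → g ∉ GammaNs C → IsInducedBy w g

end ModularCurve

end

/-!
The idea is to lift an automorphism of the curve `X(Γ)` to the upper half plane. Suppose that `u`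
preserves the cusps and the orders of the stabilizers of the points of `ℍ`. In local coordinates
`ℍ → X(Γ)` is `r ↦ r ^ e`, with `e` the order of the stabilizer, so extracting roots gives local
lifts of `u` (`exists_isLiftAt`). Two of them differ by an element of `Γ`, hence they can be glued
because `ℍ` is simply connected (`exists_glue`, `exists_global_lift`). The resulting biholomorphic
self-map of `ℍ` is given by a matrix in `SL(2, ℝ)` (`exists_moebius`) that normalizes `Γ`. All
cusps of `Γ_ns(p)` and `Γ_ns⁺(p)` have the same width `p`, which forces the matrix to be integral
(`IsLevel.exists_toReal_eq`, `IsLevel.exists_of_preservesOrders`). Finally, an element of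
`SL(2, ℤ)` that conjugates `Γ_ns(p)` into `Γ_ns⁺(p)` belongs to `Γ_ns⁺(p)`
(`IsGenerator.mem_plus_of_conj`). So `u` is the identity or the modular involution on `X_ns(p)`,
and the identity on `X_ns⁺(p)`.

It remains to show that `u` preserves the orders. For `p ≤ 5` there is nothing to show, as the
genus is `0`: the quotient of the sixth power of a holomorphic differential by `ω = Δ(z) dz ^ 6` is
holomorphic and vanishes at the cusps, so it is `0` (`IsLevel.genus_eq_zero`). If `p ≡ 1 mod 12`,
then `-1` and `-3` are squares modulo `p`, and `Γ_ns(p)` has no elliptic points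
(`IsGenerator.not_isSquare_neg_one`, `IsGenerator.not_isSquare_neg_three`).

In the other cases one knows only that `u` maps elliptic points to elliptic points, and has to
exclude that it maps a point of order `2` to a point of order `3`
(`IsGenerator.preservesOrders_plus`, `IsGenerator.preservesOrders`). The sextic differential `ω`
has order `0`, `-3`, `-4` at the points of order `1`, `2`, `3`, and order `p - 6` at the cusps
(`discOrder`, `IsChartAt.discOver_isTheta`). Therefore the poles of the meromorphic function
`u^* ω / ω` (`sexticRatio`) are simple, and are the points of order `2` mapped by `u` to points of
order `3`. If there are none, then `u^* ω / ω` is constant and `u` preserves the orders of `ω`. If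
there is exactly one, then the curve has genus `0` and `ω` has degree `-12`
(`HasOnePole.injective`, `HasOnePole.sum_discOrder_le`), which contradicts the count of cusps and
elliptic points (`IsGenerator.false_of_hasOnePole`, `IsGenerator.false_of_hasOnePole_plus`). There
are at most two on `X_ns(p)` and at most one on `X_ns⁺(p)`, because the points of order `3` are
that few. If there are two on `X_ns(p)`, then `u` interchanges the points of order `2` and those of
order `3`, so the conjugate of the modular involution by `u` preserves the orders and is again the
modular involution. Then `u^* ω / ω` descends to a function on `X_ns⁺(p)` with a single simple pole
(`exists_hasOnePole_of_invariant`), and the previous contradiction applies there.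
-/


open scoped MatrixGroups Manifold UpperHalfPlane Topology

noncomputable section

namespace ModularCurve

open ExtendedPlane

/-! ### The action of `SL(2, ℤ)` on `ℍ` -/

section Action

/-- The automorphy factor `c z + d`. -/
def aut (g : SL(2, ℤ)) (z : ℂ) : ℂ := (g 1 0 : ℂ) * z + (g 1 1 : ℂ)

theorem aut_ne_zero (g : SL(2, ℤ)) (z : ℍ) : aut g z ≠ 0 := by
  have := UpperHalfPlane.denom_ne_zero (g : GL (Fin 2) ℝ) z
  simpa [UpperHalfPlane.denom, aut] using this

theorem coe_smul_eq (g : SL(2, ℤ)) (z : ℍ) :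
    ((g • z : ℍ) : ℂ) = ((g 0 0 : ℂ) * z + (g 0 1 : ℂ)) / aut g z := by
  rw [UpperHalfPlane.coe_specialLinearGroup_apply]
  simp [aut]

theorem aut_mul (g h : SL(2, ℤ)) (z : ℍ) : aut (g * h) z = aut g (h • z : ℍ) * aut h z := by
  have hne := aut_ne_zero h z
  have e : aut g (h • z : ℍ) * aut h z
      = (g 1 0 : ℂ) * ((h 0 0 : ℂ) * z + (h 0 1 : ℂ)) + (g 1 1 : ℂ) * aut h z := by
    rw [coe_smul_eq, aut, add_mul, mul_div_assoc', div_mul_cancel₀ _ hne]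
  rw [e]
  simp only [aut, Matrix.SpecialLinearGroup.coe_mul, Matrix.mul_apply, Fin.sum_univ_two]
  push_cast
  ring

theorem aut_one (z : ℂ) : aut 1 z = 1 := by simp [aut]

theorem aut_neg (g : SL(2, ℤ)) (z : ℂ) : aut (-g) z = - aut g z := by
  simp [aut]; ring

theorem coe_smul_sub (g : SL(2, ℤ)) (z w : ℍ) :
    ((g • z : ℍ) : ℂ) - (g • w : ℍ) = ((z : ℂ) - w) / (aut g z * aut g w) := by
  have h1 := aut_ne_zero g z
  have h2 := aut_ne_zero g w
  have hd : (g 0 0 : ℂ) * g 1 1 - g 0 1 * g 1 0 = 1 := by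
    have := g.det_coe
    rw [Matrix.det_fin_two] at this
    exact_mod_cast this
  rw [coe_smul_eq, coe_smul_eq, div_sub_div _ _ h1 h2]
  congr 1
  simp only [aut]
  linear_combination ((z : ℂ) - w) * hd

theorem hasDerivAt_smul (g : SL(2, ℤ)) (z : ℍ) :
    HasDerivAt (fun t : ℂ => ((g • UpperHalfPlane.ofComplex t : ℍ) : ℂ)) (1 / aut g z ^ 2) z := by
  have hd : (g : GL (Fin 2) ℝ).val.det = 1 := (g : SL(2, ℝ)).det_coe
  have := (UpperHalfPlane.hasStrictDerivAt_smul (g := (g : GL (Fin 2) ℝ))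
    (by rw [hd]; exact one_pos) z).hasDerivAt
  rw [hd, Complex.ofReal_one] at this
  exact this

theorem continuous_smul_upperHalfPlane (g : SL(2, ℤ)) : Continuous fun z : ℍ => g • z :=
  ContinuousConstSMul.continuous_const_smul (Matrix.SpecialLinearGroup.mapGL ℝ g)

theorem im_smul_eq (g : SL(2, ℤ)) (z : ℍ) : (g • z).im = z.im / Complex.normSq (aut g z) := by
  rw [ModularGroup.im_smul_eq_div_normSq]
  simp [UpperHalfPlane.denom, aut]

/-- `SL(2, ℤ)` acts properly discontinuously on `ℍ`. -/
theorem finite_smul_inter {K L : Set ℍ} (hK : IsCompact K) (hL : IsCompact L) :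
    {g : SL(2, ℤ) | ((fun z => g • z) '' K ∩ L).Nonempty}.Finite := by
  have h := ProperlyDiscontinuousSMul.finite_disjoint_inter_image
    (Γ := (𝒮ℒ : Subgroup (GL (Fin 2) ℝ))) hK hL
  have inj : Function.Injective (fun g : SL(2, ℤ) =>
      (⟨Matrix.SpecialLinearGroup.mapGL ℝ g, g, rfl⟩ : (𝒮ℒ : Subgroup (GL (Fin 2) ℝ)))) := by
    intro a b hab
    exact Matrix.SpecialLinearGroup.mapGL_injective (Subtype.ext_iff.mp hab)
  exact (h.preimage inj.injOn).subset fun g hg => hg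

/-- Proper discontinuity, locally: an element of `SL(2, ℤ)` that maps some point near `z` close to
`w` maps `z` to `w`. -/
theorem exists_nhds_smul (z w : ℍ) : ∃ U ∈ 𝓝 z, ∃ V ∈ 𝓝 w, ∀ g : SL(2, ℤ), ∀ a ∈ U,
    g • a ∈ V → g • z = w := by
  obtain ⟨K, hK, hKz⟩ := exists_compact_mem_nhds z
  obtain ⟨L, hL, hLw⟩ := exists_compact_mem_nhds w
  have hfin := finite_smul_inter hK hL
  -- the finitely many elements moving `K` to `L` without moving `z` to `w` are excluded one by one
  have key : ∀ g : SL(2, ℤ), ∃ U ∈ 𝓝 z, ∃ V ∈ 𝓝 w, g • z ≠ w → ∀ a ∈ U, g • a ∉ V := by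
    intro g
    by_cases h : g • z = w
    · exact ⟨Set.univ, Filter.univ_mem, Set.univ, Filter.univ_mem, fun h' => absurd h h'⟩
    · obtain ⟨A, B, hA, hB, hzA, hwB, hAB⟩ := t2_separation h
      refine ⟨(fun a : ℍ => g • a) ⁻¹' A, (continuous_smul_upperHalfPlane g).continuousAt
        (hA.mem_nhds hzA), B, hB.mem_nhds hwB, fun _ a ha hb => ?_⟩
      exact Set.disjoint_left.mp hAB ha hb
  choose U hU V hV hUV using key
  refine ⟨K ∩ ⋂ g ∈ hfin.toFinset, U g, Filter.inter_mem hKz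
    ((Filter.biInter_finset_mem _).mpr fun g _ => hU g), L ∩ ⋂ g ∈ hfin.toFinset, V g,
    Filter.inter_mem hLw ((Filter.biInter_finset_mem _).mpr fun g _ => hV g), ?_⟩
  intro g a ha hb
  by_contra hne
  have hg : g ∈ hfin.toFinset := by
    rw [Set.Finite.mem_toFinset]
    exact ⟨g • a, ⟨a, ha.1, rfl⟩, hb.1⟩
  exact hUV g hne a (Set.mem_iInter₂.mp ha.2 g hg) (Set.mem_iInter₂.mp hb.2 g hg)

/-- The derivative of `g` at a fixed point `z` is `(aut g z ^ 2)⁻¹`, and the stabilizer modulo `±1`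
acts faithfully on the tangent space. -/
theorem eq_one_or_neg_one_of_aut_sq {g : SL(2, ℤ)} {z : ℍ} (hz : g • z = z)
    (h : aut g z ^ 2 = 1) : g = 1 ∨ g = -1 := by
  have key : ∀ g : SL(2, ℤ), g • z = z → aut g z = 1 → g = 1 := by
    intro g hz h
    have him := congrArg Complex.im h
    simp only [aut, Complex.add_im, Complex.mul_im, Complex.intCast_re, Complex.intCast_im,
      UpperHalfPlane.coe_im, zero_mul, add_zero, Complex.one_im, mul_eq_zero,
      z.im_ne_zero, or_false, Int.cast_eq_zero] at him
    have h11 : g 1 1 = 1 := by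
      simp only [aut, him, Int.cast_zero, zero_mul, zero_add] at h
      exact_mod_cast h
    have hd := g.det_coe
    rw [Matrix.det_fin_two, him, h11] at hd
    have h00 : g 0 0 = 1 := by simpa using hd
    have h01 : g 0 1 = 0 := by
      have := congrArg UpperHalfPlane.coe hz
      rw [coe_smul_eq, h, h00] at this
      simpa using this
    ext i j
    fin_cases i <;> fin_cases j <;> simp [h00, h01, h11, him]
  rcases sq_eq_one_iff.mp h with h | h
  · exact Or.inl (key g hz h)
  · right
    have := key (-g) (by rw [ModularGroup.SL_neg_smul, hz]) (by rw [aut_neg, h, neg_neg])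
    rw [← this, neg_neg]

end Action

/-! ### The topology of `X(Γ)` -/

section Topology

/-- The quotient map `ℍ → X(Γ)`. -/
def toCurve (Γ : Subgroup SL(2, ℤ)) (z : ℍ) : Curve Γ := proj Γ (pt z)

theorem continuous_pt : Continuous pt := ⟨fun _ hU => hU.1⟩

theorem smul_infty_ne_pt (g : SL(2, ℤ)) (z : ℍ) : g • infty ≠ pt z := by
  rw [infty, smul_cusp]
  exact fun h => by cases h

theorem isOpenMap_pt : IsOpenMap pt := by
  intro U hU
  refine (isOpen_iff _).mpr ⟨?_, fun g ⟨z, _, hz⟩ => absurd hz.symm (smul_infty_ne_pt g z)⟩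
  have : {z : ℍ | pt z ∈ pt '' U} = U := by
    ext z
    constructor
    · rintro ⟨w, hw, h⟩
      cases h
      exact hw
    · exact fun h => ⟨z, h, rfl⟩
  rwa [this]

instance (Γ : Subgroup SL(2, ℤ)) : ContinuousConstSMul Γ ExtendedPlane :=
  ⟨fun g => continuous_smul g.1⟩

theorem isOpenMap_proj (Γ : Subgroup SL(2, ℤ)) : IsOpenMap (proj Γ) :=
  isOpenMap_quotient_mk'_mul

theorem continuous_toCurve (Γ : Subgroup SL(2, ℤ)) : Continuous (toCurve Γ) :=
  continuous_proj.comp continuous_pt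

theorem isOpenMap_toCurve (Γ : Subgroup SL(2, ℤ)) : IsOpenMap (toCurve Γ) :=
  (isOpenMap_proj Γ).comp isOpenMap_pt

theorem map_toCurve_nhds (Γ : Subgroup SL(2, ℤ)) (z : ℍ) :
    Filter.map (toCurve Γ) (𝓝 z) = 𝓝 (toCurve Γ z) :=
  le_antisymm (continuous_toCurve Γ).continuousAt ((isOpenMap_toCurve Γ).nhds_le z)

theorem toCurve_eq_iff {Γ : Subgroup SL(2, ℤ)} {z w : ℍ} :
    toCurve Γ z = toCurve Γ w ↔ ∃ γ ∈ Γ, γ • w = z := by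
  rw [toCurve, toCurve, proj_eq_iff]
  refine exists_congr fun γ => and_congr_right fun _ => ?_
  rw [smul_pt]
  exact ⟨fun h => by injection h, fun h => by rw [h]⟩

theorem toCurve_smul {Γ : Subgroup SL(2, ℤ)} {γ : SL(2, ℤ)} (hγ : γ ∈ Γ) (z : ℍ) :
    toCurve Γ (γ • z) = toCurve Γ z :=
  toCurve_eq_iff.mpr ⟨γ, hγ, rfl⟩

theorem exists_smul_infty (s : OnePoint ℚ) : ∃ g : SL(2, ℤ), cusp s = g • infty := by
  obtain ⟨g, hg⟩ := OnePoint.exists_mem_SL2 ℤ s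
  exact ⟨g, by rw [infty, smul_cusp, hg]⟩

/-- The points of `X(Γ)` are the images of points of `ℍ` and the cusps. -/
theorem Curve.cases {Γ : Subgroup SL(2, ℤ)} {motive : Curve Γ → Prop}
    (h1 : ∀ z : ℍ, motive (toCurve Γ z)) (h2 : ∀ g : SL(2, ℤ), motive (proj Γ (g • infty)))
    (x : Curve Γ) : motive x := by
  obtain ⟨y, rfl⟩ : ∃ y, proj Γ y = x := Quotient.exists_rep x
  cases y with
  | pt z => exact h1 z
  | cusp s =>
    obtain ⟨g, hg⟩ := exists_smul_infty s
    rw [hg]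
    exact h2 g

theorem proj_smul_infty_mem_cusps (Γ : Subgroup SL(2, ℤ)) (g : SL(2, ℤ)) :
    proj Γ (g • infty) ∈ cusps Γ :=
  ⟨_, rfl⟩

theorem mem_cusps_iff {Γ : Subgroup SL(2, ℤ)} {x : Curve Γ} :
    x ∈ cusps Γ ↔ ∃ g : SL(2, ℤ), x = proj Γ (g • infty) := by
  constructor
  · rintro ⟨s, rfl⟩
    obtain ⟨g, hg⟩ := exists_smul_infty s
    exact ⟨g, by rw [hg]⟩
  · rintro ⟨g, rfl⟩
    exact proj_smul_infty_mem_cusps Γ g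

theorem toCurve_ne_proj_smul_infty {Γ : Subgroup SL(2, ℤ)} (z : ℍ) (g : SL(2, ℤ)) :
    toCurve Γ z ≠ proj Γ (g • infty) := by
  intro h
  obtain ⟨γ, _, h⟩ := proj_eq_iff.mp h
  rw [← mul_smul] at h
  exact smul_infty_ne_pt _ _ h

theorem toCurve_notMem_cusps {Γ : Subgroup SL(2, ℤ)} (z : ℍ) : toCurve Γ z ∉ cusps Γ := by
  rw [mem_cusps_iff]
  rintro ⟨g, hg⟩
  exact toCurve_ne_proj_smul_infty z g hg

theorem smul_infty_eq_infty_iff {g : SL(2, ℤ)} : g • infty = infty ↔ g 1 0 = 0 := by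
  have : g • infty = infty ↔ Matrix.SpecialLinearGroup.mapGL ℚ g • (OnePoint.infty : OnePoint ℚ)
      = OnePoint.infty := by
    rw [infty, smul_cusp]
    exact ⟨fun h => by injection h, fun h => by rw [h]⟩
  rw [this, OnePoint.smul_infty_eq_self_iff]
  simp

/-- An element fixing `∞` acts on `ℍ` as a translation. -/
theorem exists_T_zpow_of_smul_infty {g : SL(2, ℤ)} (h : g • infty = infty) :
    ∃ n : ℤ, g = ModularGroup.T ^ n ∨ g = -ModularGroup.T ^ n := by
  have hc := smul_infty_eq_infty_iff.mp h
  have had := g.det_coe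
  replace had : g 0 0 * g 1 1 = 1 := by rw [Matrix.det_fin_two, hc] at had; lia
  rcases Int.eq_one_or_neg_one_of_mul_eq_one' had with (⟨ha, hd⟩ | ⟨ha, hd⟩)
  · refine ⟨g 0 1, Or.inl ?_⟩
    ext i j
    fin_cases i <;> fin_cases j <;> simp [ModularGroup.coe_T_zpow, ha, hc, hd]
  · refine ⟨-g 0 1, Or.inr ?_⟩
    ext i j
    fin_cases i <;> fin_cases j <;> simp [ModularGroup.coe_T_zpow, ha, hc, hd]

theorem im_smul_of_smul_infty {g : SL(2, ℤ)} (h : g • infty = infty) (z : ℍ) :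
    (g • z).im = z.im := by
  obtain ⟨n, rfl | rfl⟩ := exists_T_zpow_of_smul_infty h
  · exact ModularGroup.im_T_zpow_smul z n
  · rw [ModularGroup.SL_neg_smul]
    exact ModularGroup.im_T_zpow_smul z n

/-- Horoballs of height `1` at different cusps are disjoint. -/
theorem im_mul_im_smul_le {g : SL(2, ℤ)} (h : g • infty ≠ infty) (z : ℍ) :
    z.im * (g • z).im ≤ 1 := by
  have hc : g 1 0 ≠ 0 := fun hc => h (smul_infty_eq_infty_iff.mpr hc)
  have h1 : (1 : ℝ) ≤ (g 1 0 : ℝ) ^ 2 := by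
    have : (1 : ℤ) ≤ (g 1 0) ^ 2 := Int.add_one_le_iff.mpr (sq_pos_of_ne_zero hc)
    exact_mod_cast this
  have hn : z.im ^ 2 ≤ Complex.normSq (aut g z) := by
    have : Complex.normSq (aut g z) = ((g 1 0 : ℝ) * z.re + g 1 1) ^ 2
        + (g 1 0 : ℝ) ^ 2 * z.im ^ 2 := by
      rw [Complex.normSq_apply]
      simp [aut]
      ring
    rw [this]
    nlinarith [sq_nonneg ((g 1 0 : ℝ) * z.re + g 1 1), sq_nonneg z.im]
  rw [im_smul_eq, mul_div_assoc', div_le_one (lt_of_lt_of_le (pow_pos z.im_pos 2) hn), ← sq]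
  exact hn

/-- The horoball `g • {z | M < Im z}` together with its cusp `g • ∞`. -/
def horoball (g : SL(2, ℤ)) (M : ℝ) : Set ExtendedPlane :=
  {x | x = g • infty ∨ ∃ z : ℍ, M < z.im ∧ x = g • pt z}

theorem isOpen_horoball (g : SL(2, ℤ)) (M : ℝ) : IsOpen (horoball g M) := by
  refine (isOpen_iff _).mpr ⟨?_, ?_⟩
  · have : {z : ℍ | pt z ∈ horoball g M} = {z : ℍ | M < (g⁻¹ • z).im} := by
      ext z
      simp only [Set.mem_ofPred_eq, horoball]
      constructor
      · rintro (h | ⟨w, hw, h⟩)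
        · exact absurd h.symm (smul_infty_ne_pt g z)
        · rw [smul_pt] at h
          injection h with h
          rwa [h, inv_smul_smul]
      · exact fun h => Or.inr ⟨g⁻¹ • z, h, by rw [smul_pt, smul_inv_smul]⟩
    rw [this]
    exact isOpen_lt continuous_const
      (UpperHalfPlane.continuous_im.comp (continuous_smul_upperHalfPlane g⁻¹))
  · rintro h (hh | ⟨w, _, hh⟩)
    · refine ⟨M, fun z hz => Or.inr ⟨(g⁻¹ * h) • z, ?_, ?_⟩⟩
      · rw [im_smul_of_smul_infty (by rw [mul_smul, hh, inv_smul_smul])]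
        exact hz
      · rw [← smul_pt, ← mul_smul, mul_inv_cancel_left]
    · exact absurd hh (smul_infty_ne_pt h _)

theorem toCurve_smul_mem_nhds_cusp {Γ : Subgroup SL(2, ℤ)} (g : SL(2, ℤ)) (M : ℝ) :
    proj Γ '' horoball g M ∈ 𝓝 (proj Γ (g • infty)) :=
  (isOpenMap_proj Γ).image_mem_nhds ((isOpen_horoball g M).mem_nhds (Or.inl rfl))

theorem exists_im_of_mem_nhds_cusp {Γ : Subgroup SL(2, ℤ)} {g : SL(2, ℤ)} {V : Set (Curve Γ)}
    (hV : V ∈ 𝓝 (proj Γ (g • infty))) : ∃ M : ℝ, ∀ z : ℍ, M < z.im → toCurve Γ (g • z) ∈ V := by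
  obtain ⟨W, hWV, hW, hgW⟩ := mem_nhds_iff.mp hV
  obtain ⟨M, hM⟩ := (hW.preimage continuous_proj).2 g hgW
  exact ⟨M, fun z hz => hWV (hM z hz)⟩

/-- Punctured neighbourhoods of the cusp `g • ∞` are the images of horoballs. -/
theorem map_atImInfty_eq_nhdsNE {Γ : Subgroup SL(2, ℤ)} (g : SL(2, ℤ)) :
    Filter.map (fun z : ℍ => toCurve Γ (g • z)) UpperHalfPlane.atImInfty
      = 𝓝[≠] (proj Γ (g • infty)) := by
  ext V
  rw [Filter.mem_map, UpperHalfPlane.atImInfty_mem, mem_nhdsWithin_iff_eventually]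
  constructor
  · rintro ⟨A, hA⟩
    filter_upwards [toCurve_smul_mem_nhds_cusp (Γ := Γ) g A]
    rintro _ ⟨x, rfl | ⟨z, hz, rfl⟩, rfl⟩ hne
    · exact absurd rfl hne
    · exact hA z hz.le
  · intro h
    obtain ⟨M, hM⟩ := exists_im_of_mem_nhds_cusp h
    exact ⟨M + 1, fun z hz => hM z (by linarith) (toCurve_ne_proj_smul_infty _ g)⟩

/-- Points of `ℍ` have neighbourhoods whose translates avoid a small enough horoball. -/
theorem exists_separation_cusp (Γ : Subgroup SL(2, ℤ)) (z : ℍ) (g : SL(2, ℤ)) :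
    ∃ U ∈ 𝓝 (toCurve Γ z), ∃ V ∈ 𝓝 (proj Γ (g • infty)), Disjoint U V := by
  -- near `z` the imaginary parts of all translates under `SL(2, ℤ)` are bounded
  obtain ⟨M, hM1, hM2⟩ : ∃ M : ℝ, z.im < M ∧ 1 / M < z.im := by
    refine ⟨z.im + 1 / z.im + 1, ?_, ?_⟩
    · have := one_div_pos.mpr z.im_pos; linarith
    · have h0 := z.im_pos
      rw [div_lt_iff₀ (by positivity)]
      have : z.im * (1 / z.im) = 1 := by field_simp
      nlinarith
  have hM0 : 0 < M := z.im_pos.trans hM1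
  have hU : {w : ℍ | w.im < M ∧ 1 / M < w.im} ∈ 𝓝 z :=
    ((isOpen_lt UpperHalfPlane.continuous_im continuous_const).inter
      (isOpen_lt continuous_const UpperHalfPlane.continuous_im)).mem_nhds ⟨hM1, hM2⟩
  refine ⟨_, (isOpenMap_toCurve Γ).image_mem_nhds hU, _, toCurve_smul_mem_nhds_cusp g M,
    Set.disjoint_left.mpr ?_⟩
  rintro _ ⟨w, ⟨hw1, hw2⟩, rfl⟩ ⟨y, rfl | ⟨v, hv, rfl⟩, hy⟩
  · exact toCurve_ne_proj_smul_infty w g hy.symm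
  · obtain ⟨γ, _, hγ⟩ := proj_eq_iff.mp hy
    rw [smul_pt, smul_pt] at hγ
    injection hγ with hγ
    have hv' : v = (g⁻¹ * γ) • w := by rw [mul_smul, hγ, inv_smul_smul]
    by_cases h : (g⁻¹ * γ) • infty = infty
    · rw [hv', im_smul_of_smul_infty h] at hv
      linarith
    · have := im_mul_im_smul_le h w
      rw [← hv'] at this
      have h2 : 1 < w.im * v.im := by
        calc (1 : ℝ) = 1 / M * M := by field_simp
          _ < w.im * v.im := mul_lt_mul'' hw2 hv (by positivity) hM0.le
      linarith

instance (Γ : Subgroup SL(2, ℤ)) : T2Space (Curve Γ) := by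
  suffices H : ∀ x y : Curve Γ, x ≠ y → ∃ U ∈ 𝓝 x, ∃ V ∈ 𝓝 y, Disjoint U V from
    t2Space_iff_disjoint_nhds.mpr fun x y hxy => by
      obtain ⟨U, hU, V, hV, hUV⟩ := H x y hxy
      exact Filter.disjoint_iff.mpr ⟨U, hU, V, hV, hUV⟩
  intro x y
  induction x using Curve.cases with
  | h1 z =>
    induction y using Curve.cases with
    | h1 w =>
      intro hne
      obtain ⟨U, hU, V, hV, hUV⟩ := exists_nhds_smul z w
      refine ⟨_, (isOpenMap_toCurve Γ).image_mem_nhds hU, _,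
        (isOpenMap_toCurve Γ).image_mem_nhds hV, Set.disjoint_left.mpr ?_⟩
      rintro _ ⟨a, ha, rfl⟩ ⟨b, hb, hab⟩
      obtain ⟨γ, hγ, rfl⟩ := toCurve_eq_iff.mp hab
      exact hne (toCurve_eq_iff.mpr ⟨γ⁻¹, Γ.inv_mem hγ, by
        rw [inv_smul_eq_iff]; exact (hUV γ a ha hb).symm⟩)
    | h2 g => exact fun _ => exists_separation_cusp Γ z g
  | h2 g =>
    induction y using Curve.cases with
    | h1 w =>
      intro _
      obtain ⟨U, hU, V, hV, hUV⟩ := exists_separation_cusp Γ w g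
      exact ⟨V, hV, U, hU, hUV.symm⟩
    | h2 h =>
      intro hne
      refine ⟨_, toCurve_smul_mem_nhds_cusp g 1, _, toCurve_smul_mem_nhds_cusp h 1,
        Set.disjoint_left.mpr ?_⟩
      have aux : ∀ γ ∈ Γ, γ • h • infty ≠ g • infty := fun γ hγ hh =>
        hne (proj_eq_iff.mpr ⟨γ, hγ, hh⟩)
      rintro _ ⟨a, ha, rfl⟩ ⟨b, hb, hab⟩
      obtain ⟨γ, hγ, hab⟩ := proj_eq_iff.mp hab
      rcases ha with rfl | ⟨v, hv, rfl⟩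
      · rcases hb with rfl | ⟨w, hw, rfl⟩
        · refine aux γ⁻¹ (Γ.inv_mem hγ) ?_
          rw [inv_smul_eq_iff, hab]
        · rw [← mul_smul, smul_pt] at hab
          exact smul_infty_ne_pt _ _ hab
      · rcases hb with rfl | ⟨w, hw, rfl⟩
        · rw [smul_pt] at hab
          rw [smul_pt] at hab
          exact smul_infty_ne_pt _ _ hab.symm
        · rw [smul_pt, smul_pt, smul_pt] at hab
          injection hab with hab
          have hw' : w = (h⁻¹ * γ * g) • v := by
            rw [mul_smul, mul_smul, hab, inv_smul_smul]
          by_cases hc : (h⁻¹ * γ * g) • infty = infty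
          · refine aux γ⁻¹ (Γ.inv_mem hγ) ?_
            rw [mul_smul, mul_smul, inv_smul_eq_iff] at hc
            rw [← hc, inv_smul_smul]
          · have := im_mul_im_smul_le hc v
            rw [← hw'] at this
            nlinarith

/-- A neighbourhood of `∞` contains all but a bounded part of the fundamental domain. -/
theorem isCompact_fd_union_infty : IsCompact (pt '' ModularGroup.fd ∪ {infty}) := by
  refine isCompact_of_finite_subcover fun {ι} U hU hcov => ?_
  obtain ⟨i₀, hi₀⟩ := Set.mem_iUnion.mp (hcov (Or.inr rfl))
  obtain ⟨M, hM⟩ := (hU i₀).2 1 (by rwa [one_smul])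
  have hcpt : IsCompact (pt '' ModularGroup.truncatedFundamentalDomain M) :=
    (ModularGroup.isCompact_truncatedFundamentalDomain M).image continuous_pt
  obtain ⟨t, ht⟩ := hcpt.elim_finite_subcover U hU (by
    refine Set.Subset.trans ?_ hcov
    rintro _ ⟨z, hz, rfl⟩
    exact Or.inl ⟨z, hz.1, rfl⟩)
  classical
  refine ⟨insert i₀ t, ?_⟩
  rintro _ (⟨z, hz, rfl⟩ | rfl)
  · by_cases hzM : z.im ≤ M
    · obtain ⟨i, hi⟩ := Set.mem_iUnion.mp (ht ⟨z, ⟨hz, hzM⟩, rfl⟩)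
      obtain ⟨hit, hi⟩ := Set.mem_iUnion.mp hi
      exact Set.mem_iUnion₂.mpr ⟨i, Finset.mem_insert_of_mem hit, hi⟩
    · have := hM z (not_le.mp hzM)
      rw [one_smul] at this
      exact Set.mem_iUnion₂.mpr ⟨i₀, Finset.mem_insert_self _ _, this⟩
  · exact Set.mem_iUnion₂.mpr ⟨i₀, Finset.mem_insert_self _ _, hi₀⟩

/-- Finitely many translates of the fundamental domain cover the curve. -/
instance (Γ : Subgroup SL(2, ℤ)) [Γ.FiniteIndex] : CompactSpace (Curve Γ) := by
  constructor
  have : Finite (SL(2, ℤ) ⧸ Γ) := inferInstance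
  have hcov : (Set.univ : Set (Curve Γ)) = ⋃ c : SL(2, ℤ) ⧸ Γ,
      (fun x => proj Γ (c.out⁻¹ • x)) '' (pt '' ModularGroup.fd ∪ {infty}) := by
    refine (Set.eq_univ_of_forall fun x => Set.mem_iUnion.mpr ?_).symm
    have aux : ∀ (g : SL(2, ℤ)) (y : ExtendedPlane), y ∈ pt '' ModularGroup.fd ∪ {infty} →
        ∃ c : SL(2, ℤ) ⧸ Γ, proj Γ (g⁻¹ • y) ∈
          (fun x => proj Γ (c.out⁻¹ • x)) '' (pt '' ModularGroup.fd ∪ {infty}) := by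
      intro g y hy
      refine ⟨(g : SL(2, ℤ) ⧸ Γ), y, hy, ?_⟩
      obtain ⟨γ, hγ⟩ := QuotientGroup.mk_out_eq_mul Γ g
      refine proj_eq_iff.mpr ⟨(γ : SL(2, ℤ))⁻¹, Γ.inv_mem γ.2, ?_⟩
      rw [hγ, mul_inv_rev, mul_smul]
    induction x using Curve.cases with
    | h1 z =>
      obtain ⟨g, hg⟩ := ModularGroup.exists_smul_mem_fd z
      have := aux g (pt (g • z)) (Or.inl ⟨_, hg, rfl⟩)
      rwa [smul_pt, inv_smul_smul] at this
    | h2 g =>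
      have := aux g⁻¹ infty (Or.inr rfl)
      rwa [inv_inv] at this
  rw [hcov]
  exact isCompact_iUnion fun c =>
    isCompact_fd_union_infty.image (continuous_proj.comp (continuous_smul _))

theorem atImInfty_neBot : UpperHalfPlane.atImInfty.NeBot := by
  refine Filter.neBot_iff.mpr fun h => ?_
  have : (∅ : Set ℍ) ∈ UpperHalfPlane.atImInfty := by rw [h]; exact Filter.mem_bot
  obtain ⟨A, hA⟩ := (UpperHalfPlane.atImInfty_mem _).mp this
  refine hA ⟨Complex.I * (max A 1 : ℝ), ?_⟩ ?_
  · simp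
  · simp only [UpperHalfPlane.im]
    simp

theorem dense_range_toCurve (Γ : Subgroup SL(2, ℤ)) : DenseRange (toCurve Γ) := by
  intro x
  induction x using Curve.cases with
  | h1 z => exact subset_closure ⟨z, rfl⟩
  | h2 g =>
    have := atImInfty_neBot
    refine mem_closure_of_tendsto (f := fun z : ℍ => toCurve Γ (g • z))
      (b := UpperHalfPlane.atImInfty) ?_ (Filter.Eventually.of_forall fun z => ⟨_, rfl⟩)
    rw [Filter.Tendsto, map_atImInfty_eq_nhdsNE]
    exact nhdsWithin_le_nhds

instance (Γ : Subgroup SL(2, ℤ)) : PreconnectedSpace (Curve Γ) :=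
  (dense_range_toCurve Γ).preconnectedSpace (continuous_toCurve Γ)

instance (Γ : Subgroup SL(2, ℤ)) : Nonempty (Curve Γ) := ⟨proj Γ infty⟩

end Topology

/-! ### Holomorphic functions and local coordinates on `X(Γ)` -/

section Holomorphic

variable {Γ : Subgroup SL(2, ℤ)}

/-- The pullback to `ℍ` of a function on `X(Γ)`, as a function of a complex variable (with junk
values outside the upper half plane). -/
def pullback (G : Curve Γ → ℂ) (t : ℂ) : ℂ := G (toCurve Γ (UpperHalfPlane.ofComplex t))

@[simp] theorem pullback_coe (G : Curve Γ → ℂ) (z : ℍ) : pullback G z = G (toCurve Γ z) := by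
  rw [pullback, UpperHalfPlane.ofComplex_apply]

/-- `G` is holomorphic in a neighbourhood of the point `x` of `X(Γ)`. -/
def HolAt (G : Curve Γ → ℂ) (x : Curve Γ) : Prop :=
  ∃ W, IsOpen W ∧ x ∈ W ∧ HolomorphicOn G W

theorem holomorphicOn_iff {G : Curve Γ → ℂ} {U : Set (Curve Γ)} (hU : IsOpen U) :
    HolomorphicOn G U ↔ ContinuousOn G U ∧
      ∀ z : ℍ, toCurve Γ z ∈ U → DifferentiableAt ℂ (pullback G) z := by
  have hU' : IsOpen {z : ℍ | proj Γ (pt z) ∈ U} := hU.preimage (continuous_toCurve Γ)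
  refine and_congr_right fun _ => ⟨fun h z hz => ?_, fun h z hz => ?_⟩
  · exact UpperHalfPlane.mdifferentiableAt_iff.mp ((h z hz).mdifferentiableAt (hU'.mem_nhds hz))
  · exact (UpperHalfPlane.mdifferentiableAt_iff.mpr (show DifferentiableAt ℂ
      ((fun z : ℍ => G (proj Γ (pt z))) ∘ UpperHalfPlane.ofComplex) z from h z hz)).mdifferentiableWithinAt

theorem HolomorphicOn.mono {G : Curve Γ → ℂ} {U V : Set (Curve Γ)} (h : HolomorphicOn G U)
    (hVU : V ⊆ U) : HolomorphicOn G V :=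
  ⟨h.1.mono hVU, h.2.mono fun _ hz => hVU hz⟩

theorem HolAt.eventually {G : Curve Γ → ℂ} {x : Curve Γ} (h : HolAt G x) :
    ∀ᶠ y in 𝓝 x, HolAt G y := by
  obtain ⟨W, hW, hx, hG⟩ := h
  filter_upwards [hW.mem_nhds hx] with y hy using ⟨W, hW, hy, hG⟩

theorem HolAt.continuousAt {G : Curve Γ → ℂ} {x : Curve Γ} (h : HolAt G x) :
    ContinuousAt G x := by
  obtain ⟨W, hW, hx, hG⟩ := h
  exact hG.1.continuousAt (hW.mem_nhds hx)

theorem HolAt.differentiableAt {G : Curve Γ → ℂ} {z : ℍ} (h : HolAt G (toCurve Γ z)) :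
    DifferentiableAt ℂ (pullback G) z := by
  obtain ⟨W, hW, hx, hG⟩ := h
  exact ((holomorphicOn_iff hW).mp hG).2 z hx

theorem holomorphicOn_of_holAt {G : Curve Γ → ℂ} {U : Set (Curve Γ)} (hU : IsOpen U)
    (h : ∀ x ∈ U, HolAt G x) : HolomorphicOn G U :=
  (holomorphicOn_iff hU).mpr ⟨fun x hx => (h x hx).continuousAt.continuousWithinAt,
    fun _ hz => (h _ hz).differentiableAt⟩

theorem tendsto_ofComplex (z : ℍ) :
    Filter.Tendsto (fun t : ℂ => UpperHalfPlane.ofComplex t) (𝓝 (z : ℂ)) (𝓝 z) := by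
  have := (UpperHalfPlane.mdifferentiableAt_ofComplex z.im_pos).continuousAt
  simpa [ContinuousAt] using this

theorem HolAt.congr {G G' : Curve Γ → ℂ} {x : Curve Γ} (h : HolAt G x) (he : G =ᶠ[𝓝 x] G') :
    HolAt G' x := by
  obtain ⟨W, hW, hx, hG⟩ := h
  obtain ⟨V, hV, hVo, hxV⟩ := eventually_nhds_iff.mp he
  refine ⟨W ∩ V, hW.inter hVo, ⟨hx, hxV⟩, ?_⟩
  have hG' := (holomorphicOn_iff (hW.inter hVo)).mp (hG.mono Set.inter_subset_left)
  refine (holomorphicOn_iff (hW.inter hVo)).mpr ⟨hG'.1.congr fun y hy => (hV y hy.2).symm,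
    fun z hz => (hG'.2 z hz).congr_of_eventuallyEq ?_⟩
  have : Filter.Tendsto (fun t : ℂ => toCurve Γ (UpperHalfPlane.ofComplex t)) (𝓝 (z : ℂ))
      (𝓝 (toCurve Γ z)) :=
    (continuous_toCurve Γ).continuousAt.tendsto.comp (tendsto_ofComplex z)
  filter_upwards [this (hVo.mem_nhds hz.2)] with t ht
  exact (hV _ ht).symm

theorem eventually_nhds_coe_iff {z : ℍ} {P : ℂ → Prop} :
    (∀ᶠ t in 𝓝 (z : ℂ), P t) ↔ ∀ᶠ w : ℍ in 𝓝 z, P w := by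
  rw [← UpperHalfPlane.isOpenEmbedding_coe.map_nhds_eq, Filter.eventually_map]

theorem pullback_smul (G : Curve Γ → ℂ) {γ : SL(2, ℤ)} (hγ : γ ∈ Γ) (z : ℍ) :
    pullback G =ᶠ[𝓝 (z : ℂ)]
      fun t => pullback G ((γ • UpperHalfPlane.ofComplex t : ℍ) : ℂ) := by
  refine Filter.Eventually.of_forall fun t => ?_
  simp only [pullback_coe]
  rw [toCurve_smul hγ, pullback]

theorem differentiableAt_pullback_smul {G : Curve Γ → ℂ} {γ : SL(2, ℤ)} (hγ : γ ∈ Γ) {z : ℍ}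
    (h : DifferentiableAt ℂ (pullback G) ((γ • z : ℍ) : ℂ)) :
    DifferentiableAt ℂ (pullback G) z := by
  refine DifferentiableAt.congr_of_eventuallyEq ?_ (pullback_smul G hγ z)
  refine DifferentiableAt.comp (g := pullback G) (z : ℂ) ?_ (hasDerivAt_smul γ z).differentiableAt
  rwa [UpperHalfPlane.ofComplex_apply]

theorem holAt_toCurve_iff {G : Curve Γ → ℂ} {z : ℍ} :
    HolAt G (toCurve Γ z) ↔ AnalyticAt ℂ (pullback G) z := by
  constructor
  · intro h
    refine Complex.analyticAt_iff_eventually_differentiableAt.mpr ?_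
    rw [eventually_nhds_coe_iff]
    filter_upwards [(continuous_toCurve Γ).continuousAt.eventually h.eventually] with w hw
    exact hw.differentiableAt
  · intro h
    have h1 := Complex.analyticAt_iff_eventually_differentiableAt.mp h
    rw [eventually_nhds_coe_iff] at h1
    obtain ⟨U, hU, hUo, hzU⟩ := eventually_nhds_iff.mp h1
    have hW := isOpenMap_toCurve Γ U hUo
    refine ⟨toCurve Γ '' U, hW, ⟨z, hzU, rfl⟩, (holomorphicOn_iff hW).mpr ⟨?_, ?_⟩⟩
    · rintro _ ⟨w, hw, rfl⟩
      refine ContinuousAt.continuousWithinAt ?_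
      rw [ContinuousAt, ← map_toCurve_nhds, Filter.tendsto_map'_iff]
      have := (hU w hw).continuousAt.tendsto.comp
        (UpperHalfPlane.continuous_coe.continuousAt (x := w)).tendsto
      rw [pullback_coe] at this
      exact this.congr fun v => by simp
    · rintro w ⟨v, hv, hvw⟩
      obtain ⟨γ, hγ, rfl⟩ := toCurve_eq_iff.mp hvw
      exact differentiableAt_pullback_smul hγ (hU _ hv)

/-- Holomorphy at a cusp only asks for continuity there and for holomorphy nearby. -/
theorem holAt_cusp {G : Curve Γ → ℂ} {g : SL(2, ℤ)} (hc : ContinuousAt G (proj Γ (g • infty)))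
    (hd : ∀ᶠ z in UpperHalfPlane.atImInfty, HolAt G (toCurve Γ (g • z))) :
    HolAt G (proj Γ (g • infty)) := by
  obtain ⟨A, hA⟩ := (UpperHalfPlane.atImInfty_mem _).mp hd
  have hW := isOpenMap_proj Γ _ (isOpen_horoball g A)
  refine ⟨_, hW, ⟨_, Or.inl rfl, rfl⟩, (holomorphicOn_iff hW).mpr ⟨?_, ?_⟩⟩
  · rintro _ ⟨x, rfl | ⟨z, hz, rfl⟩, rfl⟩
    · exact hc.continuousWithinAt
    · exact (hA z hz.le).continuousAt.continuousWithinAt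
  · rintro w ⟨x, rfl | ⟨z, hz, rfl⟩, hx⟩
    · exact absurd hx.symm (toCurve_ne_proj_smul_infty w g)
    · exact HolAt.differentiableAt (by rw [← hx]; exact hA z hz.le)

/-- A local coordinate of `X(Γ)` centred at `x`: an injective holomorphic function `F` near `x`,
vanishing at `x`, through which all functions holomorphic at `x` factor. -/
structure IsChartAt (F : Curve Γ → ℂ) (x : Curve Γ) : Prop where
  zero : F x = 0
  inj : ∃ U ∈ 𝓝 x, Set.InjOn F U
  map : Filter.map F (𝓝 x) = 𝓝 0
  hol : HolAt F x
  factor : ∀ G : Curve Γ → ℂ, HolAt G x →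
    ∃ g : ℂ → ℂ, AnalyticAt ℂ g 0 ∧ ∀ᶠ y in 𝓝 x, G y = g (F y)

/-- Only the factorization of holomorphic functions through `F` needs an argument: `G ∘ F⁻¹` is
continuous, and is holomorphic off `0` as `F` has nonzero derivative there, so `0` is a removable
singularity. -/
theorem isChartAt_of_deriv_ne_zero {F : Curve Γ → ℂ} {x : Curve Γ} {U : Set (Curve Γ)}
    (hU : IsOpen U) (hx : x ∈ U) (h0 : F x = 0) (hinj : Set.InjOn F U)
    (hmap : Filter.map F (𝓝 x) = 𝓝 0) (hhol : HolomorphicOn F U)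
    (hder : ∀ y ∈ U, y ≠ x → ∃ z : ℍ, toCurve Γ z = y ∧ deriv (pullback F) z ≠ 0) :
    IsChartAt F x := by
  refine ⟨h0, ⟨U, hU.mem_nhds hx, hinj⟩, hmap, ⟨U, hU, hx, hhol⟩, fun G hG => ?_⟩
  have hG' := hG
  obtain ⟨W, hW, hxW, hGW⟩ := hG
  set V := U ∩ W with hV
  have hVo : IsOpen V := hU.inter hW
  have hxV : x ∈ V := ⟨hx, hxW⟩
  have hinjV : Set.InjOn F V := hinj.mono Set.inter_subset_left
  -- the germ `G ∘ F⁻¹` is continuous at `0` and holomorphic in a punctured neighbourhood of `0`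
  set g : ℂ → ℂ := fun s => G (Function.invFunOn F V s) with hg
  have hgF : ∀ y ∈ V, g (F y) = G y := fun y hy => by
    rw [hg]
    simp only
    rw [hinjV.leftInvOn_invFunOn hy]
  refine ⟨g, ?_, ?_⟩
  · apply Complex.analyticAt_of_differentiable_on_punctured_nhds_of_continuousAt
    · rw [eventually_nhdsWithin_iff, ← hmap, Filter.eventually_map]
      filter_upwards [hVo.mem_nhds hxV] with y hy hy0
      have hyx : y ≠ x := fun h => hy0 (by rw [h, h0]; rfl)
      obtain ⟨z, rfl, hz⟩ := hder y hy.1 hyx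
      have han : AnalyticAt ℂ (pullback F) z :=
        holAt_toCurve_iff.mp ⟨U, hU, hy.1, hhol⟩
      have hs : HasStrictDerivAt (pullback F) (deriv (pullback F) z) z := han.hasStrictDerivAt
      set L := hs.localInverse (pullback F) _ z hz with hL
      have hLs : HasStrictDerivAt L (deriv (pullback F) z)⁻¹ (pullback F z) :=
        hs.to_localInverse hz
      have hLr : ∀ᶠ s in 𝓝 (pullback F z), pullback F (L s) = s :=
        (hs.hasStrictFDerivAt_equiv hz).eventually_right_inverse
      have hLz : L (pullback F z) = z :=
        (hs.hasStrictFDerivAt_equiv hz).eventually_left_inverse.self_of_nhds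
      rw [pullback_coe] at hLs hLr hLz
      have hLV : ∀ᶠ s in 𝓝 (F (toCurve Γ z)), toCurve Γ (UpperHalfPlane.ofComplex (L s)) ∈ V := by
        have h1 : Filter.Tendsto L (𝓝 (F (toCurve Γ z))) (𝓝 (z : ℂ)) := by
          have := hLs.hasDerivAt.continuousAt.tendsto
          rwa [hLz] at this
        exact (((continuous_toCurve Γ).continuousAt (x := z)).tendsto.comp
          ((tendsto_ofComplex z).comp h1)) (hVo.mem_nhds hy)
      have hgL : g =ᶠ[𝓝 (F (toCurve Γ z))] fun s => pullback G (L s) := by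
        filter_upwards [hLr, hLV] with s hs1 hs2
        have := hgF _ hs2
        rw [show F (toCurve Γ (UpperHalfPlane.ofComplex (L s))) = s from hs1] at this
        exact this
      refine DifferentiableAt.congr_of_eventuallyEq ?_ hgL
      refine DifferentiableAt.comp (g := pullback G) _ ?_ hLs.hasDerivAt.differentiableAt
      rw [hLz]
      exact HolAt.differentiableAt ⟨W, hW, hy.2, hGW⟩
    · have hg0 : g 0 = G x := by rw [← h0, hgF x hxV]
      rw [ContinuousAt, hg0, ← hmap, Filter.tendsto_map'_iff]
      refine hG'.continuousAt.tendsto.congr' ?_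
      filter_upwards [hVo.mem_nhds hxV] with y hy
      exact (hgF y hy).symm
  · filter_upwards [hVo.mem_nhds hxV] with y hy
    exact (hgF y hy).symm

end Holomorphic

/-! ### Stabilizers -/

section Stabilizers

theorem aut_pow {g : SL(2, ℤ)} {z : ℍ} (h : g • z = z) (n : ℕ) : aut (g ^ n) z = aut g z ^ n := by
  induction n with
  | zero => rw [pow_zero, pow_zero, aut_one]
  | succ n ih => rw [pow_succ, aut_mul, h, ih, pow_succ]

theorem aut_sq_of_eq_one_or {g : SL(2, ℤ)} (h : g = 1 ∨ g = -1) (z : ℂ) : aut g z ^ 2 = 1 := by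
  rcases h with rfl | rfl
  · rw [aut_one, one_pow]
  · rw [aut_neg, aut_one]; norm_num

/-- Points of `ℍ` with nontrivial stabilizer in `SL(2, ℤ)` are equivalent to `i` or to `ρ`. -/
theorem stabilizer_cases (z : ℍ) : (∀ g : SL(2, ℤ), g • z = z → g = 1 ∨ g = -1) ∨
    (∃ h : SL(2, ℤ), z = h • UpperHalfPlane.I) ∨ ∃ h : SL(2, ℤ), z = h • UpperHalfPlane.ρ := by
  obtain ⟨h, hh⟩ := ModularGroup.exists_smul_mem_fd z
  by_cases h1 : h • z = UpperHalfPlane.I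
  · exact Or.inr (Or.inl ⟨h⁻¹, by rw [← h1, inv_smul_smul]⟩)
  by_cases h2 : h • z = UpperHalfPlane.ρ
  · exact Or.inr (Or.inr ⟨h⁻¹, by rw [← h2, inv_smul_smul]⟩)
  by_cases h3 : h • z = (1 : ℝ) +ᵥ UpperHalfPlane.ρ
  · refine Or.inr (Or.inr ⟨h⁻¹ * ModularGroup.T, ?_⟩)
    rw [mul_smul, UpperHalfPlane.modular_T_smul, ← h3, inv_smul_smul]
  · left
    intro g hg
    have := ModularGroup.stabilizer_of_ne (g := h * g * h⁻¹) hh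
      (by rw [mul_smul, mul_smul, inv_smul_smul, hg]) h1 h2 h3
    rcases this with h' | h'
    · left
      have : g = h⁻¹ * (h * g * h⁻¹) * h := by group
      rw [this, h']; group
    · right
      have : g = h⁻¹ * (h * g * h⁻¹) * h := by group
      rw [this, h', mul_neg, neg_mul, mul_one, inv_mul_cancel]

theorem conj_smul_eq {g h : SL(2, ℤ)} {w : ℍ} (hg : g • h • w = h • w) :
    (h⁻¹ * g * h) • w = w := by
  rw [mul_smul, mul_smul, hg, inv_smul_smul]

theorem eq_one_or_of_conj {g h : SL(2, ℤ)} (hg : h⁻¹ * g * h = 1 ∨ h⁻¹ * g * h = -1) :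
    g = 1 ∨ g = -1 := by
  have : g = h * (h⁻¹ * g * h) * h⁻¹ := by group
  rcases hg with h' | h'
  · left; rw [this, h']; group
  · right; rw [this, h', mul_neg, neg_mul, mul_one, mul_inv_cancel]

theorem S_mul_S : ModularGroup.S * ModularGroup.S = -1 := by decide

theorem sq_of_smul_I {g h : SL(2, ℤ)} (hg : g • h • UpperHalfPlane.I = h • UpperHalfPlane.I) :
    (g = 1 ∨ g = -1) ∨ g ^ 2 = -1 := by
  have h1 := ModularGroup.stabilizer_I.mp (conj_smul_eq hg)
  simp only [Finset.mem_insert, Finset.mem_singleton] at h1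
  have key : ∀ s : SL(2, ℤ), h⁻¹ * g * h = s → s ^ 2 = -1 → g ^ 2 = -1 := by
    intro s hs hs2
    have : g ^ 2 = h * (h⁻¹ * g * h) ^ 2 * h⁻¹ := by simp [sq, mul_assoc]
    rw [this, hs, hs2, mul_neg, neg_mul, mul_one, mul_inv_cancel]
  rcases h1 with h' | h' | h' | h'
  · exact Or.inl (eq_one_or_of_conj (Or.inl h'))
  · exact Or.inl (eq_one_or_of_conj (Or.inr h'))
  · exact Or.inr (key _ h' (by decide))
  · exact Or.inr (key _ h' (by decide))

theorem cube_of_smul_rho {g h : SL(2, ℤ)} (hg : g • h • UpperHalfPlane.ρ = h • UpperHalfPlane.ρ) :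
    g ^ 3 = 1 ∨ g ^ 3 = -1 := by
  have h1 := ModularGroup.stabilizer_ρ.mp (conj_smul_eq hg)
  simp only [Finset.mem_insert, Finset.mem_singleton] at h1
  have e : g ^ 3 = h * (h⁻¹ * g * h) ^ 3 * h⁻¹ := by simp [pow_succ, mul_assoc]
  have key : (h⁻¹ * g * h) ^ 3 = 1 ∨ (h⁻¹ * g * h) ^ 3 = -1 := by
    rcases h1 with h' | h' | h' | h' | h' | h' <;> rw [h'] <;> decide
  rcases key with h' | h'
  · left; rw [e, h']; group
  · right; rw [e, h', mul_neg, neg_mul, mul_one, mul_inv_cancel]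

open Classical in
/-- The order of the stabilizer of `z` in `Γ / {±1}`, which is `1`, `2` or `3`. When the stabilizer
is nontrivial, its order is read off from the `SL(2, ℤ)`-orbit of `z`, which is that of `i` or that
of `ρ`. -/
def ell (Γ : Subgroup SL(2, ℤ)) (z : ℍ) : ℕ :=
  if ∀ γ ∈ Γ, γ • z = z → γ = 1 ∨ γ = -1 then 1
  else if ∃ h : SL(2, ℤ), z = h • UpperHalfPlane.I then 2 else 3

variable {Γ : Subgroup SL(2, ℤ)}

theorem ell_eq_one_iff {z : ℍ} :
    ell Γ z = 1 ↔ ∀ γ ∈ Γ, γ • z = z → γ = 1 ∨ γ = -1 := by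
  rw [ell]
  split_ifs with h1 h2
  · exact ⟨fun _ => h1, fun _ => rfl⟩
  · exact ⟨fun h => absurd h (by norm_num), fun h => absurd h h1⟩
  · exact ⟨fun h => absurd h (by norm_num), fun h => absurd h h1⟩

theorem ell_eq_two {z : ℍ} (h : ell Γ z = 2) : (∃ h : SL(2, ℤ), z = h • UpperHalfPlane.I) ∧
    ∃ γ ∈ Γ, γ • z = z ∧ γ ^ 2 = -1 := by
  unfold ell at h
  by_cases h1 : ∀ γ ∈ Γ, γ • z = z → γ = 1 ∨ γ = -1
  · rw [if_pos h1] at h; norm_num at h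
  by_cases h2 : ∃ h : SL(2, ℤ), z = h • UpperHalfPlane.I
  swap
  · rw [if_neg h1, if_neg h2] at h; norm_num at h
  obtain ⟨k, rfl⟩ := h2
  refine ⟨⟨k, rfl⟩, ?_⟩
  push Not at h1
  obtain ⟨γ, hγ, hz, h1, h2⟩ := h1
  exact ⟨γ, hγ, hz, (sq_of_smul_I hz).resolve_left (by tauto)⟩

theorem ell_eq_three {z : ℍ} (h : ell Γ z = 3) : (∃ h : SL(2, ℤ), z = h • UpperHalfPlane.ρ) ∧
    ∃ γ ∈ Γ, γ • z = z ∧ (γ ≠ 1 ∧ γ ≠ -1) ∧ (γ ^ 3 = 1 ∨ γ ^ 3 = -1) := by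
  unfold ell at h
  by_cases h1 : ∀ γ ∈ Γ, γ • z = z → γ = 1 ∨ γ = -1
  · rw [if_pos h1] at h; norm_num at h
  by_cases h2 : ∃ h : SL(2, ℤ), z = h • UpperHalfPlane.I
  · rw [if_neg h1, if_pos h2] at h; norm_num at h
  push Not at h1
  obtain ⟨γ, hγ, hz, h1, h3⟩ := h1
  rcases stabilizer_cases z with h' | h' | ⟨k, rfl⟩
  · exact absurd (h' γ hz) (by tauto)
  · exact absurd h' h2
  · exact ⟨⟨k, rfl⟩, γ, hγ, hz, ⟨h1, h3⟩, cube_of_smul_rho hz⟩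

theorem ell_cases (Γ : Subgroup SL(2, ℤ)) (z : ℍ) : ell Γ z = 1 ∨ ell Γ z = 2 ∨ ell Γ z = 3 := by
  rw [ell]; split_ifs <;> simp

theorem ell_pos (Γ : Subgroup SL(2, ℤ)) (z : ℍ) : 0 < ell Γ z := by
  rcases ell_cases Γ z with h | h | h <;> omega

theorem ell_smul_of_normalizes {g : SL(2, ℤ)} (hg : ∀ γ, γ ∈ Γ ↔ g * γ * g⁻¹ ∈ Γ) (z : ℍ) :
    ell Γ (g • z) = ell Γ z := by
  have h1 : (∀ γ ∈ Γ, γ • g • z = g • z → γ = 1 ∨ γ = -1) ↔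
      ∀ γ ∈ Γ, γ • z = z → γ = 1 ∨ γ = -1 := by
    constructor
    · intro h γ hγ hz
      refine eq_one_or_of_conj (h := g⁻¹) ?_
      rw [inv_inv]
      exact h _ ((hg γ).mp hγ) (by rw [mul_smul, mul_smul, inv_smul_smul, hz])
    · intro h γ hγ hz
      refine eq_one_or_of_conj (h := g) (h _ ((hg _).mpr ?_) (conj_smul_eq hz))
      have : g * (g⁻¹ * γ * g) * g⁻¹ = γ := by group
      rwa [this]
  have h2 : (∃ h : SL(2, ℤ), g • z = h • UpperHalfPlane.I) ↔
      ∃ h : SL(2, ℤ), z = h • UpperHalfPlane.I := by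
    constructor
    · rintro ⟨h, hh⟩
      exact ⟨g⁻¹ * h, by rw [mul_smul, ← hh, inv_smul_smul]⟩
    · rintro ⟨h, rfl⟩
      exact ⟨g * h, by rw [mul_smul]⟩
  unfold ell
  classical
  exact if_congr h1 rfl (if_congr h2 rfl rfl)

theorem ell_smul {g : SL(2, ℤ)} (hg : g ∈ Γ) (z : ℍ) : ell Γ (g • z) = ell Γ z :=
  ell_smul_of_normalizes (fun γ => ⟨fun h => Γ.mul_mem (Γ.mul_mem hg h) (Γ.inv_mem hg), fun h => by
    have := Γ.mul_mem (Γ.mul_mem (Γ.inv_mem hg) h) hg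
    have e : g⁻¹ * (g * γ * g⁻¹) * g = γ := by group
    rwa [e] at this⟩) z

theorem ell_eq_of_toCurve_eq {z w : ℍ} (h : toCurve Γ z = toCurve Γ w) : ell Γ z = ell Γ w := by
  obtain ⟨γ, hγ, rfl⟩ := toCurve_eq_iff.mp h
  exact ell_smul hγ w

theorem toCurve_mem_ellipticPoints_iff {z : ℍ} :
    toCurve Γ z ∈ ellipticPoints Γ ↔ ell Γ z ≠ 1 := by
  rw [Ne, ell_eq_one_iff]
  push Not
  constructor
  · rintro ⟨w, hw, γ, hγ, h1, h2, h3⟩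
    obtain ⟨δ, hδ, rfl⟩ := toCurve_eq_iff.mp hw
    refine ⟨δ * γ * δ⁻¹, Γ.mul_mem (Γ.mul_mem hδ hγ) (Γ.inv_mem hδ), ?_, ?_⟩
    · rw [mul_smul, mul_smul, inv_smul_smul, h3]
    · by_contra hne
      have : δ * γ * δ⁻¹ = 1 ∨ δ * γ * δ⁻¹ = -1 := by tauto
      have := eq_one_or_of_conj (g := γ) (h := δ⁻¹) (by rwa [inv_inv])
      tauto
  · rintro ⟨γ, hγ, h1, h2, h3⟩
    exact ⟨z, rfl, γ, hγ, h2, h3, h1⟩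

theorem exists_of_mem_ellipticPoints {x : Curve Γ} (hx : x ∈ ellipticPoints Γ) :
    ∃ z : ℍ, x = toCurve Γ z := by
  obtain ⟨z, hz, _⟩ := hx
  exact ⟨z, hz⟩

/-- The stabilizer of `z` acts on the tangent space at `z` by the roots of unity of order
`ell Γ z`. -/
theorem pow_ell_eq_one_iff (z : ℍ) (ζ : ℂ) :
    ζ ^ ell Γ z = 1 ↔ ∃ γ ∈ Γ, γ • z = z ∧ ζ = aut γ z ^ 2 := by
  rcases ell_cases Γ z with h | h | h
  · rw [h, pow_one]
    constructor
    · rintro rfl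
      exact ⟨1, Γ.one_mem, one_smul _ _, by rw [aut_one, one_pow]⟩
    · rintro ⟨γ, hγ, hz, rfl⟩
      exact aut_sq_of_eq_one_or (ell_eq_one_iff.mp h γ hγ hz) z
  · rw [h]
    obtain ⟨⟨k, hk⟩, γ₀, hγ₀, hz₀, hsq⟩ := ell_eq_two h
    constructor
    · intro hζ
      rcases sq_eq_one_iff.mp hζ with rfl | rfl
      · exact ⟨1, Γ.one_mem, one_smul _ _, by rw [aut_one, one_pow]⟩
      · exact ⟨γ₀, hγ₀, hz₀, by rw [← aut_pow hz₀, hsq, aut_neg, aut_one]⟩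
    · rintro ⟨γ, hγ, hz, rfl⟩
      have : (γ = 1 ∨ γ = -1) ∨ γ ^ 2 = -1 := by
        rw [hk] at hz
        exact sq_of_smul_I hz
      rcases this with h' | h'
      · rw [aut_sq_of_eq_one_or h', one_pow]
      · rw [← aut_pow hz, h', aut_neg, aut_one]; norm_num
  · rw [h]
    obtain ⟨⟨k, hk⟩, γ₀, hγ₀, hz₀, ⟨hne1, hne2⟩, hcube⟩ := ell_eq_three h
    have cube : ∀ γ : SL(2, ℤ), γ • z = z → (aut γ z ^ 2) ^ 3 = 1 := by
      intro γ hz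
      have h3 : γ ^ 3 = 1 ∨ γ ^ 3 = -1 := by
        rw [hk] at hz
        exact cube_of_smul_rho hz
      rw [← pow_mul, mul_comm, pow_mul, ← aut_pow hz]
      exact aut_sq_of_eq_one_or h3 z
    constructor
    · intro hζ
      set c := aut γ₀ z ^ 2 with hc
      have hc3 : c ^ 3 = 1 := cube γ₀ hz₀
      have hc1 : c ≠ 1 := fun hc1 => by
        have := eq_one_or_neg_one_of_aut_sq hz₀ hc1
        tauto
      have hcc : 1 + c + c ^ 2 = 0 := by
        have : (c - 1) * (1 + c + c ^ 2) = 0 := by linear_combination hc3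
        exact (mul_eq_zero.mp this).resolve_left (sub_ne_zero.mpr hc1)
      have hprod : (ζ - 1) * ((ζ - c) * (ζ - c ^ 2)) = 0 := by
        linear_combination hζ - hc3 + (ζ - ζ ^ 2 + (c - 1) * ζ) * hcc
      rcases mul_eq_zero.mp hprod with h1 | h1
      · exact ⟨1, Γ.one_mem, one_smul _ _, by rw [aut_one, one_pow]; exact sub_eq_zero.mp h1⟩
      · rcases mul_eq_zero.mp h1 with h1 | h1
        · exact ⟨γ₀, hγ₀, hz₀, sub_eq_zero.mp h1⟩
        · refine ⟨γ₀ ^ 2, Γ.pow_mem hγ₀ 2, by rw [sq, mul_smul, hz₀, hz₀], ?_⟩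
          rw [aut_pow hz₀, ← pow_mul, mul_comm 2 2, pow_mul]
          exact sub_eq_zero.mp h1
    · rintro ⟨γ, _, hz, rfl⟩
      exact cube γ hz

end Stabilizers

/-! ### Charts at the points of `ℍ` -/

section InteriorCharts

variable {Γ : Subgroup SL(2, ℤ)}

open ComplexConjugate in
/-- The coordinate `(t - z₀) / (t - conj z₀)` identifying `ℍ` with the unit disc. -/
def cayley (z₀ : ℍ) (t : ℂ) : ℂ := (t - z₀) / (t - conj (z₀ : ℂ))

open ComplexConjugate in
theorem sub_conj_ne_zero (z₀ z : ℍ) : (z : ℂ) - conj (z₀ : ℂ) ≠ 0 := by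
  intro h
  have := congrArg Complex.im h
  simp only [Complex.sub_im, Complex.conj_im, UpperHalfPlane.coe_im, Complex.zero_im] at this
  have h1 := z.im_pos
  have h2 := z₀.im_pos
  linarith

theorem cayley_self (z₀ : ℍ) : cayley z₀ z₀ = 0 := by simp [cayley]

open ComplexConjugate in
theorem hasDerivAt_cayley (z₀ z : ℍ) : HasDerivAt (cayley z₀)
    ((z₀ - conj (z₀ : ℂ)) / (z - conj (z₀ : ℂ)) ^ 2) z := by
  have := ((hasDerivAt_id (z : ℂ)).sub_const (z₀ : ℂ)).div
    ((hasDerivAt_id (z : ℂ)).sub_const (conj (z₀ : ℂ))) (sub_conj_ne_zero z₀ z)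
  convert! this using 1
  simp

theorem deriv_cayley_ne_zero (z₀ z : ℍ) : deriv (cayley z₀) z ≠ 0 := by
  rw [(hasDerivAt_cayley z₀ z).deriv]
  exact div_ne_zero (sub_conj_ne_zero z₀ z₀) (pow_ne_zero _ (sub_conj_ne_zero z₀ z))

theorem analyticAt_cayley (z₀ z : ℍ) : AnalyticAt ℂ (cayley z₀) z :=
  (analyticAt_id.sub analyticAt_const).div (analyticAt_id.sub analyticAt_const)
    (sub_conj_ne_zero z₀ z)

open ComplexConjugate in
theorem cayley_injective {z₀ z w : ℍ} (h : cayley z₀ z = cayley z₀ w) : z = w := by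
  rw [cayley, cayley, div_eq_div_iff (sub_conj_ne_zero z₀ z) (sub_conj_ne_zero z₀ w)] at h
  have : ((z₀ : ℂ) - conj (z₀ : ℂ)) * ((z : ℂ) - w) = 0 := by linear_combination h
  exact UpperHalfPlane.ext (sub_eq_zero.mp
    ((mul_eq_zero.mp this).resolve_left (sub_conj_ne_zero z₀ z₀)))

theorem cayley_eq_zero_iff {z₀ z : ℍ} : cayley z₀ z = 0 ↔ z = z₀ := by
  rw [← cayley_self z₀]
  exact ⟨fun h => cayley_injective h, fun h => by rw [h]⟩

open ComplexConjugate in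
/-- An element of the stabilizer of `z₀` acts on the Cayley coordinate as a rotation. -/
theorem cayley_smul {g : SL(2, ℤ)} {z₀ : ℍ} (hg : g • z₀ = z₀) (z : ℍ) :
    cayley z₀ z = aut g z₀ ^ 2 * cayley z₀ (g • z : ℍ) := by
  have ha := aut_ne_zero g z
  have ha0 := aut_ne_zero g z₀
  have hca : conj (aut g z₀) = aut g (conj (z₀ : ℂ)) := by simp [aut]
  have hac : aut g (conj (z₀ : ℂ)) ≠ 0 := by
    rw [← hca]
    exact (map_ne_zero _).mpr ha0
  have hnorm : aut g z₀ * aut g (conj (z₀ : ℂ)) = 1 := by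
    rw [← hca, Complex.mul_conj]
    have := im_smul_eq g z₀
    rw [hg, eq_div_iff (fun h => ha0 (Complex.normSq_eq_zero.mp h))] at this
    have h2 : Complex.normSq (aut g z₀) = 1 := by
      have h0 := z₀.im_ne_zero
      field_simp at this
      linarith
    rw [h2, Complex.ofReal_one]
  have h1 : ((g • z : ℍ) : ℂ) - z₀ = ((z : ℂ) - z₀) / (aut g z * aut g z₀) := by
    conv_lhs => rw [← hg]
    exact (coe_smul_sub g z z₀)
  have h2 : ((g • z : ℍ) : ℂ) - conj (z₀ : ℂ)
      = ((z : ℂ) - conj (z₀ : ℂ)) / (aut g z * aut g (conj (z₀ : ℂ))) := by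
    have hd : (g 0 0 : ℂ) * g 1 1 - g 0 1 * g 1 0 = 1 := by
      have := g.det_coe
      rw [Matrix.det_fin_two] at this
      exact_mod_cast this
    have hc : conj (z₀ : ℂ)
        = ((g 0 0 : ℂ) * conj (z₀ : ℂ) + (g 0 1 : ℂ)) / aut g (conj (z₀ : ℂ)) := by
      conv_lhs => rw [← hg, coe_smul_eq, map_div₀, hca]
      simp
    conv_lhs => rw [hc, coe_smul_eq, div_sub_div _ _ ha hac]
    congr 1
    simp only [aut]
    linear_combination ((z : ℂ) - conj (z₀ : ℂ)) * hd
  have h3 := sub_conj_ne_zero z₀ z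
  rw [cayley, cayley, h1, h2]
  field_simp
  linear_combination -((z : ℂ) - z₀) * hnorm

theorem map_cayley_pow (z₀ : ℍ) {n : ℕ} (hn : 0 < n) :
    Filter.map (fun z : ℍ => cayley z₀ z ^ n) (𝓝 z₀) = 𝓝 0 := by
  have han : AnalyticAt ℂ (fun t => cayley z₀ t ^ n) z₀ := (analyticAt_cayley z₀ z₀).pow n
  have h0 : cayley z₀ z₀ ^ n = 0 := by rw [cayley_self, zero_pow hn.ne']
  have hm : Filter.map (fun t => cayley z₀ t ^ n) (𝓝 (z₀ : ℂ)) = 𝓝 0 := by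
    refine le_antisymm ?_ ?_
    · have := han.continuousAt.tendsto
      rwa [h0] at this
    · rcases han.eventually_constant_or_nhds_le_map_nhds with h | h
      · exfalso
        rw [h0, eventually_nhds_coe_iff] at h
        have h' : ∀ᶠ w : ℍ in 𝓝 z₀, w = z₀ := by
          filter_upwards [h] with w hw
          exact cayley_eq_zero_iff.mp (pow_eq_zero_iff hn.ne' |>.mp hw)
        have h2 : ∀ᶠ t in 𝓝 (z₀ : ℂ), t = (z₀ : ℂ) := by
          rw [eventually_nhds_coe_iff]
          filter_upwards [h'] with w hw
          rw [hw]
        obtain ⟨t, ht, ht'⟩ := ((h2.filter_mono nhdsWithin_le_nhds).and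
          (self_mem_nhdsWithin : {(z₀ : ℂ)}ᶜ ∈ 𝓝[≠] (z₀ : ℂ))).exists
        exact ht' ht
      · rwa [h0] at h
  rw [← hm, ← UpperHalfPlane.isOpenEmbedding_coe.map_nhds_eq, Filter.map_map]
  rfl

/-- Near the image of `z₀` the curve has the coordinate `r ^ e`, where `r` is the Cayley coordinate
centred at `z₀` and `e` the order of the stabilizer of `z₀`. -/
theorem exists_chart_toCurve (z₀ : ℍ) : ∃ F : Curve Γ → ℂ,
    IsChartAt F (toCurve Γ z₀) ∧ ∀ᶠ z : ℍ in 𝓝 z₀, F (toCurve Γ z) = cayley z₀ z ^ ell Γ z₀ := by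
  classical
  set e := ell Γ z₀ with he
  have hep : 0 < e := ell_pos Γ z₀
  obtain ⟨B₁, hB₁, B₂, hB₂, hB⟩ := exists_nhds_smul z₀ z₀
  obtain ⟨B, hBs, hBo, hzB⟩ := mem_nhds_iff.mp (Filter.inter_mem hB₁ hB₂)
  set F : Curve Γ → ℂ := fun y =>
    if h : ∃ z ∈ B, toCurve Γ z = y then cayley z₀ h.choose ^ e else 0 with hFdef
  have hF : ∀ z ∈ B, F (toCurve Γ z) = cayley z₀ z ^ e := by
    intro z hz
    have h : ∃ w ∈ B, toCurve Γ w = toCurve Γ z := ⟨z, hz, rfl⟩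
    rw [hFdef]
    simp only [dif_pos h]
    obtain ⟨hw, hwz⟩ := h.choose_spec
    obtain ⟨γ, hγ, hγw⟩ := toCurve_eq_iff.mp hwz
    have hst : γ • z₀ = z₀ := hB γ z (hBs hz).1 (by rw [hγw]; exact (hBs hw).2)
    rw [cayley_smul hst z, mul_pow, (pow_ell_eq_one_iff z₀ _).mpr ⟨γ, hγ, hst, rfl⟩, one_mul,
      hγw]
  have hFe : ∀ᶠ z : ℍ in 𝓝 z₀, F (toCurve Γ z) = cayley z₀ z ^ e := by
    filter_upwards [hBo.mem_nhds hzB] with z hz using hF z hz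
  refine ⟨F, ?_, hFe⟩
  have hpb : ∀ z ∈ B, pullback F =ᶠ[𝓝 (z : ℂ)] fun t => cayley z₀ t ^ e := by
    intro z hz
    rw [Filter.EventuallyEq, eventually_nhds_coe_iff]
    filter_upwards [hBo.mem_nhds hz] with w hw
    rw [pullback_coe, hF w hw]
  have hU := isOpenMap_toCurve Γ B hBo
  refine isChartAt_of_deriv_ne_zero hU ⟨z₀, hzB, rfl⟩ ?_ ?_ ?_ ?_ ?_
  · rw [hF z₀ hzB, cayley_self, zero_pow hep.ne']
  · rintro _ ⟨z, hz, rfl⟩ _ ⟨w, hw, rfl⟩ h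
    rw [hF z hz, hF w hw] at h
    by_cases hw0 : w = z₀
    · rw [hw0, cayley_self, zero_pow hep.ne'] at h
      rw [hw0, cayley_eq_zero_iff.mp ((pow_eq_zero_iff hep.ne').mp h)]
    · have hcw : cayley z₀ w ≠ 0 := fun h => hw0 (cayley_eq_zero_iff.mp h)
      have hζ : (cayley z₀ z / cayley z₀ w) ^ e = 1 := by
        rw [div_pow, h, div_self (pow_ne_zero _ hcw)]
      obtain ⟨γ, hγ, hst, hζ⟩ := (pow_ell_eq_one_iff z₀ _).mp hζ
      rw [div_eq_iff hcw, cayley_smul hst z] at hζ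
      have : γ • z = w :=
        cayley_injective (mul_left_cancel₀ (pow_ne_zero 2 (aut_ne_zero γ z₀)) hζ)
      rw [← this, toCurve_smul hγ]
  · rw [← map_toCurve_nhds, Filter.map_map, ← map_cayley_pow z₀ hep]
    exact Filter.map_congr hFe
  · refine holomorphicOn_of_holAt hU ?_
    rintro _ ⟨z, hz, rfl⟩
    rw [holAt_toCurve_iff]
    exact ((analyticAt_cayley z₀ z).pow e).congr (hpb z hz).symm
  · rintro _ ⟨z, hz, rfl⟩ hne
    refine ⟨z, rfl, ?_⟩
    rw [(hpb z hz).deriv_eq, deriv_fun_pow (analyticAt_cayley z₀ z).differentiableAt]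
    refine mul_ne_zero (mul_ne_zero (by exact_mod_cast hep.ne') (pow_ne_zero _ fun h => hne ?_))
      (deriv_cayley_ne_zero z₀ z)
    rw [cayley_eq_zero_iff.mp h]

end InteriorCharts

/-! ### Charts at the cusps -/

section CuspCharts

/-- The hypotheses on `Γ` used for its curve: it contains `-1` and the principal congruence group
of level `p`, and all of its cusps have width `p`. -/
structure IsLevel (p : ℕ) (Γ : Subgroup SL(2, ℤ)) : Prop where
  pos : 0 < p
  neg_one_mem : -1 ∈ Γ
  gamma_le : CongruenceSubgroup.Gamma p ≤ Γ
  width : ∀ (g : SL(2, ℤ)) (k : ℤ), g * ModularGroup.T ^ k * g⁻¹ ∈ Γ → (p : ℤ) ∣ k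

variable {Γ : Subgroup SL(2, ℤ)} {p : ℕ}

theorem IsLevel.finiteIndex (h : IsLevel p Γ) : Γ.FiniteIndex := by
  have : NeZero p := ⟨h.pos.ne'⟩
  exact Subgroup.finiteIndex_of_le h.gamma_le

theorem IsLevel.neg_mem (h : IsLevel p Γ) {g : SL(2, ℤ)} (hg : -g ∈ Γ) : g ∈ Γ := by
  have := Γ.mul_mem h.neg_one_mem hg
  rwa [neg_mul_neg, one_mul] at this

theorem IsLevel.conj_T_mem (h : IsLevel p Γ) (g : SL(2, ℤ)) {k : ℤ} (hk : (p : ℤ) ∣ k) :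
    g * ModularGroup.T ^ k * g⁻¹ ∈ Γ :=
  h.gamma_le ((CongruenceSubgroup.Gamma_normal p).conj_mem _
    (by
      have hk0 : ((k : ℤ) : ZMod p) = 0 := (ZMod.intCast_zmod_eq_zero_iff_dvd k p).mpr hk
      rw [CongruenceSubgroup.Gamma_mem, ModularGroup.coe_T_zpow]
      refine ⟨?_, ?_, ?_, ?_⟩ <;> simp [hk0]) g)

/-- Equivalent points high up near the cusp `g • ∞` differ by a multiple of the width. -/
theorem IsLevel.exists_zpow (h : IsLevel p Γ) {g : SL(2, ℤ)} {z w : ℍ} (hz : 1 < z.im)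
    (hw : 1 < w.im) (hzw : toCurve Γ (g • z) = toCurve Γ (g • w)) :
    ∃ k : ℤ, (z : ℂ) = w + p * k := by
  obtain ⟨γ, hγ, hγz⟩ := toCurve_eq_iff.mp hzw
  have hz' : z = (g⁻¹ * γ * g) • w := by rw [mul_smul, mul_smul, hγz, inv_smul_smul]
  have hinf : (g⁻¹ * γ * g) • infty = infty := by
    by_contra hc
    have := im_mul_im_smul_le hc w
    rw [← hz'] at this
    nlinarith
  obtain ⟨n, hn⟩ := exists_T_zpow_of_smul_infty hinf
  have hzn : z = ModularGroup.T ^ n • w := by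
    rcases hn with hn | hn
    · rw [hz', hn]
    · rw [hz', hn, ModularGroup.SL_neg_smul]
  have hdvd : (p : ℤ) ∣ n := by
    apply h.width g
    have e : γ = g * (g⁻¹ * γ * g) * g⁻¹ := by group
    rcases hn with hn | hn
    · rw [hn] at e
      rwa [← e]
    · rw [hn, mul_neg, neg_mul] at e
      refine h.neg_mem ?_
      rwa [← e]
  obtain ⟨k, rfl⟩ := hdvd
  exact ⟨k, by rw [hzn, ModularGroup.coe_T_zpow_smul_eq]; push_cast; ring⟩

/-- The map `exp (2πiz/p)` takes the neighbourhoods of `i∞` to the punctured neighbourhoods of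
`0`. -/
theorem map_qParam_atImInfty (hp : 0 < p) :
    Filter.map (fun z : ℍ => Function.Periodic.qParam p z) UpperHalfPlane.atImInfty = 𝓝[≠] 0 := by
  have hp' : (0 : ℝ) < p := by exact_mod_cast hp
  refine le_antisymm (tendsto_nhdsWithin_iff.mpr
    ⟨UpperHalfPlane.qParam_tendsto_atImInfty hp',
      Filter.Eventually.of_forall fun z => Function.Periodic.qParam_ne_zero _⟩) fun V hV => ?_
  rw [Filter.mem_map, UpperHalfPlane.atImInfty_mem] at hV
  obtain ⟨A, hA⟩ := hV
  have hI := (Function.Periodic.invQParam_tendsto hp').eventually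
    (Filter.preimage_mem_comap (Filter.Ioi_mem_atTop (max A 0)))
  filter_upwards [hI, self_mem_nhdsWithin] with q hq hq0
  have hpos : max A 0 < (Function.Periodic.invQParam p q).im := hq
  have := hA ⟨_, (le_max_right A 0).trans_lt hpos⟩ ((le_max_left A 0).trans hpos.le)
  simp only [Set.mem_preimage] at this
  rwa [Function.Periodic.qParam_right_inv hp'.ne' hq0] at this

/-- Near the cusp `g • ∞` the curve has the coordinate `exp (2πiz/p)`. -/
theorem IsLevel.exists_chart_cusp (h : IsLevel p Γ) (g : SL(2, ℤ)) : ∃ F : Curve Γ → ℂ,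
    IsChartAt F (proj Γ (g • infty)) ∧
      ∀ z : ℍ, 1 < z.im → F (toCurve Γ (g • z)) = Function.Periodic.qParam p z := by
  classical
  have hp' : (0 : ℝ) < p := by exact_mod_cast h.pos
  have hpc : (p : ℂ) ≠ 0 := by exact_mod_cast h.pos.ne'
  have hper : ∀ (t : ℂ) (k : ℤ), Function.Periodic.qParam p (t + p * k)
      = Function.Periodic.qParam p t := by
    intro t k
    rw [Function.Periodic.qParam, Function.Periodic.qParam, Complex.exp_eq_exp_iff_exists_int]
    refine ⟨k, ?_⟩
    push_cast
    field_simp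
  set F : Curve Γ → ℂ := fun y =>
    if hy : ∃ z : ℍ, 1 < z.im ∧ toCurve Γ (g • z) = y then
      Function.Periodic.qParam p hy.choose else 0 with hFdef
  have hF : ∀ z : ℍ, 1 < z.im → F (toCurve Γ (g • z)) = Function.Periodic.qParam p z := by
    intro z hz
    have hy : ∃ w : ℍ, 1 < w.im ∧ toCurve Γ (g • w) = toCurve Γ (g • z) := ⟨z, hz, rfl⟩
    rw [hFdef]
    simp only [dif_pos hy]
    obtain ⟨hw, hwz⟩ := hy.choose_spec
    obtain ⟨k, hk⟩ := h.exists_zpow hw hz hwz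
    rw [hk, hper]
  have hF0 : F (proj Γ (g • infty)) = 0 := by
    rw [hFdef]
    simp only
    rw [dif_neg]
    rintro ⟨z, _, hz⟩
    exact toCurve_ne_proj_smul_infty _ _ hz
  refine ⟨F, ?_, hF⟩
  have hmapne : Filter.map F (𝓝[≠] (proj Γ (g • infty))) = 𝓝[≠] 0 := by
    rw [← map_atImInfty_eq_nhdsNE, Filter.map_map, ← map_qParam_atImInfty h.pos]
    refine Filter.map_congr ?_
    filter_upwards [(UpperHalfPlane.atImInfty_mem _).mpr
      ⟨2, fun z hz => (show z ∈ {z : ℍ | 1 < z.im} from lt_of_lt_of_le one_lt_two hz)⟩] with z hz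
    exact hF z hz
  have hmap : Filter.map F (𝓝 (proj Γ (g • infty))) = 𝓝 0 := by
    rw [← nhdsNE_sup_pure, ← nhdsNE_sup_pure, Filter.map_sup, hmapne, Filter.map_pure, hF0]
  have hpb : ∀ z : ℍ, 1 < z.im → (fun t : ℂ => pullback F ((g • UpperHalfPlane.ofComplex t : ℍ) : ℂ))
      =ᶠ[𝓝 (z : ℂ)] Function.Periodic.qParam p := by
    intro z hz
    rw [Filter.EventuallyEq, eventually_nhds_coe_iff]
    filter_upwards [(isOpen_lt continuous_const UpperHalfPlane.continuous_im).mem_nhds hz] with w hw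
    rw [pullback_coe, UpperHalfPlane.ofComplex_apply, hF w hw]
  have hol : ∀ z : ℍ, 1 < z.im → HolAt F (toCurve Γ (g • z)) := by
    intro z hz
    have hz' : g⁻¹ • (g • z) = z := inv_smul_smul _ _
    rw [holAt_toCurve_iff, Complex.analyticAt_iff_eventually_differentiableAt,
      eventually_nhds_coe_iff]
    have hopen : IsOpen {w : ℍ | 1 < (g⁻¹ • w).im} :=
      isOpen_lt continuous_const (UpperHalfPlane.continuous_im.comp
        (continuous_smul_upperHalfPlane g⁻¹))
    filter_upwards [hopen.mem_nhds (show 1 < (g⁻¹ • (g • z)).im by rwa [hz'])] with w hw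
    have h1 : (fun t : ℂ => Function.Periodic.qParam p ((g⁻¹ • UpperHalfPlane.ofComplex t : ℍ) : ℂ))
        =ᶠ[𝓝 (w : ℂ)] pullback F := by
      rw [Filter.EventuallyEq, eventually_nhds_coe_iff]
      filter_upwards [hopen.mem_nhds hw] with v hv
      rw [UpperHalfPlane.ofComplex_apply, pullback_coe, ← hF _ hv, smul_inv_smul]
    refine DifferentiableAt.congr_of_eventuallyEq ?_ h1.symm
    exact (Function.Periodic.differentiable_qParam _).comp (w : ℂ)
      (hasDerivAt_smul g⁻¹ w).differentiableAt
  have hU := isOpenMap_proj Γ _ (isOpen_horoball g 1)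
  refine isChartAt_of_deriv_ne_zero hU ⟨_, Or.inl rfl, rfl⟩ hF0 ?_ hmap ?_ ?_
  · have hinj : ∀ z w : ℍ, 1 < z.im → 1 < w.im → F (toCurve Γ (g • z)) = F (toCurve Γ (g • w)) →
        toCurve Γ (g • z) = toCurve Γ (g • w) := by
      intro z w hz hw hzw
      rw [hF z hz, hF w hw, Function.Periodic.qParam, Function.Periodic.qParam,
        Complex.exp_eq_exp_iff_exists_int] at hzw
      obtain ⟨k, hk⟩ := hzw
      have hzw : (z : ℂ) = w + p * k := by
        have h2 : (2 * Real.pi * Complex.I : ℂ) ≠ 0 := Complex.two_pi_I_ne_zero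
        push_cast at hk
        field_simp at hk
        exact hk
      refine toCurve_eq_iff.mpr ⟨_, h.conj_T_mem g (k := p * k) (dvd_mul_right _ _), ?_⟩
      rw [mul_smul, mul_smul, inv_smul_smul]
      congr 1
      apply UpperHalfPlane.ext
      rw [ModularGroup.coe_T_zpow_smul_eq, hzw]
      push_cast
      ring
    rintro _ ⟨x, rfl | ⟨z, hz, rfl⟩, rfl⟩ _ ⟨y, rfl | ⟨w, hw, rfl⟩, rfl⟩ hxy
    · rfl
    · rw [hF0] at hxy
      exact absurd (hxy.trans (hF w hw)).symm (Function.Periodic.qParam_ne_zero _)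
    · rw [hF0] at hxy
      exact absurd ((hF z hz).symm.trans hxy) (Function.Periodic.qParam_ne_zero _)
    · exact hinj z w hz hw hxy
  · refine holomorphicOn_of_holAt hU ?_
    rintro _ ⟨x, rfl | ⟨z, hz, rfl⟩, rfl⟩
    · refine holAt_cusp ?_ ?_
      · rw [ContinuousAt, hF0]
        exact hmap.le
      · exact (UpperHalfPlane.atImInfty_mem _).mpr
          ⟨2, fun z hz => hol z (lt_of_lt_of_le one_lt_two hz)⟩
    · exact hol z hz
  · rintro _ ⟨x, rfl | ⟨z, hz, rfl⟩, rfl⟩ hne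
    · exact absurd rfl hne
    · refine ⟨g • z, rfl, fun hd => ?_⟩
      have h1 : HasDerivAt (pullback F) 0 ((g • UpperHalfPlane.ofComplex (z : ℂ) : ℍ) : ℂ) := by
        rw [UpperHalfPlane.ofComplex_apply, ← hd]
        exact (hol z hz).differentiableAt.hasDerivAt
      have h2 := (h1.comp (z : ℂ) (hasDerivAt_smul g z)).congr_of_eventuallyEq (hpb z hz).symm
      have h3 : HasDerivAt (Function.Periodic.qParam p)
          (Function.Periodic.qParam p z * (2 * Real.pi * Complex.I / p)) z := by
        simpa only [id_eq, mul_one] using!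
          (((hasDerivAt_id (z : ℂ)).const_mul (2 * Real.pi * Complex.I)).div_const (p : ℂ)).cexp
      have := h3.unique h2
      rw [zero_mul] at this
      exact mul_ne_zero (Function.Periodic.qParam_ne_zero _)
        (div_ne_zero Complex.two_pi_I_ne_zero hpc) this

end CuspCharts

/-! ### Germs of analytic functions -/

section Germs

/-- A nonvanishing germ of an analytic function has an analytic `n`-th root. -/
theorem exists_analyticAt_pow_eq {u : ℂ → ℂ} {a : ℂ} (hu : AnalyticAt ℂ u a) (h0 : u a ≠ 0)
    {n : ℕ} (hn : n ≠ 0) : ∃ v : ℂ → ℂ, AnalyticAt ℂ v a ∧ v a ≠ 0 ∧ ∀ᶠ t in 𝓝 a, v t ^ n = u t := by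
  obtain ⟨c, hc⟩ := IsAlgClosed.exists_pow_nat_eq (u a) (Nat.pos_of_ne_zero hn)
  have hc0 : c ≠ 0 := fun h => h0 (by rw [← hc, h, zero_pow hn])
  refine ⟨fun t => c * Complex.exp (Complex.log (u t / u a) / n), ?_, ?_, ?_⟩
  · have h1 : AnalyticAt ℂ (fun t => u t / u a) a := hu.div analyticAt_const h0
    have h2 : AnalyticAt ℂ (fun t => Complex.log (u t / u a)) a := h1.clog (by
      rw [div_self h0]; exact Complex.one_mem_slitPlane)
    exact analyticAt_const.mul (h2.div analyticAt_const (by exact_mod_cast hn)).cexp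
  · exact mul_ne_zero hc0 (Complex.exp_ne_zero _)
  · filter_upwards [hu.continuousAt.eventually_ne h0] with t ht
    have hn' : (n : ℂ) ≠ 0 := by exact_mod_cast hn
    rw [mul_pow, ← Complex.exp_nat_mul, mul_div_cancel₀ _ hn', Complex.exp_log (div_ne_zero ht h0),
      hc, mul_div_cancel₀ _ h0]

theorem eventually_injOn_of_deriv_ne_zero {g : ℂ → ℂ} {a : ℂ} (hg : AnalyticAt ℂ g a)
    (h : deriv g a ≠ 0) : ∃ U ∈ 𝓝 a, Set.InjOn g U := by
  have hs : HasStrictDerivAt g (deriv g a) a := hg.hasStrictDerivAt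
  refine ⟨_, (hs.hasStrictFDerivAt_equiv h).eventually_left_inverse, ?_⟩
  intro s hs' t ht' hst
  have h1 : hs.localInverse g _ a h (g s) = s := hs'
  have h2 : hs.localInverse g _ a h (g t) = t := ht'
  rw [← h1, ← h2, hst]

theorem map_nhds_of_deriv_ne_zero {g : ℂ → ℂ} {a : ℂ} (hg : AnalyticAt ℂ g a)
    (h : deriv g a ≠ 0) : Filter.map g (𝓝 a) = 𝓝 (g a) :=
  (hg.hasStrictDerivAt : HasStrictDerivAt g (deriv g a) a).map_nhds_eq h

theorem exists_eq_sub_mul {g : ℂ → ℂ} {a : ℂ} (hg : AnalyticAt ℂ g a) (h0 : g a = 0) :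
    ∃ v : ℂ → ℂ, AnalyticAt ℂ v a ∧ v a = deriv g a ∧ ∀ᶠ t in 𝓝 a, g t = (t - a) * v t := by
  refine ⟨dslope g a, ?_, dslope_same g a, ?_⟩
  · obtain ⟨P, hP⟩ := hg
    exact ⟨_, hP.has_fpower_series_dslope_fslope⟩
  · filter_upwards with t
    have := sub_smul_dslope g a t
    rw [smul_eq_mul, h0, sub_zero] at this
    exact this.symm

/-- A nonconstant germ of an analytic function is, up to an additive constant, a power of a local
coordinate. -/
theorem exists_eq_add_pow {g : ℂ → ℂ} (hg : AnalyticAt ℂ g 0) (hne : ¬ ∀ᶠ t in 𝓝 0, g t = g 0) :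
    ∃ n : ℕ, n ≠ 0 ∧ ∃ ψ : ℂ → ℂ, AnalyticAt ℂ ψ 0 ∧ ψ 0 = 0 ∧ deriv ψ 0 ≠ 0 ∧
      ∀ᶠ t in 𝓝 0, g t = g 0 + ψ t ^ n := by
  have hg' : AnalyticAt ℂ (fun t => g t - g 0) 0 := hg.sub analyticAt_const
  obtain ⟨n, u, hu, hu0, hgu⟩ := (hg'.exists_eventuallyEq_pow_smul_nonzero_iff).mpr
    (fun h => hne (h.mono fun t ht => sub_eq_zero.mp ht))
  have hn : n ≠ 0 := by
    rintro rfl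
    have := hgu.self_of_nhds
    simp at this
    exact hu0 this.symm
  obtain ⟨v, hv, hv0, hvu⟩ := exists_analyticAt_pow_eq hu hu0 hn
  refine ⟨n, hn, fun t => t * v t, analyticAt_id.mul hv, by simp, ?_, ?_⟩
  · have h1 : HasDerivAt (fun t : ℂ => t * v t) (1 * v 0 + 0 * deriv v 0) 0 :=
      (hasDerivAt_id (0 : ℂ)).mul hv.differentiableAt.hasDerivAt
    rw [h1.deriv]
    simpa using hv0
  · filter_upwards [hgu, hvu] with t h1 h2
    rw [mul_pow, h2]
    rw [sub_zero, smul_eq_mul] at h1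
    linear_combination h1

end Germs

/-! ### Removable singularities and the maximum principle -/

section Charts

variable {Γ : Subgroup SL(2, ℤ)} {x : Curve Γ} {F G : Curve Γ → ℂ}

theorem HolAt.mul (hF : HolAt F x) (hG : HolAt G x) : HolAt (fun y => F y * G y) x := by
  obtain ⟨U, hU, hxU, hF⟩ := hF
  obtain ⟨V, hV, hxV, hG⟩ := hG
  refine ⟨U ∩ V, hU.inter hV, ⟨hxU, hxV⟩, (holomorphicOn_iff (hU.inter hV)).mpr ⟨?_, ?_⟩⟩
  · exact (hF.1.mono Set.inter_subset_left).mul (hG.1.mono Set.inter_subset_right)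
  · exact fun z hz => (((holomorphicOn_iff hU).mp hF).2 z hz.1).mul
      (((holomorphicOn_iff hV).mp hG).2 z hz.2)

theorem IsChartAt.map_nhdsNE (h : IsChartAt F x) : Filter.map F (𝓝[≠] x) = 𝓝[≠] 0 := by
  obtain ⟨U, hU, hinj⟩ := h.inj
  apply le_antisymm
  · refine tendsto_nhdsWithin_iff.mpr ⟨(show Filter.Tendsto F (𝓝 x) (𝓝 0) from h.map.le).mono_left
      nhdsWithin_le_nhds, ?_⟩
    rw [eventually_nhdsWithin_iff]
    filter_upwards [hU] with y hy hyx hF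
    exact hyx (hinj hy (mem_of_mem_nhds hU) (by rw [h.zero]; exact hF))
  · intro V hV
    rw [Filter.mem_map, mem_nhdsWithin_iff_eventually] at hV
    rw [mem_nhdsWithin_iff_eventually, ← h.map]
    have := Filter.image_mem_map (m := F) hV
    filter_upwards [this]
    rintro _ ⟨y, hy, rfl⟩ hne
    exact hy (fun hyx => hne (by rw [show y = x from hyx, h.zero]; rfl))

theorem IsChartAt.tendsto (h : IsChartAt F x) : Filter.Tendsto F (𝓝 x) (𝓝 0) := h.map.le

theorem IsChartAt.nhdsNE_neBot (h : IsChartAt F x) : (𝓝[≠] x).NeBot := by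
  have : (Filter.map F (𝓝[≠] x)).NeBot := by rw [h.map_nhdsNE]; infer_instance
  exact Filter.NeBot.of_map this

theorem IsChartAt.ne_zero (h : IsChartAt F x) : ∀ᶠ y in 𝓝[≠] x, F y ≠ 0 := by
  have : ∀ᶠ s in Filter.map F (𝓝[≠] x), s ≠ 0 := by
    rw [h.map_nhdsNE]; exact self_mem_nhdsWithin
  exact this

/-- A function with an analytic germ in a chart is locally injective if that germ has nonzero
derivative. -/
theorem IsChartAt.inj_of_deriv_ne_zero (h : IsChartAt F x) {g : ℂ → ℂ} (hg : AnalyticAt ℂ g 0)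
    (hd : deriv g 0 ≠ 0) (hG : ∀ᶠ y in 𝓝 x, G y = g (F y)) : ∃ U ∈ 𝓝 x, Set.InjOn G U := by
  obtain ⟨U, hU, hinj⟩ := h.inj
  obtain ⟨V, hV, hgV⟩ := eventually_injOn_of_deriv_ne_zero hg hd
  refine ⟨_, Filter.inter_mem (Filter.inter_mem hU (h.tendsto hV)) hG, ?_⟩
  intro a ha b hb hab
  rw [show G a = _ from ha.2, show G b = _ from hb.2] at hab
  exact hinj ha.1.1 hb.1.1 (hgV ha.1.2 hb.1.2 hab)

theorem IsLevel.exists_chart {p : ℕ} (h : IsLevel p Γ) (x : Curve Γ) : ∃ F, IsChartAt F x := by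
  induction x using Curve.cases with
  | h1 z => exact (exists_chart_toCurve z).imp fun F hF => hF.1
  | h2 g => exact (h.exists_chart_cusp g).imp fun F hF => hF.1

/-- Riemann's theorem on removable singularities, for continuous functions. -/
theorem holAt_of_punctured (hc : ContinuousAt G x) (hG : ∀ᶠ y in 𝓝[≠] x, HolAt G y) :
    HolAt G x := by
  induction x using Curve.cases with
  | h1 z =>
    rw [holAt_toCurve_iff]
    apply Complex.analyticAt_of_differentiable_on_punctured_nhds_of_continuousAt
    · rw [eventually_nhdsWithin_iff] at hG ⊢
      rw [eventually_nhds_coe_iff]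
      obtain ⟨F, hF, hFz⟩ := exists_chart_toCurve (Γ := Γ) z
      filter_upwards [(continuous_toCurve Γ).continuousAt.eventually hG, hFz] with w hw hFw hne
      refine (hw fun h => hne ?_).differentiableAt
      rw [show toCurve Γ w = toCurve Γ z from h, hF.zero] at hFw
      rw [cayley_eq_zero_iff.mp (pow_eq_zero_iff (ell_pos Γ z).ne' |>.mp hFw.symm)]
      rfl
    · have h1 := hc.comp (continuous_toCurve Γ).continuousAt
      have h2 : Filter.Tendsto (pullback G) (𝓝 (z : ℂ)) (𝓝 (G (toCurve Γ z))) :=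
        h1.tendsto.comp (tendsto_ofComplex z)
      rwa [ContinuousAt, pullback_coe]
  | h2 g =>
    refine holAt_cusp hc ?_
    have h1 := hG
    rw [← map_atImInfty_eq_nhdsNE, Filter.eventually_map] at h1
    exact h1

/-- Riemann's theorem on removable singularities. -/
theorem IsChartAt.factor_of_bounded (h : IsChartAt F x) (hG : ∀ᶠ y in 𝓝[≠] x, HolAt G y) {C : ℝ}
    (hb : ∀ᶠ y in 𝓝[≠] x, ‖G y‖ ≤ C) :
    ∃ g : ℂ → ℂ, AnalyticAt ℂ g 0 ∧ ∀ᶠ y in 𝓝[≠] x, G y = g (F y) := by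
  classical
  set H : Curve Γ → ℂ := fun y => F y * G y with hH
  have hHx : H x = 0 := by simp [hH, h.zero]
  have hlim : Filter.Tendsto H (𝓝[≠] x) (𝓝 0) := by
    have h1 : Filter.Tendsto F (𝓝[≠] x) (𝓝 0) := h.tendsto.mono_left nhdsWithin_le_nhds
    exact h1.zero_mul_isBoundedUnder_le
      (Filter.isBoundedUnder_of_eventually_le (a := C) (by simpa using hb))
  have hHc : ContinuousAt H x := by
    rw [continuousAt_iff_punctured_nhds, hHx]
    exact hlim
  have hHh : HolAt H x := holAt_of_punctured hHc (by
    filter_upwards [hG, (h.hol.eventually.filter_mono nhdsWithin_le_nhds)] with y h1 h2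
    exact h2.mul h1)
  obtain ⟨k, hk, hkF⟩ := h.factor H hHh
  have hk0 : k 0 = 0 := by
    have := hkF.self_of_nhds
    rw [hHx, h.zero] at this
    exact this.symm
  obtain ⟨v, hv, -, hkv⟩ := exists_eq_sub_mul hk hk0
  refine ⟨v, hv, ?_⟩
  filter_upwards [hkF.filter_mono nhdsWithin_le_nhds,
    (h.tendsto.eventually hkv).filter_mono nhdsWithin_le_nhds, h.ne_zero] with y h1 h2 h3
  rw [h2, sub_zero] at h1
  exact mul_left_cancel₀ h3 h1

/-- The value at `x` obtained by continuous extension from the other points. -/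
def regularize (G : Curve Γ → ℂ) (x : Curve Γ) : ℂ := Filter.limUnder (𝓝[≠] x) G

theorem IsChartAt.regularize_eq (h : IsChartAt F x) {g : ℂ → ℂ} (hg : AnalyticAt ℂ g 0)
    (hG : ∀ᶠ y in 𝓝[≠] x, G y = g (F y)) : regularize G x = g 0 := by
  have := h.nhdsNE_neBot
  refine Filter.Tendsto.limUnder_eq ?_
  refine Filter.Tendsto.congr' (hG.mono fun y hy => hy.symm) ?_
  exact (hg.continuousAt.tendsto.comp h.tendsto).mono_left nhdsWithin_le_nhds

theorem IsLevel.regularize_eq_of_holAt {p : ℕ} (hΓ : IsLevel p Γ) (h : HolAt G x) :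
    regularize G x = G x := by
  obtain ⟨F, hF⟩ := hΓ.exists_chart x
  obtain ⟨g, hg, hgF⟩ := hF.factor G h
  rw [hF.regularize_eq hg (hgF.filter_mono nhdsWithin_le_nhds), hgF.self_of_nhds, hF.zero]

theorem IsLevel.holAt_regularize {p : ℕ} (hΓ : IsLevel p Γ) (hG : ∀ᶠ y in 𝓝[≠] x, HolAt G y)
    {C : ℝ} (hb : ∀ᶠ y in 𝓝[≠] x, ‖G y‖ ≤ C) : HolAt (regularize G) x := by
  obtain ⟨F, hF⟩ := hΓ.exists_chart x
  obtain ⟨g, hg, hgF⟩ := hF.factor_of_bounded hG hb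
  have hev : ∀ᶠ y in 𝓝[≠] x, regularize G y = G y :=
    hG.mono fun y hy => hΓ.regularize_eq_of_holAt hy
  refine holAt_of_punctured ?_ ?_
  · rw [continuousAt_iff_punctured_nhds, hF.regularize_eq hg hgF]
    refine Filter.Tendsto.congr' ?_
      ((hg.continuousAt.tendsto.comp hF.tendsto).mono_left nhdsWithin_le_nhds)
    filter_upwards [hev, hgF] with y h1 h2
    rw [h1, h2]; rfl
  · have h2 := eventually_eventually_nhdsWithin.mpr hG
    rw [eventually_nhdsWithin_iff] at h2 ⊢
    have h3 := eventually_eventually_nhdsWithin.mpr hG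
    rw [eventually_nhdsWithin_iff] at h3
    filter_upwards [h3, eventually_nhdsWithin_iff.mp hG] with y hy h1 hyx
    refine (h1 hyx).congr ?_
    filter_upwards [(h1 hyx).eventually] with w hw
    exact (hΓ.regularize_eq_of_holAt hw).symm

/-- The maximum principle: a function holomorphic on all of `X(Γ)` is constant. -/
theorem IsLevel.eq_of_holAt {p : ℕ} (hΓ : IsLevel p Γ) (hG : ∀ x, HolAt G x) (x y : Curve Γ) :
    G x = G y := by
  have := hΓ.finiteIndex
  have hcont : Continuous G := continuous_iff_continuousAt.mpr fun x => (hG x).continuousAt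
  obtain ⟨x₀, -, hx₀⟩ := isCompact_univ.exists_isMaxOn ⟨x, Set.mem_univ x⟩
    (continuous_norm.comp hcont).continuousOn
  have hclopen : IsClopen {x | G x = G x₀} := by
    refine ⟨isClosed_eq hcont continuous_const, isOpen_iff_mem_nhds.mpr fun x hx => ?_⟩
    obtain ⟨F, hF⟩ := hΓ.exists_chart x
    obtain ⟨g, hg, hgF⟩ := hF.factor G (hG x)
    have hg0 : g 0 = G x₀ := by
      rw [← hF.zero, ← hgF.self_of_nhds]; exact hx
    have hmax : IsLocalMax (norm ∘ g) 0 := by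
      rw [IsLocalMax, IsMaxFilter, ← hF.map, Filter.eventually_map]
      filter_upwards [hgF] with y hy
      rw [Function.comp, Function.comp, ← hy, hg0]
      exact hx₀ (Set.mem_univ y)
    have hdiff : ∀ᶠ s in 𝓝 (0 : ℂ), DifferentiableAt ℂ g s :=
      Complex.analyticAt_iff_eventually_differentiableAt.mp hg
    have := Complex.eventually_eq_of_isLocalMax_norm hdiff hmax
    filter_upwards [hgF, hF.tendsto.eventually this] with y h1 h2
    rw [h1, h2, hg0]
  have huniv := hclopen.eq_univ ⟨x₀, rfl⟩
  have h1 : x ∈ {x | G x = G x₀} := by rw [huniv]; trivial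
  have h2 : y ∈ {x | G x = G x₀} := by rw [huniv]; trivial
  exact (show G x = G x₀ from h1).trans (show G y = G x₀ from h2).symm

end Charts

/-! ### Functions with a single simple pole -/

section DegreeOne

variable {Γ : Subgroup SL(2, ℤ)} {p : ℕ} {T : Curve Γ → ℂ} {x : Curve Γ}

/-- Ramified functions are not injective: near a point where `T` is, up to a constant, the `n`-th
power of an injective open map `Φ` with `n ≠ 1`, each value is taken several times. -/
theorem eventually_exists_ne_of_pow {n : ℕ} (hn : n ≠ 0) (hn1 : n ≠ 1) {Φ : Curve Γ → ℂ}
    (hmap : Filter.map Φ (𝓝 x) = 𝓝 0) (h0 : ∀ᶠ y in 𝓝[≠] x, Φ y ≠ 0) {c : ℂ}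
    (hT : ∀ᶠ y in 𝓝 x, T y = c + Φ y ^ n) {O : Set (Curve Γ)} (hO : O ∈ 𝓝 x) :
    ∀ᶠ y in 𝓝[≠] x, ∃ y' ∈ O, y' ≠ y ∧ T y' = T y := by
  have hζ := Complex.isPrimitiveRoot_exp n hn
  set ζ := Complex.exp (2 * Real.pi * Complex.I / n)
  have hζ1 : ζ ≠ 1 := hζ.ne_one (by omega)
  have himg : Φ '' (O ∩ {y | T y = c + Φ y ^ n}) ∈ 𝓝 (0 : ℂ) := by
    rw [← hmap]
    exact Filter.image_mem_map (Filter.inter_mem hO hT)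
  have hlim : Filter.Tendsto (fun y => ζ * Φ y) (𝓝 x) (𝓝 0) := by
    have h1 : Filter.Tendsto Φ (𝓝 x) (𝓝 0) := hmap.le
    simpa using h1.const_mul ζ
  filter_upwards [h0, (hlim.eventually himg).filter_mono nhdsWithin_le_nhds,
    hT.filter_mono nhdsWithin_le_nhds] with y hy0 ⟨y', ⟨hy'O, hy'T⟩, hy'⟩ hyT
  refine ⟨y', hy'O, ?_, ?_⟩
  · rintro rfl
    have : (ζ - 1) * Φ y' = 0 := by linear_combination -hy'
    exact (mul_ne_zero (sub_ne_zero.mpr hζ1) hy0) this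
  · rw [show T y' = _ from hy'T, hyT, hy', mul_pow, hζ.pow_eq_one, one_mul]

/-- A nonconstant holomorphic function is locally, up to an additive constant, a power of an
injective open map. -/
theorem IsChartAt.exists_pow {F : Curve Γ → ℂ} (hF : IsChartAt F x) {g : ℂ → ℂ}
    (hg : AnalyticAt ℂ g 0) (hT : ∀ᶠ y in 𝓝 x, T y = g (F y))
    (hne : ¬ ∀ᶠ y in 𝓝 x, T y = T x) :
    ∃ n : ℕ, n ≠ 0 ∧ (n = 1 → deriv g 0 ≠ 0) ∧ ∃ Φ : Curve Γ → ℂ,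
      Filter.map Φ (𝓝 x) = 𝓝 0 ∧ (∃ U ∈ 𝓝 x, Set.InjOn Φ U) ∧ (∀ᶠ y in 𝓝[≠] x, Φ y ≠ 0) ∧
      ∀ᶠ y in 𝓝 x, T y = T x + Φ y ^ n := by
  have hg0 : T x = g 0 := by rw [hT.self_of_nhds, hF.zero]
  have hgne : ¬ ∀ᶠ t in 𝓝 0, g t = g 0 := by
    intro h
    refine hne ?_
    filter_upwards [hT, hF.tendsto.eventually h] with y h1 h2
    rw [h1, h2, hg0]
  obtain ⟨n, hn, ψ, hψ, hψ0, hψd, hgψ⟩ := exists_eq_add_pow hg hgne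
  have hmap : Filter.map (fun y => ψ (F y)) (𝓝 x) = 𝓝 0 := by
    have := map_nhds_of_deriv_ne_zero hψ hψd
    rw [← hF.map, Filter.map_map, hψ0] at this
    exact this
  obtain ⟨U, hU, hinj⟩ := hF.inj_of_deriv_ne_zero (G := fun y => ψ (F y)) hψ hψd
    (Filter.Eventually.of_forall fun _ => rfl)
  refine ⟨n, hn, ?_, fun y => ψ (F y), hmap, ⟨U, hU, hinj⟩, ?_, ?_⟩
  · rintro rfl
    have : g =ᶠ[𝓝 0] fun t => g 0 + ψ t := by
      filter_upwards [hgψ] with t ht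
      rw [ht, pow_one]
    rw [this.deriv_eq, deriv_const_add]
    exact hψd
  · rw [eventually_nhdsWithin_iff]
    filter_upwards [hU] with y hy hyx h
    refine hyx (hinj hy (mem_of_mem_nhds hU) ?_)
    simp only
    rw [h, hF.zero, hψ0]
  · filter_upwards [hT, hF.tendsto.eventually hgψ] with y h1 h2
    rw [h1, h2, hg0]

/-- `T` is a function on `X(Γ)` that is holomorphic except for an at most simple pole at `P`, and
is not constant. -/
structure HasOnePole (T : Curve Γ → ℂ) (P : Curve Γ) : Prop where
  hol : ∀ x, x ≠ P → HolAt T x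
  bdd : ∃ F, IsChartAt F P ∧ ∃ C : ℝ, ∀ᶠ y in 𝓝[≠] P, ‖F y * T y‖ ≤ C
  nonconst : ∃ x y, x ≠ P ∧ y ≠ P ∧ T x ≠ T y

variable {P : Curve Γ}

/-- The pole is a true pole, of order exactly `1`: if it were removable, `T` would be constant by
the maximum principle. -/
theorem HasOnePole.exists_factor (hΓ : IsLevel p Γ) (h : HasOnePole T P) :
    ∃ F, IsChartAt F P ∧ ∃ g : ℂ → ℂ, AnalyticAt ℂ g 0 ∧ g 0 ≠ 0 ∧
      ∀ᶠ y in 𝓝[≠] P, F y * T y = g (F y) := by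
  obtain ⟨F, hF, C, hC⟩ := h.bdd
  have hhol : ∀ᶠ y in 𝓝[≠] P, HolAt T y := by
    filter_upwards [self_mem_nhdsWithin] with y hy using h.hol y hy
  obtain ⟨g, hg, hgF⟩ := hF.factor_of_bounded (G := fun y => F y * T y) (by
    filter_upwards [hhol, hF.hol.eventually.filter_mono nhdsWithin_le_nhds] with y h1 h2
    exact h2.mul h1) hC
  refine ⟨F, hF, g, hg, fun hg0 => ?_, hgF⟩
  -- otherwise `T` extends holomorphically to `P`, so it is constant
  obtain ⟨v, hv, -, hgv⟩ := exists_eq_sub_mul hg hg0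
  have hTv : ∀ᶠ y in 𝓝[≠] P, T y = v (F y) := by
    filter_upwards [hgF, (hF.tendsto.eventually hgv).filter_mono nhdsWithin_le_nhds,
      hF.ne_zero] with y h1 h2 h3
    rw [h2, sub_zero] at h1
    exact mul_left_cancel₀ h3 h1
  have hb : ∀ᶠ y in 𝓝[≠] P, ‖T y‖ ≤ ‖v 0‖ + 1 := by
    have h1 : ∀ᶠ s in 𝓝 (0 : ℂ), ‖v s‖ < ‖v 0‖ + 1 :=
      hv.continuousAt.norm.eventually_lt continuousAt_const (by simp)
    filter_upwards [hTv, (hF.tendsto.eventually h1).filter_mono nhdsWithin_le_nhds] with y h2 h3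
    rw [h2]; exact h3.le
  have hreg : ∀ x, HolAt (regularize T) x := by
    intro x
    by_cases hx : x = P
    · subst hx
      exact hΓ.holAt_regularize hhol hb
    · have h1 := h.hol x hx
      refine h1.congr ?_
      filter_upwards [h1.eventually] with w hw
      exact (hΓ.regularize_eq_of_holAt hw).symm
  obtain ⟨x, y, hx, hy, hxy⟩ := h.nonconst
  have := hΓ.eq_of_holAt hreg x y
  rw [hΓ.regularize_eq_of_holAt (h.hol x hx), hΓ.regularize_eq_of_holAt (h.hol y hy)] at this
  exact hxy this

/-- Large values are taken only once. -/
theorem HasOnePole.exists_nhds (hΓ : IsLevel p Γ) (h : HasOnePole T P) :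
    ∃ U ∈ 𝓝 P, ∀ x ∈ U, x ≠ P → ∀ y, y ≠ P → T x = T y → x = y := by
  have := hΓ.finiteIndex
  obtain ⟨F, hF, g, hg, hg0, hgF⟩ := h.exists_factor hΓ
  -- `1 / T` is a coordinate near `P`
  set k : ℂ → ℂ := fun s => s / g s with hk
  have hkan : AnalyticAt ℂ k 0 := analyticAt_id.div hg hg0
  have hkd : deriv k 0 ≠ 0 := by
    have h1 : HasDerivAt k ((1 * g 0 - 0 * deriv g 0) / g 0 ^ 2) 0 :=
      (hasDerivAt_id (0 : ℂ)).div hg.differentiableAt.hasDerivAt hg0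
    rw [h1.deriv]
    simp [hg0]
  obtain ⟨N, hN, hinj⟩ := hF.inj_of_deriv_ne_zero (G := fun y => k (F y)) hkan hkd
    (Filter.Eventually.of_forall fun _ => rfl)
  rw [eventually_nhdsWithin_iff] at hgF
  have hg0' : ∀ᶠ y in 𝓝 P, g (F y) ≠ 0 :=
    hF.tendsto.eventually (hg.continuousAt.eventually_ne hg0)
  have hF0 := hF.ne_zero
  rw [eventually_nhdsWithin_iff] at hF0
  obtain ⟨V, hVs, hVo, hPV⟩ := mem_nhds_iff.mp
    (Filter.inter_mem (Filter.inter_mem hN hgF) (Filter.inter_mem hg0' hF0))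
  have hTk : ∀ y ∈ V, y ≠ P → k (F y) = (T y)⁻¹ := by
    intro y hy hyP
    have h1 : F y * T y = g (F y) := (hVs hy).1.2 hyP
    have h2 : g (F y) ≠ 0 := (hVs hy).2.1
    have h3 : F y ≠ 0 := (hVs hy).2.2 hyP
    have h4 : T y ≠ 0 := fun h => h2 (by rw [← h1, h, mul_zero])
    rw [hk]
    simp only
    rw [← h1]
    field_simp
  have hcont : ContinuousOn T Vᶜ := fun y hy =>
    (h.hol y fun hyP => hy (hyP ▸ hPV)).continuousAt.continuousWithinAt
  obtain ⟨M, hM⟩ := hVo.isClosed_compl.isCompact.exists_bound_of_continuousOn hcont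
  have hbig : ∀ᶠ y in 𝓝 P, ‖F y‖ * M < ‖g (F y)‖ := by
    have h1 : ∀ᶠ s in 𝓝 (0 : ℂ), ‖s‖ * M < ‖g s‖ := by
      refine ContinuousAt.eventually_lt (by fun_prop) hg.continuousAt.norm ?_
      simpa using hg0
    exact hF.tendsto.eventually h1
  refine ⟨V ∩ {y | ‖F y‖ * M < ‖g (F y)‖}, Filter.inter_mem (hVo.mem_nhds hPV) hbig, ?_⟩
  rintro y ⟨hyV, hy⟩ hyP z hzP hyz
  have hy' : ‖F y‖ * M < ‖g (F y)‖ := hy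
  have h1 : F y * T y = g (F y) := (hVs hyV).1.2 hyP
  rw [← h1, norm_mul] at hy'
  have hyM : M < ‖T y‖ := lt_of_mul_lt_mul_left hy' (norm_nonneg _)
  have hzV : z ∈ V := by
    by_contra hz
    have := hM z hz
    rw [← hyz] at this
    linarith
  refine hinj (hVs hyV).1.1 (hVs hzV).1.1 ?_
  simp only
  rw [hTk y hyV hyP, hTk z hzV hzP, hyz]

/-- By the identity theorem: the set of points near which `T` is locally constant is open and
closed, and cannot contain points near the pole. -/
theorem HasOnePole.not_locally_const (hΓ : IsLevel p Γ) (h : HasOnePole T P) (hx : x ≠ P) :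
    ¬ ∀ᶠ y in 𝓝 x, T y = T x := by
  have := hΓ.finiteIndex
  have hne : ∀ y : Curve Γ, (𝓝[≠] y).NeBot := fun y =>
    (hΓ.exists_chart y).elim fun F hF => hF.nhdsNE_neBot
  set B : Set (Curve Γ) := {x | x ≠ P ∧ ∀ᶠ y in 𝓝 x, T y = T x} with hB
  have hopen : IsOpen B := by
    rw [isOpen_iff_mem_nhds]
    rintro x ⟨hxP, hx⟩
    filter_upwards [isOpen_ne.mem_nhds hxP, eventually_eventually_nhds.mpr hx, hx] with y h1 h2 h3
    refine ⟨h1, ?_⟩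
    rw [h3]; exact h2
  have hclosed : IsClosed B := by
    rw [← isOpen_compl_iff, isOpen_iff_mem_nhds]
    intro x hxB
    by_cases hxP : x = P
    · subst hxP
      obtain ⟨U, hU, hinj⟩ := h.exists_nhds hΓ
      filter_upwards [hU] with y hyU hyB
      have h1 : ∀ᶠ w in 𝓝 y, w = y := by
        filter_upwards [isOpen_ne.mem_nhds hyB.1, hyB.2] with w hw1 hw2
        exact (hinj y hyU hyB.1 w hw1 hw2.symm).symm
      have := hne y
      obtain ⟨w, hw1, hw2⟩ := ((h1.filter_mono nhdsWithin_le_nhds).and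
        (self_mem_nhdsWithin : {y}ᶜ ∈ 𝓝[≠] y)).exists
      exact hw2 hw1
    · have hxc : ¬ ∀ᶠ y in 𝓝 x, T y = T x := fun hc => hxB ⟨hxP, hc⟩
      obtain ⟨F, hF⟩ := hΓ.exists_chart x
      obtain ⟨g, hg, hgF⟩ := hF.factor T (h.hol x hxP)
      obtain ⟨n, hn, -, Φ, -, ⟨U, hU, hinj⟩, hΦ0, hTΦ⟩ := hF.exists_pow hg hgF hxc
      have hO := Filter.inter_mem hU hTΦ
      filter_upwards [eventually_mem_nhds_iff.mpr hO] with y hyO hyB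
      have h1 := Filter.inter_mem hyO hyB.2
      have := hne y
      have hinf := infinite_of_mem_nhds y h1
      refine hinf (Set.Finite.of_finite_image (f := Φ) ?_ (hinj.mono fun w hw => hw.1.1))
      refine ((Polynomial.nthRoots n (Φ y ^ n)).toFinset.finite_toSet).subset ?_
      rintro _ ⟨w, ⟨⟨hwU, hwT⟩, hw⟩, rfl⟩
      have hyT : T y = T x + Φ y ^ n := (mem_of_mem_nhds hyO).2
      have hwT : T w = T x + Φ w ^ n := hwT
      have hw : T w = T y := hw
      rw [Finset.mem_coe, Multiset.mem_toFinset, Polynomial.mem_nthRoots (Nat.pos_of_ne_zero hn)]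
      linear_combination hw - hwT + hyT
  intro hc
  have : B = Set.univ := IsClopen.eq_univ ⟨hclosed, hopen⟩ ⟨x, hx, hc⟩
  have hP : P ∈ B := by rw [this]; trivial
  exact hP.1 rfl

/-- A function on `X(Γ)` with a single simple pole is injective and unramified. The set of points
where this fails is open by the open mapping theorem, closed by compactness, and does not contain
the pole. -/
theorem HasOnePole.injective_aux (hΓ : IsLevel p Γ) (h : HasOnePole T P) (x : Curve Γ) (hx : x ≠ P)
    (y : Curve Γ) (hy : y ≠ P) (hxy : T x = T y) : x = y ∧ ∃ U ∈ 𝓝 x, Set.InjOn T U := by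
  have := hΓ.finiteIndex
  set W : Set (Curve Γ × Curve Γ) := {q | q.1 ≠ P ∧ q.2 ≠ P ∧ T q.1 = T q.2 ∧
    ¬ (q.1 = q.2 ∧ ∃ U ∈ 𝓝 q.1, Set.InjOn T U)} with hW
  obtain ⟨U₀, hU₀, hinj₀⟩ := h.exists_nhds hΓ
  have hinjnear : ∀ x ∈ interior U₀, x ≠ P → ∃ U ∈ 𝓝 x, Set.InjOn T U := by
    intro x hx hxP
    refine ⟨interior U₀ ∩ {P}ᶜ, (isOpen_interior.inter isOpen_ne).mem_nhds ⟨hx, hxP⟩, ?_⟩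
    intro a ha b hb hab
    exact hinj₀ a (interior_subset ha.1) ha.2 b hb.2 hab
  have hWclosed : IsClosed W := by
    rw [← isOpen_compl_iff, isOpen_iff_mem_nhds]
    rintro ⟨a, b⟩ hab
    have hU₀' : interior U₀ ∈ 𝓝 P := interior_mem_nhds.mpr hU₀
    by_cases haP : a = P
    · subst haP
      refine Filter.mem_of_superset (prod_mem_nhds hU₀' Filter.univ_mem) ?_
      rintro ⟨a', b'⟩ ⟨ha', -⟩ ⟨h1, h2, h3, h4⟩
      exact h4 ⟨hinj₀ a' (interior_subset ha') h1 b' h2 h3, hinjnear a' ha' h1⟩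
    by_cases hbP : b = P
    · subst hbP
      refine Filter.mem_of_superset (prod_mem_nhds Filter.univ_mem hU₀') ?_
      rintro ⟨a', b'⟩ ⟨-, hb'⟩ ⟨h1, h2, h3, h4⟩
      have he : b' = a' := hinj₀ b' (interior_subset hb') h2 a' h1 h3.symm
      refine h4 ⟨he.symm, ?_⟩
      simp only
      rw [← he]
      exact hinjnear b' hb' h2
    by_cases hT : T a = T b
    · have h1 : a = b ∧ ∃ U ∈ 𝓝 a, Set.InjOn T U := by
        by_contra hc
        exact hab ⟨haP, hbP, hT, hc⟩
      obtain ⟨rfl, U, hU, hinj⟩ := h1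
      have hUi : interior U ∈ 𝓝 a := interior_mem_nhds.mpr hU
      refine Filter.mem_of_superset (prod_mem_nhds hUi hUi) ?_
      rintro ⟨a', b'⟩ ⟨ha', hb'⟩ ⟨-, -, h3, h4⟩
      exact h4 ⟨hinj (interior_subset ha') (interior_subset hb') h3,
        interior U, isOpen_interior.mem_nhds ha', hinj.mono interior_subset⟩
    · have hc : ContinuousAt (fun q : Curve Γ × Curve Γ => (T q.1, T q.2)) (a, b) :=
        ((h.hol a haP).continuousAt.comp (x := (a, b)) continuousAt_fst).prodMk
          ((h.hol b hbP).continuousAt.comp (x := (a, b)) continuousAt_snd)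
      have : {q : ℂ × ℂ | q.1 ≠ q.2} ∈ 𝓝 (T a, T b) :=
        (isOpen_ne_fun continuous_fst continuous_snd).mem_nhds hT
      filter_upwards [hc this] with q hq hqW
      exact hq hqW.2.2.1
  set A := Prod.fst '' W with hA
  have hAclosed : IsClosed A := isClosedMap_fst_of_compactSpace _ hWclosed
  have hAopen : IsOpen A := by
    rw [isOpen_iff_mem_nhds]
    rintro _ ⟨⟨a, b⟩, ⟨haP, hbP, hT, hnot⟩, rfl⟩
    simp only at haP hbP hT hnot ⊢
    by_cases hab : a = b
    · subst hab
      have hni : ¬ ∃ U ∈ 𝓝 a, Set.InjOn T U := fun hc => hnot ⟨rfl, hc⟩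
      obtain ⟨F, hF⟩ := hΓ.exists_chart a
      obtain ⟨g, hg, hgF⟩ := hF.factor T (h.hol a haP)
      obtain ⟨n, hn, hn1, Φ, hΦm, -, hΦ0, hTΦ⟩ := hF.exists_pow hg hgF (h.not_locally_const hΓ haP)
      have hn1' : n ≠ 1 := fun h1 => hni (hF.inj_of_deriv_ne_zero hg (hn1 h1) hgF)
      have h1 := eventually_exists_ne_of_pow hn hn1' hΦm hΦ0 hTΦ (isOpen_ne.mem_nhds haP)
      rw [eventually_nhdsWithin_iff] at h1
      filter_upwards [h1, isOpen_ne.mem_nhds haP] with a' h2 h3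
      by_cases haa : a' = a
      · rw [haa]
        exact ⟨(a, a), ⟨haP, haP, rfl, fun hc => hni hc.2⟩, rfl⟩
      · obtain ⟨b', hb'P, hb'a, hTb⟩ := h2 haa
        exact ⟨(a', b'), ⟨h3, hb'P, hTb.symm, fun hc => hb'a hc.1.symm⟩, rfl⟩
    · obtain ⟨V₁, V₂, hV₁, hV₂, haV, hbV, hdisj⟩ := t2_separation hab
      obtain ⟨F, hF⟩ := hΓ.exists_chart b
      obtain ⟨g, hg, hgF⟩ := hF.factor T (h.hol b hbP)
      have hopenmap : 𝓝 (T b) ≤ Filter.map T (𝓝 b) := by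
        rcases hg.eventually_constant_or_nhds_le_map_nhds with hc | hc
        · exfalso
          refine h.not_locally_const hΓ hbP ?_
          filter_upwards [hgF, hF.tendsto.eventually hc] with y h1 h2
          rw [h1, h2, hgF.self_of_nhds, hF.zero]
        · rw [← hF.map, Filter.map_map, ← hF.zero] at hc
          rw [hgF.self_of_nhds]
          exact hc.trans_eq (Filter.map_congr (hgF.mono fun y hy => hy.symm))
      have himg : T '' (V₂ ∩ {P}ᶜ) ∈ 𝓝 (T a) := by
        rw [hT]
        exact hopenmap (Filter.image_mem_map ((hV₂.inter isOpen_ne).mem_nhds ⟨hbV, hbP⟩))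
      filter_upwards [(h.hol a haP).continuousAt himg, hV₁.mem_nhds haV,
        isOpen_ne.mem_nhds haP] with a' ⟨b', ⟨hb'V, hb'P⟩, hTb⟩ ha'V ha'P
      refine ⟨(a', b'), ⟨ha'P, hb'P, hTb.symm, fun hc => ?_⟩, rfl⟩
      have hc1 : a' = b' := hc.1
      exact Set.disjoint_left.mp hdisj ha'V (hc1 ▸ hb'V)
  by_contra hc
  have : A = Set.univ := IsClopen.eq_univ ⟨hAclosed, hAopen⟩
    ⟨x, ⟨(x, y), ⟨hx, hy, hxy, hc⟩, rfl⟩⟩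
  have hP : P ∈ A := by rw [this]; trivial
  obtain ⟨q, hq, hqP⟩ := hP
  exact hq.1 hqP

theorem HasOnePole.injective (hΓ : IsLevel p Γ) (h : HasOnePole T P) {x y : Curve Γ} (hx : x ≠ P)
    (hy : y ≠ P) (hxy : T x = T y) : x = y :=
  (h.injective_aux hΓ x hx y hy hxy).1

/-- Up to an additive constant, `T` is a local coordinate at every point other than the pole. -/
theorem HasOnePole.exists_factor_of_ne (hΓ : IsLevel p Γ) (h : HasOnePole T P) (hx : x ≠ P)
    {F : Curve Γ → ℂ} (hF : IsChartAt F x) :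
    ∃ g : ℂ → ℂ, AnalyticAt ℂ g 0 ∧ deriv g 0 ≠ 0 ∧ ∀ᶠ y in 𝓝 x, T y = g (F y) := by
  obtain ⟨g, hg, hgF⟩ := hF.factor T (h.hol x hx)
  refine ⟨g, hg, ?_, hgF⟩
  obtain ⟨n, hn, hn1, Φ, hΦm, -, hΦ0, hTΦ⟩ := hF.exists_pow hg hgF (h.not_locally_const hΓ hx)
  by_cases h1 : n = 1
  · exact hn1 h1
  · obtain ⟨-, U, hU, hinj⟩ := h.injective_aux hΓ x hx x hx rfl
    have hev := eventually_exists_ne_of_pow hn h1 hΦm hΦ0 hTΦ hU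
    have := hF.nhdsNE_neBot
    obtain ⟨y, ⟨y', hy'U, hne, hTy⟩, hyU⟩ :=
      (hev.and ((show ∀ᶠ y in 𝓝 x, y ∈ U from hU).filter_mono nhdsWithin_le_nhds)).exists
    exact absurd (hinj hy'U hyU hTy) hne

end DegreeOne

/-! ### Gluing local maps over a simply connected base -/

section Gluing

/-- Over a simply connected base, local maps to a `G`-set which differ by constants of the discrete
group `G` on overlaps can be glued, after multiplication by elements of `G`. The local maps are
the local trivializations of a covering, and the glued map comes from a section. -/
theorem exists_glue {X G Y : Type*} [TopologicalSpace X] [SimplyConnectedSpace X]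
    [LocallyPathConnectedSpace X] [Nonempty X] [Group G] [MulAction G Y] (U : X → Set X)
    (hU : ∀ i, IsOpen (U i)) (hmem : ∀ i, i ∈ U i) (f : X → X → Y) (g : X → X → G)
    (hself : ∀ i, g i i = 1)
    (hcomp : ∀ i j k, (U i ∩ U j ∩ U k).Nonempty → g i j * g j k = g i k)
    (hf : ∀ i j, ∀ x ∈ U i ∩ U j, f i x = g i j • f j x) :
    ∃ F : X → Y, ∀ i, ∃ v : G, ∀ᶠ x in 𝓝 i, F x = v • f i x := by
  let : TopologicalSpace G := ⊥
  have : DiscreteTopology G := ⟨rfl⟩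
  let Z : FiberBundleCore X X G :=
    { baseSet := U
      isOpen_baseSet := hU
      indexAt := id
      mem_baseSet_at := hmem
      coordChange := fun i j _ v => v * g i j
      coordChange_self := fun i x _ v => by rw [hself, mul_one]
      continuousOn_coordChange := fun i j =>
        ((continuous_of_discreteTopology (f := fun v : G => v * g i j)).comp
          continuous_snd).continuousOn
      coordChange_comp := fun i j k x hx v => by rw [mul_assoc, hcomp i j k ⟨x, hx⟩] }
  have hcov : IsCoveringMap (Bundle.TotalSpace.proj : Bundle.TotalSpace G Z.Fiber → X) :=
    FiberBundle.isCoveringMap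
  obtain ⟨x₀⟩ := ‹Nonempty X›
  obtain ⟨s, ⟨-, hs⟩, -⟩ := hcov.existsUnique_continuousMap_lifts (ContinuousMap.id X) x₀
    (⟨x₀, (1 : G)⟩ : Bundle.TotalSpace G Z.Fiber) rfl
  have hsx : ∀ x, (s x).1 = x := fun x => congrFun hs x
  let a : X → G := fun x => (s x).2
  have ha : ∀ i x, (Z.localTriv i (s x)).2 = a x * g x i := by
    intro i x
    have h1 : (Z.localTriv i (s x)).2 = a x * g (s x).1 i := rfl
    rw [h1, hsx]
  refine ⟨fun x => a x • f x x, fun i => ⟨a i * g i i, ?_⟩⟩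
  have hcont : ContinuousAt (fun x => (Z.localTriv i (s x)).2) i := by
    have h1 : ContinuousAt (Z.localTriv i) (s i) := (Z.localTriv i).continuousAt (by
      rw [Z.mem_localTriv_source, hsx]; exact hmem i)
    exact continuous_snd.continuousAt.comp (h1.comp s.continuous.continuousAt)
  have hconst : ∀ᶠ x in 𝓝 i, (Z.localTriv i (s x)).2 = (Z.localTriv i (s i)).2 :=
    hcont.eventually (IsOpen.mem_nhds (isOpen_discrete {(Z.localTriv i (s i)).2}) rfl)
  filter_upwards [hconst, (hU i).mem_nhds (hmem i)] with x hx hxU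
  rw [ha, ha] at hx
  rw [← hx, mul_smul, ← hf x i x ⟨hmem x, hxU⟩]

end Gluing

/-! ### Lifts of automorphisms to `ℍ` -/

section LocalLifts

variable {Γ : Subgroup SL(2, ℤ)}

theorem analyticAt_smul (g : SL(2, ℤ)) (z : ℍ) :
    AnalyticAt ℂ (fun t : ℂ => ((g • UpperHalfPlane.ofComplex t : ℍ) : ℂ)) z := by
  rw [Complex.analyticAt_iff_eventually_differentiableAt, eventually_nhds_coe_iff]
  exact Filter.Eventually.of_forall fun w => (hasDerivAt_smul g w).differentiableAt

theorem tendsto_toCurve_ofComplex (z : ℍ) :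
    Filter.Tendsto (fun t : ℂ => toCurve Γ (UpperHalfPlane.ofComplex t)) (𝓝 (z : ℂ))
      (𝓝 (toCurve Γ z)) :=
  (continuous_toCurve Γ).continuousAt.tendsto.comp (tendsto_ofComplex z)

theorem coe_ofComplex {t : ℂ} (ht : 0 < t.im) : ((UpperHalfPlane.ofComplex t : ℍ) : ℂ) = t := by
  rw [UpperHalfPlane.ofComplex_apply_of_im_pos ht]

theorem eventually_im_pos (z : ℍ) : ∀ᶠ t in 𝓝 (z : ℂ), 0 < t.im :=
  (isOpen_lt continuous_const Complex.continuous_im).mem_nhds z.im_pos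

/-- Points with nontrivial stabilizer are isolated. -/
theorem eventually_ell_eq_one (Γ : Subgroup SL(2, ℤ)) (z₀ : ℍ) :
    ∀ᶠ z in 𝓝[≠] z₀, ell Γ z = 1 := by
  obtain ⟨U, hU, V, hV, h⟩ := exists_nhds_smul z₀ z₀
  rw [eventually_nhdsWithin_iff]
  filter_upwards [hU, hV] with z hzU hzV hne
  refine ell_eq_one_iff.mpr fun γ _ hz => ?_
  have hz₀ : γ • z₀ = z₀ := h γ z hzU (by rwa [hz])
  refine eq_one_or_neg_one_of_aut_sq hz₀ ?_
  have h1 := cayley_smul hz₀ z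
  rw [hz] at h1
  have h2 : cayley z₀ z ≠ 0 := fun h => hne (cayley_eq_zero_iff.mp h)
  exact mul_right_cancel₀ h2 (by rw [one_mul, ← h1])

/-- Points with trivial stabilizer are dense. -/
theorem exists_ell_eq_one {V : Set ℂ} (hV : IsOpen V) {z₀ : ℍ} (hz₀ : (z₀ : ℂ) ∈ V) :
    ∃ z : ℍ, (z : ℂ) ∈ V ∧ ell Γ z = 1 := by
  have hne : (𝓝[≠] z₀).NeBot := by
    by_contra hc
    rw [Filter.not_neBot] at hc
    have hopen : IsOpen ({z₀} : Set ℍ) := by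
      rw [isOpen_singleton_iff_nhds_eq_pure, ← nhdsNE_sup_pure, hc, bot_sup_eq]
    have h2 := UpperHalfPlane.isOpenEmbedding_coe.isOpenMap _ hopen
    rw [Set.image_singleton] at h2
    exact not_isOpen_singleton (z₀ : ℂ) h2
  have h1 : ∀ᶠ z : ℍ in 𝓝 z₀, (z : ℂ) ∈ V :=
    UpperHalfPlane.continuous_coe.continuousAt (hV.mem_nhds hz₀)
  obtain ⟨z, hz, hzV⟩ := ((eventually_ell_eq_one Γ z₀).and
    (h1.filter_mono nhdsWithin_le_nhds)).exists
  exact ⟨z, hzV, hz⟩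

theorem HolAt.comp_aut {G : Curve Γ → ℂ} {u : Curve Γ → Curve Γ} (hu : IsHolomorphicMap u)
    {x : Curve Γ} (h : HolAt G (u x)) : HolAt (G ∘ u) x := by
  obtain ⟨W, hW, hx, hG⟩ := h
  exact ⟨u ⁻¹' W, hW.preimage hu.1, hx, hu.2 W G hW hG⟩

/-- In local coordinates an automorphism is an invertible germ. -/
theorem exists_transition (u : Aut Γ) {x : Curve Γ} {F F' : Curve Γ → ℂ} (hF : IsChartAt F x)
    (hF' : IsChartAt F' (u.1 x)) : ∃ k : ℂ → ℂ, AnalyticAt ℂ k 0 ∧ k 0 = 0 ∧ deriv k 0 ≠ 0 ∧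
      ∀ᶠ y in 𝓝 x, F' (u.1 y) = k (F y) := by
  obtain ⟨k, hk, hkF⟩ := hF.factor (F' ∘ u.1) (HolAt.comp_aut u.2.1 hF'.hol)
  obtain ⟨l, hl, hlF⟩ := hF'.factor (F ∘ u.1.symm) (HolAt.comp_aut u.2.2 (by
    rw [Homeomorph.symm_apply_apply]; exact hF.hol))
  have hk0 : k 0 = 0 := by
    have := hkF.self_of_nhds
    rw [hF.zero] at this
    rw [← this]
    exact hF'.zero
  refine ⟨k, hk, hk0, fun hd => ?_, hkF⟩
  have hlk : (fun s => l (k s)) =ᶠ[𝓝 0] id := by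
    rw [Filter.EventuallyEq, ← hF.map, Filter.eventually_map]
    filter_upwards [hkF, u.1.continuous.continuousAt.eventually hlF] with y h1 h2
    rw [← h1]
    simp only [Function.comp] at h2 ⊢
    rw [← h2, Homeomorph.symm_apply_apply]
    rfl
  have hl' : HasDerivAt l (deriv l 0) (k 0) := by
    rw [hk0]; exact hl.differentiableAt.hasDerivAt
  have h1 := (hl'.comp (0 : ℂ) hk.differentiableAt.hasDerivAt).congr_of_eventuallyEq hlk.symm
  have h2 := h1.unique (hasDerivAt_id (0 : ℂ))
  rw [hd, mul_zero] at h2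
  exact zero_ne_one h2

open ComplexConjugate in
/-- The inverse of the Cayley coordinate. -/
def cayleyInv (w₀ : ℍ) (s : ℂ) : ℂ := (w₀ - s * conj (w₀ : ℂ)) / (1 - s)

open ComplexConjugate in
theorem cayley_cayleyInv (w₀ : ℍ) {s : ℂ} (hs : s ≠ 1) : cayley w₀ (cayleyInv w₀ s) = s := by
  have h1 : 1 - s ≠ 0 := sub_ne_zero.mpr hs.symm
  have h2 := sub_conj_ne_zero w₀ w₀
  rw [cayley, cayleyInv, div_sub' h1, div_sub' h1, div_div_div_cancel_right₀ h1,
    show (w₀ : ℂ) - s * conj (w₀ : ℂ) - (1 - s) * conj (w₀ : ℂ) = w₀ - conj (w₀ : ℂ) by ring,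
    div_eq_iff h2]
  ring

theorem cayleyInv_zero (w₀ : ℍ) : cayleyInv w₀ 0 = w₀ := by simp [cayleyInv]

theorem analyticAt_cayleyInv (w₀ : ℍ) : AnalyticAt ℂ (cayleyInv w₀) 0 :=
  (analyticAt_const.sub (analyticAt_id.mul analyticAt_const)).div
    (analyticAt_const.sub analyticAt_id) (by simp)

/-- The germ at `z` of the analytic function `f` lifts the self-map `u` of the curve. -/
def IsLiftAt (u : Curve Γ → Curve Γ) (f : ℂ → ℂ) (z : ℂ) : Prop :=
  AnalyticAt ℂ f z ∧ ∀ᶠ t in 𝓝 z, 0 < (f t).im ∧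
    u (toCurve Γ (UpperHalfPlane.ofComplex t)) = toCurve Γ (UpperHalfPlane.ofComplex (f t))

/-- Local lifts exist where the order of the stabilizer of the target divides that of the source:
they are obtained by extracting a root in the local coordinates. -/
theorem exists_isLiftAt (u : Aut Γ) {z₀ w₀ : ℍ} (h : u.1 (toCurve Γ z₀) = toCurve Γ w₀)
    (hd : ell Γ w₀ ∣ ell Γ z₀) : ∃ f, IsLiftAt u.1 f z₀ ∧ f z₀ = w₀ := by
  obtain ⟨F, hF, hFz⟩ := exists_chart_toCurve (Γ := Γ) z₀
  obtain ⟨F', hF', hFw⟩ := exists_chart_toCurve (Γ := Γ) w₀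
  obtain ⟨k, hk, hk0, hkd, hkF⟩ := exists_transition u hF (by rw [h]; exact hF')
  obtain ⟨m, hm⟩ := hd
  have hew := ell_pos Γ w₀
  have hm0 : m ≠ 0 := by
    rintro rfl
    have := ell_pos Γ z₀
    omega
  obtain ⟨v, hv, hv0, hkv⟩ := exists_eq_sub_mul hk hk0
  obtain ⟨ρ, hρ, -, hρv⟩ := exists_analyticAt_pow_eq hv (by rw [hv0]; exact hkd) hew.ne'
  have hc : AnalyticAt ℂ (cayley z₀) z₀ := analyticAt_cayley z₀ z₀
  have hce0 : cayley z₀ z₀ ^ ell Γ z₀ = 0 := by rw [cayley_self, zero_pow (ell_pos Γ z₀).ne']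
  set r : ℂ → ℂ := fun t => cayley z₀ t ^ m * ρ (cayley z₀ t ^ ell Γ z₀) with hr
  have hr0 : r z₀ = 0 := by rw [hr]; simp only; rw [cayley_self, zero_pow hm0, zero_mul]
  have hran : AnalyticAt ℂ r z₀ := (hc.pow m).mul
    (AnalyticAt.comp (g := ρ) (by rw [hce0]; exact hρ) (hc.pow _))
  have hfan : AnalyticAt ℂ (fun t => cayleyInv w₀ (r t)) z₀ :=
    AnalyticAt.comp (g := cayleyInv w₀) (by rw [hr0]; exact analyticAt_cayleyInv w₀) hran
  have hf0 : cayleyInv w₀ (r z₀) = w₀ := by rw [hr0, cayleyInv_zero]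
  have hftend : Filter.Tendsto (fun t => cayleyInv w₀ (r t)) (𝓝 (z₀ : ℂ)) (𝓝 (w₀ : ℂ)) := by
    have := hfan.continuousAt.tendsto
    rwa [hf0] at this
  have him : ∀ᶠ t in 𝓝 (z₀ : ℂ), 0 < (cayleyInv w₀ (r t)).im := hftend (eventually_im_pos w₀)
  refine ⟨fun t => cayleyInv w₀ (r t), ⟨hfan, ?_⟩, hf0⟩
  obtain ⟨U, hU, hinj⟩ := hF'.inj
  have h1 : ∀ᶠ t in 𝓝 (z₀ : ℂ), u.1 (toCurve Γ (UpperHalfPlane.ofComplex t)) ∈ U := by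
    have := (u.1.continuous.continuousAt.tendsto).comp (tendsto_toCurve_ofComplex (Γ := Γ) z₀)
    rw [h] at this
    exact this hU
  have h2 : ∀ᶠ t in 𝓝 (z₀ : ℂ), toCurve Γ (UpperHalfPlane.ofComplex (cayleyInv w₀ (r t))) ∈ U :=
    ((tendsto_toCurve_ofComplex w₀).comp hftend) hU
  have h3 : ∀ᶠ t in 𝓝 (z₀ : ℂ), F' (toCurve Γ (UpperHalfPlane.ofComplex (cayleyInv w₀ (r t))))
      = cayley w₀ (UpperHalfPlane.ofComplex (cayleyInv w₀ (r t)) : ℍ) ^ ell Γ w₀ :=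
    ((tendsto_ofComplex w₀).comp hftend).eventually hFw
  have hctend : Filter.Tendsto (fun t => cayley z₀ t ^ ell Γ z₀) (𝓝 (z₀ : ℂ)) (𝓝 0) := by
    have := (hc.pow (ell Γ z₀)).continuousAt.tendsto
    rwa [Pi.pow_apply, hce0] at this
  filter_upwards [him, h1, h2, h3, eventually_im_pos z₀, (tendsto_ofComplex z₀).eventually hFz,
    (tendsto_toCurve_ofComplex (Γ := Γ) z₀).eventually hkF, hctend.eventually hkv,
    hctend.eventually hρv, hran.continuousAt.eventually_ne (show r z₀ ≠ 1 by rw [hr0]; simp)]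
    with t h4 h5 h6 h7 h8 h9 h10 h11 h12 h13
  refine ⟨h4, hinj h5 h6 ?_⟩
  rw [h10, h9, coe_ofComplex h8, h11, sub_zero, ← h12, h7, coe_ofComplex h4,
    cayley_cayleyInv w₀ h13, hr]
  simp only
  rw [mul_pow, ← pow_mul, mul_comm m, ← hm]

/-- Two lifts of the same map on a connected open set differ by an element of `Γ`. -/
theorem exists_smul_eq_of_lifts {V : Set ℂ} (hV : IsOpen V) (hVc : IsPreconnected V)
    {f f' : ℂ → ℂ} (hf : ∀ t ∈ V, AnalyticAt ℂ f t) (hf' : ∀ t ∈ V, AnalyticAt ℂ f' t)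
    (him : ∀ t ∈ V, 0 < (f t).im) (him' : ∀ t ∈ V, 0 < (f' t).im)
    (heq : ∀ t ∈ V, toCurve Γ (UpperHalfPlane.ofComplex (f t))
      = toCurve Γ (UpperHalfPlane.ofComplex (f' t)))
    {t₀ : ℂ} (ht₀ : t₀ ∈ V) (hell : ell Γ (UpperHalfPlane.ofComplex (f' t₀)) = 1) :
    ∃ γ ∈ Γ, ∀ t ∈ V, UpperHalfPlane.ofComplex (f t) = γ • UpperHalfPlane.ofComplex (f' t) := by
  obtain ⟨γ, hγ, hγ₀⟩ := toCurve_eq_iff.mp (heq t₀ ht₀)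
  refine ⟨γ, hγ, ?_⟩
  set w := UpperHalfPlane.ofComplex (f' t₀) with hw
  have tends : ∀ k : ℂ → ℂ, AnalyticAt ℂ k t₀ → 0 < (k t₀).im →
      Filter.Tendsto (fun t => UpperHalfPlane.ofComplex (k t)) (𝓝 t₀)
        (𝓝 (UpperHalfPlane.ofComplex (k t₀))) := by
    intro k hk him
    have h1 := tendsto_ofComplex (UpperHalfPlane.ofComplex (k t₀))
    rw [coe_ofComplex him] at h1
    exact h1.comp hk.continuousAt.tendsto
  obtain ⟨A, hA, B, hB, hAB⟩ := exists_nhds_smul w w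
  have h1 : ∀ᶠ t in 𝓝 t₀, UpperHalfPlane.ofComplex (f' t) ∈ A :=
    tends f' (hf' t₀ ht₀) (him' t₀ ht₀) hA
  have h2 : ∀ᶠ t in 𝓝 t₀, γ⁻¹ • UpperHalfPlane.ofComplex (f t) ∈ B := by
    have h3 := ((continuous_smul_upperHalfPlane γ⁻¹).continuousAt.tendsto.comp
      (tends f (hf t₀ ht₀) (him t₀ ht₀)))
    rw [← hγ₀, inv_smul_smul] at h3
    exact h3 hB
  have hnear : f =ᶠ[𝓝 t₀] fun t => ((γ • UpperHalfPlane.ofComplex (f' t) : ℍ) : ℂ) := by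
    filter_upwards [h1, h2, hV.mem_nhds ht₀] with t h3 h4 htV
    obtain ⟨δ, hδ, hδt⟩ := toCurve_eq_iff.mp (heq t htV)
    rw [← hδt, ← mul_smul] at h4
    have h5 := hAB _ _ h3 h4
    have h6 := ell_eq_one_iff.mp hell _ (Γ.mul_mem (Γ.inv_mem hγ) hδ) h5
    rw [← coe_ofComplex (him t htV), ← hδt]
    congr 1
    have h7 : δ = γ * (γ⁻¹ * δ) := by group
    rcases h6 with h6 | h6
    · rw [h7, h6, mul_one]
    · rw [h7, h6, mul_neg, mul_one, ModularGroup.SL_neg_smul]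
  have hg : AnalyticOnNhd ℂ (fun t => ((γ • UpperHalfPlane.ofComplex (f' t) : ℍ) : ℂ)) V := by
    intro t ht
    refine AnalyticAt.comp (g := fun s : ℂ => ((γ • UpperHalfPlane.ofComplex s : ℍ) : ℂ)) ?_
      (hf' t ht)
    have := analyticAt_smul γ (UpperHalfPlane.ofComplex (f' t))
    rwa [coe_ofComplex (him' t ht)] at this
  intro t ht
  have := AnalyticOnNhd.eqOn_of_preconnected_of_eventuallyEq (fun t ht => hf t ht) hg hVc ht₀ hnear ht
  apply UpperHalfPlane.ext
  rw [coe_ofComplex (him t ht)]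
  exact this

/-- A self-map of the curve which has local lifts everywhere, and which maps points with trivial
stabilizer to points with trivial stabilizer, has a global lift. -/
theorem exists_global_lift {u : Curve Γ → Curve Γ} (hloc : ∀ z : ℍ, ∃ f, IsLiftAt u f z)
    (hell : ∀ z w : ℍ, u (toCurve Γ z) = toCurve Γ w → ell Γ z = 1 → ell Γ w = 1) :
    ∃ F : ℍ → ℍ, (∀ z, u (toCurve Γ z) = toCurve Γ (F z)) ∧
      ∀ z : ℍ, DifferentiableAt ℂ (fun t : ℂ => (F (UpperHalfPlane.ofComplex t) : ℂ)) z := by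
  choose f hf using hloc
  have hball : ∀ z : ℍ, ∃ r > 0, ∀ t ∈ Metric.ball (z : ℂ) r, 0 < t.im ∧ AnalyticAt ℂ (f z) t ∧
      0 < (f z t).im ∧ u (toCurve Γ (UpperHalfPlane.ofComplex t))
        = toCurve Γ (UpperHalfPlane.ofComplex (f z t)) := by
    intro z
    have := ((eventually_im_pos z).and (hf z).1.eventually_analyticAt).and (hf z).2
    obtain ⟨r, hr, h⟩ := Metric.eventually_nhds_iff_ball.mp this
    exact ⟨r, hr, fun t ht => ⟨(h t ht).1.1, (h t ht).1.2, (h t ht).2⟩⟩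
  choose r hr hb using hball
  set U : ℍ → Set ℍ := fun i => {x | (x : ℂ) ∈ Metric.ball (i : ℂ) (r i)} with hUdef
  have hU : ∀ i, IsOpen (U i) := fun i =>
    Metric.isOpen_ball.preimage UpperHalfPlane.continuous_coe
  have hmem : ∀ i, i ∈ U i := fun i => Metric.mem_ball_self (hr i)
  set fl : ℍ → ℍ → ℍ := fun i x => UpperHalfPlane.ofComplex (f i x) with hfl
  have hlift : ∀ i, ∀ x ∈ U i, u (toCurve Γ x) = toCurve Γ (fl i x) := by
    intro i x hx
    have := (hb i x hx).2.2.2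
    rwa [UpperHalfPlane.ofComplex_apply] at this
  -- the group `Γ / {±1}`, as a group of transformations of `ℍ`
  set G := Γ.map (MulAction.toPermHom SL(2, ℤ) ℍ) with hG
  have huniq : ∀ (σ τ : G) (w : ℍ), ell Γ w = 1 → σ • w = τ • w → σ = τ := by
    rintro ⟨_, γ, hγ, rfl⟩ ⟨_, δ, hδ, rfl⟩ w hw hστ
    have hστ : γ • w = δ • w := hστ
    have h1 : (δ⁻¹ * γ) • w = w := by rw [mul_smul, hστ, inv_smul_smul]
    have h2 := ell_eq_one_iff.mp hw _ (Γ.mul_mem (Γ.inv_mem hδ) hγ) h1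
    apply Subtype.ext
    ext1 z
    change γ • z = δ • z
    have h7 : γ = δ * (δ⁻¹ * γ) := by group
    rcases h2 with h2 | h2
    · rw [h7, h2, mul_one]
    · rw [h7, h2, mul_neg, mul_one, ModularGroup.SL_neg_smul]
  have hex : ∀ i j, (U i ∩ U j).Nonempty → ∃ σ : G, ∀ x ∈ U i ∩ U j, fl i x = σ • fl j x := by
    rintro i j ⟨x, hxi, hxj⟩
    set V := Metric.ball (i : ℂ) (r i) ∩ Metric.ball (j : ℂ) (r j) with hV
    have hVo : IsOpen V := Metric.isOpen_ball.inter Metric.isOpen_ball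
    obtain ⟨z, hzV, hz⟩ := exists_ell_eq_one (Γ := Γ) hVo (z₀ := x) ⟨hxi, hxj⟩
    obtain ⟨γ, hγ, h⟩ := exists_smul_eq_of_lifts (Γ := Γ) hVo
      ((convex_ball _ _).inter (convex_ball _ _)).isPreconnected
      (fun t ht => (hb i t ht.1).2.1) (fun t ht => (hb j t ht.2).2.1)
      (fun t ht => (hb i t ht.1).2.2.1) (fun t ht => (hb j t ht.2).2.2.1)
      (fun t ht => by rw [← (hb i t ht.1).2.2.2, ← (hb j t ht.2).2.2.2]) hzV
      (hell z _ (hlift j z hzV.2) hz)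
    exact ⟨⟨_, γ, hγ, rfl⟩, fun x hx => h x hx⟩
  classical
  set g : ℍ → ℍ → G := fun i j => if h : (U i ∩ U j).Nonempty then (hex i j h).choose else 1 with hg
  have hgs : ∀ i j, ∀ x ∈ U i ∩ U j, fl i x = g i j • fl j x := by
    intro i j x hx
    have h : (U i ∩ U j).Nonempty := ⟨x, hx⟩
    rw [hg]
    simp only [dif_pos h]
    exact (hex i j h).choose_spec x hx
  have hexell : ∀ W : Set ℍ, IsOpen W → W.Nonempty → ∃ x ∈ W, ell Γ x = 1 := by
    rintro W hW ⟨x, hx⟩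
    obtain ⟨z, ⟨z', hz', hzz⟩, hz⟩ := exists_ell_eq_one (Γ := Γ)
      (UpperHalfPlane.isOpenEmbedding_coe.isOpenMap _ hW) (z₀ := x) ⟨x, hx, rfl⟩
    rw [UpperHalfPlane.ext hzz] at hz'
    exact ⟨z, hz', hz⟩
  obtain ⟨F, hF⟩ := exists_glue U hU hmem fl g (fun i => by
      obtain ⟨x, hx, hx1⟩ := hexell (U i) (hU i) ⟨i, hmem i⟩
      refine huniq _ _ (fl i x) (hell x _ (hlift i x hx) hx1) ?_
      rw [one_smul, ← hgs i i x ⟨hx, hx⟩]) (fun i j k hijk => by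
      obtain ⟨x, ⟨⟨hxi, hxj⟩, hxk⟩, hx1⟩ := hexell _ (((hU i).inter (hU j)).inter (hU k)) hijk
      refine huniq _ _ (fl k x) (hell x _ (hlift k x hxk) hx1) ?_
      rw [mul_smul, ← hgs j k x ⟨hxj, hxk⟩, ← hgs i j x ⟨hxi, hxj⟩, ← hgs i k x ⟨hxi, hxk⟩]) hgs
  refine ⟨F, fun z => ?_, fun z => ?_⟩
  · obtain ⟨⟨_, γ, hγ, rfl⟩, hv⟩ := hF z
    rw [hv.self_of_nhds, hlift z z (hmem z)]
    exact (toCurve_smul hγ _).symm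
  · obtain ⟨⟨_, γ, hγ, rfl⟩, hv⟩ := hF z
    have h1 : (fun t : ℂ => (F (UpperHalfPlane.ofComplex t) : ℂ)) =ᶠ[𝓝 (z : ℂ)]
        fun t => ((γ • UpperHalfPlane.ofComplex (f z t) : ℍ) : ℂ) := by
      filter_upwards [(tendsto_ofComplex z).eventually hv, eventually_im_pos z] with t ht him
      rw [ht]
      change ((γ • UpperHalfPlane.ofComplex (f z (UpperHalfPlane.ofComplex t : ℍ)) : ℍ) : ℂ) = _
      rw [coe_ofComplex him]
    refine DifferentiableAt.congr_of_eventuallyEq ?_ h1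
    refine DifferentiableAt.comp
      (g := fun s : ℂ => ((γ • UpperHalfPlane.ofComplex s : ℍ) : ℂ)) (z : ℂ) ?_
      (hf z).1.differentiableAt
    have h2 := (hasDerivAt_smul γ (UpperHalfPlane.ofComplex (f z z))).differentiableAt
    rwa [coe_ofComplex (hf z).2.self_of_nhds.1] at h2

end LocalLifts

/-! ### Automorphisms of `ℍ` -/

section AutUpperHalfPlane

open UpperHalfPlane

theorem cayleyInv_I_ne {s : ℂ} (hs : ‖s‖ < 1) : s ≠ 1 := by
  rintro rfl; simp at hs

open ComplexConjugate in
theorem cayleyInv_im_pos {s : ℂ} (hs : ‖s‖ < 1) : 0 < (cayleyInv I s).im := by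
  have hs1 := cayleyInv_I_ne hs
  have h1 : (1 - s) ≠ 0 := sub_ne_zero.mpr hs1.symm
  have h2 : cayleyInv I s = Complex.I * ((1 + s) * conj (1 - s)) / (Complex.normSq (1 - s) : ℂ) := by
    rw [← Complex.mul_conj, cayleyInv]
    have h3 : conj (1 - s) ≠ 0 := (map_ne_zero _).mpr h1
    rw [← mul_assoc, mul_div_mul_right _ _ h3]
    simp
    ring
  rw [h2, Complex.div_ofReal_im]
  refine div_pos ?_ (Complex.normSq_pos.mpr h1)
  have h4 : s.re * s.re + s.im * s.im < 1 := by
    rw [← Complex.normSq_apply, Complex.normSq_eq_norm_sq]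
    nlinarith [norm_nonneg s]
  simp
  nlinarith

open ComplexConjugate in
theorem norm_cayley_lt_one (z₀ z : ℍ) : ‖cayley z₀ z‖ < 1 := by
  rw [cayley, norm_div, div_lt_one (norm_pos_iff.mpr (sub_conj_ne_zero z₀ z))]
  refine lt_of_pow_lt_pow_left₀ 2 (norm_nonneg _) ?_
  rw [← Complex.normSq_eq_norm_sq, ← Complex.normSq_eq_norm_sq, Complex.normSq_apply,
    Complex.normSq_apply]
  simp only [Complex.sub_re, Complex.sub_im, Complex.conj_re, Complex.conj_im, coe_re, coe_im]
  nlinarith [mul_pos z.im_pos z₀.im_pos]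

/-- The rotation of `ℍ` by the angle `2θ` about `i`. -/
def rotation (θ : ℝ) : SL(2, ℝ) :=
  ⟨!![Real.cos θ, Real.sin θ; -Real.sin θ, Real.cos θ], by
    rw [Matrix.det_fin_two_of]; nlinarith [Real.sin_sq_add_cos_sq θ]⟩

theorem cayley_rotation (θ : ℝ) (z : ℍ) :
    cayley I (rotation θ • z : ℍ) = Complex.exp (2 * θ * Complex.I) * cayley I z := by
  have hE : Complex.exp (θ * Complex.I) = Real.cos θ + Real.sin θ * Complex.I := by
    rw [Complex.exp_mul_I, Complex.ofReal_cos, Complex.ofReal_sin]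
  have hsc : (Real.cos θ : ℂ) ^ 2 + (Real.sin θ : ℂ) ^ 2 = 1 := by
    exact_mod_cast Real.cos_sq_add_sin_sq θ
  have hsq : Complex.exp (2 * θ * Complex.I) = (Real.cos θ + Real.sin θ * Complex.I) ^ 2 := by
    rw [← hE, ← Complex.exp_nat_mul]; congr 1; push_cast; ring
  set c : ℂ := ((Real.cos θ : ℝ) : ℂ) with hc
  set s : ℂ := ((Real.sin θ : ℝ) : ℂ) with hs
  have hcoe : ((rotation θ • z : ℍ) : ℂ) = (c * z + s) / (-s * z + c) := by
    rw [coe_specialLinearGroup_apply]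
    simp [rotation, hc, hs]
  have hden : -s * z + c ≠ 0 := by
    have := denom_ne_zero ((rotation θ : SL(2, ℝ)) : GL (Fin 2) ℝ) z
    change (((-Real.sin θ : ℝ) : ℂ) * z + ((Real.cos θ : ℝ) : ℂ)) ≠ 0 at this
    rwa [Complex.ofReal_neg] at this
  have h1 := sub_conj_ne_zero I z
  have h2 := sub_conj_ne_zero I (rotation θ • z)
  rw [hsq, cayley, cayley, mul_div_assoc', div_eq_div_iff h2 h1, hcoe]
  simp only [coe_I, Complex.conj_I, sub_neg_eq_add]
  have hI := Complex.I_sq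
  have e1 : (c * z + s) / (-s * z + c) - Complex.I
      = (c + s * Complex.I) * (z - Complex.I) / (-s * z + c) := by
    rw [div_sub' hden]
    congr 1
    linear_combination s * hI
  have e2 : (c * z + s) / (-s * z + c) + Complex.I
      = (c - s * Complex.I) * (z + Complex.I) / (-s * z + c) := by
    rw [div_add' _ _ _ hden]
    congr 1
    linear_combination s * hI
  have e3 : (c + s * Complex.I) * (c - s * Complex.I) = 1 := by
    linear_combination hsc - s ^ 2 * hI
  rw [e1, e2]
  linear_combination (-(c + s * Complex.I) * (z - Complex.I) * (z + Complex.I) / (-s * z + c)) * e3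

/-- A biholomorphic self-map of `ℍ` fixing `i` is a rotation, by the Schwarz lemma. -/
theorem exists_rotation {F F' : ℍ → ℍ} (hF : ∀ z : ℍ, DifferentiableAt ℂ (fun t : ℂ => (F (ofComplex t) : ℂ)) z)
    (hF' : ∀ z : ℍ, DifferentiableAt ℂ (fun t : ℂ => (F' (ofComplex t) : ℂ)) z)
    (hF'F : ∀ z, F' (F z) = z) (hI : F I = I) :
    ∃ θ, ∀ z, F z = rotation θ • z := by
  have hdisc : ∀ H : ℍ → ℍ, (∀ z : ℍ, DifferentiableAt ℂ (fun t : ℂ => (H (ofComplex t) : ℂ)) z) →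
      H I = I → ∃ φ : ℂ → ℂ, DifferentiableOn ℂ φ (Metric.ball 0 1) ∧ φ 0 = 0 ∧
        Set.MapsTo φ (Metric.ball 0 1) (Metric.closedBall 0 1) ∧
        ∀ z : ℍ, φ (cayley I z) = cayley I (H z) := by
    intro H hH hHI
    have hinv : ∀ z : ℍ, ofComplex (cayleyInv I (cayley I z)) = z := by
      intro z
      apply cayley_injective (z₀ := I)
      rw [coe_ofComplex (cayleyInv_im_pos (norm_cayley_lt_one I z)),
        cayley_cayleyInv _ (cayleyInv_I_ne (norm_cayley_lt_one I z))]
    refine ⟨fun s => cayley I (H (ofComplex (cayleyInv I s))), ?_, ?_, ?_, ?_⟩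
    · intro s hs
      rw [mem_ball_zero_iff] at hs
      have h1 : DifferentiableAt ℂ (cayleyInv I) s := by
        unfold cayleyInv
        refine DifferentiableAt.div (by fun_prop) (by fun_prop)
          (sub_ne_zero.mpr (cayleyInv_I_ne hs).symm)
      have h2 := hH (ofComplex (cayleyInv I s))
      rw [coe_ofComplex (cayleyInv_im_pos hs)] at h2
      have h3 := (analyticAt_cayley I (H (ofComplex (cayleyInv I s)))).differentiableAt
      exact (DifferentiableAt.comp (g := cayley I) s h3
        (DifferentiableAt.comp (g := fun t : ℂ => (H (ofComplex t) : ℂ)) s h2 h1)).differentiableWithinAt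
    · simp only
      rw [cayleyInv_zero, ofComplex_apply, hHI, cayley_self]
    · intro s _
      rw [mem_closedBall_zero_iff]
      exact (norm_cayley_lt_one _ _).le
    · intro z
      simp only
      rw [hinv]
  obtain ⟨φ, hφd, hφ0, hφm, hφ⟩ := hdisc F hF hI
  obtain ⟨ψ, hψd, hψ0, hψm, hψ⟩ := hdisc F' hF' (by rw [← hI, hF'F, hI])
  have hnorm : ∀ z : ℍ, ‖cayley I (F z)‖ = ‖cayley I z‖ := by
    intro z
    apply le_antisymm
    · rw [← hφ]
      exact Complex.norm_le_norm_of_mapsTo_ball hφd hφm hφ0 (norm_cayley_lt_one I z)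
    · conv_lhs => rw [← hF'F z, ← hψ]
      exact Complex.norm_le_norm_of_mapsTo_ball hψd hψm hψ0 (norm_cayley_lt_one I (F z))
  -- a point of the disc different from the centre
  set z₁ : ℍ := ⟨2 * Complex.I, by simp⟩ with hz₁
  have hs₁ : cayley I z₁ ≠ 0 := by
    intro h
    have := congrArg UpperHalfPlane.im (cayley_eq_zero_iff.mp h)
    simp [hz₁, UpperHalfPlane.im] at this
  have hds : dslope φ 0 (cayley I z₁) = φ (cayley I z₁) / cayley I z₁ := by
    rw [dslope_of_ne _ hs₁, slope_def_field, hφ0, sub_zero, sub_zero]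
  have hds1 : ‖dslope φ 0 (cayley I z₁)‖ = 1 / 1 := by
    rw [hds, norm_div, hφ, hnorm, div_self (norm_ne_zero_iff.mpr hs₁), div_one]
  have haff := Complex.affine_of_mapsTo_ball_of_norm_dslope_eq_div hφd
    (by rw [hφ0]; exact hφm) (mem_ball_zero_iff.mpr (norm_cayley_lt_one I z₁)) hds1
  set ζ := dslope φ 0 (cayley I z₁) with hζ
  have hζ1 : ‖ζ‖ = 1 := by rw [hds1, div_one]
  refine ⟨Complex.arg ζ / 2, fun z => cayley_injective (z₀ := I) ?_⟩
  have hφz := haff (mem_ball_zero_iff.mpr (norm_cayley_lt_one I z))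
  simp only [hφ0, zero_add, sub_zero, smul_eq_mul] at hφz
  rw [cayley_rotation, ← hφ, hφz, mul_comm]
  congr 1
  have := Complex.norm_mul_exp_arg_mul_I ζ
  rw [hζ1, Complex.ofReal_one, one_mul] at this
  rw [← this]
  congr 1
  push_cast
  rw [this]
  ring

theorem differentiableAt_smul_real (A : SL(2, ℝ)) (z : ℍ) :
    DifferentiableAt ℂ (fun t : ℂ => ((A • ofComplex t : ℍ) : ℂ)) z :=
  (hasStrictDerivAt_smul (g := (A : GL (Fin 2) ℝ)) (by
    rw [show ((A : GL (Fin 2) ℝ) : Matrix (Fin 2) (Fin 2) ℝ).det = 1 from A.det_coe]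
    exact one_pos) z).hasDerivAt.differentiableAt

/-- Biholomorphic self-maps of `ℍ` are Möbius transformations. -/
theorem exists_moebius {F F' : ℍ → ℍ} (hF : ∀ z : ℍ, DifferentiableAt ℂ (fun t : ℂ => (F (ofComplex t) : ℂ)) z)
    (hF' : ∀ z : ℍ, DifferentiableAt ℂ (fun t : ℂ => (F' (ofComplex t) : ℂ)) z)
    (hF'F : ∀ z, F' (F z) = z) :
    ∃ A : SL(2, ℝ), ∀ z, F z = A • z := by
  obtain ⟨B, hB⟩ : ∃ B : SL(2, ℝ), B • I = F I := ⟨_, toSL2R_smul_I _⟩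
  have hcomp : ∀ (H K : ℍ → ℍ), (∀ z : ℍ, DifferentiableAt ℂ (fun t : ℂ => (H (ofComplex t) : ℂ)) z) →
      (∀ z : ℍ, DifferentiableAt ℂ (fun t : ℂ => (K (ofComplex t) : ℂ)) z) → ∀ z : ℍ,
      DifferentiableAt ℂ (fun t : ℂ => (H (K (ofComplex t)) : ℂ)) z := by
    intro H K hH hK z
    have h1 : (fun t : ℂ => (H (K (ofComplex t)) : ℂ)) =
        (fun t : ℂ => (H (ofComplex t) : ℂ)) ∘ fun t : ℂ => (K (ofComplex t) : ℂ) := by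
      ext t; simp
    rw [h1]
    refine DifferentiableAt.comp (z : ℂ) ?_ (hK z)
    rw [ofComplex_apply]
    exact hH _
  obtain ⟨θ, hθ⟩ := exists_rotation (F := fun z => B⁻¹ • F z) (F' := fun z => F' (B • z))
    (hcomp (fun z => B⁻¹ • z) F (differentiableAt_smul_real _) hF)
    (hcomp F' (fun z => B • z) hF' (differentiableAt_smul_real _))
    (fun z => by rw [smul_inv_smul, hF'F])
    (by rw [← hB, inv_smul_smul])
  refine ⟨B * rotation θ, fun z => ?_⟩
  rw [mul_smul, ← hθ, smul_inv_smul]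

end AutUpperHalfPlane

/-! ### Normalizers in `SL(2, ℝ)` -/

section Normalizer

variable {Γ : Subgroup SL(2, ℤ)} {p : ℕ}

/-- The inclusion of `SL(2, ℤ)` in `SL(2, ℝ)`. -/
abbrev toReal : SL(2, ℤ) →* SL(2, ℝ) := Matrix.SpecialLinearGroup.map (Int.castRingHom ℝ)

theorem toReal_apply (g : SL(2, ℤ)) (i j : Fin 2) : toReal g i j = (g i j : ℝ) := rfl

theorem toReal_injective : Function.Injective toReal := by
  intro g h hgh
  ext i j
  have := congrArg (fun A : SL(2, ℝ) => A i j) hgh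
  simp only [toReal_apply] at this
  exact_mod_cast this

theorem toReal_neg (g : SL(2, ℤ)) : toReal (-g) = -toReal g := by
  ext i j
  simp [toReal]

theorem toReal_smul (g : SL(2, ℤ)) (z : ℍ) : toReal g • z = g • z := rfl

theorem eq_one_or_of_forall_smul {B : SL(2, ℝ)} (h : ∀ z : ℍ, B • z = z) : B = 1 ∨ B = -1 := by
  have key : ∀ z : ℍ, (B 0 0 : ℂ) * z + B 0 1 = z * (B 1 0 * z + B 1 1) := by
    intro z
    have h1 := congrArg UpperHalfPlane.coe (h z)
    rw [UpperHalfPlane.coe_specialLinearGroup_apply, div_eq_iff] at h1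
    · simpa using h1
    · have := UpperHalfPlane.denom_ne_zero (B : GL (Fin 2) ℝ) z
      simpa [UpperHalfPlane.denom] using this
  have k1 := key UpperHalfPlane.I
  have k2 := key ⟨2 * Complex.I, by simp⟩
  have r1 := congrArg Complex.re k1
  have i1 := congrArg Complex.im k1
  have r2 := congrArg Complex.re k2
  have i2 := congrArg Complex.im k2
  simp at r1 i1 r2 i2
  have hd := B.det_coe
  rw [Matrix.det_fin_two] at hd
  have hc : B 1 0 = 0 := by linarith
  have hb : B 0 1 = 0 := by linarith
  rw [hc, hb, ← i1] at hd
  rcases mul_self_eq_one_iff.mp (by linarith : B 0 0 * B 0 0 = 1) with h1 | h1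
  · left
    ext i j
    fin_cases i <;> fin_cases j <;> simp [hc, hb, h1, ← i1]
  · right
    ext i j
    fin_cases i <;> fin_cases j <;> simp [hc, hb, h1, ← i1]

theorem eq_or_neg_of_forall_smul {A B : SL(2, ℝ)} (h : ∀ z : ℍ, A • z = B • z) :
    A = B ∨ A = -B := by
  have h1 : B⁻¹ * A = 1 ∨ B⁻¹ * A = -1 := eq_one_or_of_forall_smul fun z => by
    rw [mul_smul, h, inv_smul_smul]
  have h2 : A = B * (B⁻¹ * A) := by group
  rcases h1 with h1 | h1
  · left; rw [h2, h1, mul_one]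
  · right; rw [h2, h1, mul_neg, mul_one]

theorem isPreconnected_im_pos : IsPreconnected {t : ℂ | 0 < t.im} :=
  (convex_halfSpace_im_gt 0).isPreconnected

theorem isOpen_im_pos : IsOpen {t : ℂ | 0 < t.im} :=
  isOpen_lt continuous_const Complex.continuous_im

/-- Two holomorphic lifts to `ℍ` of the same map to the curve differ by an element of `Γ`. -/
theorem exists_smul_eq_of_global_lifts {F F' : ℍ → ℍ}
    (hF : ∀ z : ℍ, DifferentiableAt ℂ (fun t : ℂ => (F (UpperHalfPlane.ofComplex t) : ℂ)) z)
    (hF' : ∀ z : ℍ, DifferentiableAt ℂ (fun t : ℂ => (F' (UpperHalfPlane.ofComplex t) : ℂ)) z)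
    (h : ∀ z, toCurve Γ (F z) = toCurve Γ (F' z)) (hell : ∃ z, ell Γ (F' z) = 1) :
    ∃ γ ∈ Γ, ∀ z, F z = γ • F' z := by
  obtain ⟨z₀, hz₀⟩ := hell
  have han : ∀ H : ℍ → ℍ,
      (∀ z : ℍ, DifferentiableAt ℂ (fun t : ℂ => (H (UpperHalfPlane.ofComplex t) : ℂ)) z) →
      ∀ t : ℂ, t ∈ {t : ℂ | 0 < t.im} →
        AnalyticAt ℂ (fun t : ℂ => (H (UpperHalfPlane.ofComplex t) : ℂ)) t := by
    intro H hH t ht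
    rw [← coe_ofComplex ht, Complex.analyticAt_iff_eventually_differentiableAt,
      eventually_nhds_coe_iff]
    exact Filter.Eventually.of_forall hH
  obtain ⟨γ, hγ, h1⟩ := exists_smul_eq_of_lifts (Γ := Γ) isOpen_im_pos isPreconnected_im_pos
    (han F hF) (han F' hF') (fun t _ => UpperHalfPlane.im_pos _) (fun t _ => UpperHalfPlane.im_pos _)
    (fun t _ => by rw [UpperHalfPlane.ofComplex_apply, UpperHalfPlane.ofComplex_apply]; exact h _)
    z₀.im_pos (by simpa only [UpperHalfPlane.ofComplex_apply] using hz₀)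
  exact ⟨γ, hγ, fun z => by simpa only [UpperHalfPlane.ofComplex_apply] using h1 z z.im_pos⟩

/-- If the Möbius transformation `A` lifts a self-map of the curve, then it conjugates `Γ` into
`Γ`. -/
theorem IsLevel.exists_conj (hΓ : IsLevel p Γ) {u : Curve Γ → Curve Γ} {A : SL(2, ℝ)}
    (h : ∀ z : ℍ, u (toCurve Γ z) = toCurve Γ (A • z)) {γ : SL(2, ℤ)} (hγ : γ ∈ Γ) :
    ∃ δ ∈ Γ, toReal δ = A * toReal γ * A⁻¹ := by
  obtain ⟨z₁, -, hz₁⟩ := exists_ell_eq_one (Γ := Γ) isOpen_univ (z₀ := UpperHalfPlane.I) trivial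
  obtain ⟨δ, hδ, h1⟩ := exists_smul_eq_of_global_lifts (Γ := Γ)
    (F := fun z => (A * toReal γ) • z) (F' := fun z => A • z)
    (fun z => differentiableAt_smul_real _ z) (fun z => differentiableAt_smul_real _ z)
    (fun z => by
      rw [mul_smul, ← h, ← h, toReal_smul, toCurve_smul hγ]) ⟨A⁻¹ • z₁, by
      rwa [smul_inv_smul]⟩
  have h2 : A * toReal γ = toReal δ * A ∨ A * toReal γ = -(toReal δ * A) :=
    eq_or_neg_of_forall_smul fun z => by rw [h1, mul_smul]; rfl
  rcases h2 with h2 | h2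
  · exact ⟨δ, hδ, by rw [h2, mul_inv_cancel_right]⟩
  · refine ⟨-δ, ?_, ?_⟩
    · have := Γ.mul_mem hΓ.neg_one_mem hδ
      rwa [neg_mul, one_mul] at this
    · rw [toReal_neg, h2, neg_mul, mul_inv_cancel_right]

/-- Matrices in `SL(2, ℝ)` that normalize `Γ` are integral. As all cusps of `Γ` have the same width,
such a matrix is, up to `SL(2, ℤ)`, a translation. -/
theorem IsLevel.exists_toReal_eq (hΓ : IsLevel p Γ) (hp : p.Prime) {A : SL(2, ℝ)}
    (h₁ : ∀ γ ∈ Γ, ∃ δ ∈ Γ, toReal δ = A * toReal γ * A⁻¹)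
    (h₂ : ∀ γ ∈ Γ, ∃ δ ∈ Γ, toReal δ = A⁻¹ * toReal γ * A) : ∃ g : SL(2, ℤ), A = toReal g := by
  have hp0 : (p : ℝ) ≠ 0 := by exact_mod_cast hp.ne_zero
  have hTe : ∀ k : ℤ, ((toReal (ModularGroup.T ^ k) : SL(2, ℝ)) : Matrix (Fin 2) (Fin 2) ℝ)
      = !![1, (k : ℝ); 0, 1] := by
    intro k
    ext i j
    rw [toReal_apply, ModularGroup.coe_T_zpow]
    fin_cases i <;> fin_cases j <;> simp
  have hTp : ∀ g : SL(2, ℤ), g * ModularGroup.T ^ (p : ℤ) * g⁻¹ ∈ Γ := fun g =>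
    hΓ.conj_T_mem g dvd_rfl
  have hTp1 : ModularGroup.T ^ (p : ℤ) ∈ Γ := by simpa using hTp 1
  -- `A` maps the cusp `∞` to a cusp
  obtain ⟨g', hg'⟩ : ∃ g' : SL(2, ℤ), ((toReal g')⁻¹ * A) 1 0 = 0 := by
    by_cases hc : A 1 0 = 0
    · exact ⟨1, by simpa using hc⟩
    obtain ⟨δ, -, hδ⟩ := h₁ _ hTp1
    have e := congrArg (fun M : SL(2, ℝ) => (M : Matrix (Fin 2) (Fin 2) ℝ)) hδ
    simp only [Matrix.SpecialLinearGroup.coe_mul, hTe, Matrix.SpecialLinearGroup.coe_inv,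
      Matrix.adjugate_fin_two] at e
    have e10 := congrFun (congrFun e 1) 0
    have e11 := congrFun (congrFun e 1) 1
    simp [Matrix.mul_apply, Fin.sum_univ_two] at e10 e11
    have hd := A.det_coe
    rw [Matrix.det_fin_two] at hd
    set q : ℚ := ((δ 1 1 - 1 : ℤ) : ℚ) / ((-δ 1 0 : ℤ) : ℚ) with hq
    have hqA : (q : ℝ) * A 1 0 = A 0 0 := by
      rw [hq]
      push_cast
      rw [e10, e11]
      field_simp
      linear_combination -hd
    have hcop : IsCoprime q.num (q.den : ℤ) := Int.isCoprime_iff_gcd_eq_one.mpr q.reduced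
    obtain ⟨g', hg0, hg1⟩ := hcop.exists_SL2_col 0
    refine ⟨g', ?_⟩
    rw [Matrix.SpecialLinearGroup.coe_mul, Matrix.SpecialLinearGroup.coe_inv,
      Matrix.adjugate_fin_two]
    simp [Matrix.mul_apply, Fin.sum_univ_two, hg0, hg1]
    have hqd : (q : ℝ) * q.den = q.num := by exact_mod_cast Rat.mul_den_eq_num q
    rw [← hqA, ← hqd]
    ring
  set B := (toReal g')⁻¹ * A with hB
  have hAB : A = toReal g' * B := by rw [hB, mul_inv_cancel_left]
  set e := B 0 0 with he
  set b := B 0 1 with hb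
  have hdet := B.det_coe
  rw [Matrix.det_fin_two, hg', mul_zero, sub_zero] at hdet
  set e' := B 1 1 with he'
  have hBe : (B : Matrix (Fin 2) (Fin 2) ℝ) = !![e, b; 0, e'] := by
    ext i j
    fin_cases i <;> fin_cases j <;> simp [he, hb, he', hg']
  have hdet' : e * e' = 1 := hdet
  -- comparison of the widths of the cusps `∞` and `A • ∞`
  obtain ⟨k₁, hk₁⟩ : ∃ k : ℤ, (k : ℝ) = e ^ 2 := by
    obtain ⟨δ, hδΓ, hδ⟩ := h₁ _ hTp1
    have h3 : toReal (g'⁻¹ * δ * g') = B * toReal (ModularGroup.T ^ (p : ℤ)) * B⁻¹ := by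
      rw [map_mul, map_mul, map_inv, hδ, hAB]
      group
    have e1 := congrArg (fun M : SL(2, ℝ) => (M : Matrix (Fin 2) (Fin 2) ℝ)) h3
    simp only [Matrix.SpecialLinearGroup.coe_mul B, Matrix.SpecialLinearGroup.coe_mul (B * _), hTe,
      Matrix.SpecialLinearGroup.coe_inv B, Matrix.adjugate_fin_two, hBe] at e1
    set M := g'⁻¹ * δ * g' with hM
    have m00 := congrFun (congrFun e1 0) 0
    have m01 := congrFun (congrFun e1 0) 1
    have m10 := congrFun (congrFun e1 1) 0
    have m11 := congrFun (congrFun e1 1) 1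
    rw [toReal_apply] at m00 m01 m10 m11
    simp [Matrix.mul_apply, Fin.sum_univ_two] at m00 m01 m10 m11
    rw [hdet'] at m00
    rw [mul_comm, hdet'] at m11
    have hMT : M = ModularGroup.T ^ (M 0 1) := by
      ext i j
      rw [ModularGroup.coe_T_zpow]
      fin_cases i <;> fin_cases j
      · simpa using (by exact_mod_cast m00 : M 0 0 = 1)
      · simp
      · simpa using m10
      · simpa using (by exact_mod_cast m11 : M 1 1 = 1)
    have hdvd : (p : ℤ) ∣ M 0 1 := by
      apply hΓ.width g'
      rw [← hMT, hM]
      have : g' * (g'⁻¹ * δ * g') * g'⁻¹ = δ := by group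
      rwa [this]
    obtain ⟨k, hk⟩ := hdvd
    refine ⟨k, mul_left_cancel₀ hp0 ?_⟩
    have hk' : (M 0 1 : ℝ) = p * k := by rw [hk]; push_cast; ring
    rw [← hk', m01]
    ring
  obtain ⟨k₂, hk₂⟩ : ∃ k : ℤ, (k : ℝ) = e' ^ 2 := by
    obtain ⟨δ, hδΓ, hδ⟩ := h₂ _ (hTp g')
    have h3 : toReal δ = B⁻¹ * toReal (ModularGroup.T ^ (p : ℤ)) * B := by
      rw [hδ, map_mul, map_mul, map_inv, hAB]
      group
    have e1 := congrArg (fun M : SL(2, ℝ) => (M : Matrix (Fin 2) (Fin 2) ℝ)) h3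
    simp only [Matrix.SpecialLinearGroup.coe_mul B⁻¹, Matrix.SpecialLinearGroup.coe_mul (B⁻¹ * _),
      hTe, Matrix.SpecialLinearGroup.coe_inv B, Matrix.adjugate_fin_two, hBe] at e1
    have m00 := congrFun (congrFun e1 0) 0
    have m01 := congrFun (congrFun e1 0) 1
    have m10 := congrFun (congrFun e1 1) 0
    have m11 := congrFun (congrFun e1 1) 1
    rw [toReal_apply] at m00 m01 m10 m11
    simp [Matrix.mul_apply, Fin.sum_univ_two] at m00 m01 m10 m11
    rw [mul_comm, hdet'] at m00
    rw [hdet'] at m11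
    have hMT : δ = ModularGroup.T ^ (δ 0 1) := by
      ext i j
      rw [ModularGroup.coe_T_zpow]
      fin_cases i <;> fin_cases j
      · simpa using (by exact_mod_cast m00 : δ 0 0 = 1)
      · simp
      · simpa using m10
      · simpa using (by exact_mod_cast m11 : δ 1 1 = 1)
    have hdvd : (p : ℤ) ∣ δ 0 1 := by
      apply hΓ.width 1
      rw [← hMT]
      simpa using hδΓ
    obtain ⟨k, hk⟩ := hdvd
    refine ⟨k, mul_left_cancel₀ hp0 ?_⟩
    have hk' : (δ 0 1 : ℝ) = p * k := by rw [hk]; push_cast; ring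
    rw [← hk', m01]
    ring
  have he2 : e ^ 2 = 1 := by
    have h3 : (k₁ : ℝ) * k₂ = 1 := by
      rw [hk₁, hk₂, ← mul_pow, hdet', one_pow]
    have h4 : k₁ * k₂ = 1 := by exact_mod_cast h3
    have h5 : 0 ≤ k₁ := by
      have : (0 : ℝ) ≤ k₁ := by rw [hk₁]; positivity
      exact_mod_cast this
    have h6 : k₁ = 1 := by
      rcases Int.isUnit_iff.mp (IsUnit.of_mul_eq_one _ h4) with h | h
      · exact h
      · omega
    rw [← hk₁, h6, Int.cast_one]
  have hee : e' = e := by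
    have h3 : e * (e' - e) = 0 := by linear_combination hdet' - he2
    have h4 : e ≠ 0 := fun h => by rw [h] at he2; norm_num at he2
    exact sub_eq_zero.mp ((mul_eq_zero.mp h3).resolve_left h4)
  -- the translation part is integral
  obtain ⟨m, hm⟩ : ∃ m : ℤ, (m : ℝ) = e * b := by
    have hL : ModularGroup.S * ModularGroup.T ^ (-p : ℤ) * ModularGroup.S⁻¹ ∈ Γ :=
      hΓ.conj_T_mem _ (dvd_neg.mpr dvd_rfl)
    set L : SL(2, ℤ) := ModularGroup.S * ModularGroup.T ^ (-p : ℤ) * ModularGroup.S⁻¹ with hLdef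
    have hLe : ((toReal L : SL(2, ℝ)) : Matrix (Fin 2) (Fin 2) ℝ) = !![1, 0; (p : ℝ), 1] := by
      have hS : ((toReal ModularGroup.S : SL(2, ℝ)) : Matrix (Fin 2) (Fin 2) ℝ) = !![0, -1; 1, 0] := by
        ext i j
        rw [toReal_apply]
        fin_cases i <;> fin_cases j <;> simp [ModularGroup.S]
      rw [hLdef, map_mul, map_mul, map_inv, Matrix.SpecialLinearGroup.coe_mul,
        Matrix.SpecialLinearGroup.coe_mul, hTe, Matrix.SpecialLinearGroup.coe_inv, hS,
        Matrix.adjugate_fin_two]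
      ext i j
      fin_cases i <;> fin_cases j <;> simp [Matrix.mul_apply, Fin.sum_univ_two]
    obtain ⟨δ, hδΓ, hδ⟩ := h₁ _ hL
    have h3 : toReal (g'⁻¹ * δ * g') = B * toReal L * B⁻¹ := by
      rw [map_mul, map_mul, map_inv, hδ, hAB]
      group
    have e1 := congrArg (fun M : SL(2, ℝ) => (M : Matrix (Fin 2) (Fin 2) ℝ)) h3
    simp only [Matrix.SpecialLinearGroup.coe_mul B, Matrix.SpecialLinearGroup.coe_mul (B * _), hLe,
      Matrix.SpecialLinearGroup.coe_inv B, Matrix.adjugate_fin_two, hBe, hee] at e1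
    set M := g'⁻¹ * δ * g' with hM
    have m00 := congrFun (congrFun e1 0) 0
    have m01 := congrFun (congrFun e1 0) 1
    rw [toReal_apply] at m00 m01
    simp [Matrix.mul_apply, Fin.sum_univ_two] at m00 m01
    have h4 : ((M 0 0 - 1 : ℤ) : ℝ) = p * (e * b) := by
      push_cast
      linear_combination m00 + he2
    have h5 : ((-M 0 1 : ℤ) : ℝ) = p * (e * b) ^ 2 := by
      push_cast
      linear_combination -m01 - p * b ^ 2 * he2
    have h6 : (M 0 0 - 1) ^ 2 = p * -M 0 1 := by
      have : (((M 0 0 - 1) ^ 2 : ℤ) : ℝ) = ((p * -M 0 1 : ℤ) : ℝ) := by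
        rw [Int.cast_pow, h4, Int.cast_mul, h5]
        push_cast
        ring
      exact_mod_cast this
    have h7 : (p : ℤ) ∣ M 0 0 - 1 :=
      (Nat.prime_iff_prime_int.mp hp).dvd_of_dvd_pow (n := 2) ⟨_, h6⟩
    obtain ⟨m, hm⟩ := h7
    refine ⟨m, mul_left_cancel₀ hp0 ?_⟩
    rw [← h4, hm]
    push_cast
    ring
  have hBT : B = toReal (ModularGroup.T ^ m) ∨ B = -toReal (ModularGroup.T ^ m) := by
    rcases sq_eq_one_iff.mp he2 with h | h
    · left
      apply Subtype.ext
      rw [hBe, hTe, hm, hee, h, one_mul]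
    · right
      apply Subtype.ext
      change (B : Matrix (Fin 2) (Fin 2) ℝ) = -((toReal (ModularGroup.T ^ m) : SL(2, ℝ)) :
        Matrix (Fin 2) (Fin 2) ℝ)
      rw [hBe, hTe, hm, hee, h]
      ext i j
      fin_cases i <;> fin_cases j <;> simp
  rcases hBT with h | h
  · exact ⟨g' * ModularGroup.T ^ m, by rw [hAB, h, map_mul]⟩
  · exact ⟨-(g' * ModularGroup.T ^ m), by rw [hAB, h, toReal_neg, map_mul, mul_neg]⟩

theorem exists_toCurve_of_preservesCusps {u : Aut Γ} (hu : PreservesCusps u) (z : ℍ) :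
    ∃ w : ℍ, u.1 (toCurve Γ z) = toCurve Γ w := by
  have h1 : u.1 (toCurve Γ z) ∉ cusps Γ := by
    rw [← hu]
    rintro ⟨y, hy, hyz⟩
    rw [u.1.injective hyz] at hy
    exact toCurve_notMem_cusps z hy
  generalize u.1 (toCurve Γ z) = x at h1
  induction x using Curve.cases with
  | h1 w => exact ⟨w, rfl⟩
  | h2 g => exact absurd (proj_smul_infty_mem_cusps Γ g) h1

theorem PreservesCusps.inv {u : Aut Γ} (hu : PreservesCusps u) : PreservesCusps u⁻¹ := by
  have h : u.1.symm '' cusps Γ = cusps Γ := by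
    conv_lhs => rw [← (show u.1 '' cusps Γ = cusps Γ from hu)]
    rw [← Set.image_comp]
    simp
  exact h

theorem inv_apply_eq (u : Aut Γ) {x y : Curve Γ} : u⁻¹.1 x = y ↔ u.1 y = x := by
  change u.1.symm x = y ↔ _
  rw [Homeomorph.symm_apply_eq]
  exact eq_comm

/-- The automorphism `u` preserves the orders of the stabilizers. -/
def PreservesOrders (u : Aut Γ) : Prop :=
  ∀ z w : ℍ, u.1 (toCurve Γ z) = toCurve Γ w → ell Γ w = ell Γ z

theorem PreservesOrders.inv {u : Aut Γ} (hu : PreservesOrders u) : PreservesOrders u⁻¹ :=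
  fun z w h => (hu w z ((inv_apply_eq u).mp h)).symm

/-- An automorphism that preserves the cusps and the orders of the stabilizers is induced by an
element of `SL(2, ℤ)` that normalizes `Γ`: it lifts to `ℍ`. -/
theorem IsLevel.exists_of_preservesOrders (hΓ : IsLevel p Γ) (hp : p.Prime) {u : Aut Γ}
    (hc : PreservesCusps u) (ho : PreservesOrders u) : ∃ g : SL(2, ℤ),
      (∀ z : ℍ, u.1 (toCurve Γ z) = toCurve Γ (g • z)) ∧ ∀ γ, γ ∈ Γ ↔ g * γ * g⁻¹ ∈ Γ := by
  have hloc : ∀ v : Aut Γ, PreservesCusps v → PreservesOrders v → ∃ F : ℍ → ℍ,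
      (∀ z, v.1 (toCurve Γ z) = toCurve Γ (F z)) ∧
      ∀ z : ℍ, DifferentiableAt ℂ (fun t : ℂ => (F (UpperHalfPlane.ofComplex t) : ℂ)) z := by
    intro v hv hvo
    refine exists_global_lift (fun z => ?_) fun z w h h1 => by rw [hvo z w h, h1]
    obtain ⟨w, hw⟩ := exists_toCurve_of_preservesCusps hv z
    obtain ⟨f, hf, -⟩ := exists_isLiftAt v hw (by rw [hvo z w hw])
    exact ⟨f, hf⟩
  obtain ⟨F, hF, hFd⟩ := hloc u hc ho
  obtain ⟨F', hF', hFd'⟩ := hloc u⁻¹ hc.inv ho.inv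
  obtain ⟨z₁, -, hz₁⟩ := exists_ell_eq_one (Γ := Γ) isOpen_univ (z₀ := UpperHalfPlane.I) trivial
  obtain ⟨γ, hγ, h1⟩ := exists_smul_eq_of_global_lifts (Γ := Γ) (F := fun z => F' (F z))
    (F' := fun z => z) (fun z => by
      have := DifferentiableAt.comp (g := fun t : ℂ => (F' (UpperHalfPlane.ofComplex t) : ℂ)) (z : ℂ)
        (hFd' (F (UpperHalfPlane.ofComplex (z : ℂ)))) (hFd z)
      refine this.congr_of_eventuallyEq (Filter.Eventually.of_forall fun t => ?_)
      simp) (fun z => by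
      refine differentiableAt_id.congr_of_eventuallyEq ?_
      filter_upwards [eventually_im_pos z] with t ht
      rw [coe_ofComplex ht]; rfl)
    (fun z => by
      rw [← hF', inv_apply_eq, hF]) ⟨z₁, hz₁⟩
  obtain ⟨A, hA⟩ := exists_moebius (F := F) (F' := fun z => γ⁻¹ • F' z) hFd (fun z => by
      have := DifferentiableAt.comp
        (g := fun t : ℂ => ((γ⁻¹ • UpperHalfPlane.ofComplex t : ℍ) : ℂ)) (z : ℂ)
        (hasDerivAt_smul γ⁻¹ (F' (UpperHalfPlane.ofComplex (z : ℂ)))).differentiableAt (hFd' z)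
      refine this.congr_of_eventuallyEq (Filter.Eventually.of_forall fun t => ?_)
      simp only [Function.comp, UpperHalfPlane.ofComplex_apply])
    (fun z => by
      rw [h1, inv_smul_smul])
  have hA1 : ∀ z : ℍ, u.1 (toCurve Γ z) = toCurve Γ (A • z) := fun z => by rw [hF, hA]
  have hA2 : ∀ z : ℍ, u⁻¹.1 (toCurve Γ z) = toCurve Γ (A⁻¹ • z) := fun z => by
    rw [inv_apply_eq, hA1, smul_inv_smul]
  have c1 := fun γ (hγ : γ ∈ Γ) => hΓ.exists_conj hA1 hγ
  have c2 := fun γ (hγ : γ ∈ Γ) => hΓ.exists_conj hA2 hγ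
  simp only [inv_inv] at c2
  obtain ⟨g, rfl⟩ := hΓ.exists_toReal_eq hp c1 c2
  refine ⟨g, hA1, fun γ => ⟨fun hγ => ?_, fun hγ => ?_⟩⟩
  · obtain ⟨δ, hδ, h⟩ := c1 γ hγ
    rw [← map_inv, ← map_mul, ← map_mul] at h
    rwa [← toReal_injective h]
  · obtain ⟨δ, hδ, h⟩ := c2 _ hγ
    rw [← map_inv, ← map_mul, ← map_mul] at h
    have h3 := toReal_injective h
    have : g⁻¹ * (g * γ * g⁻¹) * g = γ := by group
    rw [this] at h3
    rwa [← h3]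

end Normalizer

/-! ### Reduction modulo `p` -/

section Reduction

variable {p : ℕ}

/-- Reduction modulo `p` of integral matrices. -/
abbrev redHom (p : ℕ) : SL(2, ℤ) →* SL(2, ZMod p) :=
  Matrix.SpecialLinearGroup.map (Int.castRingHom (ZMod p))

/-- The reduction modulo `p` of an element of `SL(2, ℤ)`, as a matrix. -/
def red (p : ℕ) (g : SL(2, ℤ)) : Matrix (Fin 2) (Fin 2) (ZMod p) := (redHom p g).1

theorem red_apply (g : SL(2, ℤ)) (i j : Fin 2) : red p g i j = (g i j : ZMod p) := rfl

theorem red_mul (g h : SL(2, ℤ)) : red p (g * h) = red p g * red p h := by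
  rw [red, map_mul]; rfl

theorem red_one : red p 1 = 1 := by rw [red, map_one]; rfl

theorem red_neg (g : SL(2, ℤ)) : red p (-g) = -red p g := by
  ext i j
  simp [red_apply]

theorem red_mul_red_inv (g : SL(2, ℤ)) : red p g * red p g⁻¹ = 1 := by
  rw [← red_mul, mul_inv_cancel, red_one]

theorem red_inv_mul_red (g : SL(2, ℤ)) : red p g⁻¹ * red p g = 1 := by
  rw [← red_mul, inv_mul_cancel, red_one]

theorem det_red (g : SL(2, ℤ)) : (red p g).det = 1 := (redHom p g).2

theorem red_T_zpow (k : ℤ) : red p (ModularGroup.T ^ k) = !![1, (k : ZMod p); 0, 1] := by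
  ext i j
  rw [red_apply, ModularGroup.coe_T_zpow]
  fin_cases i <;> fin_cases j <;> simp

theorem red_S : red p ModularGroup.S = !![0, -1; 1, 0] := by
  ext i j
  rw [red_apply]
  fin_cases i <;> fin_cases j <;> simp [ModularGroup.S]

theorem red_S_inv : red p ModularGroup.S⁻¹ = !![0, 1; -1, 0] := by
  have : ModularGroup.S⁻¹ = -ModularGroup.S := by decide
  rw [this, red_neg, red_S]
  ext i j
  fin_cases i <;> fin_cases j <;> simp

/-- `SL(2, ℤ) → SL(2, 𝔽_p)` is surjective. -/
theorem exists_red_eq [Fact p.Prime] (M : Matrix (Fin 2) (Fin 2) (ZMod p)) (hM : M.det = 1) :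
    ∃ g : SL(2, ℤ), red p g = M := by
  have hlow : ∀ k : ZMod p, ∃ g : SL(2, ℤ), red p g = !![1, 0; k, 1] := by
    intro k
    obtain ⟨k, rfl⟩ := ZMod.intCast_surjective k
    refine ⟨ModularGroup.S * ModularGroup.T ^ (-k) * ModularGroup.S⁻¹, ?_⟩
    rw [red_mul, red_mul, red_T_zpow, red_S, red_S_inv]
    ext i j
    fin_cases i <;> fin_cases j <;> simp [Matrix.mul_apply, Fin.sum_univ_two]
  have hup : ∀ k : ZMod p, ∃ g : SL(2, ℤ), red p g = !![1, k; 0, 1] := by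
    intro k
    obtain ⟨k, rfl⟩ := ZMod.intCast_surjective k
    exact ⟨_, red_T_zpow k⟩
  -- a matrix whose lower left entry is nonzero is a product of three elementary matrices
  have key : ∀ M : Matrix (Fin 2) (Fin 2) (ZMod p), M.det = 1 → M 1 0 ≠ 0 →
      ∃ g : SL(2, ℤ), red p g = M := by
    intro M hM hz
    obtain ⟨g₁, h₁⟩ := hup ((M 0 0 - 1) / M 1 0)
    obtain ⟨g₂, h₂⟩ := hlow (M 1 0)
    obtain ⟨g₃, h₃⟩ := hup ((M 1 1 - 1) / M 1 0)
    refine ⟨g₁ * g₂ * g₃, ?_⟩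
    rw [red_mul, red_mul, h₁, h₂, h₃]
    rw [Matrix.det_fin_two] at hM
    ext i j
    fin_cases i <;> fin_cases j <;> simp [Matrix.mul_apply, Fin.sum_univ_two]
    · field_simp; ring
    · field_simp; linear_combination hM
    · field_simp; ring
  by_cases hz : M 1 0 = 0
  · rw [Matrix.det_fin_two, hz, mul_zero, sub_zero] at hM
    have h0 : M 0 0 ≠ 0 := fun h => by rw [h, zero_mul] at hM; exact zero_ne_one hM
    obtain ⟨g, hg⟩ := key (!![1, 0; 1, 1] * M) (by
        rw [Matrix.det_mul, Matrix.det_fin_two_of, Matrix.det_fin_two, hz]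
        linear_combination hM) (by
        simpa [Matrix.mul_apply, Fin.sum_univ_two, hz] using h0)
    obtain ⟨h, hh⟩ := hlow (-1)
    refine ⟨h * g, ?_⟩
    rw [red_mul, hg, hh, ← Matrix.mul_assoc]
    ext i j
    fin_cases i <;> fin_cases j <;> simp [Matrix.mul_apply, Fin.sum_univ_two]
  · exact key M hM hz

theorem mem_congruenceGroup_iff (H : Subgroup (GL (Fin 2) (ZMod p))) (γ : SL(2, ℤ)) :
    γ ∈ congruenceGroup H ↔ Matrix.SpecialLinearGroup.toGL (redHom p γ) ∈ H := Iff.rfl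

theorem coe_toGL_redHom (γ : SL(2, ℤ)) :
    ((Matrix.SpecialLinearGroup.toGL (redHom p γ) : GL (Fin 2) (ZMod p)) :
      Matrix (Fin 2) (Fin 2) (ZMod p)) = red p γ := rfl

theorem red_eq_one_of_mem_Gamma {γ : SL(2, ℤ)} (h : γ ∈ CongruenceSubgroup.Gamma p) :
    redHom p γ = 1 := h

end Reduction

/-! ### Non-split Cartan subgroups -/

section Cartan

variable {p : ℕ} [Fact p.Prime] {C : Subgroup (GL (Fin 2) (ZMod p))}

/-- Conjugates of nonscalar elements of a field of matrices have no invariant line. -/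
theorem conj_one_zero_ne_zero {K : Subalgebra (ZMod p) (Matrix (Fin 2) (Fin 2) (ZMod p))}
    (hK : IsField K) {β : Matrix (Fin 2) (Fin 2) (ZMod p)} (hβ : β ∈ K)
    (hns : ∀ c : ZMod p, β ≠ Matrix.scalar (Fin 2) c) {P Q : Matrix (Fin 2) (Fin 2) (ZMod p)}
    (hPQ : P * Q = 1) : (P * β * Q) 1 0 ≠ 0 := by
  intro h
  have hQP : Q * P = 1 := mul_eq_one_comm.mp hPQ
  set N := P * β * Q with hN
  have hsc : ∀ c : ZMod p, Matrix.scalar (Fin 2) c ∈ K := fun c => by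
    have := K.algebraMap_mem c
    rwa [Matrix.algebraMap_eq_diagonal] at this
  have hprod : (β - Matrix.scalar (Fin 2) (N 0 0)) * (β - Matrix.scalar (Fin 2) (N 1 1)) = 0 := by
    have h1 : (N - Matrix.scalar (Fin 2) (N 0 0)) * (N - Matrix.scalar (Fin 2) (N 1 1)) = 0 := by
      ext i j
      fin_cases i <;> fin_cases j <;> simp [Matrix.mul_apply, Fin.sum_univ_two, h]
    have h2 : ∀ c, P * (β - Matrix.scalar (Fin 2) c) * Q = N - Matrix.scalar (Fin 2) c := by
      intro c
      rw [mul_sub, sub_mul, ← hN]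
      congr 1
      rw [← (Matrix.scalar_commute c (Commute.all c) P).eq, mul_assoc, hPQ, mul_one]
    have h3 : P * ((β - Matrix.scalar (Fin 2) (N 0 0)) * (β - Matrix.scalar (Fin 2) (N 1 1))) * Q
        = 0 := by
      rw [← h1, ← h2, ← h2]
      simp only [mul_assoc]
      rw [← mul_assoc Q P, hQP, one_mul]
    calc _ = Q * (P * ((β - Matrix.scalar (Fin 2) (N 0 0)) *
          (β - Matrix.scalar (Fin 2) (N 1 1))) * Q) * P := by
          simp only [mul_assoc]
          rw [hQP, mul_one, ← mul_assoc Q P, hQP, one_mul]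
      _ = 0 := by rw [h3, mul_zero, zero_mul]
  have hdom : IsDomain K := hK.isDomain
  have := mul_eq_zero.mp (show (⟨_, K.sub_mem hβ (hsc (N 0 0))⟩ : K) *
    ⟨_, K.sub_mem hβ (hsc (N 1 1))⟩ = 0 from Subtype.ext hprod)
  rcases this with h' | h'
  · exact hns _ (sub_eq_zero.mp (Subtype.ext_iff.mp h'))
  · exact hns _ (sub_eq_zero.mp (Subtype.ext_iff.mp h'))

/-- The commutant of a nonscalar matrix consists of its linear polynomials. -/
theorem exists_eq_of_commute {β M : Matrix (Fin 2) (Fin 2) (ZMod p)} (hβ : β 1 0 ≠ 0)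
    (h : M * β = β * M) : ∃ s t : ZMod p, M = Matrix.scalar (Fin 2) s + t • β := by
  have h10 := congrFun (congrFun h 1) 0
  have h11 := congrFun (congrFun h 1) 1
  simp only [Matrix.mul_apply, Fin.sum_univ_two] at h10 h11
  refine ⟨M 0 0 - M 1 0 / β 1 0 * β 0 0, M 1 0 / β 1 0, ?_⟩
  ext i j
  fin_cases i <;> fin_cases j <;> simp
  · field_simp; linear_combination -h11
  · field_simp
  · field_simp; linear_combination h10

/-- The field of matrices defining a non-split Cartan subgroup is the commutant of any of its
nonscalar elements `β`. -/
theorem IsNonsplitCartan.exists_generator (hC : IsNonsplitCartan C) :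
    ∃ K : Subalgebra (ZMod p) (Matrix (Fin 2) (Fin 2) (ZMod p)), IsField K ∧
      ∃ β ∈ K, (∀ c : ZMod p, β ≠ Matrix.scalar (Fin 2) c) ∧
      (∀ M, M ∈ K ↔ M * β = β * M) ∧
      ∀ g : GL (Fin 2) (ZMod p), g ∈ C ↔ (g : Matrix (Fin 2) (Fin 2) (ZMod p)) ∈ K := by
  obtain ⟨K, hK, hdim, hmem⟩ := hC
  have hsc : ∀ c : ZMod p, Matrix.scalar (Fin 2) c ∈ K := fun c => by
    have := K.algebraMap_mem c
    rwa [Matrix.algebraMap_eq_diagonal] at this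
  obtain ⟨β, hβ, hns⟩ : ∃ β ∈ K, ∀ c : ZMod p, β ≠ Matrix.scalar (Fin 2) c := by
    by_contra! hc
    have h1 : Module.finrank (ZMod p) K ≤ 1 := by
      refine finrank_le_one (⟨1, K.one_mem⟩ : K) fun w => ?_
      obtain ⟨c, hcw⟩ := hc w w.2
      refine ⟨c, Subtype.ext ?_⟩
      rw [hcw]
      ext i j
      fin_cases i <;> fin_cases j <;> simp
    omega
  have h10 : β 1 0 ≠ 0 := by
    have := conj_one_zero_ne_zero hK hβ hns (mul_one (1 : Matrix (Fin 2) (Fin 2) (ZMod p)))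
    rwa [one_mul, mul_one] at this
  refine ⟨K, hK, β, hβ, hns, fun M => ⟨fun hM => ?_, fun hM => ?_⟩, hmem⟩
  · exact Subtype.ext_iff.mp (hK.mul_comm ⟨M, hM⟩ ⟨β, hβ⟩)
  · obtain ⟨s, t, rfl⟩ := exists_eq_of_commute h10 hM
    exact K.add_mem (hsc s) (K.smul_mem hβ t)

theorem gamma_le_congruenceGroup (H : Subgroup (GL (Fin 2) (ZMod p))) :
    CongruenceSubgroup.Gamma p ≤ congruenceGroup H := by
  intro γ hγ
  rw [mem_congruenceGroup_iff, red_eq_one_of_mem_Gamma hγ, map_one]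
  exact H.one_mem

/-- Conjugation moves a commutation relation. -/
theorem conj_comm_iff (g κ : SL(2, ℤ)) (β : Matrix (Fin 2) (Fin 2) (ZMod p)) (ε : ZMod p) :
    red p (g * κ * g⁻¹) * β = ε • (β * red p (g * κ * g⁻¹)) ↔
      red p κ * (red p g⁻¹ * β * red p g) = ε • ((red p g⁻¹ * β * red p g) * red p κ) := by
  have h1 := red_mul_red_inv (p := p) g
  have h2 := red_inv_mul_red (p := p) g
  rw [red_mul, red_mul]
  generalize red p g = P at *
  generalize red p g⁻¹ = Q at *
  generalize red p κ = k
  constructor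
  · intro h
    have h3 := congrArg (fun M => Q * M * P) h
    simp only [Matrix.mul_smul, Matrix.smul_mul] at h3
    calc k * (Q * β * P) = (Q * P) * k * (Q * β * P) := by rw [h2, one_mul]
      _ = Q * (P * k * Q * β) * P := by simp only [mul_assoc]
      _ = ε • (Q * (β * (P * k * Q)) * P) := h3
      _ = ε • ((Q * β * P) * k * (Q * P)) := by simp only [mul_assoc]
      _ = _ := by rw [h2, mul_one]
  · intro h
    have h3 := congrArg (fun M => P * M * Q) h
    simp only [Matrix.mul_smul, Matrix.smul_mul] at h3
    calc P * k * Q * β = P * k * Q * β * (P * Q) := by rw [h1, mul_one]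
      _ = P * (k * (Q * β * P)) * Q := by simp only [mul_assoc]
      _ = ε • (P * (Q * β * P * k) * Q) := h3
      _ = ε • ((P * Q) * (β * (P * k * Q))) := by simp only [mul_assoc]
      _ = _ := by rw [h1, one_mul]

/-- The cusps have width `p`: a nontrivial unipotent matrix would fix an invariant line of a
conjugate of `β`. -/
theorem IsNonsplitCartan.isLevel (hC : IsNonsplitCartan C) : IsLevel p (GammaNs C) := by
  obtain ⟨K, hK, β, hβ, hns, hcomm, hmem⟩ := hC.exists_generator
  have hΓ : ∀ γ, γ ∈ GammaNs C ↔ red p γ * β = (1 : ZMod p) • (β * red p γ) := fun γ => by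
    rw [mem_congruenceGroup_iff, hmem, hcomm, coe_toGL_redHom, one_smul]
  refine ⟨(Fact.out : p.Prime).pos, ?_, gamma_le_congruenceGroup C, fun g k h => ?_⟩
  · rw [hΓ, red_neg, red_one]; simp
  · rw [hΓ, conj_comm_iff, one_smul] at h
    have h10 := conj_one_zero_ne_zero hK hβ hns (red_inv_mul_red (p := p) g)
    generalize red p g⁻¹ * β * red p g = B at *
    rw [red_T_zpow] at h
    have h00 := congrFun (congrFun h 0) 0
    simp [Matrix.mul_apply, Fin.sum_univ_two] at h00
    exact (ZMod.intCast_zmod_eq_zero_iff_dvd k p).mp (h00.resolve_right h10)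

/-- For odd `p`, a non-split Cartan subgroup is the centralizer of a matrix `α` of trace `0` whose
square is a scalar `δ` that is not a square; its normalizer consists of the invertible matrices
which commute or anticommute with `α`. -/
structure IsGenerator (C : Subgroup (GL (Fin 2) (ZMod p))) (α : Matrix (Fin 2) (Fin 2) (ZMod p))
    (δ : ZMod p) : Prop where
  trace : α 1 1 = -α 0 0
  sq : α 0 0 ^ 2 + α 0 1 * α 1 0 = δ
  nonsquare : ¬ IsSquare δ
  mem_iff : ∀ γ, γ ∈ GammaNs C ↔ red p γ * α = α * red p γ
  mem_plus_iff : ∀ γ, γ ∈ GammaNsPlus C ↔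
    red p γ * α = α * red p γ ∨ red p γ * α = -(α * red p γ)

theorem two_ne_zero_of_ne (hp : p ≠ 2) : (2 : ZMod p) ≠ 0 := by
  have hp2 := (Fact.out : p.Prime).two_le
  intro h
  have : ((2 : ℕ) : ZMod p) = 0 := by exact_mod_cast h
  rw [ZMod.natCast_eq_zero_iff] at this
  exact hp (le_antisymm (Nat.le_of_dvd two_pos this) hp2)

theorem mul_self_of_trace {α : Matrix (Fin 2) (Fin 2) (ZMod p)} {δ : ZMod p}
    (htr : α 1 1 = -α 0 0) (hsq : α 0 0 ^ 2 + α 0 1 * α 1 0 = δ) : α * α = δ • 1 := by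
  ext i j
  fin_cases i <;> fin_cases j <;> simp [Matrix.mul_apply, Fin.sum_univ_two, htr]
  · linear_combination hsq
  · ring
  · ring
  · linear_combination hsq

/-- The generator `α` is the trace zero part of a nonscalar element of the field. -/
theorem IsNonsplitCartan.exists_isGenerator (hC : IsNonsplitCartan C) (hp : p ≠ 2) :
    ∃ α δ, IsGenerator C α δ := by
  have h2 := two_ne_zero_of_ne hp
  obtain ⟨K, hK, β, hβ, hns, hcomm, hmem⟩ := hC.exists_generator
  have hsc : ∀ c : ZMod p, Matrix.scalar (Fin 2) c ∈ K := fun c => by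
    have := K.algebraMap_mem c
    rwa [Matrix.algebraMap_eq_diagonal] at this
  set α := β - Matrix.scalar (Fin 2) ((β 0 0 + β 1 1) / 2) with hα
  have hαK : α ∈ K := K.sub_mem hβ (hsc _)
  have hαns : ∀ c : ZMod p, α ≠ Matrix.scalar (Fin 2) c := fun c hc =>
    hns (c + (β 0 0 + β 1 1) / 2) (by rw [map_add, ← hc, hα]; abel)
  have htr : α 1 1 = -α 0 0 := by
    simp [hα]
    field_simp
    ring
  have hcommα : ∀ M, M ∈ K ↔ M * α = α * M := by
    intro M
    rw [hcomm, hα, mul_sub, sub_mul, (Matrix.scalar_commute _ (Commute.all _) M).eq]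
    exact sub_left_inj.symm
  set δ := α 0 0 ^ 2 + α 0 1 * α 1 0 with hδ
  have hαα : α * α = δ • 1 := mul_self_of_trace htr rfl
  have h10 : α 1 0 ≠ 0 := by
    have := conj_one_zero_ne_zero hK hαK hαns (mul_one (1 : Matrix (Fin 2) (Fin 2) (ZMod p)))
    rwa [one_mul, mul_one] at this
  have hnsq : ¬ IsSquare δ := by
    rintro ⟨c, hc⟩
    have hdom : IsDomain K := hK.isDomain
    have hprod : (α - Matrix.scalar (Fin 2) c) * (α - Matrix.scalar (Fin 2) (-c)) = 0 := by
      have h1 : (α - Matrix.scalar (Fin 2) c) * (α - Matrix.scalar (Fin 2) (-c))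
          = α * α - (c * c) • 1 := by
        ext i j
        fin_cases i <;> fin_cases j <;> simp [Matrix.mul_apply, Fin.sum_univ_two] <;> ring
      rw [h1, hαα, hc, sub_self]
    rcases mul_eq_zero.mp (show (⟨_, K.sub_mem hαK (hsc c)⟩ : K) *
      ⟨_, K.sub_mem hαK (hsc (-c))⟩ = 0 from Subtype.ext hprod) with h' | h'
    · exact hαns _ (sub_eq_zero.mp (Subtype.ext_iff.mp h'))
    · exact hαns _ (sub_eq_zero.mp (Subtype.ext_iff.mp h'))
  have hδ0 : δ ≠ 0 := fun h => hnsq (h ▸ IsSquare.zero)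
  have hgC : ∀ g : GL (Fin 2) (ZMod p), g ∈ C ↔ (g : Matrix (Fin 2) (Fin 2) (ZMod p)) * α = α * g :=
    fun g => by rw [hmem, hcommα]
  refine ⟨α, δ, htr, rfl, hnsq, fun γ => by rw [mem_congruenceGroup_iff, hgC, coe_toGL_redHom],
    fun γ => ?_⟩
  rw [mem_congruenceGroup_iff, ← coe_toGL_redHom]
  generalize Matrix.SpecialLinearGroup.toGL (redHom p γ) = g
  rw [Subgroup.mem_normalizer_iff]
  have hgg : (g : Matrix (Fin 2) (Fin 2) (ZMod p)) * (g⁻¹ : GL (Fin 2) (ZMod p)) = 1 := by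
    rw [← Units.val_mul, mul_inv_cancel, Units.val_one]
  have hgg' : ((g⁻¹ : GL (Fin 2) (ZMod p)) : Matrix (Fin 2) (Fin 2) (ZMod p)) * g = 1 := by
    rw [← Units.val_mul, inv_mul_cancel, Units.val_one]
  constructor
  · intro h
    -- `α` itself is an element of `C`
    have hα1 : α * (δ⁻¹ • α) = 1 := by
      rw [Matrix.mul_smul, hαα, smul_smul, inv_mul_cancel₀ hδ0, one_smul]
    have hα2 : (δ⁻¹ • α) * α = 1 := by
      rw [Matrix.smul_mul, hαα, smul_smul, inv_mul_cancel₀ hδ0, one_smul]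
    set a : GL (Fin 2) (ZMod p) := ⟨α, δ⁻¹ • α, hα1, hα2⟩ with ha
    have h1 : g * a * g⁻¹ ∈ C := (h a).mp ((hgC a).mpr rfl)
    rw [hgC, Units.val_mul, Units.val_mul] at h1
    obtain ⟨s, t, hst⟩ := exists_eq_of_commute h10 h1
    have hst : (g : Matrix (Fin 2) (Fin 2) (ZMod p)) * α * (g⁻¹ : GL (Fin 2) (ZMod p))
      = Matrix.scalar (Fin 2) s + t • α := hst
    have htrace : Matrix.trace ((g : Matrix (Fin 2) (Fin 2) (ZMod p)) * α *
        ((g⁻¹ : GL (Fin 2) (ZMod p)) : Matrix (Fin 2) (Fin 2) (ZMod p))) = 0 := by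
      rw [Matrix.trace_mul_comm, ← mul_assoc, hgg', one_mul, Matrix.trace_fin_two, htr]
      ring
    have hs : s = 0 := by
      rw [hst, Matrix.trace_fin_two] at htrace
      simp [htr] at htrace
      have : 2 * s = 0 := by linear_combination htrace
      exact (mul_eq_zero.mp this).resolve_left h2
    rw [hs, map_zero, zero_add] at hst
    have hga : (g : Matrix (Fin 2) (Fin 2) (ZMod p)) * α
        = t • (α * (g : Matrix (Fin 2) (Fin 2) (ZMod p))) := by
      calc (g : Matrix (Fin 2) (Fin 2) (ZMod p)) * α
          = g * α * ((g⁻¹ : GL (Fin 2) (ZMod p)) * g) := by rw [hgg', mul_one]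
        _ = g * α * (g⁻¹ : GL (Fin 2) (ZMod p)) * g := by simp only [mul_assoc]
        _ = t • (α * (g : Matrix (Fin 2) (Fin 2) (ZMod p))) := by rw [hst, Matrix.smul_mul]
    have ht : t ^ 2 = 1 := by
      have h3 : (g : Matrix (Fin 2) (Fin 2) (ZMod p)) * α * (g⁻¹ : GL (Fin 2) (ZMod p)) *
          ((g : Matrix (Fin 2) (Fin 2) (ZMod p)) * α * (g⁻¹ : GL (Fin 2) (ZMod p))) = δ • 1 := by
        calc _ = (g : Matrix (Fin 2) (Fin 2) (ZMod p)) * α * ((g⁻¹ : GL (Fin 2) (ZMod p)) * g) * α *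
            (g⁻¹ : GL (Fin 2) (ZMod p)) := by simp only [mul_assoc]
          _ = g * (α * α) * (g⁻¹ : GL (Fin 2) (ZMod p)) := by
            rw [hgg', mul_one]; simp only [mul_assoc]
          _ = δ • 1 := by rw [hαα, Matrix.mul_smul, mul_one, Matrix.smul_mul, hgg]
      rw [hst, Matrix.smul_mul, Matrix.mul_smul, hαα] at h3
      have h4 := congrFun (congrFun h3 0) 0
      simp at h4
      have h5 : δ * (t ^ 2 - 1) = 0 := by linear_combination h4
      exact sub_eq_zero.mp ((mul_eq_zero.mp h5).resolve_left hδ0)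
    rcases sq_eq_one_iff.mp ht with h | h
    · left; rw [hga, h, one_smul]
    · right; rw [hga, h, neg_smul, one_smul]
  · intro h k
    have hε : ∃ ε : ZMod p, ε * ε = 1 ∧
        (g : Matrix (Fin 2) (Fin 2) (ZMod p)) * α = ε • (α * g) := by
      rcases h with h | h
      · exact ⟨1, one_mul 1, by rw [h, one_smul]⟩
      · exact ⟨-1, by ring, by rw [h, neg_smul, one_smul]⟩
    obtain ⟨ε, hεε, hg⟩ := hε
    have hg' : α * g = ε • ((g : Matrix (Fin 2) (Fin 2) (ZMod p)) * α) := by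
      rw [hg, smul_smul, hεε, one_smul]
    have hgi : ((g⁻¹ : GL (Fin 2) (ZMod p)) : Matrix (Fin 2) (Fin 2) (ZMod p)) * α
        = ε • (α * (g⁻¹ : GL (Fin 2) (ZMod p))) := by
      calc ((g⁻¹ : GL (Fin 2) (ZMod p)) : Matrix (Fin 2) (Fin 2) (ZMod p)) * α
          = (g⁻¹ : GL (Fin 2) (ZMod p)) * (α * g) * (g⁻¹ : GL (Fin 2) (ZMod p)) := by
            rw [mul_assoc, mul_assoc, hgg, mul_one]
        _ = ε • (((g⁻¹ : GL (Fin 2) (ZMod p)) * g) * α * (g⁻¹ : GL (Fin 2) (ZMod p))) := by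
            rw [hg', Matrix.mul_smul, Matrix.smul_mul]; simp only [mul_assoc]
        _ = _ := by rw [hgg', one_mul]
    rw [hgC, hgC, Units.val_mul, Units.val_mul]
    generalize (k : Matrix (Fin 2) (Fin 2) (ZMod p)) = M
    generalize ((g⁻¹ : GL (Fin 2) (ZMod p)) : Matrix (Fin 2) (Fin 2) (ZMod p)) = Q at *
    generalize (g : Matrix (Fin 2) (Fin 2) (ZMod p)) = P at *
    have e1 : P * M * Q * α = ε • (P * (M * α) * Q) := by
      rw [mul_assoc, hgi, Matrix.mul_smul]; simp only [mul_assoc]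
    have e2 : α * (P * M * Q) = ε • (P * (α * M) * Q) := by
      rw [← mul_assoc, ← mul_assoc, hg', Matrix.smul_mul, Matrix.smul_mul]; simp only [mul_assoc]
    rw [e1, e2]
    constructor
    · intro hM; rw [hM]
    · intro hM
      have h3 := congrArg (fun N => ε • (Q * N * P)) hM
      simp only [Matrix.mul_smul, Matrix.smul_mul, smul_smul, hεε, one_smul] at h3
      calc M * α = (Q * P) * (M * α) * (Q * P) := by rw [hgg', one_mul, mul_one]
        _ = Q * (P * (M * α) * Q) * P := by simp only [mul_assoc]
        _ = Q * (P * (α * M) * Q) * P := h3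
        _ = (Q * P) * (α * M) * (Q * P) := by simp only [mul_assoc]
        _ = α * M := by rw [hgg', one_mul, mul_one]

end Cartan

/-! ### Conjugates of the generator of a Cartan algebra -/

section CartanGroups

variable {p : ℕ}

/-- The conjugate of the matrix `α` by the reduction of `g⁻¹`. -/
def conjRed (α : Matrix (Fin 2) (Fin 2) (ZMod p)) (g : SL(2, ℤ)) : Matrix (Fin 2) (Fin 2) (ZMod p) :=
  red p g⁻¹ * α * red p g

variable [Fact p.Prime] {C : Subgroup (GL (Fin 2) (ZMod p))}
  {α : Matrix (Fin 2) (Fin 2) (ZMod p)} {δ : ZMod p}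

theorem IsGenerator.conj_trace (h : IsGenerator C α δ) (g : SL(2, ℤ)) :
    conjRed α g 1 1 = -conjRed α g 0 0 := by
  have h1 : Matrix.trace (conjRed α g) = 0 := by
    rw [conjRed, Matrix.trace_mul_comm, ← mul_assoc, red_mul_red_inv, one_mul,
      Matrix.trace_fin_two, h.trace]
    ring
  rw [Matrix.trace_fin_two] at h1
  linear_combination h1

theorem IsGenerator.conj_sq (h : IsGenerator C α δ) (g : SL(2, ℤ)) :
    conjRed α g 0 0 ^ 2 + conjRed α g 0 1 * conjRed α g 1 0 = δ := by
  have h1 : (conjRed α g).det = α.det := by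
    rw [conjRed, Matrix.det_mul, Matrix.det_mul, det_red, det_red, one_mul, mul_one]
  rw [Matrix.det_fin_two, Matrix.det_fin_two, h.conj_trace, h.trace] at h1
  linear_combination -h1 + h.sq

theorem IsGenerator.ne_zero (h : IsGenerator C α δ) : δ ≠ 0 := fun h0 =>
  h.nonsquare (h0 ▸ IsSquare.zero)

theorem IsGenerator.conj_one_zero (h : IsGenerator C α δ) (g : SL(2, ℤ)) :
    conjRed α g 1 0 ≠ 0 := fun h0 => h.nonsquare ⟨conjRed α g 0 0, by
  rw [← h.conj_sq g, h0]; ring⟩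

theorem IsGenerator.one_zero (h : IsGenerator C α δ) : α 1 0 ≠ 0 := fun h0 =>
  h.nonsquare ⟨α 0 0, by rw [← h.sq, h0]; ring⟩

theorem IsGenerator.zero_one (h : IsGenerator C α δ) : α 0 1 ≠ 0 := fun h0 =>
  h.nonsquare ⟨α 0 0, by rw [← h.sq, h0]; ring⟩

theorem IsGenerator.mul_self (h : IsGenerator C α δ) : α * α = δ • 1 :=
  mul_self_of_trace h.trace h.sq

theorem IsGenerator.le (h : IsGenerator C α δ) : GammaNs C ≤ GammaNsPlus C := fun γ hγ =>
  (h.mem_plus_iff γ).mpr (Or.inl ((h.mem_iff γ).mp hγ))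

theorem IsGenerator.conj_mem_iff (h : IsGenerator C α δ) (g κ : SL(2, ℤ)) :
    g * κ * g⁻¹ ∈ GammaNs C ↔ red p κ * conjRed α g = conjRed α g * red p κ := by
  rw [h.mem_iff]
  have := conj_comm_iff g κ α (1 : ZMod p)
  rwa [one_smul, one_smul] at this

theorem IsGenerator.conj_mem_plus_iff (h : IsGenerator C α δ) (g κ : SL(2, ℤ)) :
    g * κ * g⁻¹ ∈ GammaNsPlus C ↔ red p κ * conjRed α g = conjRed α g * red p κ ∨
      red p κ * conjRed α g = -(conjRed α g * red p κ) := by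
  rw [h.mem_plus_iff]
  have h1 := conj_comm_iff g κ α (1 : ZMod p)
  have h2 := conj_comm_iff g κ α (-1 : ZMod p)
  rw [one_smul, one_smul] at h1
  rw [neg_smul, neg_smul, one_smul, one_smul] at h2
  exact or_congr h1 h2

theorem IsGenerator.isLevel_plus (h : IsGenerator C α δ) (hp : p ≠ 2) :
    IsLevel p (GammaNsPlus C) := by
  refine ⟨(Fact.out : p.Prime).pos, ?_, gamma_le_congruenceGroup _, fun g k hk => ?_⟩
  · refine (h.mem_plus_iff _).mpr (Or.inl ?_)
    rw [red_neg, red_one]; simp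
  · rw [h.conj_mem_plus_iff] at hk
    have h10 := h.conj_one_zero g
    generalize conjRed α g = B at *
    rw [red_T_zpow] at hk
    rcases hk with hk | hk
    · have h00 := congrFun (congrFun hk 0) 0
      simp [Matrix.mul_apply, Fin.sum_univ_two] at h00
      exact (ZMod.intCast_zmod_eq_zero_iff_dvd k p).mp (h00.resolve_right h10)
    · exfalso
      have h3 := congrFun (congrFun hk 1) 0
      simp [Matrix.mul_apply, Fin.sum_univ_two] at h3
      have h4 : 2 * B 1 0 = 0 := by linear_combination h3
      exact (mul_ne_zero (two_ne_zero_of_ne hp) h10) h4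

/-- The group `Γ_ns(p)` contains elements whose reduction is not scalar and has nonzero trace. -/
theorem IsGenerator.exists_mem (h : IsGenerator C α δ) (hp : 5 ≤ p) : ∃ γ ∈ GammaNs C, ∃ x y : ZMod p,
    x ≠ 0 ∧ y ≠ 0 ∧ red p γ = Matrix.scalar (Fin 2) x + y • α := by
  have h2 : (2 : ZMod p) ≠ 0 := two_ne_zero_of_ne (by omega)
  have h3 : (3 : ZMod p) ≠ 0 := by
    intro h
    have : ((3 : ℕ) : ZMod p) = 0 := by exact_mod_cast h
    rw [ZMod.natCast_eq_zero_iff] at this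
    have := Nat.le_of_dvd three_pos this
    omega
  obtain ⟨m, hm, hmx⟩ : ∃ m : ZMod p, m ≠ 0 ∧ 1 + δ * m ^ 2 ≠ 0 := by
    by_cases h1 : 1 + δ * 1 ^ 2 = 0
    · refine ⟨2, h2, fun h4 => h3 ?_⟩
      linear_combination 4 * h1 - h4
    · exact ⟨1, one_ne_zero, h1⟩
  have hd : 1 - δ * m ^ 2 ≠ 0 := by
    intro h0
    refine h.nonsquare ⟨m⁻¹, ?_⟩
    field_simp
    linear_combination -h0
  set x := (1 + δ * m ^ 2) / (1 - δ * m ^ 2) with hx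
  set y := 2 * m / (1 - δ * m ^ 2) with hy
  have hxy : x ^ 2 - δ * y ^ 2 = 1 := by rw [hx, hy]; field_simp; ring
  obtain ⟨γ, hγ⟩ := exists_red_eq (Matrix.scalar (Fin 2) x + y • α) (by
    rw [Matrix.det_fin_two]
    simp [h.trace]
    linear_combination hxy - y ^ 2 * h.sq)
  refine ⟨γ, ?_, x, y, div_ne_zero hmx hd, div_ne_zero (mul_ne_zero h2 hm) hd, hγ⟩
  rw [h.mem_iff, hγ, add_mul, mul_add, (Matrix.scalar_commute x (Commute.all x) α).eq,
    Matrix.smul_mul, Matrix.mul_smul]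

/-- The conjugates of `α` determine the cosets of the Cartan groups. -/
theorem IsGenerator.mem_iff_conjRed (h : IsGenerator C α δ) (g : SL(2, ℤ)) :
    g ∈ GammaNs C ↔ conjRed α g = α := by
  rw [h.mem_iff, conjRed]
  constructor
  · intro hg
    rw [mul_assoc, ← hg, ← mul_assoc, red_inv_mul_red, one_mul]
  · intro hg
    calc red p g * α = red p g * (red p g⁻¹ * α * red p g) := by rw [hg]
      _ = (red p g * red p g⁻¹) * (α * red p g) := by simp only [mul_assoc]
      _ = α * red p g := by rw [red_mul_red_inv, one_mul]

theorem IsGenerator.mem_plus_iff_conjRed (h : IsGenerator C α δ) (g : SL(2, ℤ)) :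
    g ∈ GammaNsPlus C ↔ conjRed α g = α ∨ conjRed α g = -α := by
  rw [h.mem_plus_iff, ← h.mem_iff, h.mem_iff_conjRed]
  refine or_congr_right ?_
  rw [conjRed]
  constructor
  · intro hg
    have hg' : α * red p g = -(red p g * α) := by rw [hg, neg_neg]
    rw [mul_assoc, hg', mul_neg, ← mul_assoc, red_inv_mul_red, one_mul]
  · intro hg
    rw [eq_neg_iff_add_eq_zero] at hg ⊢
    calc red p g * α + α * red p g = red p g * α + (red p g * red p g⁻¹) * (α * red p g) := by
          rw [red_mul_red_inv, one_mul]
      _ = red p g * (red p g⁻¹ * α * red p g + α) := by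
          rw [mul_add, add_comm]; simp only [mul_assoc]
      _ = 0 := by rw [hg, mul_zero]

theorem conjRed_mul (α : Matrix (Fin 2) (Fin 2) (ZMod p)) (g h : SL(2, ℤ)) :
    conjRed α (g * h) = red p h⁻¹ * conjRed α g * red p h := by
  rw [conjRed, conjRed, mul_inv_rev, red_mul, red_mul]
  simp only [mul_assoc]

theorem conjRed_neg (A : Matrix (Fin 2) (Fin 2) (ZMod p)) (g : SL(2, ℤ)) :
    conjRed (-A) g = -conjRed A g := by
  rw [conjRed, conjRed, mul_neg, neg_mul]

theorem conjRed_eq_iff (A B : Matrix (Fin 2) (Fin 2) (ZMod p)) (g h : SL(2, ℤ)) :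
    conjRed A g = conjRed B h ↔ conjRed A (g * h⁻¹) = B := by
  rw [conjRed_mul, inv_inv, conjRed, conjRed]
  have h1 := red_mul_red_inv (p := p) h
  have h2 := red_inv_mul_red (p := p) h
  generalize red p g⁻¹ * A * red p g = M
  constructor
  · intro hM
    rw [hM]
    calc _ = (red p h * red p h⁻¹) * B * (red p h * red p h⁻¹) := by simp only [mul_assoc]
      _ = B := by rw [h1, one_mul, mul_one]
  · rintro rfl
    calc M = (red p h⁻¹ * red p h) * M * (red p h⁻¹ * red p h) := by rw [h2, one_mul, mul_one]
      _ = _ := by simp only [mul_assoc]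

/-- If `g` conjugates an element of `Γ_ns(p)` with nonscalar reduction of nonzero trace into
`Γ_ns⁺(p)`, then `g` belongs to `Γ_ns⁺(p)`. -/
theorem IsGenerator.mem_plus_of_conj (h : IsGenerator C α δ) (hp : 5 ≤ p) {g : SL(2, ℤ)}
    (hg : ∀ γ ∈ GammaNs C, g * γ * g⁻¹ ∈ GammaNsPlus C) : g ∈ GammaNsPlus C := by
  have h2 : (2 : ZMod p) ≠ 0 := two_ne_zero_of_ne (by omega)
  obtain ⟨γ, hγ, x, y, hx, hy, hxy⟩ := h.exists_mem hp
  have h1 := (h.conj_mem_plus_iff g γ).mp (hg γ hγ)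
  rw [h.mem_plus_iff_conjRed]
  have hBt := h.conj_trace g
  have hBs := h.conj_sq g
  have hs := h.sq
  have ht := h.trace
  have ha := h.one_zero
  generalize conjRed α g = B at *
  rw [hxy] at h1
  have e : ∀ i j, (Matrix.scalar (Fin 2) x + y • α) i j = (if i = j then x else 0) + y * α i j := by
    intro i j
    fin_cases i <;> fin_cases j <;> simp
  have hcomm : α * B = B * α := by
    rcases h1 with h1 | h1
    · rw [add_mul, mul_add, (Matrix.scalar_commute x (Commute.all x) B).eq, Matrix.smul_mul,
        Matrix.mul_smul] at h1
      exact smul_right_injective _ hy (add_left_cancel h1)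
    · exfalso
      -- the anticommutator of `α` and `B` is scalar
      have h01 := congrFun (congrFun h1 0) 1
      have h10 := congrFun (congrFun h1 1) 0
      have h00 := congrFun (congrFun h1 0) 0
      have h11 := congrFun (congrFun h1 1) 1
      simp only [Matrix.mul_apply, Fin.sum_univ_two, Matrix.neg_apply, e, hBt, ht] at h01 h10 h00 h11
      simp at h01 h10 h00 h11
      have hB10 : B 1 0 = 0 := by
        have : (2 * x) * B 1 0 = 0 := by linear_combination h10
        exact (mul_eq_zero.mp this).resolve_left (mul_ne_zero h2 hx)
      refine h.nonsquare ⟨B 0 0, ?_⟩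
      rw [← hBs, hB10]; ring
  obtain ⟨s, t, hst⟩ := exists_eq_of_commute ha hcomm.symm
  have hs0 : s = 0 := by
    have h00 := congrFun (congrFun hst 0) 0
    have h11 := congrFun (congrFun hst 1) 1
    simp at h00 h11
    have : 2 * s = 0 := by linear_combination -h00 - h11 + hBt - t * ht
    exact (mul_eq_zero.mp this).resolve_left h2
  rw [hs0, map_zero, zero_add] at hst
  have ht1 : t ^ 2 = 1 := by
    rw [hst] at hBs
    simp at hBs
    have : δ * (t ^ 2 - 1) = 0 := by linear_combination hBs - t ^ 2 * hs
    exact sub_eq_zero.mp ((mul_eq_zero.mp this).resolve_left h.ne_zero)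
  rcases sq_eq_one_iff.mp ht1 with h' | h'
  · left; rw [hst, h', one_smul]
  · right; rw [hst, h', neg_smul, one_smul]

/-- Elements of `Γ_ns⁺(p)` normalize `Γ_ns(p)`. -/
theorem IsGenerator.conj_mem_iff_of_mem_plus (h : IsGenerator C α δ) {g : SL(2, ℤ)}
    (hg : g ∈ GammaNsPlus C) (γ : SL(2, ℤ)) : γ ∈ GammaNs C ↔ g * γ * g⁻¹ ∈ GammaNs C := by
  rw [h.conj_mem_iff, h.mem_iff]
  rcases (h.mem_plus_iff_conjRed g).mp hg with h1 | h1
  · rw [h1]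
  · rw [h1, mul_neg, neg_mul, neg_inj]

/-- `Γ_ns(p)` has index at most `2` in `Γ_ns⁺(p)`. -/
theorem IsGenerator.mul_inv_mem (h : IsGenerator C α δ) {g g' : SL(2, ℤ)}
    (hg : g ∈ GammaNsPlus C) (hg' : g' ∈ GammaNsPlus C) (hn : g ∉ GammaNs C) (hn' : g' ∉ GammaNs C) :
    g * g'⁻¹ ∈ GammaNs C := by
  rw [h.mem_iff_conjRed] at hn hn' ⊢
  rw [← conjRed_eq_iff, ((h.mem_plus_iff_conjRed g).mp hg).resolve_left hn,
    ((h.mem_plus_iff_conjRed g').mp hg').resolve_left hn']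

/-- The norm form of the quadratic extension is surjective, so the nontrivial coset of the
normalizer contains matrices of determinant `1`. -/
theorem exists_sq_sub_mul_sq_eq (hp : p ≠ 2) (hδ : δ ≠ 0) (c : ZMod p) :
    ∃ s t : ZMod p, s ^ 2 - δ * t ^ 2 = c := by
  have hf : (Polynomial.X ^ 2 - Polynomial.C c : Polynomial (ZMod p)).degree = 2 :=
    Polynomial.degree_X_pow_sub_C two_pos _
  have hg : (Polynomial.C (-δ) * Polynomial.X ^ 2 : Polynomial (ZMod p)).degree = 2 :=
    Polynomial.degree_C_mul_X_pow 2 (neg_ne_zero.mpr hδ)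
  obtain ⟨s, t, hst⟩ := FiniteField.exists_root_sum_quadratic hf hg (by
    rw [ZMod.card]
    exact (Nat.Prime.odd_of_ne_two Fact.out hp |> Nat.odd_iff.mp))
  refine ⟨s, t, ?_⟩
  simp only [Polynomial.eval_sub, Polynomial.eval_pow, Polynomial.eval_X, Polynomial.eval_C,
    Polynomial.eval_mul] at hst
  linear_combination hst

/-- `Γ_ns⁺(p)` is strictly larger than `Γ_ns(p)`. -/
theorem IsGenerator.exists_mem_plus_notMem (h : IsGenerator C α δ) (hp : p ≠ 2) :
    ∃ g ∈ GammaNsPlus C, g ∉ GammaNs C := by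
  have h2 := two_ne_zero_of_ne hp
  have hb := h.zero_one
  have hc := h.one_zero
  obtain ⟨s, t, hst⟩ := exists_sq_sub_mul_sq_eq hp h.ne_zero (α 0 1 * α 1 0)⁻¹
  -- `!![0, b; -c, 0]` anticommutes with `α`
  set M : Matrix (Fin 2) (Fin 2) (ZMod p) :=
    !![0, α 0 1; -α 1 0, 0] * (Matrix.scalar (Fin 2) s + t • α) with hM
  have hJ : !![0, α 0 1; -α 1 0, 0] * α = -(α * !![0, α 0 1; -α 1 0, 0]) := by
    ext i j
    fin_cases i <;> fin_cases j <;> simp [Matrix.mul_apply, Fin.sum_univ_two, h.trace] <;> ring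
  have hanti : M * α = -(α * M) := by
    have hN : (Matrix.scalar (Fin 2) s + t • α) * α = α * (Matrix.scalar (Fin 2) s + t • α) := by
      rw [add_mul, mul_add, (Matrix.scalar_commute s (Commute.all s) α).eq, Matrix.smul_mul,
        Matrix.mul_smul]
    rw [hM, mul_assoc, hN, ← mul_assoc, hJ, neg_mul, mul_assoc]
  obtain ⟨g, hg⟩ := exists_red_eq M (by
    have h1 : (Matrix.scalar (Fin 2) s + t • α).det = s ^ 2 - δ * t ^ 2 := by
      rw [Matrix.det_fin_two]
      simp [h.trace]
      linear_combination -t ^ 2 * h.sq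
    rw [hM, Matrix.det_mul, h1, hst, Matrix.det_fin_two_of]
    field_simp
    ring)
  refine ⟨g, (h.mem_plus_iff g).mpr (Or.inr (by rw [hg, hanti])), fun hmem => ?_⟩
  have h1 := (h.mem_iff g).mp hmem
  rw [hg, hanti] at h1
  -- `2 α M = 0`, but `α` and `M` are invertible
  have h3 : α * M = 0 := by
    have h4 : (2 : ZMod p) • (α * M) = 0 := by
      rw [two_smul]; nth_rewrite 1 [← h1]; exact neg_add_cancel _
    exact (smul_eq_zero.mp h4).resolve_left h2
  have h5 : α * α * (M * red p g⁻¹) = 0 := by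
    calc _ = α * (α * M) * red p g⁻¹ := by simp only [mul_assoc]
      _ = 0 := by rw [h3, mul_zero, zero_mul]
  rw [← hg, red_mul_red_inv, mul_one, h.mul_self] at h5
  have h6 := congrFun (congrFun h5 0) 0
  simp at h6
  exact h.ne_zero h6

end CartanGroups

/-! ### Automorphisms induced by the normalizer -/

section Induced

variable {Γ : Subgroup SL(2, ℤ)}

/-- `g` normalizes `Γ`. -/
def Normalizes (g : SL(2, ℤ)) (Γ : Subgroup SL(2, ℤ)) : Prop := ∀ γ, γ ∈ Γ ↔ g * γ * g⁻¹ ∈ Γ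

theorem Normalizes.inv {g : SL(2, ℤ)} (hg : Normalizes g Γ) : Normalizes g⁻¹ Γ := fun γ => by
  rw [hg (g⁻¹ * γ * g⁻¹⁻¹)]
  have : g * (g⁻¹ * γ * g⁻¹⁻¹) * g⁻¹ = γ := by group
  rw [this]

/-- The self-map of the curve induced by an element normalizing `Γ`. -/
def inducedFun {g : SL(2, ℤ)} (hg : Normalizes g Γ) : Curve Γ → Curve Γ :=
  Quotient.map (fun x : ExtendedPlane => g • x) (by
    intro x y hxy
    have h1 := proj_eq_iff.mp (Quotient.sound hxy : proj Γ x = proj Γ y)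
    obtain ⟨γ, hγ, rfl⟩ := h1
    refine Quotient.exact (proj_eq_iff.mpr ⟨g * γ * g⁻¹, (hg γ).mp hγ, ?_⟩ :
      proj Γ (g • γ • y) = proj Γ (g • y))
    rw [mul_smul, mul_smul, inv_smul_smul])

theorem inducedFun_proj {g : SL(2, ℤ)} (hg : Normalizes g Γ) (x : ExtendedPlane) :
    inducedFun hg (proj Γ x) = proj Γ (g • x) := rfl

theorem continuous_inducedFun {g : SL(2, ℤ)} (hg : Normalizes g Γ) : Continuous (inducedFun hg) :=
  continuous_quot_lift _ (continuous_proj.comp (ExtendedPlane.continuous_smul g))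

theorem exists_proj_eq (x : Curve Γ) : ∃ y, proj Γ y = x := Quotient.exists_rep x

theorem isHolomorphicMap_inducedFun {g : SL(2, ℤ)} (hg : Normalizes g Γ) :
    IsHolomorphicMap (inducedFun hg) := by
  refine ⟨continuous_inducedFun hg, fun V F hV hF => ?_⟩
  have hV' := hV.preimage (continuous_inducedFun hg)
  rw [holomorphicOn_iff hV] at hF
  refine (holomorphicOn_iff hV').mpr ⟨hF.1.comp (continuous_inducedFun hg).continuousOn fun x hx => hx,
    fun z hz => ?_⟩
  have h1 : pullback (F ∘ inducedFun hg)
      = fun t => pullback F ((g • UpperHalfPlane.ofComplex t : ℍ) : ℂ) := by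
    ext t
    rw [pullback_coe]
    rfl
  rw [h1]
  refine DifferentiableAt.comp (g := pullback F) (z : ℂ) ?_ (hasDerivAt_smul g z).differentiableAt
  rw [UpperHalfPlane.ofComplex_apply]
  exact hF.2 _ hz

/-- The automorphism of the curve induced by an element normalizing `Γ`. -/
def inducedAut {g : SL(2, ℤ)} (hg : Normalizes g Γ) : Aut Γ :=
  ⟨{ toFun := inducedFun hg
     invFun := inducedFun hg.inv
     left_inv := fun x => by
       obtain ⟨y, rfl⟩ := exists_proj_eq x
       rw [inducedFun_proj, inducedFun_proj, inv_smul_smul]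
     right_inv := fun x => by
       obtain ⟨y, rfl⟩ := exists_proj_eq x
       rw [inducedFun_proj, inducedFun_proj, smul_inv_smul]
     continuous_toFun := continuous_inducedFun hg
     continuous_invFun := continuous_inducedFun hg.inv },
    isHolomorphicMap_inducedFun hg, isHolomorphicMap_inducedFun hg.inv⟩

theorem inducedAut_proj {g : SL(2, ℤ)} (hg : Normalizes g Γ) (x : ExtendedPlane) :
    (inducedAut hg).1 (proj Γ x) = proj Γ (g • x) := rfl

theorem inducedAut_toCurve {g : SL(2, ℤ)} (hg : Normalizes g Γ) (z : ℍ) :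
    (inducedAut hg).1 (toCurve Γ z) = toCurve Γ (g • z) := rfl

/-- The image of `ℍ` is dense, so automorphisms may be compared there. -/
theorem aut_ext {u v : Aut Γ} (h : ∀ z, u.1 (toCurve Γ z) = v.1 (toCurve Γ z)) : u = v := by
  apply Subtype.ext
  apply Homeomorph.ext
  intro x
  exact congrFun (DenseRange.equalizer (dense_range_toCurve Γ) u.1.continuous v.1.continuous
    (funext h)) x

theorem preservesCusps_inducedAut {g : SL(2, ℤ)} (hg : Normalizes g Γ) :
    PreservesCusps (inducedAut hg) := by
  have key : ∀ {k : SL(2, ℤ)} (hk : Normalizes k Γ), ∀ x ∈ cusps Γ, inducedFun hk x ∈ cusps Γ := by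
    rintro k hk _ ⟨s, rfl⟩
    exact ⟨Matrix.SpecialLinearGroup.mapGL ℚ k • s, rfl⟩
  apply Set.Subset.antisymm
  · rintro _ ⟨x, hx, rfl⟩
    exact key hg x hx
  · intro x hx
    exact ⟨_, key hg.inv x hx, (inducedAut hg).1.apply_symm_apply x⟩

theorem preservesEllipticPoints_inducedAut {g : SL(2, ℤ)} (hg : Normalizes g Γ) :
    PreservesEllipticPoints (inducedAut hg) := by
  have key : ∀ {k : SL(2, ℤ)} (hk : Normalizes k Γ), ∀ x ∈ ellipticPoints Γ,
      inducedFun hk x ∈ ellipticPoints Γ := by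
    intro k hk x hx
    obtain ⟨z, rfl⟩ := exists_of_mem_ellipticPoints hx
    change toCurve Γ (k • z) ∈ _
    rw [toCurve_mem_ellipticPoints_iff] at hx ⊢
    rwa [ell_smul_of_normalizes hk]
  apply Set.Subset.antisymm
  · rintro _ ⟨x, hx, rfl⟩
    exact key hg x hx
  · intro x hx
    exact ⟨_, key hg.inv x hx, (inducedAut hg).1.apply_symm_apply x⟩

/-- An element of `SL(2, ℤ)` inducing the identity on the curve belongs to `Γ`. -/
theorem mem_of_forall_toCurve_eq (hneg : -1 ∈ Γ) {g : SL(2, ℤ)}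
    (h : ∀ z : ℍ, toCurve Γ (g • z) = toCurve Γ z) : g ∈ Γ := by
  obtain ⟨z₁, -, hz₁⟩ := exists_ell_eq_one (Γ := Γ) isOpen_univ (z₀ := UpperHalfPlane.I) trivial
  obtain ⟨γ, hγ, h1⟩ := exists_smul_eq_of_global_lifts (Γ := Γ) (F := fun z => g • z)
    (F' := fun z => z) (fun z => (hasDerivAt_smul g z).differentiableAt) (fun z => by
      refine differentiableAt_id.congr_of_eventuallyEq ?_
      filter_upwards [eventually_im_pos z] with t ht
      rw [coe_ofComplex ht]; rfl) h ⟨z₁, hz₁⟩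
  rcases eq_or_neg_of_forall_smul (A := toReal g) (B := toReal γ) h1 with h2 | h2
  · rwa [toReal_injective h2]
  · rw [← toReal_neg] at h2
    rw [toReal_injective h2]
    have := Γ.mul_mem hneg hγ
    rwa [neg_mul, one_mul] at this

theorem eq_one_of_mem {u : Aut Γ} {g : SL(2, ℤ)} (hg : g ∈ Γ)
    (h : ∀ z : ℍ, u.1 (toCurve Γ z) = toCurve Γ (g • z)) : u = 1 :=
  aut_ext fun z => by rw [h, toCurve_smul hg]; rfl

end Induced

/-! ### Automorphisms preserving the orders of points -/

section Rigidity

variable {p : ℕ} [Fact p.Prime] {C : Subgroup (GL (Fin 2) (ZMod p))}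
  {α : Matrix (Fin 2) (Fin 2) (ZMod p)} {δ : ZMod p}

theorem IsGenerator.normalizes (h : IsGenerator C α δ) {g : SL(2, ℤ)} (hg : g ∈ GammaNsPlus C) :
    Normalizes g (GammaNs C) := h.conj_mem_iff_of_mem_plus hg

/-- Automorphisms of `X_ns(p)` preserving cusps and stabilizer orders come from `Γ_ns⁺(p)`. -/
theorem IsGenerator.exists_mem_plus (h : IsGenerator C α δ) (hC : IsNonsplitCartan C) (hp : 5 ≤ p)
    {u : Aut (GammaNs C)} (hc : PreservesCusps u) (ho : PreservesOrders u) :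
    ∃ g ∈ GammaNsPlus C, ∀ z, u.1 (toCurve _ z) = toCurve _ (g • z) := by
  obtain ⟨g, hg, hn⟩ := hC.isLevel.exists_of_preservesOrders Fact.out hc ho
  exact ⟨g, h.mem_plus_of_conj hp fun γ hγ => h.le ((hn γ).mp hγ), hg⟩

/-- Automorphisms of `X_ns⁺(p)` preserving cusps and stabilizer orders are trivial. -/
theorem IsGenerator.eq_one_of_plus (h : IsGenerator C α δ) (hp : 5 ≤ p)
    {u : Aut (GammaNsPlus C)} (hc : PreservesCusps u) (ho : PreservesOrders u) : u = 1 := by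
  obtain ⟨g, hg, hn⟩ := (h.isLevel_plus (by omega)).exists_of_preservesOrders Fact.out hc ho
  exact eq_one_of_mem (h.mem_plus_of_conj hp fun γ hγ => (hn γ).mp (h.le hγ)) hg

/-- Any element of `Γ_ns⁺(p)` outside `Γ_ns(p)` induces the modular involution. -/
theorem IsGenerator.isModularInvolution (h : IsGenerator C α δ) {g : SL(2, ℤ)}
    (hg : g ∈ GammaNsPlus C) (hn : g ∉ GammaNs C) :
    IsModularInvolution C (inducedAut (h.normalizes hg)) := by
  refine ⟨⟨g, hg, hn⟩, fun g' hg' hn' x => ?_⟩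
  rw [inducedAut_proj]
  refine proj_eq_iff.mpr ⟨g * g'⁻¹, h.mul_inv_mem hg hg' hn hn', ?_⟩
  rw [← mul_smul, inv_mul_cancel_right]

theorem IsGenerator.inducedAut_ne_one (h : IsGenerator C α δ) (hC : IsNonsplitCartan C)
    {g : SL(2, ℤ)} (hg : g ∈ GammaNsPlus C) (hn : g ∉ GammaNs C) :
    inducedAut (h.normalizes hg) ≠ 1 := by
  intro h1
  refine hn (mem_of_forall_toCurve_eq hC.isLevel.neg_one_mem fun z => ?_)
  rw [← inducedAut_toCurve (h.normalizes hg), h1]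
  rfl

/-- Nontrivial automorphisms of `X_ns(p)` preserving cusps and stabilizer orders are equal to the
modular involution. -/
theorem IsGenerator.eq_inducedAut (h : IsGenerator C α δ) (hC : IsNonsplitCartan C) (hp : 5 ≤ p)
    {g : SL(2, ℤ)} (hg : g ∈ GammaNsPlus C) (hn : g ∉ GammaNs C) {u : Aut (GammaNs C)}
    (hc : PreservesCusps u) (ho : PreservesOrders u) (hu : u ≠ 1) :
    u = inducedAut (h.normalizes hg) := by
  obtain ⟨g', hg', hu'⟩ := h.exists_mem_plus hC hp hc ho
  have hn' : g' ∉ GammaNs C := fun hmem => hu (eq_one_of_mem hmem hu')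
  refine aut_ext fun z => ?_
  rw [hu', inducedAut_toCurve]
  refine toCurve_eq_iff.mpr ⟨g' * g⁻¹, h.mul_inv_mem hg' hg hn' hn, ?_⟩
  rw [← mul_smul, inv_mul_cancel_right]

end Rigidity

/-! ### The discriminant -/

section Discriminant

open ModularForm Asymptotics

theorem isTheta_one_of_tendsto {X : Type*} {l : Filter X} {v : X → ℂ} {c : ℂ} (hc : c ≠ 0)
    (hv : Filter.Tendsto v l (𝓝 c)) : v =Θ[l] fun _ => (1 : ℂ) :=
  ((isEquivalent_const_iff_tendsto hc).mpr hv).isTheta.trans (isTheta_const_const hc one_ne_zero)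

theorem discriminant_smul (g : SL(2, ℤ)) (z : ℍ) :
    discriminant (g • z) = aut g z ^ 12 * discriminant z := by
  have h := congrFun (SlashInvariantForm.slash_action_generators_SL2Z discriminant_S_invariant
    discriminant_T_invariant g) z
  rw [ModularForm.SL_slash_apply] at h
  have h1 : UpperHalfPlane.denom g z = aut g z := by
    simp [UpperHalfPlane.denom, aut]
  rw [h1, zpow_neg] at h
  rw [← h, mul_left_comm]
  have := aut_ne_zero g z
  field_simp

theorem analyticAt_discriminant (z : ℍ) :
    AnalyticAt ℂ (fun t : ℂ => discriminant (UpperHalfPlane.ofComplex t)) z := by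
  have h : DifferentiableOn ℂ (fun t : ℂ => discriminant (UpperHalfPlane.ofComplex t))
      {t : ℂ | 0 < t.im} := by
    have := UpperHalfPlane.mdifferentiable_iff.mp CuspForm.discriminant.holo'
    exact this
  exact h.analyticAt ((isOpen_lt continuous_const Complex.continuous_im).mem_nhds z.2)

/-- In terms of the coordinate `exp (2πiz/p)` the discriminant has a zero of order `p` at `i∞`. -/
theorem discriminant_isTheta {p : ℕ} (hp : 0 < p) :
    discriminant =Θ[UpperHalfPlane.atImInfty]
      fun z : ℍ => Function.Periodic.qParam p z ^ p := by
  have h1 : (fun z : ℍ => Function.Periodic.qParam p z ^ p)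
      = fun z : ℍ => Function.Periodic.qParam 1 z := by
    funext z
    rw [Function.Periodic.qParam, Function.Periodic.qParam, ← Complex.exp_nat_mul]
    congr 1
    have : (p : ℂ) ≠ 0 := by exact_mod_cast hp.ne'
    push_cast
    field_simp
  have h2 : discriminant = fun z : ℍ => Function.Periodic.qParam 1 z *
      ∏' n, (1 - ModularForm.eta_q n z) ^ 24 := funext discriminant_eq_q_prod
  rw [h1, h2]
  have h3 : (fun z : ℍ => ∏' n, (1 - ModularForm.eta_q n z) ^ 24)
      =Θ[UpperHalfPlane.atImInfty] fun _ => (1 : ℂ) := by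
    exact isTheta_one_of_tendsto one_ne_zero tendsto_atImInfty_tprod_one_sub_eta_q_pow
  simpa using (isTheta_refl (fun z : ℍ => Function.Periodic.qParam 1 z) _).mul h3

end Discriminant

/-! ### The sextic differential `Δ(z) dz ^ 6` -/

section DiscOver

open ModularForm Asymptotics

variable {Γ : Subgroup SL(2, ℤ)} {p : ℕ} {G : Curve Γ → ℂ} {x y : Curve Γ}

theorem deriv_pullback_smul {γ : SL(2, ℤ)} (hγ : γ ∈ Γ) {z : ℍ} (h : HolAt G (toCurve Γ z)) :
    deriv (pullback G) ((γ • z : ℍ) : ℂ) = aut γ z ^ 2 * deriv (pullback G) z := by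
  have h1 : DifferentiableAt ℂ (pullback G) ((γ • z : ℍ) : ℂ) := by
    rw [← toCurve_smul hγ] at h
    exact h.differentiableAt
  have h2 := HasDerivAt.comp_of_eq (z : ℂ) h1.hasDerivAt (hasDerivAt_smul γ z) (by simp)
  have h3 : HasDerivAt (pullback G) _ (z : ℂ) := h2.congr_of_eventuallyEq (pullback_smul G hγ z)
  rw [h3.deriv]
  have := aut_ne_zero γ z
  field_simp

open Classical in
/-- The quotient `Δ(z) dz ^ 6 / (dG) ^ 6` of sextic differentials, as a function on the curve; it
is given the value `0` at the cusps. -/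
def discOver (G : Curve Γ → ℂ) (x : Curve Γ) : ℂ :=
  if h : ∃ z : ℍ, toCurve Γ z = x then
    discriminant h.choose / deriv (pullback G) h.choose ^ 6 else 0

theorem discOver_toCurve {z : ℍ} (h : HolAt G (toCurve Γ z)) :
    discOver G (toCurve Γ z) = discriminant z / deriv (pullback G) z ^ 6 := by
  have hz : ∃ w : ℍ, toCurve Γ w = toCurve Γ z := ⟨z, rfl⟩
  rw [discOver, dif_pos hz]
  obtain ⟨γ, hγ, hw⟩ := toCurve_eq_iff.mp hz.choose_spec
  rw [← hw, discriminant_smul, deriv_pullback_smul hγ h, mul_pow, ← pow_mul]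
  have := aut_ne_zero γ z
  exact mul_div_mul_left _ _ (pow_ne_zero _ this)

theorem exists_of_discOver_ne_zero (h : HolAt G x) (h0 : discOver G x ≠ 0) :
    ∃ z : ℍ, x = toCurve Γ z ∧ deriv (pullback G) z ≠ 0 := by
  by_cases hz : ∃ z : ℍ, toCurve Γ z = x
  · obtain ⟨z, rfl⟩ := hz
    refine ⟨z, rfl, fun h1 => h0 ?_⟩
    rw [discOver_toCurve h, h1]
    simp
  · rw [discOver, dif_neg hz] at h0
    exact absurd rfl h0

theorem HolAt.discOver (h : HolAt G x) (h0 : discOver G x ≠ 0) : HolAt (discOver G) x := by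
  obtain ⟨z, rfl, hz⟩ := exists_of_discOver_ne_zero h h0
  rw [holAt_toCurve_iff] at h ⊢
  have h1 : AnalyticAt ℂ (fun t : ℂ => discriminant (UpperHalfPlane.ofComplex t) /
      deriv (pullback G) t ^ 6) z :=
    (analyticAt_discriminant z).div (h.deriv.pow 6) (pow_ne_zero _ hz)
  refine h1.congr ?_
  filter_upwards [h.eventually_analyticAt, eventually_im_pos z] with t ht him
  have h2 : HolAt G (toCurve Γ (UpperHalfPlane.ofComplex t)) := by
    rw [holAt_toCurve_iff, coe_ofComplex him]
    exact ht
  rw [pullback, discOver_toCurve h2, coe_ofComplex him]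

/-- Change of the function: composing with `k` divides `discOver` by the sixth power of the
derivative. -/
theorem discOver_congr {G' : Curve Γ → ℂ} {k : ℂ → ℂ} (hG : HolAt G x)
    (hk : DifferentiableAt ℂ k (G x)) (he : ∀ᶠ y in 𝓝 x, G' y = k (G y))
    (hG' : HolAt G' x) : discOver G' x = discOver G x / deriv k (G x) ^ 6 := by
  by_cases hz : ∃ z : ℍ, toCurve Γ z = x
  swap
  · rw [discOver, discOver, dif_neg hz, dif_neg hz, zero_div]
  obtain ⟨z, rfl⟩ := hz
  rw [discOver_toCurve hG, discOver_toCurve hG']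
  have h1 : HasDerivAt (pullback G') (deriv k (G (toCurve Γ z)) * deriv (pullback G) z) z := by
    have h2 := HasDerivAt.comp_of_eq (z : ℂ) hk.hasDerivAt hG.differentiableAt.hasDerivAt
      (by simp [pullback])
    refine h2.congr_of_eventuallyEq ?_
    filter_upwards [(tendsto_toCurve_ofComplex z).eventually he] with t ht
    exact ht
  rw [h1.deriv, mul_pow, mul_comm, div_div]

/-- The order at `x` of the sextic differential `Δ(z) dz ^ 6` on the curve of a group all of whose
cusps have width `p`: it is `p - 6` at a cusp, and `-6 (e - 1) / e` at a point of order `e`. -/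
def discOrder (p : ℕ) (x : Curve Γ) : ℤ :=
  open Classical in
  if h : ∃ z : ℍ, toCurve Γ z = x then
    -(if ell Γ h.choose = 1 then 0 else if ell Γ h.choose = 2 then 3 else 4) else p - 6

theorem discOrder_toCurve (p : ℕ) (z : ℍ) : discOrder p (toCurve Γ z) =
    -(if ell Γ z = 1 then 0 else if ell Γ z = 2 then 3 else 4) := by
  have hz : ∃ w : ℍ, toCurve Γ w = toCurve Γ z := ⟨z, rfl⟩
  rw [discOrder, dif_pos hz, ell_eq_of_toCurve_eq hz.choose_spec]

theorem discOrder_cusp (p : ℕ) (g : SL(2, ℤ)) :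
    discOrder p (proj Γ (g • infty)) = p - 6 := by
  rw [discOrder, dif_neg fun ⟨z, hz⟩ => toCurve_ne_proj_smul_infty z g hz]

theorem nhdsNE_toCurve_eq_map (z₀ : ℍ) :
    𝓝[≠] (toCurve Γ z₀) ≤ Filter.map (toCurve Γ) (𝓝[≠] z₀) := by
  intro V hV
  rw [Filter.mem_map, mem_nhdsWithin_iff_exists_mem_nhds_inter] at hV
  obtain ⟨U, hU, hUV⟩ := hV
  rw [mem_nhdsWithin_iff_exists_mem_nhds_inter]
  refine ⟨toCurve Γ '' U, ?_, ?_⟩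
  · rw [← map_toCurve_nhds]; exact Filter.image_mem_map hU
  · rintro _ ⟨⟨z, hz, rfl⟩, hne⟩
    exact hUV ⟨hz, fun h => hne (by rw [Set.mem_singleton_iff.mp h]; rfl)⟩

theorem isTheta_of_tendsto {X : Type*} {l : Filter X} {f g : X → ℂ} {c : ℂ} (hc : c ≠ 0)
    {v : X → ℂ} (hv : Filter.Tendsto v l (𝓝 c)) (h : ∀ᶠ x in l, f x = g x * v x) : f =Θ[l] g := by
  refine (Filter.EventuallyEq.isTheta h).trans ?_
  simpa using (isTheta_refl g l).mul (isTheta_one_of_tendsto hc hv)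

/-- In the coordinate `s = r ^ e` one has `dz ^ 6 = r ^ (6 * (1 - e)) ds ^ 6` up to a unit, while
`Δ` does not vanish. -/
theorem IsChartAt.discOver_isTheta_toCurve {z₀ : ℍ} (hG : IsChartAt G (toCurve Γ z₀))
    (he : ∀ᶠ z : ℍ in 𝓝 z₀, G (toCurve Γ z) = cayley z₀ z ^ ell Γ z₀) :
    discOver G =Θ[𝓝[≠] (toCurve Γ z₀)] fun y => G y ^ discOrder p (toCurve Γ z₀) := by
  refine IsTheta.mono ?_ (nhdsNE_toCurve_eq_map z₀)
  suffices h : (discOver G ∘ toCurve Γ) =Θ[𝓝[≠] z₀]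
      ((fun y => G y ^ discOrder p (toCurve Γ z₀)) ∘ toCurve Γ) by
    exact ⟨isBigO_map.mpr h.1, isBigO_map.mpr h.2⟩
  have he' : ∀ᶠ t in 𝓝 (z₀ : ℂ), pullback G t = cayley z₀ t ^ ell Γ z₀ := by
    rw [eventually_nhds_coe_iff]
    simpa [pullback] using he
  have hol : ∀ᶠ z : ℍ in 𝓝 z₀, HolAt G (toCurve Γ z) :=
    (continuous_toCurve Γ).continuousAt.eventually hG.hol.eventually
  have hd : ContinuousAt (fun z : ℍ => discriminant z / ((ell Γ z₀ : ℂ) * deriv (cayley z₀) z) ^ 6)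
      z₀ := by
    refine ContinuousAt.div ?_ ?_ ?_
    · have := ContinuousAt.comp_of_eq (analyticAt_discriminant z₀).continuousAt
        (UpperHalfPlane.continuous_coe.continuousAt (x := z₀)) rfl
      simpa [Function.comp_def] using this
    · refine (continuousAt_const.mul ?_).pow 6
      exact ContinuousAt.comp_of_eq (analyticAt_cayley z₀ z₀).deriv.continuousAt
        (UpperHalfPlane.continuous_coe.continuousAt (x := z₀)) rfl
    · exact pow_ne_zero _ (mul_ne_zero (by exact_mod_cast (ell_pos Γ z₀).ne')
        (deriv_cayley_ne_zero z₀ z₀))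
  refine isTheta_of_tendsto (c := discriminant z₀ / ((ell Γ z₀ : ℂ) * deriv (cayley z₀) z₀) ^ 6)
    (div_ne_zero (discriminant_ne_zero z₀) (pow_ne_zero _ (mul_ne_zero
      (by exact_mod_cast (ell_pos Γ z₀).ne') (deriv_cayley_ne_zero z₀ z₀))))
    (hd.tendsto.mono_left nhdsWithin_le_nhds) ?_
  filter_upwards [nhdsWithin_le_nhds hol, nhdsWithin_le_nhds he,
    nhdsWithin_le_nhds (eventually_nhds_coe_iff.mp (eventually_eventually_nhds.mpr he')),
    self_mem_nhdsWithin] with z hz hz1 hz2 hne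
  have hc : cayley z₀ z ≠ 0 := fun h => hne (cayley_eq_zero_iff.mp h)
  have h1 : HasDerivAt (pullback G)
      ((ell Γ z₀ : ℂ) * cayley z₀ z ^ (ell Γ z₀ - 1) * deriv (cayley z₀) z) z :=
    ((analyticAt_cayley z₀ z).differentiableAt.hasDerivAt.pow _).congr_of_eventuallyEq hz2
  simp only [Function.comp_apply]
  rw [discOver_toCurve hz, h1.deriv, hz1, discOrder_toCurve]
  have hd0 := deriv_cayley_ne_zero z₀ z
  rcases ell_cases Γ z₀ with h | h | h <;> rw [h]
  · simp
  · norm_num [zpow_neg]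
    field_simp
  · norm_num [zpow_neg]
    field_simp

/-- In the coordinate `s = exp (2πiz/p)` one has `dz ^ 6 = s ^ (-6) ds ^ 6` up to a constant, while
`Δ` has order `p`. -/
theorem IsChartAt.discOver_isTheta_cusp {p : ℕ} (hp : 0 < p) {g : SL(2, ℤ)}
    (hG : IsChartAt G (proj Γ (g • infty)))
    (he : ∀ z : ℍ, 1 < z.im → G (toCurve Γ (g • z)) = Function.Periodic.qParam p z) :
    discOver G =Θ[𝓝[≠] (proj Γ (g • infty))] fun y => G y ^ discOrder p (proj Γ (g • infty)) := by
  rw [← map_atImInfty_eq_nhdsNE, discOrder_cusp]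
  suffices h : (discOver G ∘ fun z : ℍ => toCurve Γ (g • z)) =Θ[UpperHalfPlane.atImInfty]
      ((fun y => G y ^ ((p : ℤ) - 6)) ∘ fun z : ℍ => toCurve Γ (g • z)) by
    exact ⟨isBigO_map.mpr h.1, isBigO_map.mpr h.2⟩
  have hpc : (p : ℂ) ≠ 0 := by exact_mod_cast hp.ne'
  have hol : ∀ᶠ z : ℍ in UpperHalfPlane.atImInfty, HolAt G (toCurve Γ (g • z)) := by
    have : ∀ᶠ y in 𝓝[≠] (proj Γ (g • infty)), HolAt G y := nhdsWithin_le_nhds hG.hol.eventually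
    rwa [← map_atImInfty_eq_nhdsNE] at this
  have him : ∀ᶠ z : ℍ in UpperHalfPlane.atImInfty, 1 < z.im :=
    UpperHalfPlane.atImInfty_mem _ |>.mpr ⟨2, fun z hz => by
      simp only [Set.mem_ofPred_eq]; linarith⟩
  have h1 : (discOver G ∘ fun z : ℍ => toCurve Γ (g • z)) =ᶠ[UpperHalfPlane.atImInfty]
      fun z : ℍ => discriminant z / Function.Periodic.qParam p z ^ 6 *
        ((p : ℂ) / (2 * Real.pi * Complex.I)) ^ 6 := by
    filter_upwards [hol, him] with z hz hz1
    have hq : HasDerivAt (Function.Periodic.qParam p)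
        (Function.Periodic.qParam p z * (2 * Real.pi * Complex.I / p)) z := by
      simpa only [id_eq, mul_one] using!
        (((hasDerivAt_id (z : ℂ)).const_mul (2 * Real.pi * Complex.I)).div_const (p : ℂ)).cexp
    have h2 := HasDerivAt.comp_of_eq (z : ℂ) hz.differentiableAt.hasDerivAt (hasDerivAt_smul g z)
      (by simp)
    have h3 : (pullback G ∘ fun t : ℂ => ((g • UpperHalfPlane.ofComplex t : ℍ) : ℂ))
        =ᶠ[𝓝 (z : ℂ)] Function.Periodic.qParam p := by
      have hopen : ∀ᶠ t : ℂ in 𝓝 (z : ℂ), 1 < t.im :=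
        (isOpen_lt continuous_const Complex.continuous_im).mem_nhds hz1
      filter_upwards [hopen, eventually_im_pos z] with t ht ht0
      have := he (UpperHalfPlane.ofComplex t) (by
        rw [← UpperHalfPlane.coe_im, coe_ofComplex ht0]; exact ht)
      rw [coe_ofComplex ht0] at this
      rw [← this, Function.comp_apply, pullback, UpperHalfPlane.ofComplex_apply]
    have h4 := hq.unique (h2.congr_of_eventuallyEq h3.symm)
    simp only [Function.comp_apply]
    rw [discOver_toCurve hz, discriminant_smul]
    have ha := aut_ne_zero g z
    have h5 : deriv (pullback G) ((g • z : ℍ) : ℂ) = aut g z ^ 2 *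
        (Function.Periodic.qParam p z * (2 * Real.pi * Complex.I / p)) := by
      rw [h4]
      field_simp
    have hq0 := Function.Periodic.qParam_ne_zero (h := (p : ℝ)) (z : ℂ)
    rw [h5]
    have hpi := Complex.two_pi_I_ne_zero
    generalize 2 * (Real.pi : ℂ) * Complex.I = w at *
    field_simp
  have h2 : ((fun y => G y ^ ((p : ℤ) - 6)) ∘ fun z : ℍ => toCurve Γ (g • z))
      =ᶠ[UpperHalfPlane.atImInfty] fun z : ℍ => Function.Periodic.qParam p z ^ p /
        Function.Periodic.qParam p z ^ 6 * 1 := by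
    filter_upwards [him] with z hz
    simp only [Function.comp_apply]
    rw [he z hz, zpow_sub₀ (Function.Periodic.qParam_ne_zero _), mul_one]
    norm_cast
  refine h1.isTheta.trans (IsTheta.trans ?_ h2.symm.isTheta)
  exact ((discriminant_isTheta hp).div (isTheta_refl _ _)).mul
    (isTheta_const_const (pow_ne_zero _ (div_ne_zero hpc Complex.two_pi_I_ne_zero)) one_ne_zero)

theorem isTheta_of_deriv_ne_zero {k : ℂ → ℂ} (hk : AnalyticAt ℂ k 0) (h0 : k 0 = 0)
    (hd : deriv k 0 ≠ 0) : k =Θ[𝓝 0] id := by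
  obtain ⟨v, hv, hv0, he⟩ := exists_eq_sub_mul hk h0
  exact isTheta_of_tendsto (hv0 ▸ hd) hv.continuousAt.tendsto (by simpa using he)

theorem comp_tendsto_isTheta {X Y : Type*} {l : Filter X} {l' : Filter Y} {f g : X → ℂ} {k : Y → X}
    (h : f =Θ[l] g) (hk : Filter.Tendsto k l' l) :
    (fun y => f (k y)) =Θ[l'] fun y => g (k y) :=
  ⟨h.1.comp_tendsto hk, h.2.comp_tendsto hk⟩

/-- A coordinate change multiplies `discOver` by a function that is bounded and bounded away
from `0`. -/
theorem IsChartAt.discOver_comp_isTheta (hG : IsChartAt G x) {G' : Curve Γ → ℂ}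
    (hG' : ∀ᶠ y in 𝓝[≠] x, HolAt G' y) {k : ℂ → ℂ} (hk : AnalyticAt ℂ k 0) (hd : deriv k 0 ≠ 0)
    (he : ∀ᶠ y in 𝓝 x, G' y = k (G y)) :
    discOver G' =Θ[𝓝[≠] x] discOver G := by
  have hF := hG.tendsto.mono_left (nhdsWithin_le_nhds (s := {x}ᶜ))
  refine isTheta_of_tendsto (c := (deriv k 0 ^ 6)⁻¹) (v := fun y => (deriv k (G y) ^ 6)⁻¹)
    (inv_ne_zero (pow_ne_zero _ hd))
    (((hk.deriv.continuousAt.tendsto.comp hF).pow 6).inv₀ (pow_ne_zero _ hd)) ?_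
  filter_upwards [hG', nhdsWithin_le_nhds hG.hol.eventually,
    nhdsWithin_le_nhds (eventually_eventually_nhds.mpr he),
    hF.eventually hk.eventually_analyticAt] with y h1 h2 h3 h4
  rw [discOver_congr h2 h4.differentiableAt h3 h1, div_eq_mul_inv]

/-- `discOrder` is the order of `Δ(z) dz ^ 6`, in any chart. -/
theorem IsChartAt.discOver_isTheta (hΓ : IsLevel p Γ) (hG : IsChartAt G x) :
    discOver G =Θ[𝓝[≠] x] fun y => G y ^ discOrder p x := by
  obtain ⟨F, hF, hFo⟩ : ∃ F, IsChartAt F x ∧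
      discOver F =Θ[𝓝[≠] x] fun y => F y ^ discOrder p x := by
    induction x using Curve.cases with
    | h1 z =>
      obtain ⟨F, hF, he⟩ := exists_chart_toCurve (Γ := Γ) z
      exact ⟨F, hF, hF.discOver_isTheta_toCurve he⟩
    | h2 g =>
      obtain ⟨F, hF, he⟩ := hΓ.exists_chart_cusp g
      exact ⟨F, hF, hF.discOver_isTheta_cusp hΓ.pos he⟩
  obtain ⟨k, hk, h0, hd, he⟩ := exists_transition 1 hF (by simpa using hG)
  replace he : ∀ᶠ y in 𝓝 x, G y = k (F y) := he
  have h1 := hF.discOver_comp_isTheta (nhdsWithin_le_nhds hG.hol.eventually) hk hd he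
  have h2 : G =Θ[𝓝[≠] x] F :=
    (Filter.EventuallyEq.isTheta (nhdsWithin_le_nhds he)).trans
      (comp_tendsto_isTheta (isTheta_of_deriv_ne_zero hk h0 hd)
        (hF.tendsto.mono_left nhdsWithin_le_nhds))
  exact (h1.trans hFo).trans (h2.symm.zpow _)

end DiscOver

/-! ### Orders of meromorphic functions and genus `0` -/

section Orders

open Asymptotics

variable {Γ : Subgroup SL(2, ℤ)} {p : ℕ} {G F T : Curve Γ → ℂ} {x P : Curve Γ}

/-- A meromorphic function without poles is constant; its values at isolated points are left
free. -/
theorem IsLevel.exists_eq_of_isBigO (hΓ : IsLevel p Γ) (hG : ∀ x, ∀ᶠ y in 𝓝[≠] x, HolAt G y)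
    (hb : ∀ x, G =O[𝓝[≠] x] fun _ => (1 : ℂ)) : ∃ c, ∀ x, ∀ᶠ y in 𝓝[≠] x, G y = c := by
  have h1 : ∀ x, HolAt (regularize G) x := fun x => by
    obtain ⟨C, hC⟩ := (hb x).bound
    exact hΓ.holAt_regularize (hG x) (C := C) (by simpa using hC)
  refine ⟨regularize G (proj Γ infty), fun x => ?_⟩
  filter_upwards [hG x] with y hy
  rw [← hΓ.regularize_eq_of_holAt hy]
  exact hΓ.eq_of_holAt h1 _ _

theorem IsChartAt.tendsto_zpow (hF : IsChartAt F x) {n : ℤ} (hn : 0 < n) :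
    Filter.Tendsto (fun y => F y ^ n) (𝓝[≠] x) (𝓝 0) := by
  have h := (hF.tendsto.mono_left (nhdsWithin_le_nhds (s := {x}ᶜ))).zpow₀ n (Or.inr hn.le)
  rwa [zero_zpow n hn.ne'] at h

theorem IsChartAt.zpow_isBigO (hF : IsChartAt F x) {n : ℤ} (hn : 0 ≤ n) :
    (fun y => F y ^ n) =O[𝓝[≠] x] fun _ => (1 : ℂ) := by
  rcases hn.eq_or_lt with rfl | hn
  · simpa using isBigO_refl (fun _ : Curve Γ => (1 : ℂ)) _
  · exact (hF.tendsto_zpow hn).isBigO_one ℂ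

theorem IsChartAt.zpow_ne_zero (hF : IsChartAt F x) (n : ℤ) (hG : G =Θ[𝓝[≠] x] fun y => F y ^ n) :
    ∀ᶠ y in 𝓝[≠] x, G y ≠ 0 := by
  filter_upwards [hG.eq_zero_iff, hF.ne_zero] with y h1 h2 h3
  exact _root_.zpow_ne_zero n h2 (h1.mp h3)

/-- A meromorphic function on the curve all of whose orders are non-negative has all its orders
equal to `0`. -/
theorem IsLevel.order_eq_zero (hΓ : IsLevel p Γ) (hG : ∀ x, ∀ᶠ y in 𝓝[≠] x, HolAt G y)
    {n : Curve Γ → ℤ} (hn : ∀ x, 0 ≤ n x)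
    (hF : ∀ x, ∃ F, IsChartAt F x ∧ G =Θ[𝓝[≠] x] fun y => F y ^ n x) (x : Curve Γ) : n x = 0 := by
  obtain ⟨c, hc⟩ := hΓ.exists_eq_of_isBigO hG fun x => by
    obtain ⟨F, hF, h⟩ := hF x
    exact h.1.trans (hF.zpow_isBigO (hn x))
  obtain ⟨F, hF, h⟩ := hF x
  by_contra h0
  have h1 := hF.tendsto_zpow (lt_of_le_of_ne (hn x) (Ne.symm h0))
  have h2 := h.tendsto_zero_iff.mpr h1
  have := hF.nhdsNE_neBot
  have h3 : c = 0 := tendsto_nhds_unique (tendsto_const_nhds.congr'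
    ((hc x).mono fun y hy => hy.symm)) h2
  obtain ⟨y, h4, h5⟩ := ((hF.zpow_ne_zero _ h).and (hc x)).exists
  exact h4 (h5.trans h3)

theorem prod_zpow_eq {ι : Type*} (S : Finset ι) (f : ι → ℤ) {a : ℂ} (ha : a ≠ 0) :
    ∏ s ∈ S, a ^ f s = a ^ ∑ s ∈ S, f s := by
  classical
  induction S using Finset.induction_on with
  | empty => simp
  | insert s S hs ih => rw [Finset.prod_insert hs, Finset.sum_insert hs, ih, zpow_add₀ ha]

theorem HasOnePole.eventually_holAt (h : HasOnePole T P) (x : Curve Γ) :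
    ∀ᶠ y in 𝓝[≠] x, HolAt T y := by
  by_cases hx : x = P
  · subst hx
    filter_upwards [self_mem_nhdsWithin] with y hy using h.hol y hy
  · exact nhdsWithin_le_nhds (h.hol x hx).eventually

open Classical in
/-- Away from the pole `T` is a local coordinate, so that `discOver T` has the orders of
`Δ(z) dz ^ 6` and `T - T s` has a simple zero at `s` and no other zeros. -/
theorem HasOnePole.isTheta_of_ne (hΓ : IsLevel p Γ) (h : HasOnePole T P) (hx : x ≠ P)
    (hF : IsChartAt F x) :
    (discOver T =Θ[𝓝[≠] x] fun y => F y ^ discOrder p x) ∧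
      ∀ s, s ≠ P → (fun y => T y - T s) =Θ[𝓝[≠] x] fun y => if s = x then F y else 1 := by
  obtain ⟨g, hg, hd, he⟩ := h.exists_factor_of_ne hΓ hx hF
  refine ⟨(hF.discOver_comp_isTheta (h.eventually_holAt x) hg hd he).trans
    (hF.discOver_isTheta hΓ), fun s hs => ?_⟩
  by_cases hsx : s = x
  · subst hsx
    have h0 : T s = g 0 := by rw [he.self_of_nhds, hF.zero]
    simp only [if_true]
    have h1 : (fun t => g t - g 0) =Θ[𝓝 0] id :=
      isTheta_of_deriv_ne_zero (hg.sub analyticAt_const) (by simp) (by simpa using hd)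
    have h2 := comp_tendsto_isTheta h1 (hF.tendsto.mono_left (nhdsWithin_le_nhds (s := {s}ᶜ)))
    refine Filter.EventuallyEq.trans_isTheta ?_ h2
    filter_upwards [nhdsWithin_le_nhds he] with y hy
    rw [hy, h0]
  · simp only [if_neg hsx]
    exact isTheta_one_of_tendsto (sub_ne_zero.mpr fun h1 => hsx (h.injective hΓ hs hx h1.symm))
      (((h.hol x hx).continuousAt.tendsto.mono_left nhdsWithin_le_nhds).sub_const _)

/-- At the pole the differential `dT` has order `-2`, so that `(dT) ^ 6` contributes `12`. -/
theorem HasOnePole.isTheta_pole (hΓ : IsLevel p Γ) (h : HasOnePole T P) :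
    ∃ F, IsChartAt F P ∧ (discOver T =Θ[𝓝[≠] P] fun y => F y ^ (discOrder p P + 12)) ∧
      ∀ c : ℂ, (fun y => T y - c) =Θ[𝓝[≠] P] fun y => F y ^ (-1 : ℤ) := by
  obtain ⟨F, hF, g, hg, hg0, he⟩ := h.exists_factor hΓ
  have hFt := hF.tendsto.mono_left (nhdsWithin_le_nhds (s := {P}ᶜ))
  refine ⟨F, hF, ?_, fun c => ?_⟩
  · have h1 : discOver T =ᶠ[𝓝[≠] P] fun y => discOver F y * F y ^ (12 : ℤ) *
        ((deriv g (F y) * F y - g (F y)) ^ 6)⁻¹ := by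
      have he' : ∀ᶠ y in 𝓝[≠] P, ∀ᶠ y' in 𝓝 y, F y' * T y' = g (F y') := by
        rw [eventually_nhdsWithin_iff] at he
        filter_upwards [nhdsWithin_le_nhds (eventually_eventually_nhds.mpr he),
          self_mem_nhdsWithin] with y h1 h2
        filter_upwards [h1, isOpen_ne.mem_nhds h2] with y' h3 h4 using h3 h4
      filter_upwards [he', hF.ne_zero, nhdsWithin_le_nhds hF.hol.eventually,
        hFt.eventually hg.eventually_analyticAt, h.eventually_holAt P] with y h1 h2 h3 h4 h5
      have h6 : HasDerivAt (fun t => g t / t) ((deriv g (F y) * F y - g (F y) * 1) / F y ^ 2)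
          (F y) := h4.differentiableAt.hasDerivAt.div (hasDerivAt_id _) h2
      rw [discOver_congr h3 h6.differentiableAt ?_ h5, h6.deriv, mul_one, div_pow, ← pow_mul]
      · rw [div_div_eq_mul_div, div_eq_mul_inv]
        norm_cast
      · filter_upwards [h1, h3.continuousAt.eventually_ne h2] with y' h7 h8
        rw [eq_div_iff h8, mul_comm, h7]
    have h2 : (fun y => ((deriv g (F y) * F y - g (F y)) ^ 6)⁻¹) =Θ[𝓝[≠] P] fun _ => (1 : ℂ) := by
      refine isTheta_one_of_tendsto (c := ((deriv g 0 * 0 - g 0) ^ 6)⁻¹) (inv_ne_zero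
        (pow_ne_zero _ (by simpa using hg0))) ?_
      exact ((((hg.deriv.continuousAt.tendsto.comp hFt).mul hFt).sub
        (hg.continuousAt.tendsto.comp hFt)).pow 6).inv₀ (pow_ne_zero _ (by simpa using hg0))
    have h3 := (((hF.discOver_isTheta hΓ).mul (isTheta_refl (fun y => F y ^ (12 : ℤ)) _)).mul h2)
    refine h1.trans_isTheta (h3.trans (Filter.EventuallyEq.isTheta ?_))
    filter_upwards [hF.ne_zero] with y hy
    rw [mul_one, zpow_add₀ hy]
  · refine isTheta_of_tendsto (c := g 0 - c * 0) (v := fun y => g (F y) - c * F y)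
      (by simpa using hg0) ((hg.continuousAt.tendsto.comp hFt).sub (hFt.const_mul c)) ?_
    filter_upwards [he, hF.ne_zero] with y h1 h2
    rw [← h1, zpow_neg_one]
    field_simp

/-- If the curve carries a function with a single simple pole, i.e. has genus `0`, then the sextic
differential `Δ(z) dz ^ 6` has degree `-12`, and a sum of its orders that includes all the negative
ones is at most `-12`. -/
theorem HasOnePole.sum_discOrder_le (hΓ : IsLevel p Γ) (h : HasOnePole T P)
    (S : Finset (Curve Γ)) (hP : P ∉ S) (hS : ∀ x ∉ S, x ≠ P → 0 ≤ discOrder p x) :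
    discOrder p P + ∑ s ∈ S, discOrder p s ≤ -12 := by
  classical
  by_contra! hlt
  have hsP : ∀ s ∈ S, s ≠ P := fun s hs hsP => hP (hsP ▸ hs)
  -- the quotient of `Δ(z) dz ^ 6 / (dT) ^ 6` by a polynomial in `T` with the same orders on `S`
  set Ψ : Curve Γ → ℂ := fun y => discOver T y * ∏ s ∈ S, (T y - T s) ^ (-discOrder p s) with hΨ
  set n : Curve Γ → ℤ := fun x => if x = P then discOrder p P + 12 + ∑ s ∈ S, discOrder p s
    else if x ∈ S then 0 else discOrder p x with hn
  have hF : ∀ x, ∃ F, IsChartAt F x ∧ Ψ =Θ[𝓝[≠] x] fun y => F y ^ n x := by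
    intro x
    by_cases hx : x = P
    · subst hx
      obtain ⟨F, hF, h1, h2⟩ := h.isTheta_pole hΓ
      refine ⟨F, hF, (h1.mul (IsTheta.finsetProd fun s _ => (h2 (T s)).zpow (-discOrder p s))).trans
        (Filter.EventuallyEq.isTheta ?_)⟩
      filter_upwards [hF.ne_zero] with y hy
      simp only [hn, if_true, ← zpow_mul, neg_mul_neg, one_mul]
      rw [prod_zpow_eq S _ hy, ← zpow_add₀ hy]
    · obtain ⟨F, hF⟩ := hΓ.exists_chart x
      obtain ⟨h1, h2⟩ := h.isTheta_of_ne hΓ hx hF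
      refine ⟨F, hF, (h1.mul (IsTheta.finsetProd fun s hs =>
        (h2 s (hsP s hs)).zpow (-discOrder p s))).trans (Filter.EventuallyEq.isTheta ?_)⟩
      filter_upwards [hF.ne_zero] with y hy
      have h3 : ∀ s, (if s = x then F y else 1) ^ (-discOrder p s)
          = if s = x then F y ^ (-discOrder p x) else 1 := fun s => by
        split_ifs with hs
        · rw [hs]
        · simp
      simp only [h3, Finset.prod_ite_eq', hn, if_neg hx]
      split_ifs
      · rw [← zpow_add₀ hy, add_neg_cancel]
      · rw [mul_one]
  have hnn : ∀ x, 0 ≤ n x := fun x => by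
    simp only [hn]
    split_ifs with h1 h2
    · linarith
    · rfl
    · exact hS x h2 h1
  refine absurd (hΓ.order_eq_zero (fun x => ?_) hnn hF P) ?_
  · obtain ⟨F, hF, h1⟩ := hF x
    filter_upwards [hF.zpow_ne_zero _ h1, h.eventually_holAt x] with y hy hT
    obtain ⟨hy1, hy2⟩ := mul_ne_zero_iff.mp hy
    obtain ⟨z, rfl, -⟩ := exists_of_discOver_ne_zero hT hy1
    rw [Finset.prod_ne_zero_iff] at hy2
    have h2 := holAt_toCurve_iff.mp (hT.discOver hy1)
    have h3 := holAt_toCurve_iff.mp hT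
    rw [holAt_toCurve_iff]
    refine h2.mul (Finset.analyticAt_fun_prod _ fun s hs => ?_)
    by_cases h0 : discOrder p s = 0
    · simp only [h0, neg_zero, zpow_zero]
      exact analyticAt_const
    · refine (h3.sub analyticAt_const).zpow fun h4 => hy2 s hs ?_
      have : T (toCurve Γ z) - T s = 0 := by simpa [pullback] using h4
      rw [this, zero_zpow _ (neg_ne_zero.mpr h0)]
  · simp only [hn, if_true]
    linarith

end Orders

/-! ### The ratio `u^* ω / ω` -/

section Ratio

open Asymptotics

variable {Γ : Subgroup SL(2, ℤ)} {p : ℕ} {G F T : Curve Γ → ℂ} {x y P : Curve Γ}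

/-- A meromorphic function whose only pole is simple becomes a `HasOnePole` function once its values
at the removable singularities are corrected. -/
theorem IsLevel.hasOnePole_regularize (hΓ : IsLevel p Γ)
    (hG : ∀ x, ∀ᶠ y in 𝓝[≠] x, HolAt G y) (hb : ∀ x, x ≠ P → G =O[𝓝[≠] x] fun _ => (1 : ℂ))
    (hFP : IsChartAt F P) (h : G =Θ[𝓝[≠] P] fun y => F y ^ (-1 : ℤ)) :
    HasOnePole (regularize G) P := by
  have heq : ∀ x, ∀ᶠ y in 𝓝[≠] x, regularize G y = G y := fun x => by
    filter_upwards [hG x] with y hy using hΓ.regularize_eq_of_holAt hy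
  have := hFP.nhdsNE_neBot
  refine ⟨fun x hx => ?_, ⟨F, hFP, ?_⟩, ?_⟩
  · obtain ⟨C, hC⟩ := (hb x hx).bound
    exact hΓ.holAt_regularize (hG x) (C := C) (by simpa using hC)
  · obtain ⟨C, hC⟩ := h.1.bound
    refine ⟨C, ?_⟩
    filter_upwards [hC, hFP.ne_zero, heq P] with y h1 h2 h3
    rw [h3, norm_mul]
    rw [zpow_neg_one, norm_inv] at h1
    calc ‖F y‖ * ‖G y‖ ≤ ‖F y‖ * (C * ‖F y‖⁻¹) := by gcongr
      _ = C := by field_simp [norm_ne_zero_iff.mpr h2]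
  · by_contra! hc
    obtain ⟨y₀, hy₀⟩ := (self_mem_nhdsWithin (s := {P}ᶜ) (a := P) |> fun h =>
      Filter.Eventually.exists (f := 𝓝[≠] P) (p := fun y => y ≠ P) h)
    have h1 : (fun y => F y ^ (-1 : ℤ)) =O[𝓝[≠] P] fun _ => (1 : ℂ) := by
      refine h.2.trans (Filter.EventuallyEq.trans_isBigO (f₂ := fun _ => regularize G y₀) ?_
        (isBigO_const_const _ one_ne_zero _))
      filter_upwards [heq P, self_mem_nhdsWithin] with y h1 h2
      rw [← h1]
      exact hc y y₀ h2 hy₀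
    have h2 : (fun _ : Curve Γ => (1 : ℂ)) =O[𝓝[≠] P] F := by
      refine IsBigO.congr' ((isBigO_refl F _).mul h1) ?_ ?_
      · filter_upwards [hFP.ne_zero] with y hy
        rw [zpow_neg_one, mul_inv_cancel₀ hy]
      · simp
    have h3 := h2.trans_tendsto (hFP.tendsto.mono_left nhdsWithin_le_nhds)
    exact one_ne_zero (tendsto_nhds_unique tendsto_const_nhds h3)

open Classical in
/-- The quotient `u^* ω / ω` for the sextic differential `ω = Δ(z) dz ^ 6`, computed with the help
of a chart at `u x`. -/
def sexticRatio (u : Aut Γ) (x : Curve Γ) : ℂ :=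
  if h : ∃ F, IsChartAt F (u.1 x) then
    discOver h.choose (u.1 x) / discOver (h.choose ∘ u.1) x else 0

/-- The ratio does not depend on the chart, and may be computed with any function that is a
coordinate at `u x`. -/
theorem sexticRatio_eq (u : Aut Γ) (hF : IsChartAt F (u.1 x)) {g : ℂ → ℂ} (hg : AnalyticAt ℂ g 0)
    (hd : deriv g 0 ≠ 0) (hGF : ∀ᶠ y in 𝓝 (u.1 x), G y = g (F y)) (hG : HolAt G (u.1 x)) :
    sexticRatio u x = discOver G (u.1 x) / discOver (G ∘ u.1) x := by
  have h : ∃ F, IsChartAt F (u.1 x) := ⟨F, hF⟩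
  have key : ∀ {G : Curve Γ → ℂ} {g : ℂ → ℂ}, AnalyticAt ℂ g 0 → deriv g 0 ≠ 0 →
      (∀ᶠ y in 𝓝 (u.1 x), G y = g (F y)) → HolAt G (u.1 x) →
      discOver G (u.1 x) / discOver (G ∘ u.1) x = discOver F (u.1 x) / discOver (F ∘ u.1) x := by
    intro G g hg hd hGF hG
    have h0 : F (u.1 x) = 0 := hF.zero
    rw [discOver_congr hF.hol (by rw [h0]; exact hg.differentiableAt) hGF hG,
      discOver_congr (G' := G ∘ u.1) (hF.hol.comp_aut u.2.1) (k := g) (by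
        rw [Function.comp_apply, h0]; exact hg.differentiableAt)
        (u.2.1.1.continuousAt.eventually hGF) (hG.comp_aut u.2.1), Function.comp_apply, h0]
    exact div_div_div_cancel_right₀ (pow_ne_zero _ hd) _ _
  rw [sexticRatio, dif_pos h, key hg hd hGF hG]
  obtain ⟨k, hk, -, hd', he⟩ := exists_transition (1 : Aut Γ) hF (by simpa using h.choose_spec)
  exact key hk hd' he h.choose_spec.hol

theorem HolAt.div {z : ℍ} (hF : HolAt F (toCurve Γ z)) (hG : HolAt G (toCurve Γ z))
    (h0 : G (toCurve Γ z) ≠ 0) : HolAt (fun y => F y / G y) (toCurve Γ z) := by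
  rw [holAt_toCurve_iff] at *
  exact hF.div hG (by simpa [pullback] using h0)

theorem tendsto_aut_nhdsNE (u : Aut Γ) (x : Curve Γ) :
    Filter.Tendsto u.1 (𝓝[≠] x) (𝓝[≠] (u.1 x)) :=
  tendsto_nhdsWithin_of_tendsto_nhds_of_eventually_within _
    (u.2.1.1.continuousAt.tendsto.mono_left nhdsWithin_le_nhds) (by
      filter_upwards [self_mem_nhdsWithin] with y hy
      exact fun h => hy (u.1.injective h))

/-- The order of `u^* ω / ω` at `x` is the difference of the orders of `ω` at `u x` and at `x`. -/
theorem IsLevel.sexticRatio_spec (hΓ : IsLevel p Γ) (u : Aut Γ) (hF : IsChartAt F x) :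
    (∀ᶠ y in 𝓝[≠] x, HolAt (sexticRatio u) y) ∧
      sexticRatio u =Θ[𝓝[≠] x] fun y => F y ^ (discOrder p (u.1 x) - discOrder p x) := by
  obtain ⟨F', hF'⟩ := hΓ.exists_chart (u.1 x)
  obtain ⟨k, hk, hk0, hd, he⟩ := exists_transition u hF hF'
  have hu := tendsto_aut_nhdsNE u x
  have hol : ∀ᶠ y in 𝓝[≠] x, HolAt (F' ∘ u.1) y :=
    nhdsWithin_le_nhds (hF'.hol.comp_aut u.2.1).eventually
  have hol' : ∀ᶠ y in 𝓝[≠] x, HolAt F' (u.1 y) :=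
    hu.eventually (nhdsWithin_le_nhds hF'.hol.eventually)
  have h1 := hF.discOver_comp_isTheta hol hk hd he
  have h2 : discOver (F' ∘ u.1) =Θ[𝓝[≠] x] fun y => F y ^ discOrder p x :=
    h1.trans (hF.discOver_isTheta hΓ)
  have h3 : (fun y => F' (u.1 y)) =Θ[𝓝[≠] x] F :=
    (Filter.EventuallyEq.isTheta (nhdsWithin_le_nhds he)).trans
      (comp_tendsto_isTheta (isTheta_of_deriv_ne_zero hk hk0 hd)
        (hF.tendsto.mono_left nhdsWithin_le_nhds))
  have h4 : (fun y => discOver F' (u.1 y)) =Θ[𝓝[≠] x] fun y => F y ^ discOrder p (u.1 x) :=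
    (comp_tendsto_isTheta (hF'.discOver_isTheta hΓ) hu).trans (h3.zpow _)
  have hne := hF.zpow_ne_zero _ h2
  have hne' := hF.zpow_ne_zero _ h4
  have heq : ∀ᶠ y in 𝓝[≠] x,
      sexticRatio u y = discOver F' (u.1 y) / discOver (F' ∘ u.1) y := by
    filter_upwards [hol', hne', hol] with y h5 h6 h7
    obtain ⟨E, hE⟩ := hΓ.exists_chart (u.1 y)
    obtain ⟨g, hg, hgE⟩ := hE.factor F' h5
    refine sexticRatio_eq u hE hg (fun h0 => h6 ?_) hgE h5
    rw [discOver_congr hE.hol (by rw [hE.zero]; exact hg.differentiableAt) hgE h5, hE.zero, h0]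
    simp
  refine ⟨?_, (Filter.EventuallyEq.isTheta heq).trans ((h4.div h2).trans
    (Filter.EventuallyEq.isTheta ?_))⟩
  · have heq' : ∀ᶠ y in 𝓝[≠] x, ∀ᶠ y' in 𝓝 y,
        sexticRatio u y' = discOver F' (u.1 y') / discOver (F' ∘ u.1) y' := by
      rw [eventually_nhdsWithin_iff] at heq
      filter_upwards [nhdsWithin_le_nhds (eventually_eventually_nhds.mpr heq),
        self_mem_nhdsWithin] with y h1 h2
      filter_upwards [h1, isOpen_ne.mem_nhds h2] with y' h3 h4 using h3 h4
    filter_upwards [heq', hol, hol', hne, hne'] with y h5 h6 h7 h8 h9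
    have h10 := h6.discOver h8
    have h11 : HolAt (discOver F' ∘ u.1) y := (h7.discOver h9).comp_aut u.2.1
    obtain ⟨z, rfl, -⟩ := exists_of_discOver_ne_zero h6 h8
    exact (HolAt.div h11 h10 h8).congr (h5.mono fun _ h => h.symm)
  · filter_upwards [hF.ne_zero] with y hy
    rw [zpow_sub₀ hy]

theorem IsLevel.eventually_holAt_sexticRatio (hΓ : IsLevel p Γ) (u : Aut Γ) (x : Curve Γ) :
    ∀ᶠ y in 𝓝[≠] x, HolAt (sexticRatio u) y := by
  obtain ⟨F, hF⟩ := hΓ.exists_chart x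
  exact (hΓ.sexticRatio_spec u hF).1

theorem IsLevel.sexticRatio_isBigO (hΓ : IsLevel p Γ) (u : Aut Γ)
    (h : discOrder p x ≤ discOrder p (u.1 x)) :
    sexticRatio u =O[𝓝[≠] x] fun _ => (1 : ℂ) := by
  obtain ⟨F, hF⟩ := hΓ.exists_chart x
  exact (hΓ.sexticRatio_spec u hF).2.1.trans (hF.zpow_isBigO (sub_nonneg.mpr h))

/-- If `u^* ω / ω` has no poles, then it is constant and has no zeros either. -/
theorem IsLevel.discOrder_eq_of_le (hΓ : IsLevel p Γ) (u : Aut Γ)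
    (h : ∀ x, discOrder p x ≤ discOrder p (u.1 x)) (x : Curve Γ) :
    discOrder p (u.1 x) = discOrder p x := by
  refine sub_eq_zero.mp (hΓ.order_eq_zero (hΓ.eventually_holAt_sexticRatio u)
    (n := fun x => discOrder p (u.1 x) - discOrder p x) (fun x => sub_nonneg.mpr (h x))
    (fun x => ?_) x)
  obtain ⟨F, hF⟩ := hΓ.exists_chart x
  exact ⟨F, hF, (hΓ.sexticRatio_spec u hF).2⟩

/-- The differential `Δ(z) dz ^ 6` is invariant under `SL(2, ℤ)`, hence under the automorphism
induced by `g`. -/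
theorem discOver_inducedAut {g : SL(2, ℤ)} (hg : Normalizes g Γ) (x : Curve Γ)
    (h : HolAt F ((inducedAut hg).1 x)) :
    discOver F ((inducedAut hg).1 x) = discOver (F ∘ (inducedAut hg).1) x := by
  have h' : HolAt (F ∘ (inducedAut hg).1) x := h.comp_aut (inducedAut hg).2.1
  induction x using Curve.cases with
  | h1 z =>
    rw [inducedAut_toCurve] at h ⊢
    rw [discOver_toCurve h, discOver_toCurve h', discriminant_smul]
    have h1 := HasDerivAt.comp_of_eq (z : ℂ) h.differentiableAt.hasDerivAt (hasDerivAt_smul g z)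
      (by simp)
    have h2 : (pullback F ∘ fun t : ℂ => ((g • UpperHalfPlane.ofComplex t : ℍ) : ℂ))
        = pullback (F ∘ (inducedAut hg).1) := by
      funext t
      simp only [Function.comp_apply, pullback, UpperHalfPlane.ofComplex_apply, inducedAut_toCurve]
    rw [h2] at h1
    rw [h1.deriv]
    have := aut_ne_zero g z
    rw [mul_pow, one_div, inv_pow, ← pow_mul, mul_comm _ (_)⁻¹, ← div_div, div_inv_eq_mul, mul_comm]
  | h2 g' =>
    rw [discOver, discOver, dif_neg, dif_neg]
    · exact fun ⟨z, hz⟩ => toCurve_ne_proj_smul_infty z g' hz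
    · rintro ⟨z, hz⟩
      rw [inducedAut_proj, ← mul_smul] at hz
      exact toCurve_ne_proj_smul_infty z _ hz

/-- If `u` commutes with the automorphism induced by `g`, then `u^* ω / ω` is invariant under `g`,
because `ω = Δ(z) dz ^ 6` is. -/
theorem IsLevel.sexticRatio_inducedAut (hΓ : IsLevel p Γ) {g : SL(2, ℤ)} (hg : Normalizes g Γ)
    {u : Aut Γ} (hu : u * inducedAut hg = inducedAut hg * u) (x : Curve Γ) :
    sexticRatio u ((inducedAut hg).1 x) = sexticRatio u x := by
  set v := inducedAut hg with hv
  have huv : ∀ y, u.1 (v.1 y) = v.1 (u.1 y) := fun y =>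
    congrArg (fun w : Aut Γ => w.1 y) hu
  obtain ⟨F, hF⟩ := hΓ.exists_chart (v.1 (u.1 x))
  obtain ⟨E, hE⟩ := hΓ.exists_chart (u.1 x)
  obtain ⟨k, hk, -, hd, he⟩ := exists_transition v hE hF
  have hF' : IsChartAt F (u.1 (v.1 x)) := by rw [huv]; exact hF
  rw [sexticRatio_eq u (G := F) (g := id) hF' analyticAt_id (by simp)
    (Filter.Eventually.of_forall fun _ => rfl) hF'.hol,
    sexticRatio_eq u hE (G := F ∘ v.1) hk hd he (hF.hol.comp_aut v.2.1), huv,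
    hv, discOver_inducedAut hg _ hF.hol, discOver_inducedAut hg _ (hF'.hol.comp_aut u.2.1)]
  congr 2
  funext y
  exact congrArg F (huv y)

theorem tendsto_toCurve_nhdsNE (z₀ : ℍ) :
    Filter.Tendsto (toCurve Γ) (𝓝[≠] z₀) (𝓝[≠] (toCurve Γ z₀)) := by
  obtain ⟨F, hF, he⟩ := exists_chart_toCurve (Γ := Γ) z₀
  refine tendsto_nhdsWithin_of_tendsto_nhds_of_eventually_within _
    ((continuous_toCurve Γ).continuousAt.tendsto.mono_left nhdsWithin_le_nhds) ?_
  filter_upwards [nhdsWithin_le_nhds he, self_mem_nhdsWithin] with z h1 h2 h3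
  rw [Set.mem_singleton_iff.mp h3, hF.zero] at h1
  exact h2 (cayley_eq_zero_iff.mp (pow_eq_zero_iff (ell_pos Γ z₀).ne' |>.mp h1.symm))

open ModularForm in
/-- For `p ≤ 5` the quotient of the sixth power of a holomorphic differential by `Δ(z) dz ^ 6` is
holomorphic on the curve and vanishes at the cusps, so that it is `0`. -/
theorem IsLevel.genus_eq_zero (hΓ : IsLevel p Γ) (hp : p ≤ 5) : genus Γ = 0 := by
  classical
  suffices h : ∀ g ∈ holomorphicDifferentials Γ, g = 0 by
    rw [genus, (Submodule.eq_bot_iff _).mpr h, finrank_bot]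
  intro g hg
  set φ : Curve Γ → ℂ := fun x =>
    if h : ∃ z : ℍ, toCurve Γ z = x then g h.choose ^ 6 / discriminant h.choose else 0 with hφ
  have key : ∀ x, ∃ F, HolAt F x ∧ (∀ᶠ y in 𝓝 x, φ y = (discOver F y)⁻¹) ∧
      ∀ᶠ y in 𝓝 x, ∀ z, toCurve Γ z = y → deriv (pullback F) z = g z := by
    intro x
    obtain ⟨U, hU, hxU, F, hF, hd⟩ := hg x
    have hd' : ∀ z, toCurve Γ z ∈ U → HasDerivAt (pullback F) (g z) z := hd
    refine ⟨F, ⟨U, hU, hxU, hF⟩, ?_, ?_⟩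
    · filter_upwards [hU.mem_nhds hxU] with y hy
      have hFy : HolAt F y := ⟨U, hU, hy, hF⟩
      simp only [hφ]
      split_ifs with h
      · have h1 := h.choose_spec
        rw [← h1] at hFy
        rw [← h1] at hy
        conv_rhs => rw [← h1]
        rw [discOver_toCurve hFy, (hd' _ hy).deriv, inv_div]
      · rw [discOver, dif_neg h, inv_zero]
    · filter_upwards [hU.mem_nhds hxU] with y hy z hz
      exact (hd' z (hz ▸ hy)).deriv
  have key2 : ∀ x, ∃ E, IsChartAt E x ∧ φ =O[𝓝[≠] x] (fun y => E y ^ (-discOrder p x)) ∧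
      ∀ᶠ y in 𝓝[≠] x, HolAt φ y := by
    intro x
    obtain ⟨F, hF, h1, -⟩ := key x
    obtain ⟨E, hE⟩ := hΓ.exists_chart x
    obtain ⟨k, hk, he⟩ := hE.factor F hF
    have hEt := hE.tendsto.mono_left (nhdsWithin_le_nhds (s := {x}ᶜ))
    have h2 : ∀ᶠ y in 𝓝[≠] x, φ y = deriv k (E y) ^ 6 * (discOver E y)⁻¹ := by
      filter_upwards [nhdsWithin_le_nhds h1, nhdsWithin_le_nhds hE.hol.eventually,
        nhdsWithin_le_nhds hF.eventually, hEt.eventually hk.eventually_analyticAt,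
        nhdsWithin_le_nhds (eventually_eventually_nhds.mpr he)] with y h2 h3 h4 h5 h6
      rw [h2, discOver_congr h3 h5.differentiableAt h6 h4, inv_div, div_eq_mul_inv]
    refine ⟨E, hE, ?_, ?_⟩
    · have h3 : (fun y => deriv k (E y) ^ 6) =O[𝓝[≠] x] fun _ => (1 : ℂ) :=
        ((hk.deriv.continuousAt.tendsto.comp hEt).pow 6).isBigO_one ℂ
      refine Filter.EventuallyEq.trans_isBigO h2 ?_
      simpa using h3.mul (hE.discOver_isTheta hΓ).inv.1
    · have h2' : ∀ᶠ y in 𝓝[≠] x, ∀ᶠ y' in 𝓝 y,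
          φ y' = deriv k (E y') ^ 6 * (discOver E y')⁻¹ := by
        rw [eventually_nhdsWithin_iff] at h2
        filter_upwards [nhdsWithin_le_nhds (eventually_eventually_nhds.mpr h2),
          self_mem_nhdsWithin] with y h1 h2
        filter_upwards [h1, isOpen_ne.mem_nhds h2] with y' h3 h4 using h3 h4
      filter_upwards [h2', hE.zpow_ne_zero _ (hE.discOver_isTheta hΓ),
        nhdsWithin_le_nhds hE.hol.eventually,
        hEt.eventually hk.eventually_analyticAt] with y h3 h4 h5 h6
      obtain ⟨z, rfl, -⟩ := exists_of_discOver_ne_zero h5 h4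
      refine HolAt.congr ?_ (h3.mono fun _ h => h.symm)
      have h7 := holAt_toCurve_iff.mp (h5.discOver h4)
      have h8 := holAt_toCurve_iff.mp h5
      rw [holAt_toCurve_iff]
      have h9 : AnalyticAt ℂ (fun t => deriv k (pullback E t)) z :=
        AnalyticAt.fun_comp (by simpa [pullback] using h6.deriv) h8
      exact (h9.pow 6).mul (h7.inv (by simpa [pullback] using h4))
  have hord : ∀ x : Curve Γ, 0 ≤ -discOrder p x := fun x => by
    induction x using Curve.cases with
    | h1 z => rw [discOrder_toCurve]; split_ifs <;> norm_num
    | h2 g => rw [discOrder_cusp]; omega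
  obtain ⟨c, hc⟩ := hΓ.exists_eq_of_isBigO (fun x => (key2 x).choose_spec.2.2) fun x => by
    obtain ⟨E, hE, h1, -⟩ := key2 x
    exact h1.trans (hE.zpow_isBigO (hord x))
  have hc0 : c = 0 := by
    obtain ⟨E, hE, h1, -⟩ := key2 (proj Γ ((1 : SL(2, ℤ)) • infty))
    rw [discOrder_cusp] at h1
    have := hE.nhdsNE_neBot
    exact tendsto_nhds_unique (tendsto_const_nhds.congr' ((hc _).mono fun y hy => hy.symm))
      (h1.trans_tendsto (hE.tendsto_zpow (by omega)))
  funext z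
  obtain ⟨F, hF, h1, h2⟩ := key (toCurve Γ z)
  have h3 : ∀ᶠ w : ℍ in 𝓝[≠] z, deriv (pullback F) w = 0 := by
    filter_upwards [(tendsto_toCurve_nhdsNE z).eventually (hc (toCurve Γ z)),
      (tendsto_toCurve_nhdsNE z).eventually (nhdsWithin_le_nhds h1),
      (tendsto_toCurve_nhdsNE z).eventually (nhdsWithin_le_nhds hF.eventually)] with w h4 h5 h6
    rw [h4, hc0, discOver_toCurve h6, inv_div, eq_comm, div_eq_zero_iff] at h5
    exact pow_eq_zero_iff (by norm_num) |>.mp (h5.resolve_right (discriminant_ne_zero w))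
  have h4 : ContinuousAt (fun w : ℍ => deriv (pullback F) w) z :=
    ContinuousAt.comp_of_eq (holAt_toCurve_iff.mp hF).deriv.continuousAt
      (UpperHalfPlane.continuous_coe.continuousAt (x := z)) rfl
  have : (𝓝[≠] z).NeBot := by
    obtain ⟨E, hE⟩ := hΓ.exists_chart (toCurve Γ z)
    have := hE.nhdsNE_neBot
    exact Filter.NeBot.of_map (Filter.neBot_of_le (nhdsNE_toCurve_eq_map (Γ := Γ) z))
  have h5 := tendsto_nhds_unique (h4.tendsto.mono_left nhdsWithin_le_nhds)
    (tendsto_const_nhds.congr' (h3.mono fun w hw => hw.symm))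
  rw [← h2.self_of_nhds z rfl, h5]
  rfl

end Ratio

/-! ### Elliptic points of Cartan groups -/

section Counting

open ModularGroup

/-- If `k • i` is an elliptic point, then `Γ` contains the generator `k * S * k⁻¹` of its stabilizer
in `SL(2, ℤ)`. -/
theorem conj_S_mem {Γ : Subgroup SL(2, ℤ)} (hneg : -1 ∈ Γ) {γ k : SL(2, ℤ)} (hγ : γ ∈ Γ)
    (h : γ • k • UpperHalfPlane.I = k • UpperHalfPlane.I) (h1 : γ ≠ 1) (h2 : γ ≠ -1) :
    k * S * k⁻¹ ∈ Γ := by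
  have h0 := stabilizer_I.mp (conj_smul_eq h)
  have e : γ = k * (k⁻¹ * γ * k) * k⁻¹ := by group
  simp only [Finset.mem_insert, Finset.mem_singleton] at h0
  rcases h0 with h' | h' | h' | h' <;> rw [h'] at e
  · exact absurd (by rw [e]; group) h1
  · exact absurd (by rw [e]; simp) h2
  · rwa [e] at hγ
  · rw [e] at hγ
    have := Γ.mul_mem hneg hγ
    simpa using this

/-- If `k • ρ` is an elliptic point, then `Γ` contains the generator `k * (S * T) * k⁻¹` of its
stabilizer in `SL(2, ℤ)`, of prime order modulo `±1`. -/
theorem conj_S_mul_T_mem {Γ : Subgroup SL(2, ℤ)} (hneg : -1 ∈ Γ) {γ k : SL(2, ℤ)} (hγ : γ ∈ Γ)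
    (h : γ • k • UpperHalfPlane.ρ = k • UpperHalfPlane.ρ) (h1 : γ ≠ 1) (h2 : γ ≠ -1) :
    k * (S * T) * k⁻¹ ∈ Γ := by
  have h0 := stabilizer_ρ.mp (conj_smul_eq h)
  have e : γ = k * (k⁻¹ * γ * k) * k⁻¹ := by group
  have hS : S⁻¹ = -S := by
    rw [inv_eq_iff_mul_eq_one, mul_neg, S_mul_S, neg_neg]
  simp only [Finset.mem_insert, Finset.mem_singleton] at h0
  rcases h0 with h' | h' | h' | h' | h' | h' <;> rw [h'] at e
  · exact absurd (by rw [e]; group) h1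
  · exact absurd (by rw [e]; simp) h2
  · rwa [e] at hγ
  · rw [e] at hγ
    have := Γ.mul_mem hneg hγ
    simpa using this
  · rw [e] at hγ
    have := Γ.mul_mem hneg (Γ.inv_mem hγ)
    simpa [mul_assoc, hS] using this
  · rw [e] at hγ
    have := Γ.inv_mem hγ
    have e2 : (-(T⁻¹ * S))⁻¹ = S * T := by
      rw [inv_eq_iff_mul_eq_one, neg_mul, show T⁻¹ * S * (S * T) = T⁻¹ * (S * S) * T by
        simp only [mul_assoc], S_mul_S]
      simp
    have e3 : (k * -(T⁻¹ * S) * k⁻¹)⁻¹ = k * (-(T⁻¹ * S))⁻¹ * k⁻¹ := by group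
    rwa [e3, e2] at this

variable {p : ℕ} [Fact p.Prime] {C : Subgroup (GL (Fin 2) (ZMod p))}
  {α : Matrix (Fin 2) (Fin 2) (ZMod p)} {δ : ZMod p}

/-- Trace zero matrices of the same square that commute with a given non-scalar matrix agree up to
sign. -/
theorem eq_or_neg_of_commute (hp : p ≠ 2) (hδ : δ ≠ 0) {κ β β' : Matrix (Fin 2) (Fin 2) (ZMod p)}
    (hκ : κ 1 0 ≠ 0) (ht : β 1 1 = -β 0 0) (ht' : β' 1 1 = -β' 0 0)
    (hs : β 0 0 ^ 2 + β 0 1 * β 1 0 = δ) (hs' : β' 0 0 ^ 2 + β' 0 1 * β' 1 0 = δ)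
    (h0 : β 1 0 ≠ 0) (hc : κ * β = β * κ) (hc' : κ * β' = β' * κ) : β' = β ∨ β' = -β := by
  have h2 := two_ne_zero_of_ne hp
  obtain ⟨s, t, rfl⟩ := exists_eq_of_commute hκ hc.symm
  obtain ⟨s', t', rfl⟩ := exists_eq_of_commute hκ hc'.symm
  simp [Matrix.scalar] at ht ht' hs hs' h0
  have e1 : t' * s = t * s' := by
    apply mul_left_cancel₀ h2
    linear_combination t' * ht - t * ht'
  have ht0 : t ≠ 0 := h0.1
  have e2 : (t' - t) * (t' + t) = 0 := by
    apply mul_right_cancel₀ hδ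
    linear_combination (-t' ^ 2) * hs + t ^ 2 * hs' +
      (t' * s + t * s' + 2 * t * t' * κ 0 0) * e1
  rcases mul_eq_zero.mp e2 with h3 | h3
  · left
    have h4 : t' = t := sub_eq_zero.mp h3
    rw [h4] at e1 ⊢
    rw [mul_left_cancel₀ ht0 e1]
  · right
    have h4 : t' = -t := eq_neg_of_add_eq_zero_left h3
    rw [h4] at e1 ⊢
    have h5 : s' = -s := mul_left_cancel₀ ht0 (by linear_combination -e1)
    rw [h5, map_neg, neg_smul, neg_add]

theorem red_S_mul_T : red p (S * T) = !![0, -1; 1, 1] := by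
  have h := red_T_zpow (p := p) 1
  rw [zpow_one] at h
  rw [red_mul, red_S, h]
  ext i j
  fin_cases i <;> fin_cases j <;> simp [Matrix.mul_apply, Fin.sum_univ_two]

/-- The elliptic points of order `2` and `3` of `Γ_ns` correspond to the conjugates of `α` that
commute with an elliptic element `κ` of order `4` or `6`. -/
theorem IsGenerator.exists_of_ell_ne_one (h : IsGenerator C α δ) {z : ℍ}
    (hz : ell (GammaNs C) z ≠ 1) : ∃ k : SL(2, ℤ),
      (ell (GammaNs C) z = 2 ∧ z = k • UpperHalfPlane.I ∧
        red p S * conjRed α k = conjRed α k * red p S) ∨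
      (ell (GammaNs C) z = 3 ∧ z = k • UpperHalfPlane.ρ ∧
        red p (S * T) * conjRed α k = conjRed α k * red p (S * T)) := by
  have hneg : -1 ∈ GammaNs C := by
    rw [h.mem_iff, red_neg, red_one]; simp
  rcases (ell_cases _ z).resolve_left hz with hz | hz
  · obtain ⟨⟨k, rfl⟩, γ, hγ, hγz, h2⟩ := ell_eq_two hz
    refine ⟨k, Or.inl ⟨hz, rfl, (h.conj_mem_iff k S).mp (conj_S_mem hneg hγ hγz ?_ ?_)⟩⟩
    · rintro rfl; revert h2; decide
    · rintro rfl; revert h2; decide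
  · obtain ⟨⟨k, rfl⟩, γ, hγ, hγz, ⟨h1, h2⟩, -⟩ := ell_eq_three hz
    exact ⟨k, Or.inr ⟨hz, rfl, (h.conj_mem_iff k _).mp (conj_S_mul_T_mem hneg hγ hγz h1 h2)⟩⟩

theorem IsGenerator.mul_inv_mem_plus (h : IsGenerator C α δ) {k k' : SL(2, ℤ)}
    (hk : conjRed α k' = conjRed α k ∨ conjRed α k' = -conjRed α k) :
    k' * k⁻¹ ∈ GammaNsPlus C := by
  rw [h.mem_plus_iff_conjRed]
  refine hk.imp (fun h1 => (conjRed_eq_iff α α k' k).mp h1) fun h1 => ?_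
  rw [← conjRed_neg] at h1
  exact (conjRed_eq_iff α (-α) k' k).mp h1

/-- `Γ_ns⁺` permutes the points of a given order `e ≠ 1` of `Γ_ns` transitively. -/
theorem IsGenerator.exists_mem_plus_smul_eq (h : IsGenerator C α δ) (hp : p ≠ 2) {z z' : ℍ}
    (hz : ell (GammaNs C) z ≠ 1) (hzz' : ell (GammaNs C) z' = ell (GammaNs C) z) :
    ∃ g ∈ GammaNsPlus C, z' = g • z := by
  obtain ⟨k, hk⟩ := h.exists_of_ell_ne_one hz
  obtain ⟨k', hk'⟩ := h.exists_of_ell_ne_one (hzz' ▸ hz)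
  suffices h1 : (conjRed α k' = conjRed α k ∨ conjRed α k' = -conjRed α k) ∧
      ∃ z₀ : ℍ, z = k • z₀ ∧ z' = k' • z₀ by
    obtain ⟨h1, z₀, rfl, rfl⟩ := h1
    exact ⟨_, h.mul_inv_mem_plus h1, by rw [mul_smul, inv_smul_smul]⟩
  have key : ∀ κ : Matrix (Fin 2) (Fin 2) (ZMod p), κ 1 0 ≠ 0 →
      κ * conjRed α k = conjRed α k * κ → κ * conjRed α k' = conjRed α k' * κ →
      (conjRed α k' = conjRed α k ∨ conjRed α k' = -conjRed α k) := fun κ h1 h2 h3 =>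
    eq_or_neg_of_commute hp h.ne_zero h1 (h.conj_trace k) (h.conj_trace k') (h.conj_sq k)
      (h.conj_sq k') (h.conj_one_zero k) h2 h3
  rcases hk with ⟨h1, h2, h3⟩ | ⟨h1, h2, h3⟩ <;> rcases hk' with ⟨h4, h5, h6⟩ | ⟨h4, h5, h6⟩
  · exact ⟨key _ (by simp [red_S]) h3 h6, _, h2, h5⟩
  · omega
  · omega
  · exact ⟨key _ (by simp [red_S_mul_T]) h3 h6, _, h2, h5⟩

/-- Elements of order `3` modulo `±1` belong to the subgroup `Γ_ns` of index `2`. -/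
theorem IsGenerator.ell_eq_three_of_plus (h : IsGenerator C α δ) {z : ℍ}
    (hz : ell (GammaNsPlus C) z = 3) : ell (GammaNs C) z = 3 := by
  obtain ⟨-, γ, hγ, hγz, ⟨h1, h2⟩, h3⟩ := ell_eq_three hz
  have hneg : -1 ∈ GammaNs C := by
    rw [h.mem_iff, red_neg, red_one]; simp
  have hmem : γ ∈ GammaNs C := by
    by_contra hn
    have hn' : γ⁻¹ ∉ GammaNs C := fun h => hn (inv_mem_iff.mp h)
    have h4 := h.mul_inv_mem hγ (inv_mem hγ) hn hn'
    rw [inv_inv, ← pow_two] at h4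
    have h5 : γ ^ 3 ∈ GammaNs C := by
      rcases h3 with h3 | h3 <;> rw [h3]
      exacts [one_mem _, hneg]
    exact hn ((Subgroup.mul_mem_cancel_left _ h4).mp (by rwa [← pow_succ]))
  have h4 : ell (GammaNs C) z ≠ 1 := fun h5 => by
    rcases ell_eq_one_iff.mp h5 γ hmem hγz with h6 | h6
    exacts [h1 h6, h2 h6]
  refine ((ell_cases _ z).resolve_left h4).resolve_left fun h5 => ?_
  obtain ⟨hI, -⟩ := ell_eq_two h5
  have h6 : ¬ ∀ γ ∈ GammaNsPlus C, γ • z = z → γ = 1 ∨ γ = -1 := fun h7 => by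
    rcases h7 γ hγ hγz with h8 | h8
    exacts [h1 h8, h2 h8]
  rw [ell, if_neg h6, if_pos hI] at hz
  norm_num at hz

/-- If a nonscalar matrix `κ` commutes with a conjugate of `α`, then the discriminant of its
characteristic polynomial is `4 * δ` up to a square. -/
theorem IsGenerator.four_mul_eq (h : IsGenerator C α δ) {k : SL(2, ℤ)}
    {κ : Matrix (Fin 2) (Fin 2) (ZMod p)} (hκ : κ 1 0 ≠ 0)
    (hc : κ * conjRed α k = conjRed α k * κ) :
    ∃ t, t ≠ 0 ∧ 4 * δ = t ^ 2 * (κ.trace ^ 2 - 4 * κ.det) := by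
  obtain ⟨s, t, hst⟩ := exists_eq_of_commute hκ hc.symm
  have h1 := h.conj_trace k
  have h2 := h.conj_sq k
  have h3 := h.conj_one_zero k
  rw [hst] at h1 h2 h3
  simp [Matrix.scalar] at h1 h2 h3
  refine ⟨t, h3.1, ?_⟩
  rw [Matrix.trace_fin_two, Matrix.det_fin_two]
  linear_combination (-4) * h2 + (2 * s + t * κ 0 0 - t * κ 1 1 + 2 * t * κ 0 0 ) * h1

/-- An elliptic point of order `2` of `Γ_ns` shows that `-1` is not a square modulo `p`. -/
theorem IsGenerator.not_isSquare_neg_one (h : IsGenerator C α δ) (hp : p ≠ 2) {z : ℍ}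
    (hz : ell (GammaNs C) z = 2) : ¬ IsSquare (-1 : ZMod p) := by
  rintro ⟨i, hi⟩
  obtain ⟨k, ⟨-, -, hc⟩ | ⟨h3, -⟩⟩ := h.exists_of_ell_ne_one (z := z) (by omega)
  swap
  · omega
  obtain ⟨t, -, ht⟩ := h.four_mul_eq (by simp [red_S]) hc
  rw [det_red, red_S] at ht
  refine h.nonsquare ⟨i * t, ?_⟩
  have h2 := two_ne_zero_of_ne hp
  apply mul_left_cancel₀ (mul_ne_zero h2 h2)
  simp [Matrix.trace_fin_two] at ht
  linear_combination ht + 4 * t ^ 2 * hi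

/-- An elliptic point of order `3` of `Γ_ns` shows that `-3` is not a square modulo `p`. -/
theorem IsGenerator.not_isSquare_neg_three (h : IsGenerator C α δ) (hp : p ≠ 2) {z : ℍ}
    (hz : ell (GammaNs C) z = 3) : ¬ IsSquare (-3 : ZMod p) := by
  rintro ⟨i, hi⟩
  obtain ⟨k, ⟨h3, -⟩ | ⟨-, -, hc⟩⟩ := h.exists_of_ell_ne_one (z := z) (by omega)
  · omega
  obtain ⟨t, -, ht⟩ := h.four_mul_eq (by simp [red_S_mul_T]) hc
  rw [det_red, red_S_mul_T] at ht
  have h2 := two_ne_zero_of_ne hp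
  refine h.nonsquare ⟨i * t / 2, ?_⟩
  apply mul_left_cancel₀ (mul_ne_zero h2 h2)
  simp [Matrix.trace_fin_two] at ht
  field_simp
  linear_combination ht + t ^ 2 * hi

/-- If `p ≡ 1 mod 3`, then `𝔽_p` contains a primitive cube root of unity `ζ`, and
`(2 * ζ + 1) ^ 2 = -3`. -/
theorem isSquare_neg_three (hp : p % 3 = 1) : IsSquare (-3 : ZMod p) := by
  have hdvd : 3 ∣ Fintype.card (ZMod p)ˣ := by
    rw [ZMod.card_units_eq_totient, Nat.totient_prime Fact.out]
    have := (Fact.out : p.Prime).two_le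
    omega
  obtain ⟨ζ, hζ⟩ := exists_prime_orderOf_dvd_card 3 hdvd
  have h1 : (ζ : ZMod p) ^ 3 = 1 := by
    rw [← Units.val_pow_eq_pow_val, ← hζ, pow_orderOf_eq_one, Units.val_one]
  have h2 : (ζ : ZMod p) - 1 ≠ 0 := fun h0 => by
    have : ζ = 1 := Units.ext (sub_eq_zero.mp h0)
    rw [this, orderOf_one] at hζ
    norm_num at hζ
  refine ⟨2 * ζ + 1, mul_left_cancel₀ h2 ?_⟩
  linear_combination (-4) * h1

end Counting

/-! ### Counting elliptic points and cusps -/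

section Bounds

variable {p : ℕ}

/-- The set of points of order `e` of the curve. -/
def orderSet (Γ : Subgroup SL(2, ℤ)) (e : ℕ) : Set (Curve Γ) := {x | ∃ z, x = toCurve Γ z ∧ ell Γ z = e}

theorem toCurve_mem_orderSet {Γ : Subgroup SL(2, ℤ)} {z : ℍ} {e : ℕ} :
    toCurve Γ z ∈ orderSet Γ e ↔ ell Γ z = e :=
  ⟨fun ⟨_, hw, h⟩ => by rw [ell_eq_of_toCurve_eq hw, h], fun h => ⟨z, rfl, h⟩⟩

theorem discOrder_of_mem_two {Γ : Subgroup SL(2, ℤ)} {x : Curve Γ} (hx : x ∈ orderSet Γ 2) :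
    discOrder p x = -3 := by
  obtain ⟨z, rfl, hz⟩ := hx
  rw [discOrder_toCurve, hz]; norm_num

theorem discOrder_of_mem_three {Γ : Subgroup SL(2, ℤ)} {x : Curve Γ} (hx : x ∈ orderSet Γ 3) :
    discOrder p x = -4 := by
  obtain ⟨z, rfl, hz⟩ := hx
  rw [discOrder_toCurve, hz]; norm_num

theorem finite_of_forall_card_le {X : Type*} {s : Set X} {n : ℕ}
    (h : ∀ A : Finset X, ↑A ⊆ s → A.card ≤ n) : s.Finite := by
  by_contra hs
  obtain ⟨A, hA, hc⟩ := (show s.Infinite from hs).exists_subset_card_eq (n + 1)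
  have := h A hA
  omega

/-- A curve with many cusps and few elliptic points carries no function whose only singularity is a
simple pole at a point of order `2`. -/
theorem HasOnePole.false_of_card {Γ : Subgroup SL(2, ℤ)} (hΓ : IsLevel p Γ) {T : Curve Γ → ℂ}
    {P : Curve Γ} (h : HasOnePole T P) (hP : P ∈ orderSet Γ 2) (hp : 6 ≤ p) {m n : ℕ}
    (h2 : ∀ A : Finset (Curve Γ), ↑A ⊆ orderSet Γ 2 → A.card ≤ m)
    (h3 : ∀ A : Finset (Curve Γ), ↑A ⊆ orderSet Γ 3 → A.card ≤ n)
    (A : Finset (Curve Γ)) (hA : ↑A ⊆ cusps Γ) (hlt : 3 * m + 4 * n < (p - 6) * A.card + 12) :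
    False := by
  classical
  have f2 := finite_of_forall_card_le h2
  have f3 := finite_of_forall_card_le h3
  set E2 := f2.toFinset with hE2
  set E3 := f3.toFinset with hE3
  have c2 := h2 E2 (by simp [hE2])
  have c3 := h3 E3 (by simp [hE3])
  have hPE : P ∈ E2 := by simpa [hE2] using hP
  have d1 : Disjoint (E2 ∪ E3) A := by
    rw [Finset.disjoint_left]
    intro x hx hxA
    have hxc := hA (Finset.mem_coe.mpr hxA)
    rcases Finset.mem_union.mp hx with hx | hx
    · obtain ⟨z, rfl, -⟩ := f2.mem_toFinset.mp hx
      exact toCurve_notMem_cusps z hxc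
    · obtain ⟨z, rfl, -⟩ := f3.mem_toFinset.mp hx
      exact toCurve_notMem_cusps z hxc
  have d2 : Disjoint E2 E3 := by
    rw [Finset.disjoint_left]
    intro x hx hx'
    obtain ⟨z, rfl, h4⟩ := f2.mem_toFinset.mp hx
    have h5 := toCurve_mem_orderSet.mp (f3.mem_toFinset.mp hx')
    omega
  have h4 := h.sum_discOrder_le hΓ ((E2 ∪ E3 ∪ A).erase P) (by simp) fun x hx hxP => by
    have hx' : x ∉ E2 ∪ E3 := fun h' =>
      hx (Finset.mem_erase.mpr ⟨hxP, Finset.mem_union_left _ h'⟩)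
    induction x using Curve.cases with
    | h1 z =>
      rw [discOrder_toCurve]
      have e2 : ell Γ z ≠ 2 := fun h' => hx' (Finset.mem_union_left _
        (f2.mem_toFinset.mpr (toCurve_mem_orderSet.mpr h')))
      have e3 : ell Γ z ≠ 3 := fun h' => hx' (Finset.mem_union_right _
        (f3.mem_toFinset.mpr (toCurve_mem_orderSet.mpr h')))
      have := ell_cases Γ z
      rw [if_pos (by omega)]; norm_num
    | h2 g => rw [discOrder_cusp]; omega
  have s2 : ∑ x ∈ E2, discOrder p x = E2.card * (-3) := by
    rw [Finset.sum_congr rfl fun x hx => discOrder_of_mem_two (f2.mem_toFinset.mp hx),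
      Finset.sum_const, nsmul_eq_mul]
  have s3 : ∑ x ∈ E3, discOrder p x = E3.card * (-4) := by
    rw [Finset.sum_congr rfl fun x hx => discOrder_of_mem_three (f3.mem_toFinset.mp hx),
      Finset.sum_const, nsmul_eq_mul]
  have sA : ∑ x ∈ A, discOrder p x = A.card * ((p : ℤ) - 6) := by
    rw [Finset.sum_congr (g := fun _ => ((p : ℤ) - 6)) rfl fun x hx => by
      obtain ⟨g, rfl⟩ := mem_cusps_iff.mp (hA (Finset.mem_coe.mpr hx))
      exact discOrder_cusp p g, Finset.sum_const, nsmul_eq_mul]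
  rw [Finset.add_sum_erase _ _ (by simp [hPE]), Finset.sum_union d1, Finset.sum_union d2,
    s2, s3, sA] at h4
  zify [hp] at hlt
  have c2' : (E2.card : ℤ) ≤ m := by exact_mod_cast c2
  have c3' : (E3.card : ℤ) ≤ n := by exact_mod_cast c3
  linarith

theorem conjRed_neg_right (A : Matrix (Fin 2) (Fin 2) (ZMod p)) (g : SL(2, ℤ)) :
    conjRed A (-g) = conjRed A g := by
  rw [conjRed, conjRed, show (-g)⁻¹ = -g⁻¹ by
    rw [inv_eq_iff_mul_eq_one, neg_mul_neg, mul_inv_cancel], red_neg, red_neg, neg_mul, neg_mul_neg]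

variable [Fact p.Prime] {C : Subgroup (GL (Fin 2) (ZMod p))}
  {α : Matrix (Fin 2) (Fin 2) (ZMod p)} {δ : ZMod p}

/-- A conic has at most `p + 2` points, as the projection from one of its points to the projective
line is injective on the others. -/
theorem card_sq_add_sq_le (hp : p ≠ 2) (hδ : δ ≠ 0) :
    (Finset.univ.filter fun q : ZMod p × ZMod p => q.1 ^ 2 + q.2 ^ 2 = δ).card ≤ p + 2 := by
  classical
  set S := Finset.univ.filter fun q : ZMod p × ZMod p => q.1 ^ 2 + q.2 ^ 2 = δ with hS
  rcases S.eq_empty_or_nonempty with h0 | ⟨⟨a, b⟩, hab⟩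
  · rw [h0]; simp
  have hab' : a ^ 2 + b ^ 2 = δ := by simpa [hS] using hab
  have h1 : (S.erase (a, b)).card ≤ (Finset.univ : Finset (Option (ZMod p))).card := by
    refine Finset.card_le_card_of_injOn
      (fun q => if q.2 = b then none else some ((q.1 - a) / (q.2 - b))) (fun _ _ => by simp) ?_
    rintro ⟨x, y⟩ hq ⟨x', y'⟩ hq' heq
    simp only [Finset.coe_erase, Set.mem_sdiff, Finset.mem_coe, Set.mem_singleton_iff,
      Prod.mk.injEq, hS, Finset.mem_filter, Finset.mem_univ, true_and] at hq hq'
    obtain ⟨hq, hne⟩ := hq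
    obtain ⟨hq', hne'⟩ := hq'
    dsimp only at heq
    split_ifs at heq with h1 h2 h2
    · subst h1
      subst h2
      have e : ∀ w : ZMod p, w ^ 2 + y' ^ 2 = δ → ¬ (w = a ∧ y' = y') → w = -a := fun w hw hn => by
        have : (w - a) * (w + a) = 0 := by linear_combination hw - hab'
        rcases mul_eq_zero.mp this with h | h
        · exact absurd ⟨sub_eq_zero.mp h, rfl⟩ hn
        · exact eq_neg_of_add_eq_zero_left h
      rw [e x hq hne, e x' hq' hne']
    · rw [Option.some.injEq] at heq
      have hy := sub_ne_zero.mpr h1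
      have hy' := sub_ne_zero.mpr h2
      set s := (x - a) / (y - b) with hs
      have hx : x = a + s * (y - b) := by rw [hs]; field_simp; ring
      have hx' : x' = a + s * (y' - b) := by rw [heq]; field_simp; ring
      have e1 : (y - b) * (s ^ 2 + 1) = -2 * (a * s + b) := by
        apply mul_left_cancel₀ hy
        rw [hx] at hq
        linear_combination hq - hab'
      have e2 : (y' - b) * (s ^ 2 + 1) = -2 * (a * s + b) := by
        apply mul_left_cancel₀ hy'
        rw [hx'] at hq'
        linear_combination hq' - hab'
      have e3 : (y - y') * (s ^ 2 + 1) = 0 := by linear_combination e1 - e2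
      rcases mul_eq_zero.mp e3 with h | h
      · have hyy := sub_eq_zero.mp h
        rw [hx, hx', hyy]
      · -- a line through the base point of isotropic direction meets the conic only there
        exfalso
        rw [h, mul_zero] at e1
        have e4 : a * s + b = 0 :=
          (mul_eq_zero.mp e1.symm).resolve_left (neg_ne_zero.mpr (two_ne_zero_of_ne hp))
        exact hδ (by linear_combination -hab' + (b - a * s) * e4 + a ^ 2 * h)
  rw [Finset.card_univ, Fintype.card_option, ZMod.card] at h1
  have h2 := Finset.card_erase_add_one hab
  omega

open ModularGroup in
/-- The points of order `2` of `X_ns⁺` correspond to the conjugates of `α`, up to sign, that commute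
or anticommute with `S`. At most one of them commutes; those that anticommute are the points of the
conic `x ^ 2 + y ^ 2 = δ`, which has at most `p + 2` points, so that there are at most `(p + 2) / 2`
of them up to sign. -/
theorem IsGenerator.card_order_two_le (h : IsGenerator C α δ) (hp : p ≠ 2)
    (A : Finset (Curve (GammaNsPlus C))) (hA : ↑A ⊆ orderSet (GammaNsPlus C) 2) :
    2 * A.card ≤ p + 4 := by
  classical
  have hneg : -1 ∈ GammaNsPlus C := (h.isLevel_plus hp).neg_one_mem
  have hex : ∀ x ∈ A, ∃ k : SL(2, ℤ), x = toCurve _ (k • UpperHalfPlane.I) ∧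
      (red p S * conjRed α k = conjRed α k * red p S ∨
        red p S * conjRed α k = -(conjRed α k * red p S)) := by
    intro x hx
    obtain ⟨z, rfl, hz⟩ := hA (Finset.mem_coe.mpr hx)
    obtain ⟨⟨k, rfl⟩, γ, hγ, hγz, h2⟩ := ell_eq_two hz
    refine ⟨k, rfl, (h.conj_mem_plus_iff k S).mp (conj_S_mem hneg hγ hγz ?_ ?_)⟩
    · rintro rfl; revert h2; decide
    · rintro rfl; revert h2; decide
  choose! k hk1 hk2 using hex
  have heq : ∀ x ∈ A, ∀ y ∈ A, (conjRed α (k y) = conjRed α (k x) ∨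
      conjRed α (k y) = -conjRed α (k x)) → x = y := by
    intro x hx y hy hxy
    rw [hk1 x hx, hk1 y hy, ← toCurve_smul (h.mul_inv_mem_plus hxy), mul_smul, inv_smul_smul]
  set B := A.filter fun x => red p S * conjRed α (k x) = conjRed α (k x) * red p S with hB
  set D := A.filter fun x => ¬ red p S * conjRed α (k x) = conjRed α (k x) * red p S with hD
  have hBD : B.card + D.card = A.card := Finset.card_filter_add_card_filter_not _
  have hB1 : B.card ≤ 1 := by
    rw [Finset.card_le_one]
    intro x hx y hy
    obtain ⟨hx, hx'⟩ := Finset.mem_filter.mp hx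
    obtain ⟨hy, hy'⟩ := Finset.mem_filter.mp hy
    exact heq x hx y hy (eq_or_neg_of_commute hp h.ne_zero (by simp [red_S]) (h.conj_trace _)
      (h.conj_trace _) (h.conj_sq _) (h.conj_sq _) (h.conj_one_zero _) hx' hy')
  have hsymm : ∀ x ∈ D, conjRed α (k x) 1 0 = conjRed α (k x) 0 1 := by
    intro x hx
    obtain ⟨hx, hx'⟩ := Finset.mem_filter.mp hx
    have h1 := congrFun (congrFun ((hk2 x hx).resolve_left hx') 0) 0
    rw [red_S] at h1
    simp [Matrix.mul_apply, Fin.sum_univ_two] at h1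
    exact h1
  -- each remaining point accounts for two points of a conic, one for each sign
  have hD1 : (D ×ˢ (Finset.univ : Finset Bool)).card ≤ p + 2 := by
    refine le_trans (Finset.card_le_card_of_injOn (fun q =>
      (bif q.2 then conjRed α (k q.1) 0 0 else -conjRed α (k q.1) 0 0,
        bif q.2 then conjRed α (k q.1) 0 1 else -conjRed α (k q.1) 0 1)) ?_ ?_)
        (card_sq_add_sq_le hp h.ne_zero)
    · rintro ⟨x, b⟩ hq
      have hx := (Finset.mem_product.mp hq).1
      have h1 := h.conj_sq (k x)
      rw [hsymm x hx] at h1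
      simp only [Finset.coe_filter, Finset.mem_univ, true_and, Set.mem_ofPred_eq]
      cases b <;> simp <;> linear_combination h1
    · rintro ⟨x, b⟩ hq ⟨y, c⟩ hq' hxy
      have hx := (Finset.mem_product.mp hq).1
      have hy := (Finset.mem_product.mp hq').1
      have h2 := two_ne_zero_of_ne hp
      have mext : ∀ M N : Matrix (Fin 2) (Fin 2) (ZMod p), M 0 0 = N 0 0 → M 0 1 = N 0 1 →
          M 1 0 = N 1 0 → M 1 1 = N 1 1 → M = N := fun M N h1 h2 h3 h4 => by
        ext i j; fin_cases i <;> fin_cases j <;> assumption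
      have hpos : conjRed α (k y) 0 0 = conjRed α (k x) 0 0 →
          conjRed α (k y) 0 1 = conjRed α (k x) 0 1 → x = y := fun h3 h4 =>
        heq x (Finset.mem_filter.mp hx).1 y (Finset.mem_filter.mp hy).1 (Or.inl
          (mext _ _ h3 h4 (by rw [hsymm x hx, hsymm y hy, h4])
            (by rw [h.conj_trace, h.conj_trace, h3])))
      have hneg' : conjRed α (k y) 0 0 = -conjRed α (k x) 0 0 →
          conjRed α (k y) 0 1 = -conjRed α (k x) 0 1 → x = y := fun h3 h4 =>
        heq x (Finset.mem_filter.mp hx).1 y (Finset.mem_filter.mp hy).1 (Or.inr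
          (mext _ _ (by simpa using h3) (by simpa using h4)
            (by rw [Matrix.neg_apply, hsymm x hx, hsymm y hy, h4])
            (by rw [Matrix.neg_apply, h.conj_trace, h.conj_trace, h3])))
      have hself : x = y → conjRed α (k y) 0 1 ≠ -conjRed α (k x) 0 1 := fun h3 h4 => by
        rw [h3, ← hsymm y hy] at h4
        refine h.conj_one_zero (k y) (mul_left_cancel₀ h2 ?_)
        linear_combination h4
      rw [Prod.mk.injEq] at hxy
      cases b <;> cases c <;> simp only [cond_true, cond_false, neg_inj] at hxy
      · rw [hpos hxy.1.symm hxy.2.symm]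
      · exact absurd hxy.2.symm (hself (hneg' hxy.1.symm hxy.2.symm))
      · exact absurd (by rw [hxy.2, neg_neg]) (hself (hneg' (by rw [hxy.1, neg_neg])
          (by rw [hxy.2, neg_neg])))
      · rw [hpos hxy.1.symm hxy.2.symm]
  rw [Finset.card_product, Finset.card_univ, Fintype.card_bool] at hD1
  omega

/-- Points of order `3` of `Γ_ns⁺` have order `3` for `Γ_ns`, where `Γ_ns⁺` permutes them
transitively. -/
theorem IsGenerator.card_order_three_le (h : IsGenerator C α δ) (hp : p ≠ 2)
    (A : Finset (Curve (GammaNsPlus C))) (hA : ↑A ⊆ orderSet (GammaNsPlus C) 3) :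
    A.card ≤ 1 := by
  rw [Finset.card_le_one]
  intro x hx y hy
  obtain ⟨z, rfl, hz⟩ := hA (Finset.mem_coe.mpr hx)
  obtain ⟨w, rfl, hw⟩ := hA (Finset.mem_coe.mpr hy)
  have hz' := h.ell_eq_three_of_plus hz
  have hw' := h.ell_eq_three_of_plus hw
  obtain ⟨g, hg, rfl⟩ := h.exists_mem_plus_smul_eq hp (z := z) (z' := w) (by omega) (by omega)
  exact (toCurve_smul hg z).symm

/-- The points of a given order `e ≠ 1` of `X_ns` form at most one orbit of the modular
involution. -/
theorem IsGenerator.eq_or_eq_of_mem_orderSet (h : IsGenerator C α δ) (hp : p ≠ 2) {e : ℕ}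
    (he : e ≠ 1) {g : SL(2, ℤ)} (hg : g ∈ GammaNsPlus C) (hn : g ∉ GammaNs C)
    {x y : Curve (GammaNs C)} (hx : x ∈ orderSet _ e) (hy : y ∈ orderSet _ e) :
    y = x ∨ y = (inducedAut (h.normalizes hg)).1 x := by
  obtain ⟨z, rfl, hz⟩ := hx
  obtain ⟨w, rfl, hw⟩ := hy
  obtain ⟨k, hk, rfl⟩ := h.exists_mem_plus_smul_eq hp (z := z) (z' := w) (by omega) (by omega)
  by_cases hk' : k ∈ GammaNs C
  · exact Or.inl (toCurve_smul hk' z)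
  · right
    rw [inducedAut_toCurve, ← toCurve_smul (h.mul_inv_mem hk hg hk' hn) (g • z), ← mul_smul,
      inv_mul_cancel_right]

theorem IsGenerator.card_orderSet_le (h : IsGenerator C α δ) (hp : p ≠ 2) {e : ℕ} (he : e ≠ 1)
    (A : Finset (Curve (GammaNs C))) (hA : ↑A ⊆ orderSet (GammaNs C) e) : A.card ≤ 2 := by
  classical
  obtain ⟨g, hg, hn⟩ := h.exists_mem_plus_notMem hp
  rcases A.eq_empty_or_nonempty with rfl | ⟨x, hx⟩
  · simp
  refine le_trans (Finset.card_le_card (t := {x, (inducedAut (h.normalizes hg)).1 x})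
    fun y hy => ?_) Finset.card_le_two
  rw [Finset.mem_insert, Finset.mem_singleton]
  exact h.eq_or_eq_of_mem_orderSet hp he hg hn (hA (Finset.mem_coe.mpr hx))
    (hA (Finset.mem_coe.mpr hy))

/-- The lower left entry of the conjugates of `α` is a binary quadratic form in the first column of
`g`. For the generator of a Cartan group it is anisotropic of discriminant `4 * δ`. -/
theorem conjRed_one_zero (α : Matrix (Fin 2) (Fin 2) (ZMod p)) (g : SL(2, ℤ)) :
    conjRed α g 1 0 = α 1 0 * red p g 0 0 ^ 2 + (α 1 1 - α 0 0) * red p g 0 0 * red p g 1 0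
      - α 0 1 * red p g 1 0 ^ 2 := by
  have h1 : red p g⁻¹ 1 0 = -red p g 1 0 ∧ red p g⁻¹ 1 1 = red p g 0 0 := by
    rw [red_apply, red_apply, red_apply, red_apply, Matrix.SpecialLinearGroup.SL2_inv_expl]
    simp
  rw [conjRed, Matrix.mul_apply, Fin.sum_univ_two, Matrix.mul_apply, Matrix.mul_apply,
    Fin.sum_univ_two, Fin.sum_univ_two, h1.1, h1.2]
  ring

/-- The quadratic form represents all nonzero values; completing the square reduces this to the norm
form. -/
theorem IsGenerator.exists_conjRed_one_zero_eq (h : IsGenerator C α δ) (hp : p ≠ 2) {c : ZMod p}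
    (hc : c ≠ 0) : ∃ g, conjRed α g 1 0 = c := by
  have h0 := h.one_zero
  obtain ⟨X, Y, hXY⟩ := exists_sq_sub_mul_sq_eq hp h.ne_zero (α 1 0 * c)
  obtain ⟨x, hx⟩ : ∃ x, α 1 0 * x - α 0 0 * Y = X := ⟨(X + α 0 0 * Y) / α 1 0, by field_simp; ring⟩
  obtain ⟨M, hM, h1, h2⟩ : ∃ M : Matrix (Fin 2) (Fin 2) (ZMod p), M.det = 1 ∧ M 0 0 = x ∧
      M 1 0 = Y := by
    by_cases hx0 : x = 0
    · have hY : Y ≠ 0 := fun hY => by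
        rw [hx0, hY] at hx
        rw [← hx, hY] at hXY
        exact mul_ne_zero h0 hc (by rw [← hXY]; ring)
      exact ⟨!![x, -Y⁻¹; Y, 0], by rw [Matrix.det_fin_two_of]; field_simp; ring, rfl, rfl⟩
    · exact ⟨!![x, 0; Y, x⁻¹], by rw [Matrix.det_fin_two_of]; field_simp; ring, rfl, rfl⟩
  obtain ⟨g, hg⟩ := exists_red_eq M hM
  refine ⟨g, mul_left_cancel₀ h0 ?_⟩
  rw [conjRed_one_zero, hg, h1, h2, h.trace]
  linear_combination hXY + (α 1 0 * x - α 0 0 * Y + X) * hx - Y ^ 2 * h.sq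

theorem conjRed_mul_T_zpow_one_zero (A : Matrix (Fin 2) (Fin 2) (ZMod p)) (g : SL(2, ℤ)) (n : ℤ) :
    conjRed A (g * ModularGroup.T ^ n) 1 0 = conjRed A g 1 0 := by
  rw [conjRed_mul, ← zpow_neg, red_T_zpow, red_T_zpow, Matrix.mul_apply, Fin.sum_univ_two,
    Matrix.mul_apply, Matrix.mul_apply, Fin.sum_univ_two, Fin.sum_univ_two]
  simp

/-- The square of the lower left entry of `g⁻¹ α g` depends only on the image of `g • ∞` in
`X_ns⁺`. -/
theorem IsGenerator.conjRed_sq_eq_of_proj_eq (h : IsGenerator C α δ) {g g' : SL(2, ℤ)}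
    (hgg' : proj (GammaNsPlus C) (g • infty) = proj (GammaNsPlus C) (g' • infty)) :
    conjRed α g 1 0 ^ 2 = conjRed α g' 1 0 ^ 2 := by
  obtain ⟨γ, hγ, he⟩ := proj_eq_iff.mp hgg'
  have h1 : ((γ * g')⁻¹ * g) • infty = infty := by
    rw [mul_smul, ← he, ← mul_smul γ, inv_smul_smul]
  have h3 : conjRed α (γ * g') 1 0 ^ 2 = conjRed α g' 1 0 ^ 2 := by
    have h4 : conjRed α (γ * g') = conjRed (conjRed α γ) g' := conjRed_mul α γ g'
    rcases (h.mem_plus_iff_conjRed γ).mp hγ with h2 | h2 <;> rw [h4, h2]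
    rw [conjRed_neg, Matrix.neg_apply, neg_sq]
  obtain ⟨n, hn | hn⟩ := exists_T_zpow_of_smul_infty h1
  · rw [← h3, show g = γ * g' * ModularGroup.T ^ n by rw [← hn]; group, conjRed_mul_T_zpow_one_zero]
  · rw [← h3, show g = -(γ * g' * ModularGroup.T ^ n) by rw [← mul_neg, ← hn]; group,
      conjRed_neg_right, conjRed_mul_T_zpow_one_zero]

/-- The square of the lower left entry of the conjugate of `α` is an invariant of a cusp, and takes
the values `1`, `4`, `9`, which are distinct modulo `p`. -/
theorem IsGenerator.exists_three_cusps (h : IsGenerator C α δ) (hp : 7 ≤ p) :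
    ∃ A : Finset (Curve (GammaNsPlus C)), ↑A ⊆ cusps (GammaNsPlus C) ∧ A.card = 3 := by
  classical
  have hne : ∀ n : ℕ, n ∈ ({1, 2, 3, 5, 8} : Finset ℕ) → (n : ZMod p) ≠ 0 := by
    intro n hn h0
    rw [ZMod.natCast_eq_zero_iff] at h0
    have hpp : p.Prime := Fact.out
    fin_cases hn
    · exact absurd (Nat.le_of_dvd (by norm_num) h0) (by omega)
    · exact absurd (Nat.le_of_dvd (by norm_num) h0) (by omega)
    · exact absurd (Nat.le_of_dvd (by norm_num) h0) (by omega)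
    · exact absurd (Nat.le_of_dvd (by norm_num) h0) (by omega)
    · have := Nat.le_of_dvd (by norm_num) (hpp.dvd_of_dvd_pow (show p ∣ 2 ^ 3 from h0))
      omega
  have hp2 : p ≠ 2 := by omega
  obtain ⟨g₁, h1⟩ := h.exists_conjRed_one_zero_eq hp2 (hne 1 (by simp))
  obtain ⟨g₂, h2⟩ := h.exists_conjRed_one_zero_eq hp2 (hne 2 (by simp))
  obtain ⟨g₃, h3⟩ := h.exists_conjRed_one_zero_eq hp2 (hne 3 (by simp))
  refine ⟨{proj _ (g₁ • infty), proj _ (g₂ • infty), proj _ (g₃ • infty)}, ?_, ?_⟩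
  · intro x hx
    simp only [Finset.coe_insert, Finset.coe_singleton, Set.mem_insert_iff,
      Set.mem_singleton_iff] at hx
    rcases hx with rfl | rfl | rfl <;> exact proj_smul_infty_mem_cusps _ _
  · refine Finset.card_eq_three.mpr ⟨_, _, _, fun he => ?_, fun he => ?_, fun he => ?_, rfl⟩
    · have := h.conjRed_sq_eq_of_proj_eq he
      rw [h1, h2] at this
      exact hne 3 (by simp) (by push_cast at this ⊢; linear_combination -this)
    · have := h.conjRed_sq_eq_of_proj_eq he
      rw [h1, h3] at this
      exact hne 8 (by simp) (by push_cast at this ⊢; linear_combination -this)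
    · have := h.conjRed_sq_eq_of_proj_eq he
      rw [h2, h3] at this
      exact hne 5 (by simp) (by push_cast at this ⊢; linear_combination -this)

/-- `X_ns⁺` carries no function with a single simple pole at a point of order `2`. -/
theorem IsGenerator.false_of_hasOnePole_plus (h : IsGenerator C α δ) (hp : 11 ≤ p)
    {T : Curve (GammaNsPlus C) → ℂ} {P : Curve (GammaNsPlus C)} (hT : HasOnePole T P)
    (hP : P ∈ orderSet (GammaNsPlus C) 2) : False := by
  obtain ⟨A, hA, hc⟩ := h.exists_three_cusps (by omega)
  refine hT.false_of_card (h.isLevel_plus (by omega)) hP (by omega) (m := (p + 4) / 2)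
    (fun B hB => ?_) (fun B hB => h.card_order_three_le (by omega) B hB) A hA (by rw [hc]; omega)
  have := h.card_order_two_le (by omega) B hB
  omega

/-- `X_ns` carries no function with a single simple pole at a point of order `2`. -/
theorem IsGenerator.false_of_hasOnePole (h : IsGenerator C α δ) (hC : IsNonsplitCartan C)
    (hp : 11 ≤ p) {T : Curve (GammaNs C) → ℂ} {P : Curve (GammaNs C)} (hT : HasOnePole T P)
    (hP : P ∈ orderSet (GammaNs C) 2) : False := by
  have hp2 : p ≠ 2 := by omega
  refine hT.false_of_card hC.isLevel hP (by omega) (h.card_orderSet_le hp2 (by norm_num))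
    (h.card_orderSet_le hp2 (by norm_num)) {proj _ ((1 : SL(2, ℤ)) • infty)} ?_ ?_
  · rw [Finset.coe_singleton, Set.singleton_subset_iff]
    exact proj_smul_infty_mem_cusps _ _
  · rw [Finset.card_singleton]
    omega

end Bounds

/-! ### Automorphisms preserve the orders of elliptic points -/

section Matching

open Asymptotics

variable {Γ : Subgroup SL(2, ℤ)} {p : ℕ}

theorem PreservesCusps.mul {u v : Aut Γ} (hu : PreservesCusps u) (hv : PreservesCusps v) :
    PreservesCusps (u * v) := by
  have : (u * v).1 '' cusps Γ = u.1 '' (v.1 '' cusps Γ) := Set.image_comp u.1 v.1 _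
  rw [PreservesCusps, this, hv, hu]

theorem PreservesEllipticPoints.ell_eq_one_iff {u : Aut Γ} (he : PreservesEllipticPoints u) {z w : ℍ}
    (h : u.1 (toCurve Γ z) = toCurve Γ w) : ell Γ z = 1 ↔ ell Γ w = 1 := by
  have h1 : toCurve Γ w ∈ ellipticPoints Γ ↔ toCurve Γ z ∈ ellipticPoints Γ := by
    rw [← h]
    conv_lhs => rw [← he]
    exact u.1.injective.mem_set_image
  rw [toCurve_mem_ellipticPoints_iff, toCurve_mem_ellipticPoints_iff] at h1
  exact (not_iff_not.mp h1).symm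

/-- The order of `Δ(z) dz ^ 6` drops only at the points of order `2` mapped to points of
order `3`. -/
theorem discOrder_le_of_not {u : Aut Γ} (hc : PreservesCusps u) (he : PreservesEllipticPoints u)
    {x : Curve Γ} (hx : ¬ (x ∈ orderSet Γ 2 ∧ u.1 x ∈ orderSet Γ 3)) :
    discOrder p x ≤ discOrder p (u.1 x) := by
  induction x using Curve.cases with
  | h1 z =>
    obtain ⟨w, hw⟩ := exists_toCurve_of_preservesCusps hc z
    have h1 := he.ell_eq_one_iff hw
    rw [hw, toCurve_mem_orderSet, toCurve_mem_orderSet] at hx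
    rw [hw, discOrder_toCurve, discOrder_toCurve]
    rcases ell_cases Γ z with h | h | h <;> rcases ell_cases Γ w with h' | h' | h' <;>
      simp [h, h'] at hx h1 ⊢
  | h2 g =>
    obtain ⟨g', hg'⟩ := mem_cusps_iff.mp (hc ▸ Set.mem_image_of_mem u.1
      (proj_smul_infty_mem_cusps Γ g) : u.1 (proj Γ (g • infty)) ∈ cusps Γ)
    rw [hg', discOrder_cusp, discOrder_cusp]

/-- If no point of order `2` is mapped to a point of order `3`, then the converse does not happen
either. -/
theorem IsLevel.preservesOrders_of_forall (hΓ : IsLevel p Γ) {u : Aut Γ} (hc : PreservesCusps u)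
    (he : PreservesEllipticPoints u)
    (h : ∀ x ∈ orderSet Γ 2, u.1 x ∉ orderSet Γ 3) : PreservesOrders u := fun z w hzw => by
  have h1 := hΓ.discOrder_eq_of_le u (fun x => discOrder_le_of_not hc he fun hx => h x hx.1 hx.2)
    (toCurve Γ z)
  rw [hzw, discOrder_toCurve, discOrder_toCurve] at h1
  rcases ell_cases Γ z with h | h | h <;> rcases ell_cases Γ w with h' | h' | h' <;>
    simp [h, h'] at h1 ⊢

theorem IsLevel.sexticRatio_isTheta_pole (hΓ : IsLevel p Γ) {u : Aut Γ} {P : Curve Γ}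
    (hP : P ∈ orderSet Γ 2) (hP' : u.1 P ∈ orderSet Γ 3) {F : Curve Γ → ℂ} (hF : IsChartAt F P) :
    sexticRatio u =Θ[𝓝[≠] P] fun y => F y ^ (-1 : ℤ) := by
  have := (hΓ.sexticRatio_spec u hF).2
  rwa [discOrder_of_mem_two hP, discOrder_of_mem_three hP'] at this

/-- If just one point of order `2` is mapped to a point of order `3`, it is the only pole of
`u^* ω / ω`. -/
theorem IsLevel.hasOnePole_sexticRatio (hΓ : IsLevel p Γ) {u : Aut Γ} (hc : PreservesCusps u)
    (he : PreservesEllipticPoints u) {P : Curve Γ} (hP : P ∈ orderSet Γ 2)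
    (hP' : u.1 P ∈ orderSet Γ 3)
    (huniq : ∀ x ∈ orderSet Γ 2, u.1 x ∈ orderSet Γ 3 → x = P) :
    HasOnePole (regularize (sexticRatio u)) P := by
  obtain ⟨F, hF⟩ := hΓ.exists_chart P
  exact hΓ.hasOnePole_regularize (hΓ.eventually_holAt_sexticRatio u)
    (fun x hx => hΓ.sexticRatio_isBigO u (discOrder_le_of_not hc he fun h => hx (huniq x h.1 h.2)))
    hF (hΓ.sexticRatio_isTheta_pole hP hP' hF)

theorem ell_eq_two_of_le {Γ' : Subgroup SL(2, ℤ)} (hle : Γ ≤ Γ') {z : ℍ} (hz : ell Γ z = 2) :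
    ell Γ' z = 2 := by
  obtain ⟨hI, γ, hγ, hγz, h2⟩ := ell_eq_two hz
  have h1 : ¬ ∀ γ ∈ Γ', γ • z = z → γ = 1 ∨ γ = -1 := fun h => by
    rcases h γ (hle hγ) hγz with h3 | h3 <;> subst h3 <;> revert h2 <;> decide
  rw [ell, if_neg h1, if_pos hI]

/-- A meromorphic function on `X(Γ)` that is invariant under the larger group `Γ'` descends to
`X(Γ')`. Its poles there are simple when they are points of order `2` for both groups. -/
theorem exists_hasOnePole_of_invariant {Γ' : Subgroup SL(2, ℤ)} (hle : Γ ≤ Γ')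
    (hΓ' : IsLevel p Γ') {T : Curve Γ → ℂ}
    (hinv : ∀ γ ∈ Γ', ∀ z, T (toCurve Γ (γ • z)) = T (toCurve Γ z))
    (hol : ∀ x, ∀ᶠ y in 𝓝[≠] x, HolAt T y) {z₀ : ℍ} (hz₀ : ell Γ z₀ = 2)
    (hb : ∀ x, (∀ γ ∈ Γ', x ≠ toCurve Γ (γ • z₀)) → T =O[𝓝[≠] x] fun _ => (1 : ℂ))
    (hpole : ∀ F, IsChartAt F (toCurve Γ z₀) →
      T =Θ[𝓝[≠] (toCurve Γ z₀)] fun y => F y ^ (-1 : ℤ)) :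
    ∃ T', HasOnePole T' (toCurve Γ' z₀) := by
  classical
  set G : Curve Γ' → ℂ := fun x =>
    if h : ∃ z : ℍ, toCurve Γ' z = x then T (toCurve Γ h.choose) else 0 with hG
  have hGT : ∀ z, G (toCurve Γ' z) = T (toCurve Γ z) := fun z => by
    have hz : ∃ w : ℍ, toCurve Γ' w = toCurve Γ' z := ⟨z, rfl⟩
    obtain ⟨γ, hγ, hw⟩ := toCurve_eq_iff.mp hz.choose_spec
    simp only [hG]
    rw [dif_pos hz, ← hw, hinv γ hγ]
  have hpb : pullback G = pullback T := funext fun t => hGT _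
  have hhol : ∀ z, HolAt T (toCurve Γ z) → HolAt G (toCurve Γ' z) := fun z hz => by
    rw [holAt_toCurve_iff] at hz ⊢
    rwa [hpb]
  obtain ⟨F', hF', he'⟩ := exists_chart_toCurve (Γ := Γ') z₀
  obtain ⟨F, hF, he⟩ := exists_chart_toCurve (Γ := Γ) z₀
  refine ⟨_, hΓ'.hasOnePole_regularize (G := G) (fun x => ?_) (fun x hx => ?_) hF' ?_⟩
  · induction x using Curve.cases with
    | h1 z =>
      refine nhdsNE_toCurve_eq_map z (Filter.mem_map.mpr ?_)
      filter_upwards [(tendsto_toCurve_nhdsNE z).eventually (hol (toCurve Γ z))] with w hw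
      exact hhol w hw
    | h2 g =>
      have h1 := hol (proj Γ (g • infty))
      rw [← map_atImInfty_eq_nhdsNE, Filter.eventually_map] at h1 ⊢
      exact h1.mono fun z hz => hhol _ hz
  · induction x using Curve.cases with
    | h1 z =>
      refine IsBigO.mono (isBigO_map.mpr ?_) (nhdsNE_toCurve_eq_map z)
      refine IsBigO.congr_left ((hb (toCurve Γ z) fun γ hγ h => hx ?_).comp_tendsto
        (tendsto_toCurve_nhdsNE z)) fun w => (hGT w).symm
      obtain ⟨γ', hγ', h'⟩ := toCurve_eq_iff.mp h
      rw [← h', toCurve_smul (hle hγ'), toCurve_smul hγ]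
    | h2 g =>
      have h1 := hb (proj Γ (g • infty)) fun γ hγ h => toCurve_ne_proj_smul_infty _ g h.symm
      rw [← map_atImInfty_eq_nhdsNE, isBigO_map] at h1 ⊢
      exact h1.congr_left fun w => (hGT _).symm
  · refine IsTheta.mono ?_ (nhdsNE_toCurve_eq_map z₀)
    have h1 := comp_tendsto_isTheta (hpole F hF) (tendsto_toCurve_nhdsNE z₀)
    have h2 : (G ∘ toCurve Γ') =Θ[𝓝[≠] z₀] ((fun y => F' y ^ (-1 : ℤ)) ∘ toCurve Γ') := by
      refine IsTheta.trans (f := G ∘ toCurve Γ') ?_ (h1.trans (Filter.EventuallyEq.isTheta ?_))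
      · exact Filter.EventuallyEq.isTheta (Filter.Eventually.of_forall hGT)
      · filter_upwards [nhdsWithin_le_nhds he, nhdsWithin_le_nhds he'] with z h3 h4
        rw [Function.comp_apply, h3, h4, hz₀, ell_eq_two_of_le hle hz₀]
    exact ⟨isBigO_map.mpr h2.1, isBigO_map.mpr h2.2⟩

variable [Fact p.Prime] {C : Subgroup (GL (Fin 2) (ZMod p))}
  {α : Matrix (Fin 2) (Fin 2) (ZMod p)} {δ : ZMod p}

/-- For `p = 7` there are no points of order `3`, because `-3` is a square. -/
theorem IsGenerator.eleven_le (h : IsGenerator C α δ) (hp : 7 ≤ p) {z : ℍ}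
    (hz : ell (GammaNs C) z = 3) : 11 ≤ p := by
  by_contra hlt
  have hpp : p.Prime := Fact.out
  have : p = 7 := by
    have h1 : p < 11 := by omega
    interval_cases p
    · rfl
    all_goals norm_num at hpp
  exact h.not_isSquare_neg_three (by omega) hz (isSquare_neg_three (by omega))

/-- An automorphism of `X_ns⁺` that preserves the cusps and the elliptic points does not
mix up elliptic points of orders `2` and `3`. -/
theorem IsGenerator.preservesOrders_plus (h : IsGenerator C α δ) (hp : 7 ≤ p)
    {u : Aut (GammaNsPlus C)} (hc : PreservesCusps u) (he : PreservesEllipticPoints u) :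
    PreservesOrders u := by
  have hΓ := h.isLevel_plus (by omega)
  by_contra hu
  obtain ⟨P, hP, hP'⟩ : ∃ P ∈ orderSet (GammaNsPlus C) 2, u.1 P ∈ orderSet (GammaNsPlus C) 3 := by
    by_contra! hn
    exact hu (hΓ.preservesOrders_of_forall hc he hn)
  have hp11 : 11 ≤ p := by
    obtain ⟨z, -, hz⟩ := hP'
    exact h.eleven_le hp (h.ell_eq_three_of_plus hz)
  refine h.false_of_hasOnePole_plus hp11 (hΓ.hasOnePole_sexticRatio hc he hP hP' ?_) hP
  intro x hx hx'
  classical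
  have h1 := h.card_order_three_le (by omega) {u.1 x, u.1 P} (by
    rw [Finset.coe_insert, Finset.coe_singleton, Set.insert_subset_iff, Set.singleton_subset_iff]
    exact ⟨hx', hP'⟩)
  exact u.1.injective (Finset.card_le_one.mp h1 _ (by simp) _ (by simp))

/-- An automorphism of `X_ns` that preserves the cusps and the elliptic points does not mix up
elliptic points of orders `2` and `3`. -/
theorem IsGenerator.preservesOrders (h : IsGenerator C α δ) (hC : IsNonsplitCartan C) (hp : 7 ≤ p)
    {u : Aut (GammaNs C)} (hc : PreservesCusps u) (he : PreservesEllipticPoints u) :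
    PreservesOrders u := by
  have hΓ := hC.isLevel
  have hp2 : p ≠ 2 := by omega
  by_contra hu
  obtain ⟨P, hP, hP'⟩ : ∃ P ∈ orderSet (GammaNs C) 2, u.1 P ∈ orderSet (GammaNs C) 3 := by
    by_contra! hn
    exact hu (hΓ.preservesOrders_of_forall hc he hn)
  have hp11 : 11 ≤ p := by
    obtain ⟨z, -, hz⟩ := hP'
    exact h.eleven_le hp hz
  obtain ⟨g, hg, hn⟩ := h.exists_mem_plus_notMem hp2
  have hN := h.normalizes hg
  set v := inducedAut hN with hv
  have hvo : ∀ x e, x ∈ orderSet (GammaNs C) e → v.1 x ∈ orderSet (GammaNs C) e := by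
    rintro _ e ⟨z, rfl, rfl⟩
    exact ⟨g • z, rfl, ell_smul_of_normalizes hN z⟩
  have hdisj : ∀ x, x ∈ orderSet (GammaNs C) 2 → x ∉ orderSet (GammaNs C) 3 := by
    rintro _ ⟨z, rfl, hz⟩ h3
    rw [toCurve_mem_orderSet] at h3
    omega
  -- otherwise `u^* ω / ω` has a single pole
  obtain ⟨Q, hQ, hQ', hQP⟩ : ∃ Q ∈ orderSet (GammaNs C) 2, u.1 Q ∈ orderSet (GammaNs C) 3 ∧
      Q ≠ P := by
    by_contra! hn
    exact h.false_of_hasOnePole hC hp11 (hΓ.hasOnePole_sexticRatio hc he hP hP' hn) hP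
  -- so `u` exchanges the points of order `2` and the points of order `3`
  have h23 : ∀ x ∈ orderSet (GammaNs C) 2, u.1 x ∈ orderSet (GammaNs C) 3 := by
    intro x hx
    have e1 := (h.eq_or_eq_of_mem_orderSet hp2 (by norm_num) hg hn hP hQ).resolve_left hQP
    rcases h.eq_or_eq_of_mem_orderSet hp2 (by norm_num) hg hn hP hx with rfl | h1
    · exact hP'
    · rw [h1, ← e1]; exact hQ'
  have h3 : ∀ y ∈ orderSet (GammaNs C) 3, y = u.1 P ∨ y = u.1 Q := by
    intro y hy
    have e1 := (h.eq_or_eq_of_mem_orderSet hp2 (by norm_num) hg hn hP' hQ').resolve_left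
      fun h1 => hQP (u.1.injective h1)
    rw [e1]
    exact h.eq_or_eq_of_mem_orderSet hp2 (by norm_num) hg hn hP' hy
  have h32 : ∀ x ∈ orderSet (GammaNs C) 3, u.1 x ∈ orderSet (GammaNs C) 2 := by
    intro x hx
    obtain ⟨z, rfl, hz⟩ := id hx
    obtain ⟨w, hw⟩ := exists_toCurve_of_preservesCusps hc z
    have h1 := he.ell_eq_one_iff hw
    rw [hw, toCurve_mem_orderSet]
    refine ((ell_cases _ w).resolve_left (by omega)).resolve_right fun h2 => ?_
    rcases h3 (u.1 (toCurve _ z)) (by rw [hw, toCurve_mem_orderSet, h2]) with h4 | h4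
    · exact hdisj _ hP (u.1.injective h4 ▸ hx)
    · exact hdisj _ hQ (u.1.injective h4 ▸ hx)
  have h1 : ∀ x ∈ orderSet (GammaNs C) 1, u.1 x ∈ orderSet (GammaNs C) 1 := by
    rintro _ ⟨z, rfl, hz⟩
    obtain ⟨w, hw⟩ := exists_toCurve_of_preservesCusps hc z
    rw [hw, toCurve_mem_orderSet, ← he.ell_eq_one_iff hw, hz]
  -- the conjugate of the modular involution by `u` preserves the orders, hence is the involution
  have hconj : u * v * u⁻¹ = v := by
    refine h.eq_inducedAut hC (by omega) hg hn
      ((hc.mul (preservesCusps_inducedAut hN)).mul hc.inv) ?_ ?_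
    · intro z w hzw
      obtain ⟨y, hy⟩ := exists_toCurve_of_preservesCusps hc.inv z
      have hy' := (inv_apply_eq u).mp hy
      have e1 : (u * v * u⁻¹).1 (toCurve _ z) = u.1 (v.1 (toCurve _ y)) := by
        rw [← hy]; rfl
      rw [e1] at hzw
      rcases ell_cases (GammaNs C) y with h4 | h4 | h4
      · have h5 := toCurve_mem_orderSet.mpr h4
        have h6 := h1 _ h5
        have h7 := h1 _ (hvo _ _ h5)
        rw [hy', toCurve_mem_orderSet] at h6
        rw [hzw, toCurve_mem_orderSet] at h7
        omega
      · have h5 := toCurve_mem_orderSet.mpr h4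
        have h6 := h23 _ h5
        have h7 := h23 _ (hvo _ _ h5)
        rw [hy', toCurve_mem_orderSet] at h6
        rw [hzw, toCurve_mem_orderSet] at h7
        omega
      · have h5 := toCurve_mem_orderSet.mpr h4
        have h6 := h32 _ h5
        have h7 := h32 _ (hvo _ _ h5)
        rw [hy', toCurve_mem_orderSet] at h6
        rw [hzw, toCurve_mem_orderSet] at h7
        omega
    · exact fun h0 => h.inducedAut_ne_one hC hg hn (conj_eq_one_iff.mp h0)
  -- therefore `u^* ω / ω` descends to a function on `X_ns⁺` with a single pole
  obtain ⟨z₀, rfl, hz₀⟩ := id hP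
  have hinv : ∀ γ ∈ GammaNsPlus C, ∀ z,
      sexticRatio u (toCurve (GammaNs C) (γ • z)) = sexticRatio u (toCurve (GammaNs C) z) := by
    intro γ hγ z
    by_cases hγ' : γ ∈ GammaNs C
    · rw [toCurve_smul hγ']
    · have e1 : toCurve (GammaNs C) (γ • z) = v.1 (toCurve _ z) := by
        rw [hv, inducedAut_toCurve, ← toCurve_smul (h.mul_inv_mem hγ hg hγ' hn) (g • z),
          ← mul_smul, inv_mul_cancel_right]
      rw [e1]
      exact hΓ.sexticRatio_inducedAut hN (mul_inv_eq_iff_eq_mul.mp hconj) _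
  have hb : ∀ x, (∀ γ ∈ GammaNsPlus C, x ≠ toCurve (GammaNs C) (γ • z₀)) →
      sexticRatio u =O[𝓝[≠] x] fun _ => (1 : ℂ) := by
    refine fun x hx => hΓ.sexticRatio_isBigO u (discOrder_le_of_not hc he fun h4 => ?_)
    rcases h.eq_or_eq_of_mem_orderSet hp2 (by norm_num) hg hn hP h4.1 with h5 | h5
    · exact hx 1 (one_mem _) (by rw [one_smul, h5])
    · exact hx g hg h5
  obtain ⟨T, hT⟩ := exists_hasOnePole_of_invariant h.le (h.isLevel_plus hp2) hinv
    (hΓ.eventually_holAt_sexticRatio u) hz₀ hb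
    (fun F hF => hΓ.sexticRatio_isTheta_pole hP hP' hF)
  exact h.false_of_hasOnePole_plus hp11 hT
    (toCurve_mem_orderSet.mpr (ell_eq_two_of_le h.le hz₀))

end Matching

end ModularCurve

end

theorem mainTheorem7 (p : ℕ) [Fact p.Prime] (C : Subgroup (GL (Fin 2) (ZMod p)))
    (hC : ModularCurve.IsNonsplitCartan C)
    (hgenus : 2 ≤ ModularCurve.genus (ModularCurve.GammaNs C)) :
    ∃ w : ModularCurve.Aut (ModularCurve.GammaNs C),
      ModularCurve.IsModularInvolution C w ∧
      (p ≡ 1 [MOD 12] →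
        ∀ u : ModularCurve.Aut (ModularCurve.GammaNs C),
          (u ≠ 1 ∧ ModularCurve.PreservesCusps u) ↔ u = w) ∧
      (¬ p ≡ 1 [MOD 12] →
        ∀ u : ModularCurve.Aut (ModularCurve.GammaNs C),
          (u ≠ 1 ∧ ModularCurve.PreservesCusps u ∧ ModularCurve.PreservesEllipticPoints u) ↔
            u = w) ∧
      (∀ u : ModularCurve.Aut (ModularCurve.GammaNsPlus C),
        (ModularCurve.PreservesCusps u ∧ ModularCurve.PreservesEllipticPoints u) ↔ u = 1) := by
  have hp : 7 ≤ p := by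
    by_contra hlt
    have hp6 : p ≠ 6 := by
      rintro rfl
      exact absurd (Fact.out : Nat.Prime 6) (by norm_num)
    have := hC.isLevel.genus_eq_zero (by omega)
    omega
  have hp2 : p ≠ 2 := by omega
  obtain ⟨α, δ, h⟩ := hC.exists_isGenerator hp2
  obtain ⟨g, hg, hn⟩ := h.exists_mem_plus_notMem hp2
  have hw := h.inducedAut_ne_one hC hg hn
  refine ⟨ModularCurve.inducedAut (h.normalizes hg), h.isModularInvolution hg hn,
    fun h12 u => ⟨fun ⟨hu, hc⟩ => ?_, ?_⟩, fun _ u => ⟨fun ⟨hu, hc, he⟩ => ?_, ?_⟩,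
    fun u => ⟨fun ⟨hc, he⟩ => ?_, ?_⟩⟩
  · -- there are no elliptic points
    have h12' : p % 12 = 1 := h12
    have hell : ∀ z, ModularCurve.ell (ModularCurve.GammaNs C) z = 1 := fun z => by
      rcases ModularCurve.ell_cases (ModularCurve.GammaNs C) z with h1 | h1 | h1
      · exact h1
      · exact absurd (ZMod.exists_sq_eq_neg_one_iff.mpr (by omega))
          (h.not_isSquare_neg_one hp2 h1)
      · exact absurd (ModularCurve.isSquare_neg_three (by omega))
          (h.not_isSquare_neg_three hp2 h1)
    exact h.eq_inducedAut hC (by omega) hg hn hc (fun z w _ => by rw [hell, hell]) hu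
  · rintro rfl
    exact ⟨hw, ModularCurve.preservesCusps_inducedAut _⟩
  · exact h.eq_inducedAut hC (by omega) hg hn hc (h.preservesOrders hC hp hc he) hu
  · rintro rfl
    exact ⟨hw, ModularCurve.preservesCusps_inducedAut _,
      ModularCurve.preservesEllipticPoints_inducedAut _⟩
  · exact h.eq_one_of_plus (by omega) hc (h.preservesOrders_plus hp hc he)
  · rintro rfl
    exact ⟨Set.image_id _, Set.image_id _⟩
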